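/- Let $R$ be a discrete valuation ring with uniformizer $\pi$, algebraically closed residue field $\kappa$ and fraction field $K$, and let $d\ge 1$. A lattice in $K^d$ is a finitely generated $R$-submodule spanning $K^d$; two lattices are homothetic if they differ by a factor in $K^\times$; classes $[L],[L']$ are adjacent if they have representatives with $\pi L_1\subset L_2\subset L_1$. Let $\Gamma=\{[L_v]\}_v$ be a finite set of homothety classes of lattices, with chosen representatives $L_v$, which is convex: $[N\cap N']\in\Gamma$ for all representatives $N,N'$ of members of $\Gamma$. Let $n_{u,v}$ be the least integer with $\pi^{n_{u,v}}L_u\subset L_v$, let $\overline L_v=L_v/\pi L_v$, and let $f_{u,v}:\overline L_u\to\overline L_v$ be induced by multiplication by $\pi^{n_{u,v}}$. The quiver $Q(\Gamma)$ has vertex set $\Gamma$ and an arrow $u\to v$ ($u\ne v$) unless $f_{u,v}$ is the composition of the maps $f$ along some sequence of at least two steps, each between distinct vertices, from $u$ to $v$; the $\overline L_v$ and $f_{u,v}$ form a representation $M_\Gamma$ of $Q(\Gamma)$. Assume that $\Gamma$ is locally weakly independent: for each $v$ there is $I_v\subset\Gamma$ such that for each $u\neq v$ one has $f_{u,v}=f_{w,v}\circ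 f_{u,w}$ for some $w\in I_v$, and the subspaces $\operatorname{im} f_{w,v}=\ker f_{v,w}$ $(w\in I_v)$ of $\overline L_v$ are linearly independent. For a dimension vector $\underline x$, let $\mathrm{Gr}(\underline x,M_\Gamma)$ be the quiver Grassmannian of sub-representations of $M_\Gamma$ of dimension $\underline x$ ($\kappa$-points, with the Zariski topology). For $M=(V_v)_v$ in it, let $\Phi(M)=(\dim f_{u,v}(V_u))_{u,v}$ be its rank vector and $\mathcal S_M$ the set of points isomorphic to $M$ as representations of $Q(\Gamma)$ (the quiver stratum of $M$). Rank vectors are ordered componentwise. **Theorem.** Let $\Gamma$ be locally weakly independent. 1. For every $\underline x$ and all $M,M'\in\mathrm{Gr}(\underline x,M_\Gamma)$: $\Phi(M)=\Phi(M')$ if and only if $M\simeq M'$. 2. For every $\underline x$ and all $M,M'\in\mathrm{Gr}(\underline x,M_\Gamma)$: $\mathcal S_M\subset\overline{\mathcal S_{M'}}$ if and only if $\Phi(M)\le\Phi(M')$. 3. $\Gamma$ is contained in an apartment: there are a basis $e_1,\dots,e_d$ of $K^d$ and vectors $a_v\in\mathbb Z^d$ with $L_v=\Lambda_{a_v}$,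 where $\Lambda_a=\langle \pi^{-a(1)}e_1,\dots,\pi^{-a(d)}e_d\rangle_R$. For every such choice and every $0<r<d$, on $LG_r(\Gamma)_0=\mathrm{Gr}((r,\dots,r),M_\Gamma)$ the quiver stratification, the stratification by the fibres of $\Phi$ (rank-vector stratification) and the Bruhat stratification, defined below, have the same strata. For the nonempty Bruhat strata $S_{\mathbf x},S_{\mathbf y}$ the topological order ($S_{\mathbf x}\subset\overline{S_{\mathbf y}}$), the componentwise order of the rank vectors of their points, and the generalized Bruhat order ($\mathbf x\preceq\mathbf y$) agree. *Bruhat stratification.* Let $\widetilde W=\mathfrak S_d\ltimes\mathbb Z^d$ act on $\mathbb Z^d$ by $(\sigma,t)\cdot a=(a_{\sigma^{-1}(k)}+t_k)_k$, and let $W_a\subset\widetilde W$ be the affine Weyl group (elements with $\sum_k t_k=0$). For a set $F$ of integer vectors let $W_F\subset W_a$ be its pointwise stabilizer. Let $\tau$ run over the maximal simplices of $\Gamma$ (maximal nonempty sets of pairwise adjacent vertices). Write $W_\tau$ and $W_{\tau\tau'}$ for $W_F$ with $F=\{a_v\}_{v\in\tau}$ and $F=\{a_v\}_{v\in\tau\cap\tau'}$.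 An admissible collection $\mathbf x=(h_\tau W_\tau)_\tau$ of size $r$ consists of cosets with $h_\tau\in\widetilde W$, $a_v\le h_\tau\cdot a_v\le a_v+(1,\dots,1)$ and $\sum_k (h_\tau\cdot a_v-a_v)(k)=r$ for all $v\in\tau$, and $W_{\tau\tau'}h_\tau W_{\tau\tau'}=W_{\tau\tau'}h_{\tau'}W_{\tau\tau'}$ for all $\tau,\tau'$. Let $P_\tau\subset\mathrm{SL}_d(K)$ be the stabilizer of all $L_v$, $v\in\tau$. Then $S_{\mathbf x}$ is the set of points $(V_v)_v$ such that for every $\tau$ there is $p\in P_\tau$ with $\pi^{-1}\cdot(\text{preimage of }V_v\text{ in }L_v)=p\,\Lambda_{h_\tau\cdot a_v}$ for all $v\in\tau$; the Bruhat strata are the nonempty sets $S_{\mathbf x}$. *Generalized Bruhat order.* Let $\omega_m=(1^m,0^{d-m})$ $(0\le m<d)$ and $\omega_J=(\omega_m)_{m\in J}$, and let $\iota=((1\,2\cdots d),(1,0,\dots,0))$. Use the Bruhat order on $W_a$ with respect to the Coxeter generators $s_0=((1\,d),(1,0,\dots,0,-1))$ and $s_i=((i\ i{+}1),0)$, $1\le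 i<d$; a double coset is below another if some element of the first is below some element of the second. Then $\mathbf x=(h_\tau W_\tau)\preceq\mathbf y=(h'_\tau W_\tau)$ if for every $\tau$, writing $\tau=g\cdot\omega_J$ up to homothety with $g\in\widetilde W$, the double coset of $g^{-1}h_\tau g\,\iota^{-r}$ in $W_{\omega_J}\backslash W_a/W_{\iota^r\omega_J}$ is below that of $g^{-1}h'_\tau g\,\iota^{-r}$. -/

import Mathlib

open scoped TensorProduct Pointwise

noncomputable section

namespace LinkedGrassmannian

/-! ### Lattice configurations -/

section Lattices

/-- A finite family of lattices in `K ^ d`, no two of which are homothetic: a finite set of vertices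
of the Bruhat-Tits building of `SL_d`, indexed by `I`, with a chosen representative of each vertex.
A lattice is a finitely generated (equivalently, free) `R`-submodule that spans `K ^ d`. -/
structure LatticeConfig (R K : Type*) [CommRing R] [Field K] [Algebra R K] (d : ℕ)
    (I : Type*) where
  /-- The chosen representative of the vertex `v`. -/
  L : I → Submodule R (Fin d → K)
  isLattice : ∀ v, (L v).IsLattice K
  /-- Distinct indices give distinct homothety classes. -/
  distinct : ∀ u v, (∃ c : K, c ≠ 0 ∧ L u = c • L v) → u = v

variable {R K : Type*} [CommRing R] [Field K] [Algebra R K] {d : ℕ} {I : Type*}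

/-- `N` and `N'` are homothetic. -/
def Homothetic (N N' : Submodule R (Fin d → K)) : Prop :=
  ∃ c : K, c ≠ 0 ∧ N = c • N'

/-- The homothety classes of `N` and `N'` are adjacent: they have representatives `N₁`, `N₂` with
`ϖ N₁ ⊆ N₂ ⊆ N₁`. -/
def Adjacent (ϖ : R) (N N' : Submodule R (Fin d → K)) : Prop :=
  ∃ N₁ N₂ : Submodule R (Fin d → K), Homothetic N₁ N ∧ Homothetic N₂ N' ∧
    algebraMap R K ϖ • N₁ ≤ N₂ ∧ N₂ ≤ N₁

/-- The configuration is convex: for all representatives of two members, the class of the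
intersection is again a member. -/
def LatticeConfig.Convex (Γ : LatticeConfig R K d I) : Prop :=
  ∀ (u v : I) (N N' : Submodule R (Fin d → K)), Homothetic N (Γ.L u) → Homothetic N' (Γ.L v) →
    ∃ w, Homothetic (N ⊓ N') (Γ.L w)

/-- The least integer `n` such that `ϖ ^ n L ⊆ L'`. -/
def minExp (ϖ : R) (L L' : Submodule R (Fin d → K)) : ℤ :=
  sInf {n : ℤ | ∀ x ∈ L, (algebraMap R K ϖ ^ n) • x ∈ L'}

open Classical in
/-- Multiplication by `ϖ ^ n`, `n = minExp ϖ L L'`, as a map `L → L'`. For lattices with `0 < d` and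
`ϖ` a uniformizer the minimum is attained, so that the second branch does not occur. -/
def latticeMap (ϖ : R) (L L' : Submodule R (Fin d → K)) : L →ₗ[R] L' :=
  if h : ∀ x ∈ L, (algebraMap R K ϖ ^ minExp ϖ L L') • x ∈ L' then
    (Algebra.lsmul R R (Fin d → K) (algebraMap R K ϖ ^ minExp ϖ L L')).restrict h
  else 0

end Lattices

/-! ### The quiver `Q(Γ)`, the representation `M_Γ` and its sub-representations -/

section Quiver

variable {R K : Type*} [CommRing R] [IsLocalRing R] [Field K] [Algebra R K] {d : ℕ} {I : Type*}

/-- The reduction `L_v / ϖ L_v`, as a vector space over the residue field. -/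
abbrev LatticeConfig.Lbar (Γ : LatticeConfig R K d I) (v : I) : Type _ :=
  IsLocalRing.ResidueField R ⊗[R] (Γ.L v)

/-- The map `f_{u,v} : L_u / ϖ L_u → L_v / ϖ L_v`. -/
def LatticeConfig.f (Γ : LatticeConfig R K d I) (ϖ : R) (u v : I) :
    Γ.Lbar u →ₗ[IsLocalRing.ResidueField R] Γ.Lbar v :=
  (latticeMap ϖ (Γ.L u) (Γ.L v)).baseChange (IsLocalRing.ResidueField R)

/-- `Γ.IsPathMap ϖ n u v g`: there is a path `ℓ` of length `n` from `u` to `v` in the complete quiver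
on `I` (one arrow `i → j` for all `i ≠ j`) such that `g` is the composition of the maps `f` along
`ℓ`. -/
inductive LatticeConfig.IsPathMap (Γ : LatticeConfig R K d I) (ϖ : R) :
    ℕ → (u v : I) → (Γ.Lbar u →ₗ[IsLocalRing.ResidueField R] Γ.Lbar v) → Prop
  | nil (u : I) : Γ.IsPathMap ϖ 0 u u LinearMap.id
  | cons {n : ℕ} {u v w : I} {g : Γ.Lbar u →ₗ[IsLocalRing.ResidueField R] Γ.Lbar v}
      (hg : Γ.IsPathMap ϖ n u v g) (hvw : v ≠ w) : Γ.IsPathMap ϖ (n + 1) u w (Γ.f ϖ v w ∘ₗ g)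

/-- The arrows of `Q(Γ)`: those arrows `u → v` of the complete quiver for which `f_{u,v}` is not the
composition along a path of length at least `2`. -/
def LatticeConfig.Arrow (Γ : LatticeConfig R K d I) (ϖ : R) (u v : I) : Prop :=
  u ≠ v ∧ ¬ ∃ n, 2 ≤ n ∧ Γ.IsPathMap ϖ n u v (Γ.f ϖ u v)

/-- `Γ` is locally weakly independent: for each `v` there is a set `S` of vertices (called `I_v`)
such that every `f_{u,v}` with `u ≠ v` factors through a member of `S`, and the subspaces
`im f_{w,v} = ker f_{v,w}`, `w ∈ S`, are linearly independent. As `f_{v,v}` is the identity, the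
equality of image and kernel excludes `v ∈ S`. -/
def LatticeConfig.LocallyWeaklyIndependent (Γ : LatticeConfig R K d I) (ϖ : R) : Prop :=
  ∀ v : I, ∃ S : Set I,
    (∀ u, u ≠ v → ∃ w ∈ S, Γ.f ϖ u v = Γ.f ϖ w v ∘ₗ Γ.f ϖ u w) ∧
    (∀ w ∈ S, LinearMap.range (Γ.f ϖ w v) = LinearMap.ker (Γ.f ϖ v w)) ∧
    iSupIndep (fun w : S => LinearMap.range (Γ.f ϖ w v))

/-- The subspaces `V_v` form a sub-representation of the representation `M_Γ` of `Q(Γ)`. -/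
def LatticeConfig.IsSubrep (Γ : LatticeConfig R K d I) (ϖ : R)
    (V : ∀ v, Submodule (IsLocalRing.ResidueField R) (Γ.Lbar v)) : Prop :=
  ∀ u v, Γ.Arrow ϖ u v → ∀ y ∈ V u, Γ.f ϖ u v y ∈ V v

/-- The (`κ`-points of the) quiver Grassmannian `Gr(x, M_Γ)`: sub-representations of `M_Γ` of dimension
vector `x`. -/
structure QuiverGr (Γ : LatticeConfig R K d I) (ϖ : R) (x : I → ℕ) where
  V : ∀ v, Submodule (IsLocalRing.ResidueField R) (Γ.Lbar v)
  isSubrep : Γ.IsSubrep ϖ V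
  finrank_eq : ∀ v, Module.finrank (IsLocalRing.ResidueField R) (V v) = x v

variable {Γ : LatticeConfig R K d I} {ϖ : R} {x : I → ℕ}

/-- The two sub-representations are isomorphic as representations of `Q(Γ)`. -/
def QuiverGr.Iso (M N : QuiverGr Γ ϖ x) : Prop :=
  ∃ φ : ∀ v, M.V v ≃ₗ[IsLocalRing.ResidueField R] N.V v,
    ∀ (u v : I) (h : Γ.Arrow ϖ u v) (y : M.V u),
      (φ v ⟨Γ.f ϖ u v y, M.isSubrep u v h y y.2⟩ : Γ.Lbar v) = Γ.f ϖ u v (φ u y)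

/-- The rank vector `Φ(M) = (dim f_{u,v}(V_u))_{u,v}`; rank vectors are ordered componentwise. -/
def QuiverGr.rankVector (M : QuiverGr Γ ϖ x) : I × I → ℕ :=
  fun p => Module.finrank (IsLocalRing.ResidueField R) ((M.V p.1).map (Γ.f ϖ p.1 p.2))

/-- The quiver stratum of `M`. -/
def QuiverGr.quiverStratum (M : QuiverGr Γ ϖ x) : Set (QuiverGr Γ ϖ x) := {N | N.Iso M}

/-- The rank-vector stratum of `M`. -/
def QuiverGr.rankStratum (M : QuiverGr Γ ϖ x) : Set (QuiverGr Γ ϖ x) :=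
  {N | N.rankVector = M.rankVector}

variable (Γ ϖ x) in
/-- The set of strata of the quiver stratification of `Gr(x, M_Γ)`. -/
def quiverStrata : Set (Set (QuiverGr Γ ϖ x)) := Set.range QuiverGr.quiverStratum

variable (Γ ϖ x) in
/-- The set of strata of the rank-vector stratification of `Gr(x, M_Γ)`. -/
def rankStrata : Set (Set (QuiverGr Γ ϖ x)) := Set.range QuiverGr.rankStratum

end Quiver

/-! ### The Zariski topology on the quiver Grassmannian -/

section Topology

/-- The polynomial functions on a vector space: the algebra generated by the linear forms. -/
def polynomialFunctions (k W : Type*) [Field k] [AddCommGroup W] [Module k W] :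
    Subalgebra k (W → k) :=
  Algebra.adjoin k (Set.range fun φ : Module.Dual k W => (φ : W → k))

/-- The Zariski topology on a (finite-dimensional) vector space: the sets `{p ≠ 0}`, with `p` a
polynomial function, form a basis of open sets. -/
@[reducible]
def zariskiTopology (k W : Type*) [Field k] [AddCommGroup W] [Module k W] : TopologicalSpace W :=
  TopologicalSpace.generateFrom {U | ∃ p ∈ polynomialFunctions k W, U = {w | p w ≠ 0}}

variable {R K : Type*} [CommRing R] [IsLocalRing R] [Field K] [Algebra R K] {d : ℕ} {I : Type*}

/-- A point of `Gr(x, M_Γ)` together with a basis of each of its subspaces. -/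
structure Frame (Γ : LatticeConfig R K d I) (ϖ : R) (x : I → ℕ) where
  b : ∀ v, Fin (x v) → Γ.Lbar v
  linInd : ∀ v, LinearIndependent (IsLocalRing.ResidueField R) (b v)
  isSubrep : Γ.IsSubrep ϖ fun v => Submodule.span (IsLocalRing.ResidueField R) (Set.range (b v))

variable {Γ : LatticeConfig R K d I} {ϖ : R} {x : I → ℕ}

/-- The point spanned by a frame. -/
def Frame.toGr (B : Frame Γ ϖ x) : QuiverGr Γ ϖ x where
  V v := Submodule.span (IsLocalRing.ResidueField R) (Set.range (B.b v))
  isSubrep := B.isSubrep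
  finrank_eq v := by simpa using finrank_span_eq_card (B.linInd v)

/-- The Zariski topology on `Gr(x, M_Γ)`: the quotient topology from the space of frames, which is a
locally closed subset of the vector space of tuples of vectors (and a torsor over the Grassmannian
under a product of general linear groups). -/
instance : TopologicalSpace (QuiverGr Γ ϖ x) :=
  TopologicalSpace.coinduced Frame.toGr
    (TopologicalSpace.induced Frame.b
      (zariskiTopology (IsLocalRing.ResidueField R) (∀ v, Fin (x v) → Γ.Lbar v)))

end Topology

/-! ### The affine Weyl group and its Bruhat order -/

section Weyl

variable {d : ℕ}

/-- The extended affine Weyl group of `GL_d`: the semidirect product of `ℤ ^ d` and the symmetric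
group. -/
def ExtAffineWeyl (d : ℕ) : Type :=
  (Fin d → Multiplicative ℤ) ⋊[mulAutArrow] Equiv.Perm (Fin d)

instance : Group (ExtAffineWeyl d) :=
  inferInstanceAs (Group ((Fin d → Multiplicative ℤ) ⋊[mulAutArrow] Equiv.Perm (Fin d)))

/-- The element with permutation `σ` and translation vector `t`. -/
def ExtAffineWeyl.mk (σ : Equiv.Perm (Fin d)) (t : Fin d → ℤ) : ExtAffineWeyl d :=
  ⟨fun k => Multiplicative.ofAdd (t k), σ⟩

/-- The permutation of an element. -/
def ExtAffineWeyl.perm (w : ExtAffineWeyl d) : Equiv.Perm (Fin d) := SemidirectProduct.right w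

/-- The translation vector of an element. -/
def ExtAffineWeyl.trans (w : ExtAffineWeyl d) : Fin d → ℤ :=
  fun k => (SemidirectProduct.left w k).toAdd

theorem ExtAffineWeyl.perm_one : (1 : ExtAffineWeyl d).perm = 1 := rfl

theorem ExtAffineWeyl.trans_one : (1 : ExtAffineWeyl d).trans = 0 := rfl

theorem ExtAffineWeyl.perm_mul (w w' : ExtAffineWeyl d) : (w * w').perm = w.perm * w'.perm := rfl

theorem ExtAffineWeyl.trans_mul (w w' : ExtAffineWeyl d) :
    (w * w').trans = fun k => w.trans k + w'.trans (w.perm⁻¹ k) := rfl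

/-- The action on `ℤ ^ d`: `(σ, t) • a = (a_{σ⁻¹(k)} + t_k)_k`. -/
instance : MulAction (ExtAffineWeyl d) (Fin d → ℤ) where
  smul w a := fun k => a (w.perm⁻¹ k) + w.trans k
  one_smul a := by
    funext k
    change a ((1 : ExtAffineWeyl d).perm⁻¹ k) + (1 : ExtAffineWeyl d).trans k = a k
    simp [ExtAffineWeyl.perm_one, ExtAffineWeyl.trans_one]
  mul_smul w w' a := by
    funext k
    change a ((w * w').perm⁻¹ k) + (w * w').trans k =
      (a (w'.perm⁻¹ (w.perm⁻¹ k)) + w'.trans (w.perm⁻¹ k)) + w.trans k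
    simp only [ExtAffineWeyl.perm_mul, ExtAffineWeyl.trans_mul, mul_inv_rev, Equiv.Perm.mul_apply]
    ring

/-- The affine Weyl group `W_a`: the elements whose translation vector has sum `0`. -/
def affineWeyl (d : ℕ) : Subgroup (ExtAffineWeyl d) where
  carrier := {w | ∑ k, w.trans k = 0}
  one_mem' := by simp [ExtAffineWeyl.trans_one]
  mul_mem' {w w'} hw hw' := by
    simp only [Set.mem_ofPred_eq] at hw hw' ⊢
    simp only [ExtAffineWeyl.trans_mul, Finset.sum_add_distrib, hw, zero_add]
    rw [← hw']
    exact Equiv.sum_comp w.perm⁻¹ w'.trans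
  inv_mem' {w} hw := by
    simp only [Set.mem_ofPred_eq] at hw ⊢
    have h : (w * w⁻¹).trans = 0 := by rw [mul_inv_cancel, ExtAffineWeyl.trans_one]
    have h2 : ∑ k, (w * w⁻¹).trans k = 0 := by rw [h]; simp
    simp only [ExtAffineWeyl.trans_mul, Finset.sum_add_distrib, hw, zero_add] at h2
    rw [← h2]
    exact (Equiv.sum_comp w.perm⁻¹ w⁻¹.trans).symm

/-- The Coxeter generators of `W_a` (for `2 ≤ d`), with coordinates numbered from `0` to `d - 1`: for
`i ≠ 0`, `s_i` exchanges the coordinates `i - 1` and `i`; and `s_0` exchanges the coordinates `0` and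
`d - 1` and then translates by `(1, 0, …, 0, -1)`. -/
def simpleReflection (i : Fin d) : ExtAffineWeyl d :=
  ExtAffineWeyl.mk (Equiv.swap ((finRotate d).symm i) i)
    (if i.val = 0 then Pi.single i 1 - Pi.single ((finRotate d).symm i) 1 else 0)

/-- The word length with respect to the Coxeter generators. -/
def weylLength (w : ExtAffineWeyl d) : ℕ :=
  sInf {n | ∃ l : List (Fin d), l.length = n ∧ (l.map simpleReflection).prod = w}

/-- The reflections of `W_a`: the conjugates of the Coxeter generators. -/
def IsReflection (t : ExtAffineWeyl d) : Prop :=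
  ∃ c ∈ affineWeyl d, ∃ i, t = c * simpleReflection i * c⁻¹

/-- The Bruhat order on `W_a`: generated by `u < u t` for reflections `t` with `ℓ(u) < ℓ(u t)`. -/
def BruhatLE : ExtAffineWeyl d → ExtAffineWeyl d → Prop :=
  Relation.ReflTransGen fun u w => ∃ t, IsReflection t ∧ w = u * t ∧ weylLength u < weylLength w

/-- The partial order on the double cosets `A u B` induced by the Bruhat order: a double coset is
below another one if some element of the first is below some element of the second. -/
def DoubleCosetBruhatLE (A B : Subgroup (ExtAffineWeyl d)) (u w : ExtAffineWeyl d) : Prop :=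
  ∃ u' ∈ DoubleCoset.doubleCoset u (A : Set (ExtAffineWeyl d)) B,
    ∃ w' ∈ DoubleCoset.doubleCoset w (A : Set (ExtAffineWeyl d)) B, BruhatLE u' w'

/-- The pointwise stabilizer in `W_a` of a set of integer vectors. -/
def weylStabilizer (F : Set (Fin d → ℤ)) : Subgroup (ExtAffineWeyl d) :=
  affineWeyl d ⊓ fixingSubgroup (ExtAffineWeyl d) F

/-- The vertex `ω_m = (1, …, 1, 0, …, 0)` (with `m` ones) of the standard alcove. -/
def omega (m : Fin d) : Fin d → ℤ := fun k => if k < m then 1 else 0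

/-- The element `ι`: the cycle `(1 2 … d)` followed by the translation by `(1, 0, …, 0)`; it stabilizes
the standard alcove. -/
def iota (d : ℕ) : ExtAffineWeyl d :=
  ExtAffineWeyl.mk (finRotate d) (fun k => if k.val = 0 then 1 else 0)

/-- Two integer vectors represent the same vertex of the apartment. -/
def SameClass (a b : Fin d → ℤ) : Prop := ∃ c : ℤ, ∀ k, a k = b k + c

end Weyl

/-! ### The Bruhat stratification -/

section Bruhat

variable {R K : Type*} [CommRing R] [Field K] [Algebra R K] {d : ℕ} {I : Type*}

/-- The lattice `⟨ϖ ^ (-a_1) e_1, …, ϖ ^ (-a_d) e_d⟩` of the apartment given by the basis `e`. -/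
def apartmentLattice (ϖ : R) (e : Module.Basis (Fin d) K (Fin d → K)) (a : Fin d → ℤ) :
    Submodule R (Fin d → K) :=
  Submodule.span R (Set.range fun k => (algebraMap R K ϖ ^ (-a k)) • e k)

/-- `Γ` lies in the apartment given by the basis `e`, its lattices being given by the integer vectors
`a v`. -/
def LatticeConfig.InApartment (Γ : LatticeConfig R K d I) (ϖ : R)
    (e : Module.Basis (Fin d) K (Fin d → K)) (a : I → Fin d → ℤ) : Prop :=
  ∀ v, Γ.L v = apartmentLattice ϖ e (a v)

/-- The vertex sets of the simplices of the complex spanned by `Γ`: nonempty sets of pairwise adjacent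
vertices. -/
def LatticeConfig.IsSimplex (Γ : LatticeConfig R K d I) (ϖ : R) (τ : Set I) : Prop :=
  τ.Nonempty ∧ ∀ u ∈ τ, ∀ v ∈ τ, u ≠ v → Adjacent ϖ (Γ.L u) (Γ.L v)

/-- The maximal simplices of the complex spanned by `Γ`. -/
def LatticeConfig.MaxSimplex (Γ : LatticeConfig R K d I) (ϖ : R) : Type _ :=
  {τ : Set I // Maximal (Γ.IsSimplex ϖ) τ}

/-- A `Γ`-admissible collection of size `r`, where `a v` is the integer vector of the vertex `v`: a
tuple of cosets `h_τ W_τ` (given by representatives `h_τ`), indexed by the maximal simplices `τ`, such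
that `a v ≤ h_τ • a v ≤ a v + (1, …, 1)` and `∑ (h_τ • a v) - ∑ a v = r` for all `v ∈ τ`, and such that
`h_τ` and `h_τ'` have the same double coset with respect to the stabilizer of the common vertices. -/
structure AdmissibleCollection (Γ : LatticeConfig R K d I) (ϖ : R) (a : I → Fin d → ℤ)
    (r : ℕ) where
  h : Γ.MaxSimplex ϖ → ExtAffineWeyl d
  bounds : ∀ τ, ∀ v ∈ τ.1, ∀ k, a v k ≤ (h τ • a v) k ∧ (h τ • a v) k ≤ a v k + 1
  size : ∀ τ, ∀ v ∈ τ.1, ∑ k, (h τ • a v) k - ∑ k, a v k = r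
  compat : ∀ τ τ' : Γ.MaxSimplex ϖ,
    DoubleCoset.doubleCoset (h τ) (weylStabilizer (a '' (τ.1 ∩ τ'.1)) : Set (ExtAffineWeyl d))
        (weylStabilizer (a '' (τ.1 ∩ τ'.1))) =
      DoubleCoset.doubleCoset (h τ') (weylStabilizer (a '' (τ.1 ∩ τ'.1)) : Set (ExtAffineWeyl d))
        (weylStabilizer (a '' (τ.1 ∩ τ'.1)))

/-- The translate `g N` of a submodule by `g ∈ SL_d(K)`. -/
def slTranslate (g : Matrix.SpecialLinearGroup (Fin d) K) (N : Submodule R (Fin d → K)) :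
    Submodule R (Fin d → K) :=
  N.map ((Matrix.toLin' (g : Matrix (Fin d) (Fin d) K)).restrictScalars R)

/-- `g` lies in the parahoric subgroup of `SL_d(K)` attached to a simplex `τ` of `Γ`, the pointwise
stabilizer of `τ`. -/
def LatticeConfig.InParahoric (Γ : LatticeConfig R K d I) (τ : Set I)
    (g : Matrix.SpecialLinearGroup (Fin d) K) : Prop :=
  ∀ v ∈ τ, slTranslate g (Γ.L v) = Γ.L v

/-- The generalized Bruhat order on admissible collections: for each maximal simplex `τ`, writing
`τ = g • ω_J` as a translate of a face of the standard alcove, the double cosets of `g⁻¹ h_τ g ι⁻ʳ` and `g⁻¹ h'_τ g ι⁻ʳ` in `W_{ω_J} \ W_a / W_{ιʳ ω_J}` are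
related by the Bruhat order. -/
def AdmissibleCollection.BruhatLE {Γ : LatticeConfig R K d I} {ϖ : R} {a : I → Fin d → ℤ} {r : ℕ}
    (X Y : AdmissibleCollection Γ ϖ a r) : Prop :=
  ∀ τ : Γ.MaxSimplex ϖ, ∃ (g : ExtAffineWeyl d) (J : Set (Fin d)),
    (∀ v ∈ τ.1, ∃ m ∈ J, SameClass (a v) (g • omega m)) ∧
    (∀ m ∈ J, ∃ v ∈ τ.1, SameClass (a v) (g • omega m)) ∧
    DoubleCosetBruhatLE (weylStabilizer (omega '' J))
      (weylStabilizer ((fun m => iota d ^ r • omega m) '' J))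
      (g⁻¹ * X.h τ * g * (iota d ^ r)⁻¹) (g⁻¹ * Y.h τ * g * (iota d ^ r)⁻¹)

variable [IsLocalRing R]

/-- The preimage in `L_v` of a subspace of `L_v / ϖ L_v`, as a submodule of `K ^ d`. -/
def LatticeConfig.preimage (Γ : LatticeConfig R K d I) (v : I)
    (V : Submodule (IsLocalRing.ResidueField R) (Γ.Lbar v)) : Submodule R (Fin d → K) :=
  ((V.restrictScalars R).comap
    (TensorProduct.mk R (IsLocalRing.ResidueField R) (Γ.L v) 1)).map (Γ.L v).subtype

/-- The set `S_X` of the Bruhat stratification: the points `(V_v)_v` such that, for each maximal simplex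
`τ`, the chain of lattices `ϖ⁻¹ (preimage of V_v)`, `v ∈ τ`, is a translate under the parahoric subgroup
of `τ` of the chain of lattices of the apartment given by the integer vectors `h_τ • a v`. That is, its
restriction to each `τ` lies in the Schubert cell of `h_τ`. -/
def schubertStratum (Γ : LatticeConfig R K d I) (ϖ : R)
    (e : Module.Basis (Fin d) K (Fin d → K)) (a : I → Fin d → ℤ) {r : ℕ}
    (X : AdmissibleCollection Γ ϖ a r) : Set (QuiverGr Γ ϖ fun _ => r) :=
  {M | ∀ τ : Γ.MaxSimplex ϖ, ∃ p : Matrix.SpecialLinearGroup (Fin d) K, Γ.InParahoric τ.1 p ∧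
    ∀ v ∈ τ.1, (algebraMap R K ϖ)⁻¹ • Γ.preimage v (M.V v) =
      slTranslate p (apartmentLattice ϖ e (X.h τ • a v))}

/-- The set of (nonempty) strata of the Bruhat stratification of `Gr((r, …, r), M_Γ)`. -/
def bruhatStrata (Γ : LatticeConfig R K d I) (ϖ : R)
    (e : Module.Basis (Fin d) K (Fin d → K)) (a : I → Fin d → ℤ) (r : ℕ) :
    Set (Set (QuiverGr Γ ϖ fun _ => r)) :=
  {S | S.Nonempty ∧ ∃ X : AdmissibleCollection Γ ϖ a r, S = schubertStratum Γ ϖ e a X}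

end Bruhat

end LinkedGrassmannian

end

set_option linter.unusedSectionVars false

namespace LinkedGrassmannian

/-! ### Bases adapted to chains of subspaces -/

section Flags

variable {κ Q Y : Type*} [Field κ] [AddCommGroup Q] [Module κ Q] [AddCommGroup Y] [Module κ Y]

/-! The exponents `n u v` form a directed metric on the vertices: `f v w ∘ f u v` is `f u w` if `v`
lies on a geodesic from `u` to `w`, and zero otherwise. Convexity supplies, for `u ≠ v`, a neighbour
`s` of `u` on a geodesic to `v` with `ker f u v = ker f u s = im f s u`. Local weak independence
makes the last step of a geodesic unique. Hence geodesic intervals are chains, and for `w ∈ S u` the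
kernels `ker f u q` contained in `im f w u` form a flag. The structure `Linked` records this linear
algebra.

Ranks and isomorphism. In a sub-representation `V` choose generators at each `u`: modulo the sum of
all `V u ∩ im f w u`, and, for each `w ∈ S u`, in `V u ∩ im f w u` modulo `f w u (V w)`, the latter
adapted to the flag of kernels. The images at `q` of the generators not killed by the map to `q`
form a basis of `V q` (`AdaptedGens.span_eq`, `AdaptedGens.linearIndependent`). The number of
generators of each kind, and the number killed by each map, depend only on the ranks. So equal rank
vectors give an isomorphism that matches generators; the converse holds because an isomorphism
commutes with all `f u v`, not only with arrows.

Closures. Ranks are lower semicontinuous, whence one direction. Conversely let `Φ(M) < Φ(M')`. The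
vertices between `u` and some `w ∈ S u` form a cycle, and the ranks along it are a function on pairs
of integers. `exists_elementary_move` finds two generators on the cycle such that adding to the
first a multiple of a vector over the second raises ranks by one, and only at places where `M'` has
room. This is an affine line of sub-representations through `M`, almost all of whose points have a
larger rank vector, still at most `Φ(M')`; induction on the gap finishes
(`mem_closure_of_rankVector_le`).

Apartments and Bruhat order. For `V = ⊤` no generator is ever killed, so the images of the
generators are bases of all reductions and lift by Nakayama to a basis of `K ^ d`. A point and a
maximal simplex `τ` always have a common adapted basis (`LatticeConfig.exists_position`), which
yields a Weyl group element `h_τ`; the rank of `f u v` on `V u` is then the `excess` of `h_τ • a u`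
over `a v + n u v`. On the Weyl group side, elements act as permutations of `ℤ`, and the Bruhat
order is the comparison of the numbers `cnt w i j` of integers below `i` sent to at least `j`. For
double cosets of stabilizers it is enough to compare at the walls, where these numbers are the
excesses above. So the ranks on `τ` determine the double coset of `h_τ` and its place in the Bruhat
order. Ranks on adjacent pairs determine the rank vector, and each adjacent pair lies in a maximal
simplex. -/

theorem finrank_map_add_finrank_inf_ker [FiniteDimensional κ Q] (g : Q →ₗ[κ] Y)
    (A : Submodule κ Q) :
    Module.finrank κ (A.map g) + Module.finrank κ (A ⊓ LinearMap.ker g : Submodule κ Q) =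
      Module.finrank κ A := by
  have h := (g.domRestrict A).finrank_range_add_finrank_ker
  rw [LinearMap.range_domRestrict] at h
  rw [← h]
  congr 1
  rw [LinearMap.ker_domRestrict, ← Submodule.finrank_map_subtype_eq A, Submodule.map_comap_subtype]

/-- Induction on the dimension: a vector `x` outside the largest proper member of the chain becomes
the last basis vector, and the induction hypothesis is applied to a hyperplane of `A` that contains
every proper member and avoids `x`. -/
theorem exists_flag_basis [FiniteDimensional κ Q] {ι : Type*} (n : ℕ) (A : Submodule κ Q)
    (hA : Module.finrank κ A = n) (F : ι → Submodule κ Q) (hF : ∀ i, F i ≤ A)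
    (hch : ∀ i j, F i ≤ F j ∨ F j ≤ F i) :
    ∃ y : Fin n → Q, LinearIndependent κ y ∧ Submodule.span κ (Set.range y) = A ∧
      ∀ i, F i = Submodule.span κ (y '' {j | (j : ℕ) < Module.finrank κ (F i)}) := by
  induction n generalizing A ι with
  | zero =>
    have hA0 : A = ⊥ := Submodule.finrank_eq_zero.mp hA
    subst hA0
    refine ⟨Fin.elim0, linearIndependent_empty_type, by simp, fun i => ?_⟩
    rw [le_bot_iff.mp (hF i)]
    simp
  | succ n ih =>
    -- the largest proper member of the chain
    obtain ⟨F₀, hF₀A, hF₀⟩ : ∃ F₀ : Submodule κ Q, F₀ < A ∧ ∀ i, F i ≠ A → F i ≤ F₀ := by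
      by_cases hne : ∃ i, F i ≠ A
      · obtain ⟨i₀, hi₀⟩ := hne
        have hbdd : BddAbove {m | ∃ i, F i ≠ A ∧ Module.finrank κ (F i) = m} :=
          ⟨n + 1, by rintro m ⟨i, -, rfl⟩; rw [← hA]; exact Submodule.finrank_mono (hF i)⟩
        obtain ⟨i, hi, him⟩ := Nat.sSup_mem (s := {m | ∃ i, F i ≠ A ∧ Module.finrank κ (F i) = m})
          ⟨_, i₀, hi₀, rfl⟩ hbdd
        refine ⟨F i, lt_of_le_of_ne (hF i) hi, fun j hj => ?_⟩
        rcases hch j i with h | h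
        · exact h
        · have : Module.finrank κ (F j) ≤ Module.finrank κ (F i) := by
            rw [him]; exact le_csSup hbdd ⟨j, hj, rfl⟩
          exact (Submodule.eq_of_le_of_finrank_le h this).ge
      · push Not at hne
        refine ⟨⊥, bot_lt_iff_ne_bot.mpr ?_, fun i hi => absurd (hne i) hi⟩
        rintro rfl
        simp at hA
    obtain ⟨x, hxA, hxF⟩ := SetLike.exists_of_lt hF₀A
    obtain ⟨φ, hφx, hφ⟩ := Submodule.exists_le_ker_of_notMem hxF
    set H : Submodule κ Q := A ⊓ LinearMap.ker φ with hH
    have hxH : x ∉ H := fun h => hφx h.2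
    have hAH : A = H ⊔ Submodule.span κ {x} := by
      apply le_antisymm
      · intro a ha
        rw [Submodule.mem_sup]
        refine ⟨a - (φ a / φ x) • x, ⟨A.sub_mem ha (A.smul_mem _ hxA), ?_⟩, (φ a / φ x) • x,
          Submodule.smul_mem _ _ (Submodule.mem_span_singleton_self x), by abel⟩
        simp [LinearMap.mem_ker, div_mul_cancel₀ _ hφx]
      · exact sup_le inf_le_left (by simpa using hxA)
    have hx0 : x ≠ 0 := by rintro rfl; exact hφx (map_zero φ)
    have hHn : Module.finrank κ H = n := by
      have h1 := Submodule.finrank_sup_add_finrank_inf_eq H (Submodule.span κ {x})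
      have h2 : H ⊓ Submodule.span κ {x} = ⊥ := by
        rw [← disjoint_iff, Submodule.disjoint_span_singleton' hx0]
        exact hxH
      rw [← hAH, h2, finrank_bot, finrank_span_singleton hx0, hA] at h1
      omega
    obtain ⟨y, hy, hyH, hyF⟩ := ih H hHn (fun i : {i // F i ≠ A} => F i)
      (fun i => le_inf (hF i) ((hF₀ i i.2).trans hφ)) (fun i j => hch i j)
    refine ⟨Fin.snoc y x, ?_, ?_, ?_⟩
    · rw [linearIndependent_finSnoc]
      exact ⟨hy, by rwa [hyH]⟩
    · rw [Fin.range_snoc, Submodule.span_insert, hyH, sup_comm, ← hAH]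
    · intro i
      by_cases hi : F i = A
      · have : {j : Fin (n + 1) | (j : ℕ) < Module.finrank κ (F i)} = Set.univ := by
          ext j
          have h1 := congrArg (fun C : Submodule κ Q => Module.finrank κ C) hi
          have h2 := j.isLt
          simp only [Set.mem_ofPred_eq, Set.mem_univ, iff_true]
          omega
        rw [this, Set.image_univ, Fin.range_snoc, Submodule.span_insert, hyH, sup_comm, ← hAH, hi]
      · have h1 := hyF ⟨i, hi⟩
        have hle : Module.finrank κ (F i) ≤ n := by
          rw [← hHn]
          exact Submodule.finrank_mono (le_inf (hF i) ((hF₀ i hi).trans hφ))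
        refine h1.trans ?_
        congr 1
        ext z
        constructor
        · rintro ⟨j, hj, rfl⟩
          exact ⟨j.castSucc, by simpa using hj, by simp⟩
        · rintro ⟨j, hj, rfl⟩
          have hjn : (j : ℕ) < n := lt_of_lt_of_le hj hle
          refine ⟨j.castLT hjn, by simpa using hj, ?_⟩
          conv_rhs => rw [← Fin.castSucc_castLT j hjn]
          rw [Fin.snoc_castSucc]

/-- A basis of `A` modulo `B` adapted to a finite chain of subspaces of `A`. -/
theorem exists_relative_flag [FiniteDimensional κ Q] {ι : Type*} [Finite ι]
    {A B : Submodule κ Q} (hBA : B ≤ A) (F : ι → Submodule κ Q) (hF : ∀ i, F i ≤ A)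
    (hch : ∀ i j, F i ≤ F j ∨ F j ≤ F i) {n : ℕ}
    (hn : n = Module.finrank κ A - Module.finrank κ B) (φ : ι → ℕ)
    (hφ : ∀ i, φ i = Module.finrank κ (F i) - Module.finrank κ (F i ⊓ B : Submodule κ Q)) :
    ∃ x : Fin n → Q, (∀ j, x j ∈ A) ∧ (∀ c : Fin n → κ, ∑ j, c j • x j ∈ B → c = 0) ∧
      A ≤ B ⊔ Submodule.span κ (Set.range x) ∧
      ∀ i, (∀ j : Fin n, (j : ℕ) < φ i → x j ∈ F i) ∧
        F i ≤ B ⊔ Submodule.span κ (x '' {j | (j : ℕ) < φ i}) := by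
  have hfr : ∀ C : Submodule κ Q, Module.finrank κ (C.map B.mkQ) =
      Module.finrank κ C - Module.finrank κ (C ⊓ B : Submodule κ Q) := fun C => by
    have := finrank_map_add_finrank_inf_ker B.mkQ C
    rw [Submodule.ker_mkQ] at this
    omega
  obtain ⟨y, hy, hyA, hyF⟩ := exists_flag_basis n (A.map B.mkQ)
    (by rw [hfr, inf_eq_right.mpr hBA, hn]) (fun i => (F i).map B.mkQ)
    (fun i => Submodule.map_mono (hF i))
    (fun i j => (hch i j).imp (Submodule.map_mono ·) (Submodule.map_mono ·))
  have hφ' : ∀ i, Module.finrank κ ((F i).map B.mkQ) = φ i := fun i => by rw [hfr, hφ]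
  simp only [hφ'] at hyF
  have key : ∀ j : Fin n, ∃ x ∈ A, B.mkQ x = y j ∧ ∀ i, (j : ℕ) < φ i → x ∈ F i := by
    intro j
    by_cases hne : ∃ i, (j : ℕ) < φ i
    -- Lift `y j` into the smallest member of the chain that has to contain it; it then lies in all
    -- the others.
    · obtain ⟨i, hi, hmin⟩ : ∃ i, (j : ℕ) < φ i ∧ ∀ i', (j : ℕ) < φ i' → F i ≤ F i' := by
        obtain ⟨i₀, h₀⟩ := hne
        have : Nonempty {i // (j : ℕ) < φ i} := ⟨⟨i₀, h₀⟩⟩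
        obtain ⟨⟨i, hi⟩, hm⟩ :=
          Finite.exists_min (fun i : {i // (j : ℕ) < φ i} => Module.finrank κ (F i))
        refine ⟨i, hi, fun i' hi' => ?_⟩
        rcases hch i i' with h | h
        · exact h
        · exact (Submodule.eq_of_le_of_finrank_le h (hm ⟨i', hi'⟩)).ge
      have : y j ∈ (F i).map B.mkQ := by
        rw [hyF i]
        exact Submodule.subset_span ⟨j, hi, rfl⟩
      obtain ⟨x, hx, hxy⟩ := this
      exact ⟨x, hF i hx, hxy, fun i' hi' => hmin i' hi' hx⟩
    · have : y j ∈ A.map B.mkQ := by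
        rw [← hyA]
        exact Submodule.subset_span ⟨j, rfl⟩
      obtain ⟨x, hx, hxy⟩ := this
      exact ⟨x, hx, hxy, fun i hi => absurd ⟨i, hi⟩ hne⟩
  choose x hxA hxy hxF using key
  have hle : ∀ (C : Submodule κ Q) (s : Set (Fin n)),
      C.map B.mkQ ≤ Submodule.span κ (y '' s) → C ≤ B ⊔ Submodule.span κ (x '' s) := by
    intro C s h
    have h1 : y '' s = B.mkQ '' (x '' s) := by
      rw [Set.image_image]
      simp only [hxy]
    rw [h1, ← Submodule.map_span, Submodule.map_le_iff_le_comap, Submodule.comap_map_mkQ] at h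
    exact h
  refine ⟨x, hxA, fun c hc => ?_, ?_, fun i => ⟨fun j hj => hxF j i hj, hle _ _ (hyF i).le⟩⟩
  · have h0 : ∑ j, c j • y j = 0 := by
      have := (Submodule.Quotient.mk_eq_zero B).mpr hc
      rw [← Submodule.mkQ_apply, map_sum] at this
      simpa [← hxy] using this
    funext j
    exact Fintype.linearIndependent_iff.mp hy c h0 j
  · rw [← Set.image_univ]
    exact hle _ _ (by rw [Set.image_univ, hyA])

theorem exists_sum_eq_of_mem_span_image {ι : Type*} [Fintype ι] {x : ι → Q} {s : Set ι} {z : Q}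
    (hz : z ∈ Submodule.span κ (x '' s)) :
    ∃ e : ι → κ, (∀ j, j ∉ s → e j = 0) ∧ ∑ j, e j • x j = z := by
  obtain ⟨l, hl, rfl⟩ := (Finsupp.mem_span_image_iff_linearCombination κ).mp hz
  refine ⟨l, fun j hj => ?_, ?_⟩
  · by_contra h
    exact hj (hl (Finsupp.mem_support_iff.mpr h))
  · rw [Finsupp.linearCombination_apply, Finsupp.sum_fintype _ _ (by simp)]

/-- A combination of the vectors of index at least `m` lies in `B` plus the span of the others only
if it is trivial. -/
theorem eq_zero_of_add_mem_sup_span {n m : ℕ} {B : Submodule κ Q} {x : Fin n → Q}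
    (hx : ∀ c : Fin n → κ, ∑ j, c j • x j ∈ B → c = 0) {c : Fin n → κ}
    (hc : ∀ j : Fin n, (j : ℕ) < m → c j = 0) {b : Q} (hb : b ∈ B)
    (h : ∑ j, c j • x j + b ∈ B ⊔ Submodule.span κ (x '' {j | (j : ℕ) < m})) : c = 0 := by
  obtain ⟨b', hb', z, hz, hsum⟩ := Submodule.mem_sup.mp h
  obtain ⟨e', he, hz'⟩ := exists_sum_eq_of_mem_span_image hz
  have h1 : c - e' = 0 := hx _ (by
    have : ∑ j, (c - e') j • x j = b' - b := by
      simp only [Pi.sub_apply, sub_smul, Finset.sum_sub_distrib]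
      rw [hz', sub_eq_sub_iff_add_eq_add, ← hsum]
    rw [this]
    exact B.sub_mem hb' hb)
  funext j
  by_cases hj : (j : ℕ) < m
  · exact hc j hj
  · have := congrFun h1 j
    simpa [he j hj, sub_eq_zero] using this

end Flags
end LinkedGrassmannian

namespace LinkedGrassmannian

/-! ### Directed metrics and betweenness -/

section Metric

variable {I : Type*}

/-- `w` lies on a geodesic from `u` to `v`. -/
def Btw (n : I → I → ℤ) (u w v : I) : Prop := n u v = n u w + n w v

/-- `u` and `v` are at distance one. -/
def Adj (n : I → I → ℤ) (u v : I) : Prop := n u v + n v u = 1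

/-- The function `n` is a directed metric, up to the coboundary of a function. -/
structure IsLinkMetric (n : I → I → ℤ) : Prop where
  self : ∀ u, n u u = 0
  tri : ∀ u v w, n u w ≤ n u v + n v w
  pos : ∀ u v, u ≠ v → 1 ≤ n u v + n v u

variable {n : I → I → ℤ}

theorem Adj.symm {u v : I} (h : Adj n u v) : Adj n v u := by
  unfold Adj at *; omega

namespace IsLinkMetric

variable (h : IsLinkMetric n) {a b u v w x y : I}
include h

theorem btw_left : Btw n u u v := by simp [Btw, h.self]

theorem btw_right : Btw n u v v := by simp [Btw, h.self]

theorem eq_of_sum_le (huv : n u v + n v u ≤ 0) : u = v := by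
  by_contra hne
  have := h.pos u v hne
  omega

theorem eq_left (h1 : Btw n u w v) (h2 : Btw n w u v) : u = w := by
  unfold Btw at *
  exact h.eq_of_sum_le (by omega)

theorem eq_right (h1 : Btw n u w v) (h2 : Btw n u v w) : w = v := by
  unfold Btw at *
  exact h.eq_of_sum_le (by omega)

theorem eq_of_btw_self (h1 : Btw n u w u) : w = u := by
  unfold Btw at *
  have := h.self u
  exact h.eq_of_sum_le (by omega)

theorem trans_left (h1 : Btw n u w v) (h2 : Btw n u x w) : Btw n u x v := by
  unfold Btw at *
  have := h.tri x w v
  have := h.tri u x v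
  omega

theorem trans_left' (h1 : Btw n u w v) (h2 : Btw n u x w) : Btw n x w v := by
  unfold Btw at *
  have := h.tri x w v
  have := h.tri u x v
  omega

theorem trans_right (h1 : Btw n u w v) (h2 : Btw n w x v) : Btw n u x v := by
  unfold Btw at *
  have := h.tri u w x
  have := h.tri u x v
  omega

theorem trans_right' (h1 : Btw n u w v) (h2 : Btw n w x v) : Btw n u w x := by
  unfold Btw at *
  have := h.tri u w x
  have := h.tri u x v
  omega

theorem adj_ne (hab : Adj n a b) : a ≠ b := by
  rintro rfl
  have := h.self a
  unfold Adj at hab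
  omega

/-- The triangle inequalities for `s, a, b` and `s, b, a` have total slack `n a b + n b a = 1`, so
one of them is an equality. -/
theorem adj_btw_or (hab : Adj n a b) (s : I) : Btw n s a b ∨ Btw n s b a := by
  unfold Adj Btw at *
  have := h.tri s a b
  have := h.tri s b a
  omega

omit h in
/-- Cyclic rotation of betweenness in a simplex. -/
theorem _root_.LinkedGrassmannian.Btw.rotate (hb : Btw n u v w) (h1 : Adj n u v)
    (h2 : Adj n u w) : Btw n v w u := by
  unfold Adj Btw at *
  omega

omit h in
theorem _root_.LinkedGrassmannian.Btw.rotate' (hb : Btw n u v w) (h1 : Adj n v w)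
    (h2 : Adj n u w) : Btw n w u v := by
  unfold Adj Btw at *
  omega

/-- The points of a geodesic between adjacent points are pairwise adjacent. -/
theorem adj_of_btw_of_btw (hab : Adj n a b) (h1 : Btw n a x y) (h2 : Btw n a y b) (hxy : x ≠ y) :
    Adj n x y := by
  unfold Adj Btw at *
  have := h.tri y b x
  have := h.tri b a x
  have := h.pos x y hxy
  omega

/-- For induction from the far vertices towards `q`: the hypothesis concerns those `w` that have `u`
on a geodesic to `q`. -/
theorem wellFounded_left [Finite I] (q : I) :
    WellFounded fun w u : I => Btw n w u q ∧ w ≠ u := by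
  have : IsTrans I fun w u : I => Btw n w u q ∧ w ≠ u :=
    ⟨fun x y z hxy hyz => ⟨h.trans_right hxy.1 hyz.1, by
      rintro rfl
      exact hxy.2 (h.eq_left hxy.1 hyz.1)⟩⟩
  have : Std.Irrefl fun w u : I => Btw n w u q ∧ w ≠ u := ⟨fun x hx => hx.2 rfl⟩
  exact Finite.wellFounded_of_trans_of_irrefl _

theorem wellFounded_right [Finite I] (q : I) :
    WellFounded fun w u : I => Btw n q w u ∧ w ≠ u := by
  have : IsTrans I fun w u : I => Btw n q w u ∧ w ≠ u :=
    ⟨fun x y z hxy hyz => ⟨h.trans_left hyz.1 hxy.1, by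
      rintro rfl
      exact hxy.2 (h.eq_right hxy.1 hyz.1)⟩⟩
  have : Std.Irrefl fun w u : I => Btw n q w u ∧ w ≠ u := ⟨fun x hx => hx.2 rfl⟩
  exact Finite.wellFounded_of_trans_of_irrefl _

end IsLinkMetric

end Metric

/-! ### Linked families of vector spaces -/

section Linked

variable {κ I : Type*} [Field κ] {W : I → Type*} [∀ v, AddCommGroup (W v)] [∀ v, Module κ (W v)]

/-- A family of vector spaces with maps `f u v`, composing along geodesics to each other and along
other paths to zero, which is locally weakly independent: for each `v` every geodesic to `v` passes
through `S v`, and the images of the maps `f w v`, `w ∈ S v`, are independent. -/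
structure Linked (n : I → I → ℤ) (f : ∀ u v, W u →ₗ[κ] W v) (S : I → Set I) : Prop
    extends IsLinkMetric n where
  map_self : ∀ u, f u u = LinearMap.id
  map_comp : ∀ u v w, Btw n u v w → f v w ∘ₗ f u v = f u w
  map_zero : ∀ u v w, ¬ Btw n u v w → f v w ∘ₗ f u v = 0
  map_ne : ∀ u v, f u v ≠ 0
  ker_eq : ∀ u v, Adj n u v → LinearMap.ker (f u v) = LinearMap.range (f v u)
  exists_pred : ∀ u v, u ≠ v → ∃ w ∈ S v, Btw n u w v
  adj_of_mem : ∀ v, ∀ w ∈ S v, Adj n w v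
  indep : ∀ v, iSupIndep fun w : S v => LinearMap.range (f w v)
  exists_adj_ker : ∀ u v, u ≠ v →
    ∃ s, Adj n u s ∧ Btw n u s v ∧ LinearMap.ker (f u v) = LinearMap.ker (f u s)

variable {n : I → I → ℤ} {f : ∀ u v, W u →ₗ[κ] W v} {S : I → Set I}

namespace Linked

variable (h : Linked n f S) {a b u v w x y : I}
include h

theorem apply_apply (hb : Btw n u v w) (z : W u) : f v w (f u v z) = f u w z := by
  rw [← h.map_comp u v w hb]; rfl

theorem apply_apply_zero (hb : ¬ Btw n u v w) (z : W u) : f v w (f u v z) = 0 := by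
  have := LinearMap.congr_fun (h.map_zero u v w hb) z
  simpa using this

theorem range_le (hb : Btw n u v w) : LinearMap.range (f u w) ≤ LinearMap.range (f v w) := by
  rw [← h.map_comp u v w hb]
  exact LinearMap.range_comp_le_range _ _

theorem ker_le (hb : Btw n u v w) : LinearMap.ker (f u v) ≤ LinearMap.ker (f u w) := by
  rw [← h.map_comp u v w hb]
  exact LinearMap.ker_le_ker_comp _ _

/-- A nonzero subspace cannot lie in two different members of an independent family, and `f u v ≠
0`. -/
theorem eq_of_le_range {w w' : I} (hw : w ∈ S v) (hw' : w' ∈ S v)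
    (h1 : LinearMap.range (f u v) ≤ LinearMap.range (f w v))
    (h2 : LinearMap.range (f u v) ≤ LinearMap.range (f w' v)) : w = w' := by
  by_contra hne
  have hd := (h.indep v).pairwiseDisjoint (i := ⟨w, hw⟩) (j := ⟨w', hw'⟩) (by simpa using hne)
  have := hd h1 h2
  exact h.map_ne u v (LinearMap.range_eq_bot.mp (le_bot_iff.mp this))

theorem pred_unique {w w' : I} (hw : w ∈ S v) (hw' : w' ∈ S v) (h1 : Btw n u w v)
    (h2 : Btw n u w' v) : w = w' :=
  h.eq_of_le_range hw hw' (h.range_le h1) (h.range_le h2)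

/-- If `s ≠ v` lies on a geodesic from `u` to `v` then the predecessors of `v` on the geodesics from
`u` and from `s` agree. -/
theorem btw_pred {s : I} (hs : Btw n u s v) (hsv : s ≠ v) (hw : w ∈ S v) (hb : Btw n u w v) :
    Btw n u s w := by
  obtain ⟨w', hw', hb'⟩ := h.exists_pred s v hsv
  have := h.pred_unique hw hw' hb (h.trans_right hs hb')
  subst this
  exact h.trans_right' hs hb'

/-- Geodesic intervals are chains. -/
theorem btw_or_btw [Finite I] (h1 : Btw n u x v) (h2 : Btw n u y v) :
    Btw n u x y ∨ Btw n u y x := by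
  -- Outward induction from `u`: unless `x` or `y` is the endpoint, both lie on the interval ending
  -- at the unique predecessor of `v`.
  induction v using (h.wellFounded_right u).induction with
  | _ v ih =>
    by_cases hx : x = v
    · subst hx; exact Or.inr h2
    by_cases hy : y = v
    · subst hy; exact Or.inl h1
    by_cases huv : u = v
    · subst huv
      exact absurd (h.eq_of_btw_self h1) hx
    obtain ⟨w, hw, hb⟩ := h.exists_pred u v huv
    exact ih w ⟨hb, h.adj_ne (h.adj_of_mem v w hw)⟩ (h.btw_pred h1 hx hw hb) (h.btw_pred h2 hy hw hb)

/-- A neighbour `b` of `a` lies on the geodesic from `a` to the predecessor of `a` from `b`. -/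
theorem btw_of_adj (hab : Adj n a b) (hw : w ∈ S a) (hb : Btw n b w a) : Btw n a b w := by
  have h1 := h.adj_of_mem a w hw
  unfold Adj Btw at *
  omega

/-- The kernel is `im f s u` for a neighbour `s` of `u`, and a geodesic from `s` to `u` enters `u`
through some `w ∈ S u`. -/
theorem exists_ker_le_range (huv : u ≠ v) :
    ∃ w : S u, LinearMap.ker (f u v) ≤ LinearMap.range (f w u) := by
  obtain ⟨s, hs, -, hk⟩ := h.exists_adj_ker u v huv
  obtain ⟨w, hw, hb⟩ := h.exists_pred s u (h.adj_ne hs).symm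
  exact ⟨⟨w, hw⟩, by rw [hk, h.ker_eq u s hs]; exact h.range_le hb⟩

/-- The description of the kernels contained in the image of `f w u`, for `w ∈ S u`. -/
theorem exists_of_ker_le_range (huv : u ≠ v) (hw : w ∈ S u)
    (hk : LinearMap.ker (f u v) ≤ LinearMap.range (f w u)) :
    ∃ s, Adj n u s ∧ Btw n u s v ∧ LinearMap.ker (f u v) = LinearMap.ker (f u s) ∧
      Btw n s w u ∧ Btw n u s w := by
  obtain ⟨s, hs, hsv, hks⟩ := h.exists_adj_ker u v huv
  obtain ⟨w', hw', hb⟩ := h.exists_pred s u (h.adj_ne hs).symm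
  have hle : LinearMap.range (f s u) ≤ LinearMap.range (f w u) := by
    rwa [← h.ker_eq u s hs, ← hks]
  have := h.eq_of_le_range hw hw' hle (h.range_le hb)
  subst this
  exact ⟨s, hs, hsv, hks, hb, h.btw_of_adj hs hw hb⟩

/-- The two kernels are those of `f u s` and `f u s'` with `s`, `s'` in the interval from `u` to
`w`, which is a chain. -/
theorem ker_chain [Finite I] {q q' : I} (hq : u ≠ q) (hq' : u ≠ q') (hw : w ∈ S u)
    (hk : LinearMap.ker (f u q) ≤ LinearMap.range (f w u))
    (hk' : LinearMap.ker (f u q') ≤ LinearMap.range (f w u)) :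
    LinearMap.ker (f u q) ≤ LinearMap.ker (f u q') ∨
      LinearMap.ker (f u q') ≤ LinearMap.ker (f u q) := by
  obtain ⟨s, -, -, h1, -, h2⟩ := h.exists_of_ker_le_range hq hw hk
  obtain ⟨s', -, -, h1', -, h2'⟩ := h.exists_of_ker_le_range hq' hw hk'
  rw [h1, h1']
  exact (h.btw_or_btw h2 h2').imp h.ker_le h.ker_le

theorem eq_zero_of_sum_eq_zero [Fintype (S u)] (g : S u → W u)
    (hg : ∀ w : S u, g w ∈ LinearMap.range (f w u)) (h0 : ∑ w, g w = 0) (w : S u) : g w = 0 :=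
  (iSupIndep_iff_finsetSum_eq_zero_imp_eq_zero _).mp (h.indep u) Finset.univ g
    (fun w _ => hg w) h0 w (Finset.mem_univ w)

end Linked

end Linked

end LinkedGrassmannian

namespace LinkedGrassmannian

/-! ### Adapted generators of a sub-representation -/

section Generators

variable {κ I : Type*} [Field κ] {W : I → Type*} [∀ v, AddCommGroup (W v)] [∀ v, Module κ (W v)]

section Defs

variable (f : ∀ u v, W u →ₗ[κ] W v) (S : I → Set I) (V : ∀ v, Submodule κ (W v))

/-- The part of `V u` generated by the generators of class `o` at `u`, together with `genBot`. -/
def genTop (u : I) : Option (S u) → Submodule κ (W u)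
  | none => V u
  | some w => V u ⊓ LinearMap.range (f w u)

/-- The part of `genTop` not generated by the generators of class `o` at `u`. -/
def genBot (u : I) : Option (S u) → Submodule κ (W u)
  | none => ⨆ w : S u, V u ⊓ LinearMap.range (f w u)
  | some w => (V w).map (f w u)

/-- The number of generators of class `o` at `u`. -/
noncomputable def genCount (u : I) (o : Option (S u)) : ℕ :=
  Module.finrank κ (genTop f S V u o) - Module.finrank κ (genBot f S V u o)

/-- The number of generators of class `some w` at `u` that are killed by `f u q`. -/
noncomputable def killCount (u : I) (w : S u) (q : I) : ℕ :=
  Module.finrank κ (V u ⊓ LinearMap.ker (f u q) : Submodule κ (W u)) -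
    Module.finrank κ (V u ⊓ LinearMap.ker (f u q) ⊓ (V w).map (f w u) : Submodule κ (W u))

variable {S} in
/-- The generator `t` is killed by the map to `W q`. -/
def Killed {δ : ∀ u, Option (S u) → ℕ} (φ : ∀ u, S u → I → ℕ)
    (t : Σ u, Σ o : Option (S u), Fin (δ u o)) (q : I) : Prop :=
  t.1 ≠ q ∧ ∃ w, t.2.1 = some w ∧
    LinearMap.ker (f t.1 q) ≤ LinearMap.range (f w t.1) ∧ (t.2.2 : ℕ) < φ t.1 w q

/-- The family `x` generates `V` in a way adapted to the kernels of the maps `f u q`. -/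
structure AdaptedGens (δ : ∀ u, Option (S u) → ℕ) (φ : ∀ u, S u → I → ℕ)
    (x : ∀ u (o : Option (S u)), Fin (δ u o) → W u) : Prop where
  stable : ∀ u v, (V u).map (f u v) ≤ V v
  mem : ∀ u o j, x u o j ∈ genTop f S V u o
  indep : ∀ u o (c : Fin (δ u o) → κ), ∑ j, c j • x u o j ∈ genBot f S V u o → c = 0
  span : ∀ u o, genTop f S V u o ≤ genBot f S V u o ⊔ Submodule.span κ (Set.range (x u o))
  killed : ∀ u (w : S u) q, u ≠ q → LinearMap.ker (f u q) ≤ LinearMap.range (f w u) →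
    ∀ j : Fin (δ u (some w)), (j : ℕ) < φ u w q → f u q (x u (some w) j) = 0
  flag : ∀ u (w : S u) q, u ≠ q → LinearMap.ker (f u q) ≤ LinearMap.range (f w u) →
    V u ⊓ LinearMap.ker (f u q) ≤
      (V w).map (f w u) ⊔ Submodule.span κ (x u (some w) '' {j | (j : ℕ) < φ u w q})

end Defs

variable {n : I → I → ℤ} {f : ∀ u v, W u →ₗ[κ] W v} {S : I → Set I}
  {V : ∀ v, Submodule κ (W v)}

/-- Apply `exists_relative_flag` to each class separately. For `some w` the chain consists of the `V
u ⊓ ker (f u q)` inside `im f w u`; for `none` it is empty. -/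
theorem Linked.exists_adaptedGens [Finite I] [∀ v, FiniteDimensional κ (W v)] (h : Linked n f S)
    (hV : ∀ u v, (V u).map (f u v) ≤ V v) {δ : ∀ u, Option (S u) → ℕ} {φ : ∀ u, S u → I → ℕ}
    (hδ : δ = genCount f S V) (hφ : φ = killCount f S V) :
    ∃ x, AdaptedGens f S V δ φ x := by
  have h1 : ∀ u (w : S u), ∃ x : Fin (δ u (some w)) → W u,
      (∀ j, x j ∈ genTop f S V u (some w)) ∧
      (∀ c : Fin (δ u (some w)) → κ, ∑ j, c j • x j ∈ genBot f S V u (some w) → c = 0) ∧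
      genTop f S V u (some w) ≤ genBot f S V u (some w) ⊔ Submodule.span κ (Set.range x) ∧
      ∀ q : {q // u ≠ q ∧ LinearMap.ker (f u q) ≤ LinearMap.range (f w u)},
        (∀ j : Fin (δ u (some w)), (j : ℕ) < φ u w q → x j ∈ V u ⊓ LinearMap.ker (f u q)) ∧
        V u ⊓ LinearMap.ker (f u q) ≤
          (V w).map (f w u) ⊔ Submodule.span κ (x '' {j | (j : ℕ) < φ u w q}) := by
    intro u w
    refine exists_relative_flag (ι := {q // u ≠ q ∧ LinearMap.ker (f u q) ≤ LinearMap.range (f w u)})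
      (A := genTop f S V u (some w)) (B := genBot f S V u (some w))
      (le_inf (hV w u) (LinearMap.map_le_range)) (fun q => V u ⊓ LinearMap.ker (f u q))
      (fun q => inf_le_inf_left _ q.2.2) (fun q q' => ?_) (by rw [hδ]; rfl) (fun q => φ u w q)
      (fun q => by rw [hφ]; rfl)
    exact (h.ker_chain q.2.1 q'.2.1 w.2 q.2.2 q'.2.2).imp (inf_le_inf_left _) (inf_le_inf_left _)
  have h2 : ∀ u, ∃ x : Fin (δ u none) → W u,
      (∀ j, x j ∈ genTop f S V u none) ∧
      (∀ c : Fin (δ u none) → κ, ∑ j, c j • x j ∈ genBot f S V u none → c = 0) ∧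
      genTop f S V u none ≤ genBot f S V u none ⊔ Submodule.span κ (Set.range x) := by
    intro u
    obtain ⟨x, hx1, hx2, hx3, -⟩ := exists_relative_flag (ι := Empty)
      (A := genTop f S V u none) (B := genBot f S V u none)
      (iSup_le fun w => inf_le_left) (fun q => q.elim) (fun q => q.elim) (fun q => q.elim)
      (by rw [hδ]; rfl : δ u none = _) (fun q => q.elim) (fun q => q.elim)
    exact ⟨x, hx1, hx2, hx3⟩
  choose x1 hx1 using h1
  choose x2 hx2 using h2
  refine ⟨fun u o => match o with
    | none => x2 u
    | some w => x1 u w, hV, ?_, ?_, ?_, ?_, ?_⟩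
  · rintro u (_ | w) j
    · exact (hx2 u).1 j
    · exact (hx1 u w).1 j
  · rintro u (_ | w) c
    · exact (hx2 u).2.1 c
    · exact (hx1 u w).2.1 c
  · rintro u (_ | w)
    · exact (hx2 u).2.2
    · exact (hx1 u w).2.2.1
  · intro u w q hq hk j hj
    exact (((hx1 u w).2.2.2 ⟨q, hq, hk⟩).1 j hj).2
  · intro u w q hq hk
    exact ((hx1 u w).2.2.2 ⟨q, hq, hk⟩).2

namespace AdaptedGens

variable {δ : ∀ u, Option (S u) → ℕ} {φ : ∀ u, S u → I → ℕ}
  {x : ∀ v (o : Option (S v)), Fin (δ v o) → W v} (hx : AdaptedGens f S V δ φ x)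
include hx

theorem mem_V (u : I) (o : Option (S u)) (j : Fin (δ u o)) : x u o j ∈ V u := by
  have := hx.mem u o j
  rcases o with _ | w
  · exact this
  · exact this.1

theorem map_mem (u q : I) (o : Option (S u)) (j : Fin (δ u o)) : f u q (x u o j) ∈ V q :=
  hx.stable u q (Submodule.mem_map_of_mem (hx.mem_V u o j))

theorem map_eq_zero {t : Σ u, Σ o : Option (S u), Fin (δ u o)} {q : I} (ht : Killed f φ t q) :
    f t.1 q (x t.1 t.2.1 t.2.2) = 0 := by
  obtain ⟨u, _ | w, j⟩ := t
  · obtain ⟨-, w, hw, -⟩ := ht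
    simp at hw
  · obtain ⟨hq, w', hw, hk, hj⟩ := ht
    obtain rfl : w = w' := Option.some_injective _ hw
    exact hx.killed u w q hq hk j hj

/-- By induction from the far vertices, the image of each `V u` in `W q` is generated: modulo the
generators at `u`, an element of `V u` comes from the `V w` with `w ∈ S u`, and going on from `w`
through `u` to `q` is either a geodesic or zero. -/
theorem span_eq [Finite I] (h : Linked n f S) (q : I) :
    Submodule.span κ (Set.range fun t : {t : Σ u, Σ o : Option (S u), Fin (δ u o) //
      ¬ Killed f φ t q} => f t.1.1 q (x t.1.1 t.1.2.1 t.1.2.2)) = V q := by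
  apply le_antisymm
  · rw [Submodule.span_le]
    rintro _ ⟨t, rfl⟩
    exact hx.map_mem _ _ _ _
  set P := Submodule.span κ (Set.range fun t : {t : Σ u, Σ o : Option (S u), Fin (δ u o) //
      ¬ Killed f φ t q} => f t.1.1 q (x t.1.1 t.1.2.1 t.1.2.2)) with hP
  have hgen : ∀ u o j, f u q (x u o j) ∈ P := by
    intro u o j
    by_cases hk : Killed f φ ⟨u, o, j⟩ q
    · have := hx.map_eq_zero hk
      simp only at this
      rw [this]
      exact P.zero_mem
    · exact Submodule.subset_span ⟨⟨⟨u, o, j⟩, hk⟩, rfl⟩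
  have key : ∀ u, (V u).map (f u q) ≤ P := by
    intro u
    induction u using (h.wellFounded_left q).induction with
    | _ u ih =>
      have hspan : ∀ o, (Submodule.span κ (Set.range (x u o))).map (f u q) ≤ P := by
        intro o
        rw [Submodule.map_span, Submodule.span_le]
        rintro _ ⟨_, ⟨j, rfl⟩, rfl⟩
        exact hgen u o j
      have hsome : ∀ w : S u, (genTop f S V u (some w)).map (f u q) ≤ P := by
        intro w
        refine (Submodule.map_mono (hx.span u (some w))).trans ?_
        rw [Submodule.map_sup]
        refine sup_le ?_ (hspan _)
        change ((V w).map (f w u)).map (f u q) ≤ P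
        rw [← Submodule.map_comp]
        by_cases hb : Btw n w u q
        · rw [h.map_comp _ _ _ hb]
          exact ih w ⟨hb, h.adj_ne (h.adj_of_mem u w w.2)⟩
        · rw [h.map_zero _ _ _ hb, Submodule.map_zero]
          exact bot_le
      refine (Submodule.map_mono (hx.span u none)).trans ?_
      rw [Submodule.map_sup]
      refine sup_le ?_ (hspan _)
      change (⨆ w : S u, V u ⊓ LinearMap.range (f w u)).map (f u q) ≤ P
      rw [Submodule.map_iSup]
      exact iSup_le hsome
  have := key q
  rwa [h.map_self, Submodule.map_id] at this

omit hx in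
/-- Vanishing of the components of an element of `ker (f u q)`. -/
theorem component_aux (h : Linked n f S) {u q : I} [Fintype (S u)] {z : W u} {g : S u → W u}
    (hz : ∀ b ∈ genBot f S V u none, z + b = 0 → z = 0)
    (hg : ∀ w : S u, g w ∈ V u ⊓ LinearMap.range (f w u)) (hzV : z ∈ V u)
    (hsum : z + ∑ w, g w ∈ LinearMap.ker (f u q)) :
    z = 0 ∧ ∀ w : S u, g w ∈ LinearMap.ker (f u q) ∧
      (g w ≠ 0 → u ≠ q ∧ LinearMap.ker (f u q) ≤ LinearMap.range (f w u)) := by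
  classical
  have hgb : ∀ w, g w ∈ genBot f S V u none := fun w =>
    Submodule.mem_iSup_of_mem (p := fun w : S u => V u ⊓ LinearMap.range (f w u)) w (hg w)
  have hgs : ∑ w, g w ∈ genBot f S V u none := Submodule.sum_mem _ fun w _ => hgb w
  by_cases huq : u = q
  · subst huq
    rw [h.map_self, LinearMap.ker_id, Submodule.mem_bot] at hsum
    have hz0 : z = 0 := hz _ hgs hsum
    refine ⟨hz0, fun w => ?_⟩
    rw [hz0, zero_add] at hsum
    have := h.eq_zero_of_sum_eq_zero g (fun w => (hg w).2) hsum w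
    rw [this]
    exact ⟨Submodule.zero_mem _, fun hh => absurd rfl hh⟩
  -- The kernel lies in a single `im f w₀ u`. So the whole sum `k` belongs to the summand of `w₀`,
  -- and independence leaves no other component.
  · obtain ⟨w₀, hw₀⟩ := h.exists_ker_le_range huq
    set k := z + ∑ w, g w with hk
    have hkV : k ∈ V u ⊓ LinearMap.range (f w₀ u) :=
      ⟨(V u).add_mem hzV (Submodule.sum_mem _ fun w _ => (hg w).1), hw₀ hsum⟩
    have hkb : k ∈ genBot f S V u none :=
      Submodule.mem_iSup_of_mem (p := fun w : S u => V u ⊓ LinearMap.range (f w u)) w₀ hkV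
    have hz0 : z = 0 := hz (∑ w, g w - k) (Submodule.sub_mem _ hgs hkb) (by rw [hk]; abel)
    have hall := h.eq_zero_of_sum_eq_zero (fun w => g w - if w = w₀ then k else 0)
      (fun w => by
        refine Submodule.sub_mem _ (hg w).2 ?_
        split_ifs with hw
        · subst hw; exact hkV.2
        · exact Submodule.zero_mem _)
      (by rw [Finset.sum_sub_distrib, Finset.sum_ite_eq' Finset.univ w₀, if_pos (Finset.mem_univ _),
            hk, hz0]; abel)
    refine ⟨hz0, fun w => ?_⟩
    by_cases hw : w = w₀
    · subst hw
      have := hall w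
      rw [if_pos rfl, sub_eq_zero] at this
      rw [this]
      exact ⟨hsum, fun _ => ⟨huq, hw₀⟩⟩
    · have := hall w
      rw [if_neg hw, sub_zero] at this
      rw [this]
      exact ⟨Submodule.zero_mem _, fun hh => absurd rfl hh⟩

/-- A relation at `q` among generators that reach `q` through `u` is pulled back to `u`, where the
sum lies in `ker (f u q)`. Independence of the images splits it into one part for each `w ∈ S u`.
The coefficients at `u` vanish by the choice of generators, and what remains of the part of `w` is a
relation among generators reaching `q` through `w`, so induction applies. -/
theorem coeff_eq_zero [Fintype I] [∀ u, Fintype (S u)] (h : Linked n f S) (q u : I)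
    (C : ∀ s (o : Option (S s)), Fin (δ s o) → κ)
    (hC : ∀ s o j, C s o j ≠ 0 → Btw n s u q ∧ ¬ Killed f φ ⟨s, o, j⟩ q)
    (h0 : ∑ s, f s q (∑ o, ∑ j, C s o j • x s o j) = 0) : C = 0 := by
  classical
  induction u using (h.wellFounded_left q).induction generalizing C with
  | _ u ih =>
    set X : ∀ s, W s := fun s => ∑ o, ∑ j, C s o j • x s o j with hX
    have hXV : ∀ s, X s ∈ V s := fun s => Submodule.sum_mem _ fun o _ => Submodule.sum_mem _
      fun j _ => Submodule.smul_mem _ _ (hx.mem_V s o j)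
    have hC0 : ∀ s, ¬ Btw n s u q → C s = 0 := fun s hs => by
      funext o j
      by_contra hne
      exact hs (hC s o j hne).1
    have hX0 : ∀ s, C s = 0 → X s = 0 := fun s hs => by simp [hX, hs]
    -- the part of the sum through `w`
    set C' : S u → ∀ s (o : Option (S s)), Fin (δ s o) → κ :=
      fun w s => if s ≠ u ∧ Btw n s w u then C s else 0 with hC'
    set y : ∀ w : S u, W w := fun w =>
      ∑ s, if s ≠ u ∧ Btw n s w u then f s w (X s) else 0 with hy
    have hyV : ∀ w : S u, y w ∈ V w := fun w => Submodule.sum_mem _ fun s _ => by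
      split_ifs
      · exact hx.stable s w (Submodule.mem_map_of_mem (hXV s))
      · exact Submodule.zero_mem _
    set g : S u → W u := fun w => ∑ j, C u (some w) j • x u (some w) j + f w u (y w) with hg
    have hgV : ∀ w : S u, g w ∈ V u ⊓ LinearMap.range (f w u) := fun w =>
      Submodule.add_mem _ (Submodule.sum_mem _ fun j _ => Submodule.smul_mem _ _
        (hx.mem u (some w) j)) ⟨hx.stable w u (Submodule.mem_map_of_mem (hyV w)), ⟨_, rfl⟩⟩
    -- Each `s ≠ u` reaches `u` through exactly one `w ∈ S u`, so its contribution occurs in exactly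
    -- one `y w`.
    have hsplit : ∑ w : S u, f w u (y w) = ∑ s, if s = u then 0 else f s u (X s) := by
      simp only [hy, map_sum]
      rw [Finset.sum_comm]
      refine Finset.sum_congr rfl fun s _ => ?_
      by_cases hs : s = u
      · simp [hs]
      · rw [if_neg hs]
        obtain ⟨w, hw, hb⟩ := h.exists_pred s u hs
        rw [Finset.sum_eq_single ⟨w, hw⟩]
        · rw [if_pos ⟨hs, hb⟩, h.apply_apply hb]
        · intro w' _ hne
          rw [if_neg, map_zero]
          rintro ⟨-, hb'⟩
          exact hne (Subtype.ext (h.pred_unique w'.2 hw hb' hb))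
        · exact fun hh => absurd (Finset.mem_univ _) hh
    set z : W u := ∑ j, C u none j • x u none j with hz
    have hXu : X u = z + ∑ w : S u, ∑ j, C u (some w) j • x u (some w) j := by
      simp only [hX, hz]
      rw [Fintype.sum_option]
    have hsum : z + ∑ w, g w ∈ LinearMap.ker (f u q) := by
      rw [LinearMap.mem_ker, ← h0, hg, Finset.sum_add_distrib, ← add_assoc, ← hXu, hsplit, map_add]
      have : ∀ s, f s q (X s) = (if s = u then f u q (X u) else 0) +
          f u q (if s = u then 0 else f s u (X s)) := by
        intro s
        by_cases hs : s = u
        · subst hs; simp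
        · rw [if_neg hs, if_neg hs, zero_add]
          by_cases hb : Btw n s u q
          · rw [h.apply_apply hb]
          · rw [hX0 s (hC0 s hb)]; simp
      rw [Finset.sum_congr rfl fun s _ => this s, Finset.sum_add_distrib,
        Finset.sum_ite_eq' Finset.univ u, if_pos (Finset.mem_univ u), ← map_sum]
    obtain ⟨hz0, hgk⟩ := component_aux h (fun b hb hzb => by
        have := hx.indep u none (C u none) (by
          have : ∑ j, C u none j • x u none j = -b := eq_neg_of_add_eq_zero_left hzb
          rw [this]
          exact Submodule.neg_mem _ hb)
        simp [this]) hgV (Submodule.sum_mem _ fun j _ => Submodule.smul_mem _ _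
          (hx.mem_V u none j)) hsum
    have hCnone : C u none = 0 := hx.indep u none _ (by
      rw [hz0]; exact Submodule.zero_mem _)
    have hCsome : ∀ w : S u, C u (some w) = 0 := by
      intro w
      have hmem : f w u (y w) ∈ (V w).map (f w u) := Submodule.mem_map_of_mem (hyV w)
      by_cases hgw : g w = 0
      · refine hx.indep u (some w) _ ?_
        have : ∑ j, C u (some w) j • x u (some w) j = - f w u (y w) :=
          eq_neg_of_add_eq_zero_left hgw
        rw [this]
        exact Submodule.neg_mem _ hmem
      -- Now `g w` lies in the flag member spanned, modulo `f w u (V w)`, by the generators of index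
      -- below `φ u w q`. These are killed at `q` and have coefficient zero by assumption.
      · obtain ⟨huq, hk⟩ := (hgk w).2 hgw
        refine eq_zero_of_add_mem_sup_span (hx.indep u (some w)) (m := φ u w q) (fun j hj => ?_)
          hmem (hx.flag u w q huq hk ⟨(hgV w).1, (hgk w).1⟩)
        by_contra hne
        exact (hC u (some w) j hne).2 ⟨huq, w, rfl, hk, hj⟩
    have hCu : C u = 0 := by
      funext o
      rcases o with _ | w
      · exact hCnone
      · exact hCsome w
    have hC'0 : ∀ w : S u, C' w = 0 := by
      intro w
      by_cases hbw : Btw n w u q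
      · refine ih w ⟨hbw, h.adj_ne (h.adj_of_mem u w w.2)⟩ (C' w) (fun s o j hne => ?_) ?_
        · by_cases hs : s ≠ u ∧ Btw n s w u
          · simp only [hC', if_pos hs] at hne
            obtain ⟨h1, h2⟩ := hC s o j hne
            exact ⟨h.trans_left h1 hs.2 , h2⟩
          · simp [hC', if_neg hs] at hne
        · have hgw : g w = f w u (y w) := by simp [hg, hCsome w]
          have := (hgk w).1
          rw [LinearMap.mem_ker, hgw, h.apply_apply hbw, hy, map_sum] at this
          rw [← this]
          refine Finset.sum_congr rfl fun s _ => ?_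
          by_cases hs : s ≠ u ∧ Btw n s w u
          · rw [if_pos hs]
            simp only [hC', if_pos hs]
            by_cases hb : Btw n s u q
            · rw [h.apply_apply (h.trans_left hb hs.2)]
            · have := hC0 s hb
              simp [hX, this]
          · simp [hC', if_neg hs]
      · funext s o j
        by_contra hne
        by_cases hs : s ≠ u ∧ Btw n s w u
        · simp only [hC', if_pos hs] at hne
          exact hbw (h.trans_left' (hC s o j hne).1 hs.2)
        · simp [hC', if_neg hs] at hne
    funext s
    by_cases hs : s = u
    · subst hs; exact hCu
    · obtain ⟨w, hw, hb⟩ := h.exists_pred s u hs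
      have := congrFun (hC'0 ⟨w, hw⟩) s
      simpa [hC', hs, hb] using this

/-- The case `u = q` of `coeff_eq_zero`, where the betweenness condition is void; the coefficients
are extended by zero to the killed generators. -/
theorem linearIndependent [Finite I] (h : Linked n f S) (q : I) :
    LinearIndependent κ (fun t : {t : Σ u, Σ o : Option (S u), Fin (δ u o) // ¬ Killed f φ t q} =>
      f t.1.1 q (x t.1.1 t.1.2.1 t.1.2.2)) := by
  classical
  have := Fintype.ofFinite I
  have : ∀ u, Fintype (S u) := fun u => Fintype.ofFinite _
  rw [Fintype.linearIndependent_iff]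
  intro c hc
  set C : ∀ s (o : Option (S s)), Fin (δ s o) → κ :=
    fun s o j => if hk : Killed f φ ⟨s, o, j⟩ q then 0 else c ⟨⟨s, o, j⟩, hk⟩ with hC
  have hC0 := hx.coeff_eq_zero h q q C (fun s o j hne => ⟨h.btw_right, fun hk => by
    simp [hC, hk] at hne⟩) (by
      rw [← hc]
      simp only [map_sum, map_smul]
      set F : (Σ u, Σ o : Option (S u), Fin (δ u o)) → W q :=
        fun t => C t.1 t.2.1 t.2.2 • f t.1 q (x t.1 t.2.1 t.2.2) with hF
      have h1 : ∑ t, F t = ∑ s, ∑ o, ∑ j, C s o j • f s q (x s o j) := by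
        rw [Fintype.sum_sigma]
        exact Finset.sum_congr rfl fun s _ => by rw [Fintype.sum_sigma]
      rw [← h1, ← Finset.sum_filter_add_sum_filter_not Finset.univ (fun t => Killed f φ t q) F,
        Finset.sum_eq_zero, zero_add]
      · rw [Finset.sum_subtype (p := fun t => ¬ Killed f φ t q) _ (by simp) F]
        refine Finset.sum_congr rfl fun t _ => ?_
        simp [hF, hC, t.2]
      · intro t ht
        have := (Finset.mem_filter.mp ht).2
        simp [hF, hC, this])
  intro t
  have := congrFun (congrFun (congrFun hC0 t.1.1) t.1.2.1) t.1.2.2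
  simpa [hC, t.2] using this

theorem map_eq_zero_iff [Finite I] (h : Linked n f S)
    (t : Σ u, Σ o : Option (S u), Fin (δ u o)) (q : I) :
    f t.1 q (x t.1 t.2.1 t.2.2) = 0 ↔ Killed f φ t q :=
  ⟨fun h0 => by_contra fun hk => (hx.linearIndependent h q).ne_zero ⟨t, hk⟩ h0, hx.map_eq_zero⟩

end AdaptedGens

end Generators

end LinkedGrassmannian

namespace LinkedGrassmannian

/-! ### Rank vectors determine sub-representations up to isomorphism -/

section RankVectors

variable {κ I : Type*} [Field κ] {W : I → Type*} [∀ v, AddCommGroup (W v)] [∀ v, Module κ (W v)]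

/-- The rank of `f u v` on `V u`. -/
noncomputable def subRank (f : ∀ u v, W u →ₗ[κ] W v) (V : ∀ v, Submodule κ (W v)) (u v : I) : ℕ :=
  Module.finrank κ ((V u).map (f u v))

variable {n : I → I → ℤ} {f : ∀ u v, W u →ₗ[κ] W v} {S : I → Set I}
  {V V' : ∀ v, Submodule κ (W v)} [∀ v, FiniteDimensional κ (W v)]

theorem subRank_add_finrank_ker (V : ∀ v, Submodule κ (W v)) (u v : I) :
    subRank f V u v + Module.finrank κ (V u ⊓ LinearMap.ker (f u v) : Submodule κ (W u)) =
      Module.finrank κ (V u) :=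
  finrank_map_add_finrank_inf_ker (f u v) (V u)

omit [∀ v, FiniteDimensional κ (W v)] in
theorem Linked.subRank_self (h : Linked n f S) (u : I) :
    subRank f V u u = Module.finrank κ (V u) := by
  rw [subRank, h.map_self, Submodule.map_id]

/-- As `w` and `u` are adjacent, `im f w u = ker f u w`, so rank-nullity for `f u w` on `V u`
applies. -/
theorem Linked.genCount_some (h : Linked n f S) (u : I) (w : S u) :
    genCount f S V u (some w) = subRank f V u u - subRank f V u w - subRank f V w u := by
  have h1 := subRank_add_finrank_ker (f := f) V u w
  rw [h.ker_eq u w (h.adj_of_mem u w w.2).symm] at h1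
  change Module.finrank κ (V u ⊓ LinearMap.range (f w u) : Submodule κ (W u)) -
    Module.finrank κ ((V w).map (f w u)) = _
  rw [h.subRank_self, ← h1, Nat.add_sub_cancel_left]
  rfl

theorem finrank_iSup_of_iSupIndep {ι Q : Type*} [AddCommGroup Q] [Module κ Q]
    [FiniteDimensional κ Q] [Fintype ι] (A : ι → Submodule κ Q) (hA : iSupIndep A) :
    Module.finrank κ (⨆ i, A i : Submodule κ Q) = ∑ i, Module.finrank κ (A i) := by
  classical
  have key : ∀ s : Finset ι, Module.finrank κ (⨆ i ∈ s, A i : Submodule κ Q) =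
      ∑ i ∈ s, Module.finrank κ (A i) := by
    intro s
    induction s using Finset.induction_on with
    | empty => simp
    | insert a s ha ih =>
      rw [Finset.sum_insert ha, Finset.iSup_insert, ← ih, ← Submodule.finrank_sup_add_finrank_inf_eq,
        disjoint_iff.mp (by simpa using hA.disjoint_biSup (y := (s : Set ι)) ha)]
      simp
  have huniv : (⨆ i ∈ Finset.univ, A i) = ⨆ i, A i := by simp
  rw [← huniv, key]

/-- By independence of the images the sum of the `V u ⊓ im f w u` is direct, so its dimension is the
sum of the nullities. -/
theorem Linked.genCount_none (h : Linked n f S) (u : I) [Fintype (S u)] :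
    genCount f S V u none =
      subRank f V u u - ∑ w : S u, (subRank f V u u - subRank f V u w) := by
  change Module.finrank κ (V u) -
    Module.finrank κ (⨆ w : S u, V u ⊓ LinearMap.range (f w u) : Submodule κ (W u)) = _
  rw [finrank_iSup_of_iSupIndep _ ((h.indep u).mono fun w => inf_le_right), h.subRank_self]
  congr 1
  refine Finset.sum_congr rfl fun w _ => ?_
  have h1 := subRank_add_finrank_ker (f := f) V u w
  rw [h.ker_eq u w (h.adj_of_mem u w w.2).symm] at h1
  omega

open Classical in
-- The part of `V u ⊓ ker (f u q)` that comes from `V w` is the image of the kernel on `V w` of `f u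
-- q ∘ f w u`, which is `f w q` or zero. Additive form avoids truncated subtraction.
theorem Linked.killCount_eq (h : Linked n f S) (hV : ∀ u v, (V u).map (f u v) ≤ V v)
    (u : I) (w : S u) (q : I) :
    killCount f S V u w q + subRank f V u q + subRank f V w u =
      subRank f V u u + if Btw n w u q then subRank f V w q else 0 := by
  set A : Submodule κ (W w) := V w ⊓ LinearMap.ker (f u q ∘ₗ f w u) with hA
  have hmap : V u ⊓ LinearMap.ker (f u q) ⊓ (V w).map (f w u) = A.map (f w u) := by
    ext z
    constructor
    · rintro ⟨⟨-, hz⟩, y, hy, rfl⟩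
      exact ⟨y, ⟨hy, hz⟩, rfl⟩
    · rintro ⟨y, ⟨hy, hz⟩, rfl⟩
      exact ⟨⟨hV w u (Submodule.mem_map_of_mem hy), hz⟩, Submodule.mem_map_of_mem hy⟩
  have h1 := finrank_map_add_finrank_inf_ker (f w u) A
  have hAk : A ⊓ LinearMap.ker (f w u) = V w ⊓ LinearMap.ker (f w u) := by
    rw [hA, inf_assoc, inf_eq_right.mpr (LinearMap.ker_le_ker_comp (f w u) (f u q))]
  rw [hAk] at h1
  have h2 := subRank_add_finrank_ker (f := f) V w u
  have h3 := finrank_map_add_finrank_inf_ker (f u q ∘ₗ f w u) (V w)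
  rw [← hA] at h3
  have h4 := subRank_add_finrank_ker (f := f) V u q
  have h5 : Module.finrank κ ((V w).map (f u q ∘ₗ f w u)) =
      if Btw n w u q then subRank f V w q else 0 := by
    split_ifs with hb
    · rw [h.map_comp _ _ _ hb, subRank]
    · rw [h.map_zero _ _ _ hb, Submodule.map_zero, finrank_bot]
  have h6 : Module.finrank κ (V u ⊓ LinearMap.ker (f u q) ⊓ (V w).map (f w u) :
      Submodule κ (W u)) ≤ Module.finrank κ (V u ⊓ LinearMap.ker (f u q) : Submodule κ (W u)) :=
    Submodule.finrank_mono inf_le_left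
  rw [← h5, h.subRank_self, killCount]
  rw [hmap] at h6 ⊢
  omega

theorem Linked.genCount_congr [Finite I] (h : Linked n f S)
    (hr : ∀ u v, subRank f V u v = subRank f V' u v) : genCount f S V = genCount f S V' := by
  have : ∀ u, Fintype (S u) := fun u => Fintype.ofFinite _
  funext u o
  rcases o with _ | w
  · simp only [h.genCount_none, hr]
  · simp only [h.genCount_some, hr]

theorem Linked.killCount_congr (h : Linked n f S) (hV : ∀ u v, (V u).map (f u v) ≤ V v)
    (hV' : ∀ u v, (V' u).map (f u v) ≤ V' v)
    (hr : ∀ u v, subRank f V u v = subRank f V' u v) : killCount f S V = killCount f S V' := by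
  classical
  funext u w q
  have h1 := h.killCount_eq hV u w q
  have h2 := h.killCount_eq hV' u w q
  simp only [hr] at h1
  omega

omit [∀ v, FiniteDimensional κ (W v)] in
theorem AdaptedGens.exists_basis [Finite I] {δ : ∀ u, Option (S u) → ℕ} {φ : ∀ u, S u → I → ℕ}
    {x : ∀ v (o : Option (S v)), Fin (δ v o) → W v} (hx : AdaptedGens f S V δ φ x)
    (h : Linked n f S) (q : I) :
    ∃ b : Module.Basis {t : Σ u, Σ o : Option (S u), Fin (δ u o) // ¬ Killed f φ t q} κ (V q),
      ∀ t, (b t : W q) = f t.1.1 q (x t.1.1 t.1.2.1 t.1.2.2) :=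
  ⟨(Module.Basis.span (hx.linearIndependent h q)).map (LinearEquiv.ofEq _ _ (hx.span_eq h q)),
    fun t => by simp [Module.Basis.span_apply]⟩

/-- Sub-representations with the same ranks are isomorphic. -/
theorem Linked.exists_equiv [Finite I] (h : Linked n f S) (hV : ∀ u v, (V u).map (f u v) ≤ V v)
    (hV' : ∀ u v, (V' u).map (f u v) ≤ V' v)
    (hr : ∀ u v, subRank f V u v = subRank f V' u v) :
    ∃ e : ∀ v, V v ≃ₗ[κ] V' v, ∀ (u v : I) (y : V u) (hy : f u v y ∈ V v),
      (e v ⟨f u v y, hy⟩ : W v) = f u v (e u y) := by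
  obtain ⟨x, hx⟩ := h.exists_adaptedGens hV rfl rfl
  obtain ⟨x', hx'⟩ := h.exists_adaptedGens hV' (h.genCount_congr hr) (h.killCount_congr hV hV' hr)
  choose b hb using hx.exists_basis h
  choose b' hb' using hx'.exists_basis h
  -- With equal counts, the two generating families have the same index types and the same killed
  -- indices, so generators of the same index can be matched.
  set e : ∀ v, V v ≃ₗ[κ] V' v := fun v => (b v).equiv (b' v) (Equiv.refl _) with he
  have hmem : ∀ u v (y : V u), f u v y ∈ V v := fun u v y => hV u v (Submodule.mem_map_of_mem y.2)
  refine ⟨e, fun u v y hy => ?_⟩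
  have key : (V' v).subtype ∘ₗ (e v).toLinearMap ∘ₗ
      ((f u v ∘ₗ (V u).subtype).codRestrict (V v) (hmem u v)) =
      f u v ∘ₗ (V' u).subtype ∘ₗ (e u).toLinearMap := by
    refine (b u).ext fun t => ?_
    have hbt : f u v (b u t) = f u v (f t.1.1 u (x t.1.1 t.1.2.1 t.1.2.2)) := by rw [hb]
    have het : e u (b u t) = b' u t := by simp [he]
    change ((e v ⟨f u v (b u t), hmem u v _⟩ : V' v) : W v) = f u v (e u (b u t) : V' u)
    rw [het, hb']
    by_cases hbtw : Btw n t.1.1 u v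
    · rw [h.apply_apply hbtw] at hbt ⊢
      by_cases hk : Killed f (killCount f S V) t.1 v
      · rw [hx'.map_eq_zero hk]
        have h0 : (⟨f u v (b u t), hmem u v _⟩ : V v) = 0 :=
          Subtype.ext (hbt.trans (hx.map_eq_zero hk))
        rw [h0, (e v).map_zero]; rfl
      · have h0 : (⟨f u v (b u t), hmem u v _⟩ : V v) = b v ⟨t.1, hk⟩ :=
          Subtype.ext (hbt.trans (hb v ⟨t.1, hk⟩).symm)
        have h1 : e v (b v ⟨t.1, hk⟩) = b' v ⟨t.1, hk⟩ := by simp [he]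
        rw [h0, h1, hb']
    · rw [h.apply_apply_zero hbtw] at hbt ⊢
      have h0 : (⟨f u v (b u t), hmem u v _⟩ : V v) = 0 := Subtype.ext hbt
      rw [h0, (e v).map_zero]; rfl
  exact LinearMap.congr_fun key y

end RankVectors

end LinkedGrassmannian

namespace LinkedGrassmannian

/-! ### Elementary moves between rank functions on a cycle -/

/-- Think of `R i j` as the rank of the map from the `i`-th to the `j`-th point of a cycle of length
`N`. For fixed `i`, `R i j - R (i - 1) j` counts the generators at `i` alive at `j`, and a strict
drop at `j` means that one of them dies there. Wanted are a generator living from `a` to `b` and one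
living from `c` to `e` such that `R < R'` on the whole rectangle `[a, c) × [b, e)`, where the move
will raise the rank. -/
theorem exists_elementary_move {R R' : ℤ → ℤ → ℤ} {N : ℤ}
    (hR0 : ∀ i j, i + N ≤ j → R i j = 0) (hR0' : ∀ i j, i + N ≤ j → R' i j = 0)
    (hR : ∀ i i' j j', i ≤ i' → i' ≤ j → j ≤ j' → R i j - R i j' ≤ R i' j - R i' j')
    (hR' : ∀ i i' j j', i ≤ i' → i' ≤ j → j ≤ j' → R' i j - R' i j' ≤ R' i' j - R' i' j')
    (hle : ∀ i j, i ≤ j → R i j ≤ R' i j) (hd : ∀ i, R i i = R' i i) {p q : ℤ} (hpq : p ≤ q)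
    (hlt : R p q < R' p q) :
    ∃ a b c e, a < c ∧ c ≤ b ∧ b < e ∧ e ≤ a + N ∧
      R a b - R (a - 1) b < R a (b - 1) - R (a - 1) (b - 1) ∧
      R c e - R (c - 1) e < R c (e - 1) - R (c - 1) (e - 1) ∧
      ∀ i j, a ≤ i → i < c → b ≤ j → j < e → R i j < R' i j := by
  -- `a` is the first row with a gap in column `q`, so there is no gap at `(a - 1, q)`.
  obtain ⟨a, ⟨haq, haD⟩, hamin⟩ := Int.exists_least_of_bdd
    (P := fun i => i ≤ q ∧ R i q < R' i q) ⟨q - N, fun z hz => by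
      by_contra hlt
      have h1 := hR0 z q (by omega)
      have h2 := hR0' z q (by omega)
      omega⟩ ⟨p, hpq, hlt⟩
  have hne : a ≠ q := by
    rintro rfl
    have := hd a
    omega
  have hprev : R (a - 1) q = R' (a - 1) q := by
    have h1 := hle (a - 1) q (by omega)
    by_contra hne
    have := hamin (a - 1) ⟨by omega, by omega⟩
    omega
  have hs : ∀ j j', a ≤ j → j ≤ j' → R a j' - R (a - 1) j' ≤ R a j - R (a - 1) j := fun j j' h1 h2 =>
    by have := hR (a - 1) a j j' (by omega) h1 h2; omega
  have hs' : ∀ j j', a ≤ j → j ≤ j' → R' a j' - R' (a - 1) j' ≤ R' a j - R' (a - 1) j :=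
    fun j j' h1 h2 => by have := hR' (a - 1) a j j' (by omega) h1 h2; omega
  -- `b` is the first column where the number of generators at `a` still alive has dropped to its
  -- value at `q`; hence the jump at `b`.
  obtain ⟨b, ⟨hab, hbs⟩, hbmin⟩ := Int.exists_least_of_bdd
    (P := fun j => a ≤ j ∧ R a j - R (a - 1) j ≤ R a q - R (a - 1) q) ⟨a, fun z hz => hz.1⟩
    ⟨q, haq, le_rfl⟩
  have hbq : b ≤ q := hbmin q ⟨haq, le_rfl⟩
  have hab' : a < b := by
    rcases hab.lt_or_eq with h1 | h1
    · exact h1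
    · subst h1
      have h2 := hs' a q le_rfl haq
      have h3 := hle (a - 1) a (by omega)
      have h4 := hd a
      omega
  have hjump : R a b - R (a - 1) b < R a (b - 1) - R (a - 1) (b - 1) := by
    by_contra hcon
    have := hbmin (b - 1) ⟨by omega, by omega⟩
    omega
  have hDb : R a b < R' a b := by
    have h1 := hs' b q hab hbq
    have h2 := hle (a - 1) b (by omega)
    omega
  -- The gap in row `a` persists on `[b, E)` and closes at `E`, at the latest after a full turn.
  obtain ⟨E, ⟨hbE, hE⟩, hEmin⟩ := Int.exists_least_of_bdd
    (P := fun j => b ≤ j ∧ R a j = R' a j) ⟨b, fun z hz => hz.1⟩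
    ⟨max b (a + N), le_max_left _ _, by rw [hR0 _ _ (le_max_right _ _), hR0' _ _ (le_max_right _ _)]⟩
  have hEN : E ≤ a + N := by
    have h1 := hEmin (max b (a + N)) ⟨le_max_left _ _, by
      rw [hR0 _ _ (le_max_right _ _), hR0' _ _ (le_max_right _ _)]⟩
    rcases le_total b (a + N) with h2 | h2
    · rwa [max_eq_right h2] at h1
    · rw [hR0 _ _ h2, hR0' _ _ h2] at hDb
      omega
  have hDE : ∀ j, b ≤ j → j < E → R a j < R' a j := fun j h1 h2 => by
    have h3 := hle a j (by omega)
    by_contra hcon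
    have := hEmin j ⟨h1, by omega⟩
    omega
  have hbE' : b < E := by
    rcases hbE.lt_or_eq with h1 | h1
    · exact h1
    · subst h1; omega
  -- `c` is the first row in which the rank drops by more than in row `a` between some `q' ∈ [b, E)`
  -- and `E`. Row `b` qualifies because `R b b = R' b b`. In the rows before `c`, the smaller drop
  -- of `R` forces a gap on all of `[b, E)`.
  obtain ⟨c, ⟨hac, q', hbq', hq'E, hcq'⟩, hcmin⟩ := Int.exists_least_of_bdd
    (P := fun i => a < i ∧ ∃ q', b ≤ q' ∧ q' < E ∧ R a q' - R a E < R i q' - R i E)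
    ⟨a, fun z hz => hz.1.le⟩ ⟨b, hab', b, le_rfl, hbE', by
      have h1 := hR' a b b E hab le_rfl hbE
      have h2 := hd b
      have h3 := hle b E hbE
      omega⟩
  have hcb : c ≤ b := hcmin b ⟨hab', b, le_rfl, hbE', by
      have h1 := hR' a b b E hab le_rfl hbE
      have h2 := hd b
      have h3 := hle b E hbE
      omega⟩
  have hbelow : ∀ i j, a ≤ i → i < c → b ≤ j → j < E → R i j - R i E ≤ R a j - R a E := by
    intro i j h1 h2 h3 h4
    rcases h1.lt_or_eq with h5 | h5
    · by_contra hcon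
      have := hcmin i ⟨h5, j, h3, h4, by omega⟩
      omega
    · subst h5; exact le_rfl
  have hrect : ∀ i j, a ≤ i → i < c → b ≤ j → j < E → R i j < R' i j := by
    intro i j h1 h2 h3 h4
    have h5 := hbelow i j h1 h2 h3 h4
    have h6 := hR' a i j E h1 (by omega) h4.le
    have h7 := hDE j h3 h4
    have h8 := hle i E (by omega)
    omega
  have hsc : R c E - R (c - 1) E < R c q' - R (c - 1) q' := by
    have := hbelow (c - 1) q' (by omega) (by omega) hbq' hq'E
    omega
  -- The generators at `c` lose a member between `q'` and `E`; `e` is the first place after `q'`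
  -- where this happens.
  obtain ⟨e, ⟨hqe, hes⟩, hemin⟩ := Int.exists_least_of_bdd
    (P := fun j => q' ≤ j ∧ R c j - R (c - 1) j < R c q' - R (c - 1) q') ⟨q', fun z hz => hz.1⟩
    ⟨E, hq'E.le, hsc⟩
  have heE : e ≤ E := hemin E ⟨hq'E.le, hsc⟩
  have hqe' : q' < e := by
    rcases hqe.lt_or_eq with h1 | h1
    · exact h1
    · subst h1; omega
  refine ⟨a, b, c, e, hac, hcb, by omega, by omega, hjump, ?_, fun i j h1 h2 h3 h4 =>
    hrect i j h1 h2 h3 (by omega)⟩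
  by_contra hcon
  have := hemin (e - 1) ⟨by omega, by omega⟩
  omega

/-! ### Cycles -/

section Cycles

variable {κ I : Type*} [Field κ] {W : I → Type*} [∀ v, AddCommGroup (W v)] [∀ v, Module κ (W v)]

/-- The periodic sequence `c` runs through a cycle of geodesics with arrows in `S`. -/
structure IsCycle (n : I → I → ℤ) (S : I → Set I) (N : ℕ) (c : ℤ → I) : Prop where
  two_le : 2 ≤ N
  per : ∀ i : ℤ, c (i + N) = c i
  inj : ∀ i j : ℤ, i < j → j < i + N → c i ≠ c j
  btw : ∀ i j k : ℤ, i ≤ j → j ≤ k → k < i + N → Btw n (c i) (c j) (c k)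
  pred : ∀ i : ℤ, c i ∈ S (c (i + 1))

variable {n : I → I → ℤ} {f : ∀ u v, W u →ₗ[κ] W v} {S : I → Set I}

/-- The interval from `a` to `w` is a chain of pairwise adjacent vertices, and `w → a` closes it up.
Numbering its vertices along the chain and continuing periodically gives the cycle. -/
theorem Linked.exists_cycle [Finite I] (h : Linked n f S) {a w : I} (hw : w ∈ S a) :
    ∃ N c, IsCycle n S N c ∧ c 0 = a ∧ c (-1) = w := by
  classical
  have hawne : w ≠ a := h.adj_ne (h.adj_of_mem a w hw)
  have hadjaw : Adj n a w := (h.adj_of_mem a w hw).symm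
  set τ : Set I := {x | Btw n a x w} with hτ
  -- The position in the chain, as the number of vertices strictly before.
  set k : I → ℕ := fun x => Set.ncard {y | Btw n a y x ∧ y ≠ x} with hk
  set N := τ.ncard with hN
  have haτ : a ∈ τ := h.btw_left
  have hwτ : w ∈ τ := h.btw_right
  have hklt : ∀ x y, Btw n a x y → x ≠ y → k x < k y := by
    intro x y hxy hne
    refine Set.ncard_lt_ncard ⟨fun z hz => ⟨h.trans_left hxy hz.1, ?_⟩, fun hsub => ?_⟩
      (Set.toFinite _)
    · rintro rfl
      exact hz.2 (h.eq_right hz.1 hxy)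
    · exact (hsub ⟨hxy, hne⟩ : _ ∧ _).2 rfl
  have hkw : k w + 1 = N := by
    have : {y | Btw n a y w ∧ y ≠ w} = τ \ {w} := by
      ext y; simp [hτ]
    rw [hk]; simp only
    rw [this, Set.ncard_sdiff_singleton_add_one hwτ (Set.toFinite _)]
  have hka : k a = 0 := by
    rw [hk]; simp only
    rw [Set.ncard_eq_zero (Set.toFinite _)]
    ext y
    simp only [Set.mem_ofPred_eq, Set.mem_empty_iff_false, iff_false]
    rintro ⟨h1, h2⟩
    exact h2 (h.eq_of_btw_self h1)
  have hkN : ∀ x ∈ τ, k x < N := by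
    intro x hx
    by_cases hxw : x = w
    · subst hxw; omega
    · have := hklt x w hx hxw; omega
  have hkinj : ∀ x ∈ τ, ∀ y ∈ τ, k x ≤ k y → Btw n a x y := by
    intro x hx y hy hle
    by_cases hxy : x = y
    · subst hxy; exact h.btw_right
    rcases h.btw_or_btw hx hy with h1 | h1
    · exact h1
    · have := hklt y x h1 (Ne.symm hxy); omega
  have hsurj : ∀ i < N, ∃ x ∈ τ, k x = i := by
    have hbij : Function.Bijective (fun x : τ => (⟨k x, hkN x x.2⟩ : Fin N)) := by
      have := Fintype.ofFinite τ
      rw [Fintype.bijective_iff_injective_and_card]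
      refine ⟨fun x y hxy => ?_, ?_⟩
      · have hxy' : k x = k y := by simpa using hxy
        exact Subtype.ext (h.eq_right (hkinj x x.2 y y.2 hxy'.le) (hkinj y y.2 x x.2 hxy'.ge))
      · rw [Fintype.card_fin, hN, ← Nat.card_coe_set_eq, Nat.card_eq_fintype_card]
    intro i hi
    obtain ⟨x, hx⟩ := hbij.2 ⟨i, hi⟩
    exact ⟨x, x.2, by simpa using hx⟩
  have hN2 : 2 ≤ N := by
    have := hklt a w haτ hawne.symm
    omega
  have : Nonempty I := ⟨a⟩
  choose! c0 hc0τ hc0k using hsurj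
  set c : ℤ → I := fun i => c0 (i % N).toNat with hc
  have hmod : ∀ i : ℤ, 0 ≤ i % N ∧ i % N < N := fun i =>
    ⟨Int.emod_nonneg _ (by omega), Int.emod_lt_of_pos _ (by omega)⟩
  have hlt : ∀ i : ℤ, (i % N).toNat < N := fun i => by
    have := hmod i
    omega
  have hcτ : ∀ i, c i ∈ τ := fun i => hc0τ _ (hlt i)
  have hck : ∀ i, (k (c i) : ℤ) = i % N := fun i => by
    rw [hc]; simp only
    rw [hc0k _ (hlt i)]
    have := hmod i
    omega
  have hkeq : ∀ x ∈ τ, ∀ i, (k x : ℤ) = i % N → x = c i := fun x hx i hi => by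
    have h1 := hck i
    exact h.eq_right (hkinj x hx _ (hcτ i) (by omega)) (hkinj _ (hcτ i) x hx (by omega))
  have hper : ∀ i, c (i + N) = c i := fun i => by simp [hc]
  have hper' : ∀ i (m : ℤ), c (i + m * N) = c i := fun i m => by simp [hc]
  have hb0 : ∀ i j : ℤ, i % N ≤ j % N → Btw n a (c i) (c j) := fun i j hij =>
    hkinj _ (hcτ i) _ (hcτ j) (by have := hck i; have := hck j; omega)
  have hb1 : ∀ i j l : ℤ, i % N ≤ j % N → j % N ≤ l % N → Btw n (c i) (c j) (c l) :=
    fun i j l h1 h2 => h.trans_left' (hb0 j l h2) (hb0 i j h1)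
  have hadj : ∀ i j : ℤ, i % N ≠ j % N → Adj n (c i) (c j) := by
    intro i j hij
    have hne : c i ≠ c j := fun he => by
      have h1 := hck i
      rw [he, hck j] at h1
      exact hij h1.symm
    rcases le_total (i % N) (j % N) with h1 | h1
    · exact h.adj_of_btw_of_btw hadjaw (hb0 i j h1) (hcτ j) hne
    · exact (h.adj_of_btw_of_btw hadjaw (hb0 j i h1) (hcτ i) hne.symm).symm
  refine ⟨N, c, ⟨hN2, hper, ?_, ?_, ?_⟩, ?_, ?_⟩
  · intro i j hij hjN he
    have h1 := hck i
    rw [he, hck j] at h1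
    have h2 : (j - i) % N = 0 := Int.emod_eq_zero_of_dvd (Int.ModEq.dvd h1.symm)
    rw [Int.emod_eq_of_lt (by omega) (by omega)] at h2
    omega
  · intro i j l hij hjl hl
    have hi := hmod i
    have hq := Int.emod_add_mul_ediv i N
    set i₀ := i % N with hi₀
    set m := i / N with hm
    have hj : c j = c (j - m * N) := by
      have := hper' (j - m * N) m
      rw [← this]; congr 1; ring
    have hl' : c l = c (l - m * N) := by
      have := hper' (l - m * N) m
      rw [← this]; congr 1; ring
    have hi' : c i = c i₀ := by
      have := hper' i₀ m
      rw [← this]; congr 1; linarith [mul_comm m (N : ℤ)]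
    have hmN : (N : ℤ) * m = m * N := mul_comm _ _
    rw [hj, hl', hi']
    generalize hj₀ : j - m * N = j₀
    generalize hl₀ : l - m * N = l₀
    have e1 : i₀ ≤ j₀ := by omega
    have e2 : j₀ ≤ l₀ := by omega
    have e3 : l₀ < i₀ + N := by omega
    have ei : i₀ % N = i₀ := Int.emod_eq_of_lt (by omega) (by omega)
    have hsub : ∀ z : ℤ, N ≤ z → z < 2 * N → z % N = z - N := fun z h1 h2 => by
      rw [← Int.sub_emod_right, Int.emod_eq_of_lt (by omega) (by omega)]
    -- When the window crosses the end of a period, betweenness follows from that inside the period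
    -- by cyclic rotation, all points being adjacent.
    rcases eq_or_ne i₀ j₀ with e4 | e4
    · rw [← e4]; exact h.btw_left
    rcases lt_or_ge l₀ N with e5 | e5
    · have ej : j₀ % N = j₀ := Int.emod_eq_of_lt (by omega) (by omega)
      have el : l₀ % N = l₀ := Int.emod_eq_of_lt (by omega) (by omega)
      exact hb1 _ _ _ (by omega) (by omega)
    have el := hsub l₀ e5 (by omega)
    rcases lt_or_ge j₀ N with e6 | e6
    · have ej : j₀ % N = j₀ := Int.emod_eq_of_lt (by omega) (by omega)
      exact (hb1 l₀ i₀ j₀ (by omega) (by omega)).rotate (hadj _ _ (by omega)) (hadj _ _ (by omega))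
    · have ej := hsub j₀ e6 (by omega)
      exact (hb1 j₀ l₀ i₀ (by omega) (by omega)).rotate' (hadj _ _ (by omega))
        (hadj _ _ (by omega))
  · intro i
    have hi := hmod i
    by_cases hlast : i % N = N - 1
    · have h1 : c i = w := (hkeq w hwτ i (by omega)).symm
      have h2 : c (i + 1) = a := (hkeq a haτ (i + 1) (by
        rw [hka, Int.add_emod, hlast, Int.emod_eq_of_lt (a := 1) (by omega) (by omega)]
        simp)).symm
      rw [h1, h2]
      exact hw
    · have hi1 : (i + 1) % N = i % N + 1 := by
        rw [Int.add_emod, Int.emod_eq_of_lt (a := 1) (by omega) (by omega),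
          Int.emod_eq_of_lt (by omega) (by omega)]
      have hne : c i ≠ c (i + 1) := fun he => by
        have h1 := hck i
        rw [he, hck (i + 1)] at h1
        omega
      -- The predecessor of `c (i + 1)` from `c i` lies in the chain, not before `c i` and strictly
      -- before `c (i + 1)`, so it is `c i`.
      obtain ⟨w', hw', hb'⟩ := h.exists_pred (c i) (c (i + 1)) hne
      have h3 : Btw n a (c i) (c (i + 1)) := hb0 _ _ (by omega)
      have h4 : Btw n a w' (c (i + 1)) := h.trans_right h3 hb'
      have h5 : w' ∈ τ := h.trans_left (hcτ (i + 1)) h4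
      have h6 := hklt w' (c (i + 1)) h4 (h.adj_ne (h.adj_of_mem _ _ hw'))
      have h7 : Btw n a (c i) w' := h.trans_right' h3 hb'
      have h8 : w' = c i := by
        by_contra hne'
        have h9 := hklt (c i) w' h7 (Ne.symm hne')
        have h10 := hck i
        have h11 := hck (i + 1)
        omega
      rw [← h8]
      exact hw'
  · exact (hkeq a haτ 0 (by simp [hka])).symm
  · refine (hkeq w hwτ (-1) ?_).symm
    have h1 : (-1 : ℤ) % N = N - 1 := by
      rw [← Int.add_emod_right, Int.emod_eq_of_lt (by omega) (by omega)]
      ring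
    omega

namespace IsCycle

variable {N : ℕ} {c : ℤ → I}

/-- One period starting at `c i` lies on the geodesic from `c i` to its neighbour `c (i + N - 1)`.
-/
theorem adj (h : Linked n f S) (hc : IsCycle n S N c) {i j : ℤ} (hij : i < j) (hj : j < i + N) :
    Adj n (c i) (c j) := by
  have h1 : Adj n (c i) (c (i + N - 1)) := by
    have := hc.pred (i + N - 1)
    rw [sub_add_cancel, hc.per] at this
    exact (h.adj_of_mem _ _ this).symm
  exact h.adj_of_btw_of_btw h1 (hc.btw i i j le_rfl hij.le hj)
    (hc.btw i j (i + N - 1) hij.le (by omega) (by omega)) (hc.inj i j hij hj)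

/-- The points between `c i` and `c m` are the obvious ones. -/
theorem exists_eq (h : Linked n f S) (hc : IsCycle n S N c) {i m : ℤ} (him : i ≤ m)
    (hm : m < i + N) {q : I} (hq : Btw n (c i) q (c m)) : ∃ k, i ≤ k ∧ k ≤ m ∧ q = c k := by
  obtain ⟨j, ⟨hij, hqj⟩, hmin⟩ := Int.exists_least_of_bdd
    (P := fun j => i ≤ j ∧ Btw n (c i) q (c j)) ⟨i, fun z hz => hz.1⟩ ⟨m, him, hq⟩
  have hjm : j ≤ m := hmin m ⟨him, hq⟩
  refine ⟨j, hij, hjm, ?_⟩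
  rcases hij.lt_or_eq with h1 | h1
  · by_contra hne
    have hp := hc.pred (j - 1)
    rw [sub_add_cancel] at hp
    have := hmin (j - 1) ⟨by omega, h.btw_pred hqj hne hp
      (hc.btw i (j - 1) j (by omega) (by omega) (by omega))⟩
    omega
  · subst h1
    exact h.eq_of_btw_self hqj

theorem not_btw (h : Linked n f S) (hc : IsCycle n S N c) {i j k : ℤ} (hij : i ≤ j) (hjk : j < k)
    (hk : k < i + N) : ¬ Btw n (c i) (c k) (c j) := fun hb =>
  hc.inj j k hjk (by omega) (h.eq_right (hc.btw i j k hij hjk.le hk) hb)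

/-- A neighbour `q` of a point `c i` of a cycle such that some other point of the cycle lies between
`c i` and `q` belongs to the cycle. -/
theorem exists_eq_of_adj [Finite I] (h : Linked n f S) (hc : IsCycle n S N c) {i b : ℤ}
    (hib : i < b) (hb : b < i + N) {q : I} (hq : Adj n (c i) q) (hbq : Btw n (c i) (c b) q) :
    ∃ k, b ≤ k ∧ k < i + N ∧ q = c k := by
  obtain ⟨w, hw, hqw⟩ := h.exists_pred q (c i) (h.adj_ne hq).symm
  have h1 : Btw n (c i) q w := h.btw_of_adj hq hw hqw
  have h2 : Btw n (c i) (c b) w := h.trans_left h1 hbq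
  have h3 : Btw n (c b) w (c i) := h2.rotate (hc.adj h hib hb) (h.adj_of_mem _ _ hw).symm
  have hp := hc.pred (i + N - 1)
  rw [sub_add_cancel, hc.per] at hp
  have h4 : Btw n (c b) (c (i + N - 1)) (c i) := by
    have := hc.btw b (i + N - 1) (i + N) (by omega) (by omega) (by omega)
    rwa [hc.per] at this
  rw [h.pred_unique hw hp h3 h4] at h1
  obtain ⟨k, hik, hkm, rfl⟩ := hc.exists_eq h (by omega) (by omega) h1
  refine ⟨k, ?_, by omega, rfl⟩
  by_contra hlt
  exact hc.not_btw h hik (by omega : k < b) hb hbq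

end IsCycle

end Cycles

end LinkedGrassmannian

namespace LinkedGrassmannian

/-! ### Ranks along a cycle -/

section CycleRank

variable {κ I : Type*} [Field κ] {W : I → Type*} [∀ v, AddCommGroup (W v)] [∀ v, Module κ (W v)]

/-- The map from the `i`-th to the `j`-th space of a cycle of length `N` along the cycle. -/
noncomputable def cycleMap (f : ∀ u v, W u →ₗ[κ] W v) (N : ℕ) (c : ℤ → I) (i j : ℤ) :
    W (c i) →ₗ[κ] W (c j) :=
  if j < i + N then f (c i) (c j) else 0

/-- The rank of `cycleMap` on the subspaces `V`. -/
noncomputable def cycleRank (f : ∀ u v, W u →ₗ[κ] W v) (V : ∀ v, Submodule κ (W v)) (N : ℕ)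
    (c : ℤ → I) (i j : ℤ) : ℤ :=
  if j < i + N then subRank f V (c i) (c j) else 0

variable {n : I → I → ℤ} {f : ∀ u v, W u →ₗ[κ] W v} {S : I → Set I}
  {V V' : ∀ v, Submodule κ (W v)} {N : ℕ} {c : ℤ → I}

/-- The cutoff in `cycleMap` is consistent: if `i + N ≤ k < j + N` and `j < i + N`, then `c k = c (k
- N)` precedes `c j` on the way from `c i`, so the path is not a geodesic and the composite
vanishes. -/
theorem IsCycle.cycleMap_comp (h : Linked n f S) (hc : IsCycle n S N c) {i j k : ℤ} (hij : i ≤ j)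
    (hjk : j ≤ k) : cycleMap f N c j k ∘ₗ cycleMap f N c i j = cycleMap f N c i k := by
  unfold cycleMap
  by_cases hk : k < i + N
  · rw [if_pos hk, if_pos (by omega), if_pos (by omega),
      h.map_comp _ _ _ (hc.btw i j k hij hjk hk)]
  · rw [if_neg hk]
    split_ifs with h1 h2
    · refine h.map_zero _ _ _ fun hb => ?_
      have h3 := hc.per (k - N)
      rw [sub_add_cancel] at h3
      rw [h3] at hb
      have h4 := hc.btw i (k - N) j (by omega) (by omega) h2
      exact hc.inj (k - N) j (by omega) (by omega) (h.eq_right h4 hb)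
    all_goals simp

theorem cycleRank_eq_finrank (i j : ℤ) :
    cycleRank f V N c i j = Module.finrank κ ((V (c i)).map (cycleMap f N c i j)) := by
  unfold cycleRank cycleMap
  by_cases hj : j < i + N
  · rw [if_pos hj, if_pos hj, subRank]
  · rw [if_neg hj, if_neg hj, Submodule.map_zero, finrank_bot, Nat.cast_zero]

theorem cycleRank_eq_zero {i j : ℤ} (hij : i + N ≤ j) : cycleRank f V N c i j = 0 :=
  if_neg (by omega)

/-- Each difference is the dimension of the part of the image at `j` that dies on the way to `j'`,
and the image from `i'` contains the image from `i`. -/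
theorem IsCycle.cycleRank_sub_le [∀ v, FiniteDimensional κ (W v)] (h : Linked n f S)
    (hc : IsCycle n S N c) (hV : ∀ u v, (V u).map (f u v) ≤ V v) {i i' j j' : ℤ} (hi : i ≤ i')
    (hij : i' ≤ j) (hj : j ≤ j') :
    cycleRank f V N c i j - cycleRank f V N c i j' ≤
      cycleRank f V N c i' j - cycleRank f V N c i' j' := by
  simp only [cycleRank_eq_finrank]
  rw [← hc.cycleMap_comp h (hi.trans hij) hj, ← hc.cycleMap_comp h hij hj, Submodule.map_comp,
    Submodule.map_comp]
  have h1 := finrank_map_add_finrank_inf_ker (cycleMap f N c j j')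
    ((V (c i)).map (cycleMap f N c i j))
  have h2 := finrank_map_add_finrank_inf_ker (cycleMap f N c j j')
    ((V (c i')).map (cycleMap f N c i' j))
  have h3 : (V (c i)).map (cycleMap f N c i j) ≤ (V (c i')).map (cycleMap f N c i' j) := by
    rw [← hc.cycleMap_comp h hi hij, Submodule.map_comp]
    refine Submodule.map_mono ?_
    unfold cycleMap
    split_ifs
    · exact hV _ _
    · simp
  have h4 := Submodule.finrank_mono (inf_le_inf_right (LinearMap.ker (cycleMap f N c j j')) h3)
  omega

/-- Ensures that indices below the kill count are indices of generators. -/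
theorem killCount_le_genCount [∀ v, FiniteDimensional κ (W v)] (hV : ∀ u v, (V u).map (f u v) ≤ V v)
    {u q : I} {w : S u} (hk : LinearMap.ker (f u q) ≤ LinearMap.range (f w u)) :
    killCount f S V u w q ≤ genCount f S V u (some w) := by
  change Module.finrank κ (V u ⊓ LinearMap.ker (f u q) : Submodule κ (W u)) -
    Module.finrank κ (V u ⊓ LinearMap.ker (f u q) ⊓ (V w).map (f w u) : Submodule κ (W u)) ≤
    Module.finrank κ (V u ⊓ LinearMap.range (f w u) : Submodule κ (W u)) -
    Module.finrank κ ((V w).map (f w u))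
  have h1 := Submodule.finrank_sup_add_finrank_inf_eq (V u ⊓ LinearMap.ker (f u q))
    ((V w).map (f w u))
  have h2 : V u ⊓ LinearMap.ker (f u q) ⊔ (V w).map (f w u) ≤ V u ⊓ LinearMap.range (f w u) :=
    sup_le (inf_le_inf_left _ hk) (le_inf (hV _ _) LinearMap.map_le_range)
  have h3 := Submodule.finrank_mono h2
  omega

theorem IsCycle.killCount_eq [∀ v, FiniteDimensional κ (W v)] (h : Linked n f S)
    (hc : IsCycle n S N c) (hV : ∀ u v, (V u).map (f u v) ≤ V v) {i k : ℤ}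
    (hik : i < k) (hk : k < i + N) (w : S (c i)) (hw : w = c (i - 1)) :
    (killCount f S V (c i) w (c k) : ℤ) =
      (cycleRank f V N c i i - cycleRank f V N c (i - 1) i) -
        (cycleRank f V N c i k - cycleRank f V N c (i - 1) k) := by
  classical
  have h1 := h.killCount_eq hV (c i) w (c k)
  have hN := hc.two_le
  have e1 : cycleRank f V N c i i = subRank f V (c i) (c i) := if_pos (by omega)
  have e2 : cycleRank f V N c (i - 1) i = subRank f V (c (i - 1)) (c i) := if_pos (by omega)
  have e3 : cycleRank f V N c i k = subRank f V (c i) (c k) := if_pos (by omega)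
  have e4 : cycleRank f V N c (i - 1) k =
      ((if Btw n w (c i) (c k) then subRank f V w (c k) else 0 : ℕ) : ℤ) := by
    unfold cycleRank
    by_cases hk' : k < i - 1 + N
    · rw [if_pos hk', if_pos, hw]
      rw [hw]
      exact hc.btw _ _ _ (by omega) hik.le hk'
    -- Here `k = i - 1 + N`, so that `c k` is `c (i - 1)` itself and both conventions give zero.
    · rw [if_neg hk', if_neg]
      · rfl
      · have : k = i - 1 + N := by omega
        rw [this, hc.per, hw]
        intro hb
        exact hc.inj (i - 1) i (by omega) (by omega) (h.eq_of_btw_self hb).symm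
  rw [hw] at e4 h1
  rw [e1, e2, e3, e4]
  omega

/-- A jump of the ranks along a cycle yields a generator at `c i` killed exactly from `c k` on. -/
theorem AdaptedGens.exists_killed_iff [Finite I] [∀ v, FiniteDimensional κ (W v)]
    (h : Linked n f S) (hc : IsCycle n S N c)
    {x : ∀ v (o : Option (S v)), Fin (genCount f S V v o) → W v}
    (hx : AdaptedGens f S V (genCount f S V) (killCount f S V) x) {i k : ℤ} (hik : i < k)
    (hk : k < i + N)
    (hjump : cycleRank f V N c i k - cycleRank f V N c (i - 1) k <
      cycleRank f V N c i (k - 1) - cycleRank f V N c (i - 1) (k - 1)) :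
    ∃ t : Σ u, Σ o : Option (S u), Fin (genCount f S V u o), t.1 = c i ∧
      ∀ q, Killed f (killCount f S V) t q ↔ Btw n (c i) (c k) q := by
  have hV := hx.stable
  have hp : c (i - 1) ∈ S (c i) := by
    have := hc.pred (i - 1)
    rwa [sub_add_cancel] at this
  set w : S (c i) := ⟨c (i - 1), hp⟩ with hw
  have hkill := fun m h1 h2 => hc.killCount_eq h hV (i := i) (k := m) h1 h2 w rfl
  have hs : ∀ j j', i ≤ j → j ≤ j' → cycleRank f V N c i j' - cycleRank f V N c (i - 1) j' ≤
      cycleRank f V N c i j - cycleRank f V N c (i - 1) j := fun j j' h1 h2 => by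
    have := hc.cycleRank_sub_le h hV (i := i - 1) (i' := i) (by omega) h1 h2
    omega
  have hadj := hc.adj h hik hk
  have hker : LinearMap.ker (f (c i) (c k)) ≤ LinearMap.range (f w (c i)) := by
    rw [h.ker_eq _ _ hadj]
    refine h.range_le ?_
    have := hc.btw k (i - 1 + N) (i + N) (by omega) (by omega) (by omega)
    rwa [hc.per, hc.per] at this
  have hle := killCount_le_genCount hV hker
  have hk0 := hkill k hik hk
  have hs0 := hs i (k - 1) le_rfl (by omega)
  set m := killCount f S V (c i) w (c k) with hm
  have hne := h.adj_ne hadj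
  -- Of the generators of this class killed at `c k`, take the last one. By the jump, fewer than `m`
  -- of them are killed at `c l` for `l < k`.
  set t : Σ u, Σ o : Option (S u), Fin (genCount f S V u o) :=
    ⟨c i, some w, ⟨m - 1, by omega⟩⟩ with ht
  have htk : Killed f (killCount f S V) t (c k) :=
    ⟨hne, w, rfl, hker, by
      change m - 1 < m
      omega⟩
  refine ⟨t, rfl, fun q => ⟨?_, fun hb => ?_⟩⟩
  · rintro ⟨hq, w', hw', hkq, hj⟩
    obtain rfl : w = w' := Option.some_injective _ hw'
    change c i ≠ q at hq
    change LinearMap.ker (f (c i) q) ≤ LinearMap.range (f w (c i)) at hkq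
    change m - 1 < killCount f S V (c i) w q at hj
    obtain ⟨s, hs1, hs2, hs3, -, hs4⟩ := h.exists_of_ker_le_range hq w.2 hkq
    have hs5 : Btw n (c i) s (c (i + N - 1)) := by
      have e : c (i + N - 1) = c (i - 1) := by
        rw [← hc.per (i - 1)]; congr 1; ring
      rw [e]
      exact hs4
    obtain ⟨l, hl1, hl2, rfl⟩ := hc.exists_eq h (by have := hc.two_le; omega) (by omega) hs5
    have hil : i ≠ l := by
      rintro rfl
      exact h.adj_ne hs1 rfl
    have hkl : killCount f S V (c i) w q = killCount f S V (c i) w (c l) := by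
      unfold killCount
      rw [hs3]
    rw [hkl] at hj
    have hl3 := hkill l (by omega) (by omega)
    have hkl : k ≤ l := by
      by_contra hlt
      have := hs l (k - 1) hl1 (by omega)
      omega
    exact h.trans_left hs2 (hc.btw i k l hik.le hkl (by omega))
  · rw [← hx.map_eq_zero_iff h]
    change f (c i) q (x (c i) (some w) _) = 0
    rw [← h.apply_apply hb]
    have := hx.map_eq_zero htk
    change f (c i) (c k) (x (c i) (some w) _) = 0 at this
    rw [this, map_zero]

end CycleRank

end LinkedGrassmannian

namespace LinkedGrassmannian

/-! ### Moving one generator of a sub-representation -/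

section Deformation

variable {κ I : Type*} [Field κ] {W : I → Type*} [∀ v, AddCommGroup (W v)] [∀ v, Module κ (W v)]
  {n : I → I → ℤ} {f : ∀ u v, W u →ₗ[κ] W v} {S : I → Set I} {V V' : ∀ v, Submodule κ (W v)}

/-- Since `ker f u v = ker f u s`, a single `s` serves all sub-representations simultaneously. -/
theorem Linked.exists_adj_subRank_eq [∀ v, FiniteDimensional κ (W v)] (h : Linked n f S)
    {u v : I} (huv : u ≠ v) : ∃ s, Adj n u s ∧ Btw n u s v ∧
      ∀ V : ∀ v, Submodule κ (W v), subRank f V u v = subRank f V u s := by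
  obtain ⟨s, hs, hb, hk⟩ := h.exists_adj_ker u v huv
  refine ⟨s, hs, hb, fun V => ?_⟩
  have h1 := subRank_add_finrank_ker (f := f) V u v
  have h2 := subRank_add_finrank_ker (f := f) V u s
  rw [hk] at h1
  omega

/-- The rank vector of a sub-representation is determined by its dimension vector and its values on
adjacent pairs. -/
theorem Linked.subRank_le_of_adj [∀ v, FiniteDimensional κ (W v)] (h : Linked n f S)
    (hd : ∀ u, Module.finrank κ (V u) ≤ Module.finrank κ (V' u))
    (ha : ∀ u v, Adj n u v → subRank f V u v ≤ subRank f V' u v) (u v : I) :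
    subRank f V u v ≤ subRank f V' u v := by
  by_cases huv : u = v
  · subst huv
    rw [h.subRank_self, h.subRank_self]
    exact hd u
  · obtain ⟨s, hs, -, hr⟩ := h.exists_adj_subRank_eq huv
    rw [hr V, hr V']
    exact ha u s hs

/-- The set of generators mapping to basis vectors of the image of `V p` in `V q`. -/
def survivors (n : I → I → ℤ) (f : ∀ u v, W u →ₗ[κ] W v) {δ : ∀ u, Option (S u) → ℕ}
    (φ : ∀ u, S u → I → ℕ) (p q : I) : Set (Σ u, Σ o : Option (S u), Fin (δ u o)) :=
  {t | Btw n t.1 p q ∧ ¬ Killed f φ t q}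

variable {δ : ∀ u, Option (S u) → ℕ} {φ : ∀ u, S u → I → ℕ}
    {x : ∀ v (o : Option (S v)), Fin (δ v o) → W v}

theorem AdaptedGens.not_killed_of_btw [Finite I] (hx : AdaptedGens f S V δ φ x) (h : Linked n f S)
    {t : Σ u, Σ o : Option (S u), Fin (δ u o)} {p q : I} (hb : Btw n t.1 p q)
    (ht : ¬ Killed f φ t q) : ¬ Killed f φ t p := fun hk => ht (by
  rw [← hx.map_eq_zero_iff h, ← h.apply_apply hb, hx.map_eq_zero hk, map_zero])

/-- The map `f p q` sends each vector of the basis of `V p` to zero or to the basis vector of `V q`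
with the same index. -/
theorem AdaptedGens.subRank_eq [Finite I] (hx : AdaptedGens f S V δ φ x) (h : Linked n f S)
    (p q : I) : subRank f V p q = (survivors (δ := δ) n f φ p q).ncard := by
  have h1 : (V p).map (f p q) = Submodule.span κ (Set.range fun t : survivors (δ := δ) n f φ p q =>
      f t.1.1 q (x t.1.1 t.1.2.1 t.1.2.2)) := by
    rw [← hx.span_eq h p, Submodule.map_span]
    apply le_antisymm
    · rw [Submodule.span_le]
      rintro _ ⟨_, ⟨t, rfl⟩, rfl⟩
      by_cases hb : Btw n t.1.1 p q
      · simp only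
        rw [h.apply_apply hb]
        by_cases hk : Killed f φ t.1 q
        · rw [hx.map_eq_zero hk]
          exact Submodule.zero_mem _
        · exact Submodule.subset_span ⟨⟨t.1, hb, hk⟩, rfl⟩
      · simp only
        rw [h.apply_apply_zero hb]
        exact Submodule.zero_mem _
    · rw [Submodule.span_le]
      rintro _ ⟨t, rfl⟩
      refine Submodule.subset_span ⟨_, ⟨⟨t.1, hx.not_killed_of_btw h t.2.1 t.2.2⟩, rfl⟩, ?_⟩
      exact h.apply_apply t.2.1 _
  have h2 : LinearIndependent κ fun t : survivors (δ := δ) n f φ p q =>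
      f t.1.1 q (x t.1.1 t.1.2.1 t.1.2.2) :=
    (hx.linearIndependent h q).comp
      (fun t : survivors (δ := δ) n f φ p q => (⟨t.1, t.2.2⟩ : {t : Σ u, Σ o : Option (S u), Fin (δ u o) // ¬ Killed f φ t q}))
      (fun t t' htt => Subtype.ext (by simpa using htt))
  have : Fintype (survivors (δ := δ) n f φ p q) := Fintype.ofFinite _
  rw [subRank, h1, finrank_span_eq_card h2, ← Nat.card_coe_set_eq, Nat.card_eq_fintype_card]

/-- The elementary degeneration: two generators `t₀` at `a`, killed from `b` on, and `t₁` at `c`,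
killed from `e` on, where `c` lies between `a` and `b`; the generator `x₀` of index `t₀` is replaced
by `x₀ + s z`, with `z` mapping to the generator of index `t₁`. -/
theorem AdaptedGens.exists_deformation [Finite I] [∀ v, FiniteDimensional κ (W v)]
    (hx : AdaptedGens f S V δ φ x) (h : Linked n f S)
    {t₀ t₁ : Σ u, Σ o : Option (S u), Fin (δ u o)} {b e : I}
    (h₀ : ∀ q, Killed f φ t₀ q ↔ Btw n t₀.1 b q) (h₁ : ∀ q, Killed f φ t₁ q ↔ Btw n t₁.1 e q)
    (hne : t₀ ≠ t₁) (hacb : Btw n t₀.1 t₁.1 b) (hcab : ¬ Btw n t₁.1 t₀.1 b)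
    (hceb : ¬ Btw n t₁.1 e b) (z : W t₀.1) (hz : f t₀.1 t₁.1 z = x t₁.1 t₁.2.1 t₁.2.2)
    (hV' : ∀ p q, Adj n p q → subRank f V p q ≤ subRank f V' p q)
    (hd : ∀ q, Module.finrank κ (V q) = Module.finrank κ (V' q))
    (hspecial : ∀ p q, Adj n p q → Btw n t₀.1 p q → ¬ Btw n t₀.1 b p → Btw n t₀.1 b q →
      ¬ Btw n t₁.1 e q → ¬ Btw n t₁.1 p q → subRank f V p q < subRank f V' p q) :
    ∃ v v' : ∀ q, {t : Σ u, Σ o : Option (S u), Fin (δ u o) // ¬ Killed f φ t q} → W q, (∀ q, LinearIndependent κ (v q)) ∧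
      (∀ q, Submodule.span κ (Set.range (v q)) = V q) ∧
      ∀ s : κ, ∀ Vs : ∀ q, Submodule κ (W q),
        (∀ q, Vs q = Submodule.span κ (Set.range fun t => v q t + s • v' q t)) →
        (∀ p q, (Vs p).map (f p q) ≤ Vs q) ∧
        (s ≠ 0 → (∀ q, LinearIndependent κ fun t => v q t + s • v' q t) →
          (∀ p q, subRank f V p q ≤ subRank f Vs p q) ∧
          (∃ p q, subRank f V p q < subRank f Vs p q) ∧
          ∀ p q, subRank f Vs p q ≤ subRank f V' p q) := by
  classical
  set v : ∀ q, {t : Σ u, Σ o : Option (S u), Fin (δ u o) // ¬ Killed f φ t q} → W q := fun q t => f t.1.1 q (x t.1.1 t.1.2.1 t.1.2.2)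
    with hv
  -- the direction of the deformation at the source of each generator
  set y : ∀ t : (Σ u, Σ o : Option (S u), Fin (δ u o)), W t.1 :=
    fun t => if ht : t₀ = t then ht ▸ z else 0 with hy
  have hy0 : y t₀ = z := by simp [hy]
  have hy1 : ∀ t, t ≠ t₀ → y t = 0 := fun t ht => by simp [hy, ht.symm]
  set v' : ∀ q, {t : Σ u, Σ o : Option (S u), Fin (δ u o) // ¬ Killed f φ t q} → W q := fun q t => f t.1.1 q (y t.1) with hv'
  have hzq : ∀ q, Btw n t₀.1 b q → f t₀.1 q z = f t₁.1 q (x t₁.1 t₁.2.1 t₁.2.2) := fun q hb => by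
    rw [← hz, h.apply_apply (h.trans_left hb hacb)]
  refine ⟨v, v', fun q => hx.linearIndependent h q, fun q => hx.span_eq h q, ?_⟩
  intro s Vs hVs
  set vs : ∀ q, {t : Σ u, Σ o : Option (S u), Fin (δ u o) // ¬ Killed f φ t q} → W q := fun q t => v q t + s • v' q t with hvs
  -- the images of the moved basis vectors
  have hmap0 : ∀ p q (t : {t : Σ u, Σ o : Option (S u), Fin (δ u o) // ¬ Killed f φ t p}), ¬ Btw n t.1.1 p q → f p q (vs p t) = 0 := by
    intro p q t hb
    simp only [hvs, hv, hv', map_add, map_smul]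
    rw [h.apply_apply_zero hb, h.apply_apply_zero hb]; simp
  have hmap1 : ∀ p q (t : {t : Σ u, Σ o : Option (S u), Fin (δ u o) // ¬ Killed f φ t p}) (hb : Btw n t.1.1 p q)
      (hk : ¬ Killed f φ t.1 q), f p q (vs p t) = vs q ⟨t.1, hk⟩ := by
    intro p q t hb hk
    simp only [hvs, hv, hv', map_add, map_smul]
    rw [h.apply_apply hb, h.apply_apply hb]
  have hmap2 : ∀ p q (t : {t : Σ u, Σ o : Option (S u), Fin (δ u o) // ¬ Killed f φ t p}), t.1 ≠ t₀ → Killed f φ t.1 q →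
      f p q (vs p t) = 0 := by
    intro p q t ht hk
    by_cases hb : Btw n t.1.1 p q
    · simp only [hvs, hv, hv', map_add, map_smul]
      rw [h.apply_apply hb, hx.map_eq_zero hk, hy1 _ ht]; simp
    · exact hmap0 p q t hb
  have hmap3 : ∀ p q (ht : ¬ Killed f φ t₀ p), Btw n t₀.1 p q → Killed f φ t₀ q →
      f p q (vs p ⟨t₀, ht⟩) = s • f t₁.1 q (x t₁.1 t₁.2.1 t₁.2.2) := by
    intro p q ht hb hk
    simp only [hvs, hv, hv', map_add, map_smul]
    rw [h.apply_apply hb, hx.map_eq_zero hk, zero_add, h.apply_apply hb, hy0,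
      hzq q ((h₀ q).mp hk)]
  have hvs1 : ∀ q (hk : ¬ Killed f φ t₁ q), vs q ⟨t₁, hk⟩ = f t₁.1 q (x t₁.1 t₁.2.1 t₁.2.2) := by
    intro q hk
    simp only [hvs, hv, hv']
    rw [hy1 t₁ hne.symm]; simp
  have hstable : ∀ p q, (Vs p).map (f p q) ≤ Vs q := by
    intro p q
    rw [hVs p, hVs q, Submodule.map_span, Submodule.span_le]
    rintro _ ⟨_, ⟨t, rfl⟩, rfl⟩
    change f p q (vs p t) ∈ Submodule.span κ (Set.range (vs q))
    by_cases hb : Btw n t.1.1 p q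
    · by_cases hk : Killed f φ t.1 q
      · by_cases ht : t.1 = t₀
        · obtain ⟨t, htp⟩ := t
          subst ht
          rw [hmap3 p q htp hb hk]
          by_cases hk1 : Killed f φ t₁ q
          · rw [hx.map_eq_zero hk1, smul_zero]
            exact Submodule.zero_mem _
          · rw [← hvs1 q hk1]
            exact Submodule.smul_mem _ _ (Submodule.subset_span ⟨_, rfl⟩)
        · rw [hmap2 p q t ht hk]
          exact Submodule.zero_mem _
      · rw [hmap1 p q t hb hk]
        exact Submodule.subset_span ⟨_, rfl⟩
    · rw [hmap0 p q t hb]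
      exact Submodule.zero_mem _
  refine ⟨hstable, fun hs hli => ?_⟩
  have hfin : ∀ p q, Finite (survivors (δ := δ) n f φ p q) := fun p q => inferInstance
  -- the surviving basis vectors
  set E : ∀ p q, Submodule κ (W q) := fun p q => Submodule.span κ
    (Set.range fun t : survivors (δ := δ) n f φ p q => vs q ⟨t.1, t.2.2⟩) with hE
  have hEr : ∀ p q, Module.finrank κ (E p q) = subRank f V p q := by
    intro p q
    have hli' : LinearIndependent κ fun t : survivors (δ := δ) n f φ p q => vs q ⟨t.1, t.2.2⟩ :=
      (hli q).comp (fun t : survivors (δ := δ) n f φ p q => (⟨t.1, t.2.2⟩ : {t : Σ u, Σ o : Option (S u), Fin (δ u o) // ¬ Killed f φ t q}))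
        (fun t t' htt => Subtype.ext (by simpa using htt))
    have : Fintype (survivors (δ := δ) n f φ p q) := Fintype.ofFinite _
    rw [hx.subRank_eq h, finrank_span_eq_card hli', ← Nat.card_coe_set_eq,
      Nat.card_eq_fintype_card]
  have hEle : ∀ p q, E p q ≤ (Vs p).map (f p q) := by
    intro p q
    rw [hE, Submodule.span_le]
    rintro _ ⟨t, rfl⟩
    have hkp := hx.not_killed_of_btw h t.2.1 t.2.2
    refine ⟨vs p ⟨t.1, hkp⟩, ?_, hmap1 p q ⟨t.1, hkp⟩ t.2.1 t.2.2⟩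
    rw [hVs p]
    exact Submodule.subset_span ⟨_, rfl⟩
  -- The image can exceed the span of the survivors only if `t₀` passes through `p` and is killed on
  -- the way to `q`, while `t₁` is alive at `q` without coming through `p`. In that case it grows by
  -- at most a line.
  have hup : ∀ p q, (Vs p).map (f p q) ≤ E p q ∨
      (Btw n t₀.1 p q ∧ ¬ Btw n t₀.1 b p ∧ Btw n t₀.1 b q ∧ ¬ Btw n t₁.1 e q ∧ ¬ Btw n t₁.1 p q ∧
        (Vs p).map (f p q) ≤ E p q ⊔ Submodule.span κ {f t₁.1 q (x t₁.1 t₁.2.1 t₁.2.2)}) := by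
    intro p q
    by_cases hsp : Btw n t₀.1 p q ∧ ¬ Btw n t₀.1 b p ∧ Btw n t₀.1 b q ∧ ¬ Btw n t₁.1 e q ∧
        ¬ Btw n t₁.1 p q
    · refine Or.inr ⟨hsp.1, hsp.2.1, hsp.2.2.1, hsp.2.2.2.1, hsp.2.2.2.2, ?_⟩
      rw [hVs p, Submodule.map_span, Submodule.span_le]
      rintro _ ⟨_, ⟨t, rfl⟩, rfl⟩
      change f p q (vs p t) ∈ _
      by_cases hb : Btw n t.1.1 p q
      · by_cases hk : Killed f φ t.1 q
        · by_cases ht : t.1 = t₀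
          · obtain ⟨t, htp⟩ := t
            subst ht
            rw [hmap3 p q htp hb hk]
            exact Submodule.mem_sup_right (Submodule.smul_mem _ _
              (Submodule.mem_span_singleton_self _))
          · rw [hmap2 p q t ht hk]
            exact Submodule.zero_mem _
        · rw [hmap1 p q t hb hk]
          exact Submodule.mem_sup_left (Submodule.subset_span ⟨⟨t.1, hb, hk⟩, rfl⟩)
      · rw [hmap0 p q t hb]
        exact Submodule.zero_mem _
    · refine Or.inl ?_
      rw [hVs p, Submodule.map_span, Submodule.span_le]
      rintro _ ⟨_, ⟨t, rfl⟩, rfl⟩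
      change f p q (vs p t) ∈ _
      by_cases hb : Btw n t.1.1 p q
      · by_cases hk : Killed f φ t.1 q
        · by_cases ht : t.1 = t₀
          · obtain ⟨t, htp⟩ := t
            subst ht
            rw [hmap3 p q htp hb hk]
            by_cases hk1 : Killed f φ t₁ q
            · rw [hx.map_eq_zero hk1, smul_zero]
              exact Submodule.zero_mem _
            · have hb1 : Btw n t₁.1 p q := by
                by_contra hb1
                exact hsp ⟨hb, fun hh => htp ((h₀ p).mpr hh), (h₀ q).mp hk,
                  fun hh => hk1 ((h₁ q).mpr hh), hb1⟩
              rw [← hvs1 q hk1]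
              exact Submodule.smul_mem _ _ (Submodule.subset_span ⟨⟨t₁, hb1, hk1⟩, rfl⟩)
          · rw [hmap2 p q t ht hk]
            exact Submodule.zero_mem _
        · rw [hmap1 p q t hb hk]
          exact Submodule.subset_span ⟨⟨t.1, hb, hk⟩, rfl⟩
      · rw [hmap0 p q t hb]
        exact Submodule.zero_mem _
  refine ⟨fun p q => ?_, ⟨t₀.1, b, ?_⟩, ?_⟩
  · rw [← hEr]
    exact Submodule.finrank_mono (hEle p q)
  · rw [← hEr]
    refine Submodule.finrank_lt_finrank_of_lt (lt_of_le_of_ne (hEle _ _) fun heq => ?_)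
    have hkb : Killed f φ t₀ b := (h₀ b).mpr h.btw_right
    have hk1 : ¬ Killed f φ t₁ b := fun hk => hceb ((h₁ b).mp hk)
    have hka : ¬ Killed f φ t₀ t₀.1 := fun hk => hk.1 rfl
    -- Since `s ≠ 0`, the image at `b` contains the basis vector of `t₁`. This is a basis vector
    -- outside the survivors, so the rank at `(t₀.1, b)` increases strictly.
    have hmem : vs b ⟨t₁, hk1⟩ ∈ E t₀.1 b := by
      rw [heq, hvs1]
      have h2 : f t₀.1 b (vs t₀.1 ⟨t₀, hka⟩) ∈ (Vs t₀.1).map (f t₀.1 b) :=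
        Submodule.mem_map_of_mem (by
          rw [hVs]
          exact Submodule.subset_span ⟨_, rfl⟩)
      rw [hmap3 t₀.1 b hka h.btw_left hkb] at h2
      exact (Submodule.smul_mem_iff _ hs).mp h2
    have hE' : E t₀.1 b = Submodule.span κ (vs b '' {t | t.1 ∈ survivors (δ := δ) n f φ t₀.1 b}) := by
      refine congrArg (Submodule.span κ) (Set.ext fun w => ?_)
      constructor
      · rintro ⟨t, rfl⟩
        exact ⟨⟨t.1, t.2.2⟩, t.2, rfl⟩
      · rintro ⟨t, ht, rfl⟩
        exact ⟨⟨t.1, ht⟩, rfl⟩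
    rw [hE'] at hmem
    exact (hli b).notMem_span_image (s := {t | t.1 ∈ survivors (δ := δ) n f φ t₀.1 b})
      (fun hh : _ ∈ survivors (δ := δ) n f φ t₀.1 b => hcab hh.1) hmem
  · refine h.subRank_le_of_adj (fun q => ?_) (fun p q hpq => ?_)
    · have := Fintype.ofFinite
        {t : Σ u, Σ o : Option (S u), Fin (δ u o) // ¬ Killed f φ t q}
      rw [← hd q, hVs q, ← hx.span_eq h q, finrank_span_eq_card (hx.linearIndependent h q),
        finrank_span_eq_card (hli q)]
    · rcases hup p q with h2 | ⟨g1, g2, g3, g4, g5, h2⟩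
      · exact ((Submodule.finrank_mono h2).trans (hEr p q).le).trans (hV' p q hpq)
      · have h3 := hspecial p q hpq g1 g2 g3 g4 g5
        have h4 : subRank f Vs p q ≤ subRank f V p q + 1 := by
          rw [← hEr p q]
          refine (Submodule.finrank_mono h2).trans ?_
          refine (Submodule.finrank_add_le_finrank_add_finrank _ _).trans ?_
          exact Nat.add_le_add_left (by
            simpa using finrank_span_le_card (R := κ)
              ({f t₁.1 q (x t₁.1 t₁.2.1 t₁.2.2)} : Set (W q))) _
        omega

end Deformation

end LinkedGrassmannian

namespace LinkedGrassmannian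

/-! ### The degeneration attached to a strict inequality of ranks -/

section Deformation

variable {κ I : Type*} [Field κ] {W : I → Type*} [∀ v, AddCommGroup (W v)] [∀ v, Module κ (W v)]
  {n : I → I → ℤ} {f : ∀ u v, W u →ₗ[κ] W v} {S : I → Set I} {V V' : ∀ v, Submodule κ (W v)}

/-- Locates on the cycle the adjacent pairs at which the deformation may change the rank; they are
then compared with the rectangle of `exists_elementary_move`. -/
theorem IsCycle.mem_of_adj [Finite I] {N : ℕ} {c : ℤ → I} (h : Linked n f S)
    (hc : IsCycle n S N c) {a b : ℤ} (hab : a < b) (hb : b < a + N) {p q : I} (hpq : Adj n p q)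
    (h1 : Btw n (c a) p q) (h2 : ¬ Btw n (c a) (c b) p) (h3 : Btw n (c a) (c b) q) :
    ∃ i k, a ≤ i ∧ i < b ∧ b ≤ k ∧ k < a + N ∧ p = c i ∧ q = c k := by
  have h4 : Btw n (c a) p (c b) := (h.btw_or_btw h1 h3).resolve_right h2
  obtain ⟨i, hai, hib, rfl⟩ := hc.exists_eq h hab.le hb h4
  have hib' : i < b := by
    rcases hib.lt_or_eq with h5 | rfl
    · exact h5
    · exact absurd h.btw_right h2
  obtain ⟨k, hbk, hk, rfl⟩ := hc.exists_eq_of_adj h hib' (by omega) hpq (h.trans_left' h3 h4)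
  refine ⟨i, k, hai, hib', hbk, ?_, rfl, rfl⟩
  by_contra hka
  have h6 := hc.per (k - N)
  rw [sub_add_cancel] at h6
  rw [h6] at h1
  exact hc.not_btw h (i := a) (j := k - N) (k := i) (by omega) (by omega) (by omega) h1

/-- A strict inequality already occurs at an adjacent pair `u₀, s`. With `w ∈ S u₀` the predecessor
of `u₀` from `s`, the cycle through `w` and `u₀` contains `s`, and the two generators come from
`exists_elementary_move`. -/
theorem Linked.exists_deformation [Finite I] [∀ v, FiniteDimensional κ (W v)] (h : Linked n f S)
    {m : I → ℕ} (hm : ∀ v, Module.finrank κ (V v) = m v)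
    (hm' : ∀ v, Module.finrank κ (V' v) = m v) (hV : ∀ u v, (V u).map (f u v) ≤ V v)
    (hV' : ∀ u v, (V' u).map (f u v) ≤ V' v) (hle : ∀ u v, subRank f V u v ≤ subRank f V' u v)
    {u₀ v₀ : I} (hlt : subRank f V u₀ v₀ < subRank f V' u₀ v₀) :
    ∃ v v' : ∀ q, Fin (m q) → W q, (∀ q, LinearIndependent κ (v q)) ∧
      (∀ q, Submodule.span κ (Set.range (v q)) = V q) ∧
      ∀ s : κ, ∀ Vs : ∀ q, Submodule κ (W q),
        (∀ q, Vs q = Submodule.span κ (Set.range (v q + s • v' q))) →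
        (∀ p q, (Vs p).map (f p q) ≤ Vs q) ∧
        (s ≠ 0 → (∀ q, LinearIndependent κ (v q + s • v' q)) →
          (∀ p q, subRank f V p q ≤ subRank f Vs p q) ∧
          (∃ p q, subRank f V p q < subRank f Vs p q) ∧
          ∀ p q, subRank f Vs p q ≤ subRank f V' p q) := by
  classical
  have hdd : ∀ v, Module.finrank κ (V v) = Module.finrank κ (V' v) := fun v => by rw [hm, hm']
  have huv : u₀ ≠ v₀ := by
    rintro rfl
    rw [h.subRank_self, h.subRank_self, hdd] at hlt
    exact lt_irrefl _ hlt
  obtain ⟨s, hus, -, hr⟩ := h.exists_adj_subRank_eq huv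
  rw [hr V, hr V'] at hlt
  obtain ⟨w, hw, hb⟩ := h.exists_pred s u₀ (h.adj_ne hus).symm
  obtain ⟨N, c, hc, hc0, hc1⟩ := h.exists_cycle hw
  have hN := hc.two_le
  have hper := hc.per (-1)
  obtain ⟨k, hk0, hkN, rfl⟩ := hc.exists_eq h (i := 0) (m := -1 + N) (q := s) (by omega) (by omega) (by
    rw [hper, hc0, hc1]; exact h.btw_of_adj hus hw hb)
  subst hc0
  have hR : ∀ {V : ∀ v, Submodule κ (W v)} {i j : ℤ}, j < i + N →
      cycleRank f V N c i j = subRank f V (c i) (c j) := fun hj => if_pos hj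
  obtain ⟨a, b, c', e, hac, hcb, hbe, heN, hj0, hj1, hD⟩ := exists_elementary_move (N := N)
    (R := cycleRank f V N c) (R' := cycleRank f V' N c) (fun i j => cycleRank_eq_zero)
    (fun i j => cycleRank_eq_zero) (fun i i' j j' => hc.cycleRank_sub_le h hV)
    (fun i i' j j' => hc.cycleRank_sub_le h hV') (fun i j hij => by
      by_cases hj : j < i + N
      · rw [hR hj, hR hj]
        exact_mod_cast hle _ _
      · rw [cycleRank_eq_zero (by omega), cycleRank_eq_zero (by omega)])
    (fun i => by
      rw [hR (by omega), hR (by omega), h.subRank_self, h.subRank_self, hdd]) hk0 (by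
      rw [hR (by omega), hR (by omega)]
      exact_mod_cast hlt)
  obtain ⟨x, hx⟩ := h.exists_adaptedGens hV rfl rfl
  obtain ⟨t₀, ht₀, h₀⟩ := hx.exists_killed_iff h hc (i := a) (k := b) (by omega) (by omega) hj0
  obtain ⟨t₁, ht₁, h₁⟩ := hx.exists_killed_iff h hc (i := c') (k := e) (by omega) (by omega) hj1
  -- The second generator dies at `c e`, so it lies in `ker f (c c') (c e) = im f (c e) (c c')`. As
  -- `c a` lies between `c e` and `c c'` (from `e` via `a + N` to `c' + N`), it also lies in the
  -- image from `c a`.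
  have hz : ∃ z, f t₀.1 t₁.1 z = x t₁.1 t₁.2.1 t₁.2.2 := by
    have hk := hx.map_eq_zero ((h₁ (c e)).mpr h.btw_right)
    have hadj : Adj n t₁.1 (c e) := ht₁ ▸ hc.adj h (by omega) (by omega)
    have hmem : x t₁.1 t₁.2.1 t₁.2.2 ∈ LinearMap.range (f (c e) t₁.1) := by
      rw [← h.ker_eq _ _ hadj]
      exact hk
    have hbt := hc.btw e (a + N) (c' + N) (by omega) (by omega) (by omega)
    rw [hc.per, hc.per, ← ht₀, ← ht₁] at hbt
    exact h.range_le hbt hmem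
  obtain ⟨z, hz⟩ := hz
  have hac' : ¬ Btw n (c c') (c a) (c b) := by
    rw [← hc.per a]
    exact hc.not_btw h hcb (by omega) (by omega)
  rw [← ht₀] at h₀
  rw [← ht₁] at h₁
  obtain ⟨v, v', hv, hvs, hmain⟩ := hx.exists_deformation (V' := V') h h₀ h₁
    (fun heq => hc.inj a c' hac (by omega) (by rw [← ht₀, ← ht₁, heq]))
    (by rw [ht₀, ht₁]; exact hc.btw a c' b hac.le hcb (by omega))
    (by rw [ht₀, ht₁]; exact hac')
    (by rw [ht₁]; exact hc.not_btw h hcb hbe (by omega)) z hz (fun p q _ => hle p q) hdd (by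
      rw [ht₀, ht₁]
      intro p q hpq g1 g2 g3 g4 g5
      obtain ⟨i, k, hai, hib, hbk, hka, rfl, rfl⟩ := hc.mem_of_adj h (by omega) (by omega) hpq g1 g2 g3
      have hke : k < e := by
        by_contra hke
        exact g4 (hc.btw c' e k (by omega) (by omega) (by omega))
      have hic : i < c' := by
        by_contra hic
        exact g5 (hc.btw c' i k (by omega) (by omega) (by omega))
      have := hD i k hai hic hbk hke
      rw [hR (by omega), hR (by omega)] at this
      exact_mod_cast this)
  have := fun q => Fintype.ofFinite {t : Σ u, Σ o : Option (S u), Fin (genCount f S V u o) //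
    ¬ Killed f (killCount f S V) t q}
  have hcard : ∀ q, Nonempty (Fin (m q) ≃ {t : Σ u, Σ o : Option (S u), Fin (genCount f S V u o) //
      ¬ Killed f (killCount f S V) t q}) := fun q => ⟨(Fintype.equivFinOfCardEq (by
        rw [← hm q, ← hvs q, finrank_span_eq_card (hv q)])).symm⟩
  have g := fun q => (hcard q).some
  have hrange : ∀ (s : κ) q, Set.range ((v q ∘ g q) + s • (v' q ∘ g q)) =
      Set.range fun t => v q t + s • v' q t := fun s q => by
    rw [← (g q).surjective.range_comp fun t => v q t + s • v' q t]
    rfl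
  refine ⟨fun q => v q ∘ g q, fun q => v' q ∘ g q, fun q => (hv q).comp _ (g q).injective,
    fun q => by rw [(g q).surjective.range_comp, hvs], fun s Vs hVs => ?_⟩
  obtain ⟨m1, m2⟩ := hmain s Vs (fun q => by rw [hVs q]; congr 1; exact hrange s q)
  refine ⟨m1, fun hs hli => m2 hs fun q => ?_⟩
  exact (linearIndependent_equiv (g q)).mp (hli q)

end Deformation

end LinkedGrassmannian

namespace LinkedGrassmannian

/-! ### The Zariski topology -/

section Zariski

variable {k W : Type*} [Field k] [AddCommGroup W] [Module k W]

theorem isOpen_ne_zero {p : W → k} (hp : p ∈ polynomialFunctions k W) :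
    @IsOpen W (zariskiTopology k W) {w | p w ≠ 0} :=
  TopologicalSpace.isOpen_generateFrom_of_mem ⟨p, hp, rfl⟩

theorem det_mem_polynomialFunctions {m : ℕ} (A : Fin m → Fin m → Module.Dual k W) :
    (fun w => (Matrix.of fun i j => A i j w).det) ∈ polynomialFunctions k W := by
  have h1 : (fun w => (Matrix.of fun i j => A i j w).det) =
      ∑ σ : Equiv.Perm (Fin m), (((Equiv.Perm.sign σ : ℤ) : k)) • ∏ i, (A (σ i) i : W → k) := by
    funext w
    simp only [Matrix.det_apply', Finset.sum_apply, Pi.smul_apply, Finset.prod_apply, smul_eq_mul,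
      Matrix.of_apply]
  rw [h1]
  exact Subalgebra.sum_mem _ fun σ _ => Subalgebra.smul_mem _
    (Subalgebra.prod_mem _ fun i _ => Algebra.subset_adjoin (Set.mem_range_self (A (σ i) i))) _

theorem linearIndependent_iff_exists_det {Q : Type*} [AddCommGroup Q] [Module k Q] {m : ℕ}
    {v : Fin m → Q} : LinearIndependent k v ↔
      ∃ ψ : Fin m → Module.Dual k Q, (Matrix.of fun i j => ψ j (v i)).det ≠ 0 := by
  constructor
  · intro hv
    obtain ⟨g, hg⟩ := LinearMap.exists_leftInverse_of_injective (Fintype.linearCombination k v)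
      (LinearMap.ker_eq_bot.mpr ((linearIndependent_iff_injective_fintypeLinearCombination.mp hv)))
    refine ⟨fun j => LinearMap.proj j ∘ₗ g, ?_⟩
    have : (Matrix.of fun i j => (LinearMap.proj (R := k) (φ := fun _ : Fin m => k) j ∘ₗ g) (v i)) =
        (1 : Matrix (Fin m) (Fin m) k) := by
      ext i j
      have h1 := LinearMap.congr_fun hg (Pi.single i 1)
      simp only [LinearMap.comp_apply, Fintype.linearCombination_apply_single, one_smul,
        LinearMap.id_apply] at h1
      simp [h1, Matrix.one_apply, Pi.single_apply, eq_comm]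
    rw [this]
    simp
  · rintro ⟨ψ, hψ⟩
    rw [Fintype.linearIndependent_iff]
    intro c hc
    refine fun i => congrFun (Matrix.eq_zero_of_vecMul_eq_zero hψ (v := c) ?_) i
    funext j
    have h1 := congrArg (ψ j) hc
    simpa [Matrix.vecMul, dotProduct] using h1

/-- A union of nonvanishing loci of determinants of linear forms, over all families of forms on `Q`.
-/
theorem isOpen_linearIndependent {Q : Type*} [AddCommGroup Q] [Module k Q] {m : ℕ}
    (g : Fin m → W →ₗ[k] Q) :
    @IsOpen W (zariskiTopology k W) {w | LinearIndependent k fun i => g i w} := by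
  have h1 : {w | LinearIndependent k fun i => g i w} = ⋃ ψ : Fin m → Module.Dual k Q,
      {w | (Matrix.of fun i j => (ψ j ∘ₗ g i) w).det ≠ 0} := by
    ext w
    simp only [Set.mem_ofPred_eq, Set.mem_iUnion]
    exact linearIndependent_iff_exists_det
  rw [h1]
  exact @isOpen_iUnion _ _ (zariskiTopology k W) _ fun ψ => isOpen_ne_zero (det_mem_polynomialFunctions fun i j => ψ j ∘ₗ g i)

theorem exists_polynomial_on_line {p : W → k} (hp : p ∈ polynomialFunctions k W) (w₀ w₁ : W) :
    ∃ P : Polynomial k, ∀ t : k, p (w₀ + t • w₁) = P.eval t := by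
  induction hp using Algebra.adjoin_induction with
  | mem p hp =>
    obtain ⟨φ, rfl⟩ := hp
    exact ⟨Polynomial.C (φ w₀) + Polynomial.C (φ w₁) * Polynomial.X, fun t => by
      change φ (w₀ + t • w₁) = _
      rw [map_add, map_smul, Polynomial.eval_add, Polynomial.eval_mul, Polynomial.eval_C,
        Polynomial.eval_C, Polynomial.eval_X, smul_eq_mul, mul_comm]⟩
  | algebraMap r => exact ⟨Polynomial.C r, fun t => by simp⟩
  | add p q _ _ hp hq =>
    obtain ⟨P, hP⟩ := hp
    obtain ⟨Q, hQ⟩ := hq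
    exact ⟨P + Q, fun t => by simp [hP, hQ]⟩
  | mul p q _ _ hp hq =>
    obtain ⟨P, hP⟩ := hp
    obtain ⟨Q, hQ⟩ := hq
    exact ⟨P * Q, fun t => by simp [hP, hQ]⟩

/-- An affine line through a point of an open set lies in it, up to finitely many points. -/
theorem finite_notMem_line {U : Set W} (hU : @IsOpen W (zariskiTopology k W) U) {w₀ w₁ : W}
    {t₀ : k} (h₀ : w₀ + t₀ • w₁ ∈ U) : {t : k | w₀ + t • w₁ ∉ U}.Finite := by
  induction hU with
  | basic U hU =>
    obtain ⟨p, hp, rfl⟩ := hU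
    obtain ⟨P, hP⟩ := exists_polynomial_on_line hp w₀ w₁
    have hP0 : P ≠ 0 := by
      rintro rfl
      exact h₀ (by rw [hP]; simp)
    refine (P.rootSet_finite k).subset fun t ht => ?_
    rw [Polynomial.mem_rootSet]
    simp only [Set.mem_ofPred_eq, not_not] at ht
    exact ⟨hP0, by rw [Polynomial.coe_aeval_eq_eval, ← hP, ht]⟩
  | univ => simp
  | inter U V _ _ hU hV =>
    refine ((hU h₀.1).union (hV h₀.2)).subset fun t ht => ?_
    by_contra hh
    simp only [Set.mem_union, Set.mem_ofPred_eq, not_or, not_not] at hh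
    exact ht hh
  | sUnion C _ hC =>
    obtain ⟨U, hU, hm⟩ := h₀
    exact (hC U hU hm).subset fun t ht hh => ht ⟨U, hU, hh⟩

theorem finite_not_linearIndependent_line {Q : Type*} [AddCommGroup Q] [Module k Q] {m : ℕ}
    {b : Fin m → Q} (hb : LinearIndependent k b) (b' : Fin m → Q) :
    {t : k | ¬ LinearIndependent k (b + t • b')}.Finite :=
  finite_notMem_line (t₀ := 0)
    (isOpen_linearIndependent fun i => (LinearMap.proj i : (Fin m → Q) →ₗ[k] Q))
    (by simpa using hb)

theorem le_finrank_span_iff {Q : Type*} [AddCommGroup Q] [Module k Q]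
    {m l : ℕ} (v : Fin m → Q) : l ≤ Module.finrank k (Submodule.span k (Set.range v)) ↔
      ∃ s : Fin l → Fin m, LinearIndependent k (v ∘ s) := by
  have hfd : FiniteDimensional k (Submodule.span k (Set.range v)) :=
    FiniteDimensional.span_of_finite k (Set.finite_range v)
  constructor
  · intro hl
    obtain ⟨g, hg, -, hli⟩ := Submodule.exists_fun_fin_finrank_span_eq k (Set.range v)
    choose s hs using hg
    refine ⟨s ∘ Fin.castLE hl, ?_⟩
    have : v ∘ s = g := funext hs
    rw [← Function.comp_assoc, this]
    exact hli.comp _ (Fin.castLE_injective hl)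
  · rintro ⟨s, hs⟩
    have h1 := finrank_span_eq_card hs
    rw [Fintype.card_fin] at h1
    rw [← h1]
    exact Submodule.finrank_mono (Submodule.span_mono (Set.range_comp_subset_range _ _))

end Zariski

/-! ### The topology of the quiver Grassmannian -/

section QuiverGr

variable {R K : Type*} [CommRing R] [IsLocalRing R] [Field K] [Algebra R K] {d : ℕ} {I : Type*}
  {Γ : LatticeConfig R K d I} {ϖ : R} {x : I → ℕ}

open IsLocalRing (ResidueField)

theorem QuiverGr.ext {M N : QuiverGr Γ ϖ x} (h : ∀ v, M.V v = N.V v) : M = N := by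
  cases M
  cases N
  congr
  exact funext h

/-- Lower semicontinuity: on frames the condition says that some `l` of the image vectors are
linearly independent. -/
theorem isOpen_le_rankVector (p : I × I) (l : ℕ) :
    IsOpen {M : QuiverGr Γ ϖ x | l ≤ M.rankVector p} := by
  rw [isOpen_coinduced]
  refine ⟨⋃ s : Fin l → Fin (x p.1), {b | LinearIndependent (ResidueField R) fun i =>
    (Γ.f ϖ p.1 p.2 ∘ₗ LinearMap.proj (s i) ∘ₗ LinearMap.proj p.1) b}, ?_, ?_⟩
  · exact @isOpen_iUnion _ _ (zariskiTopology _ _) _ fun s => isOpen_linearIndependent _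
  · ext B
    have h1 : (B.toGr).rankVector p = Module.finrank (ResidueField R)
        (Submodule.span (ResidueField R) (Set.range (Γ.f ϖ p.1 p.2 ∘ B.b p.1))) := by
      rw [Set.range_comp, ← Submodule.map_span]
      rfl
    simp only [Set.mem_preimage, Set.mem_iUnion, Set.mem_ofPred_eq]
    rw [h1, le_finrank_span_iff]
    rfl

/-- A point on an affine line of frames lies in the closure of any set containing almost all other
points of the line. -/
theorem mem_closure_of_line [Infinite (ResidueField R)] {T : Set (QuiverGr Γ ϖ x)}
    (B : Frame Γ ϖ x) (b' : ∀ v, Fin (x v) → Γ.Lbar v)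
    (h : ∀ t : ResidueField R, t ≠ 0 → (∀ v, LinearIndependent (ResidueField R) (B.b v + t • b' v)) →
      ∃ B' : Frame Γ ϖ x, B'.b = (fun v => B.b v + t • b' v) ∧ B'.toGr ∈ T) [Finite I] :
    B.toGr ∈ closure T := by
  rw [mem_closure_iff]
  intro U hU hB
  rw [isOpen_coinduced] at hU
  obtain ⟨O, hO, hOU⟩ := hU
  have hBO : B.b ∈ O := by
    change B ∈ Frame.b ⁻¹' O
    rw [hOU]
    exact hB
  have h1 : {t : ResidueField R | B.b + t • b' ∉ O}.Finite :=
    finite_notMem_line (t₀ := 0) hO (by simpa using hBO)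
  have h2 : ∀ v, {t : ResidueField R |
      ¬ LinearIndependent (ResidueField R) (B.b v + t • b' v)}.Finite := fun v =>
    finite_not_linearIndependent_line (B.linInd v) (b' v)
  -- Finitely many parameters are excluded, and the residue field is infinite.
  have h3 := ((h1.union (Set.finite_iUnion h2)).union (Set.finite_singleton 0)).infinite_compl
  obtain ⟨t, ht⟩ := h3.nonempty
  simp only [Set.mem_compl_iff, Set.mem_union, Set.mem_iUnion, Set.mem_ofPred_eq, not_or,
    Set.mem_singleton_iff, not_exists, not_not] at ht
  obtain ⟨B', hB', hT⟩ := h t ht.2 ht.1.2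
  refine ⟨B'.toGr, ?_, hT⟩
  change B' ∈ Frame.toGr ⁻¹' U
  rw [← hOU]
  change B'.b ∈ O
  rw [hB']
  exact ht.1.1

variable {n : I → I → ℤ} {S : I → Set I}

theorem isPathMap_eq_or (h : Linked n (Γ.f ϖ) S) {m : ℕ} {u v : I}
    {g : Γ.Lbar u →ₗ[ResidueField R] Γ.Lbar v} (hg : Γ.IsPathMap ϖ m u v g) :
    g = 0 ∨ g = Γ.f ϖ u v := by
  induction hg with
  | nil u => exact Or.inr (h.map_self u).symm
  | @cons m u v w g hg hvw ih =>
    rcases ih with rfl | rfl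
    · exact Or.inl (LinearMap.comp_zero _)
    · by_cases hb : Btw n u v w
      · exact Or.inr (h.map_comp _ _ _ hb)
      · exact Or.inl (h.map_zero _ _ _ hb)

/-- Along a path the maps compose to zero or to `f`. As `f u v ≠ 0`, the last intermediate vertex of
a path for `f u v` lies on a geodesic. -/
theorem exists_btw_of_not_arrow (h : Linked n (Γ.f ϖ) S) {u v : I} (huv : u ≠ v)
    (hA : ¬ Γ.Arrow ϖ u v) : ∃ s, s ≠ u ∧ s ≠ v ∧ Btw n u s v := by
  have h1 : ∃ m, 2 ≤ m ∧ Γ.IsPathMap ϖ m u v (Γ.f ϖ u v) := by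
    by_contra hh
    exact hA ⟨huv, hh⟩
  obtain ⟨m, hm, hp⟩ := h1
  generalize hf : Γ.f ϖ u v = g at hp
  cases hp with
  | nil => exact absurd rfl huv
  | @cons m _ s _ g hg hsv =>
    have hg0 : g ≠ 0 := by
      rintro rfl
      exact h.map_ne u v (by rw [hf, LinearMap.comp_zero])
    have hgf := (isPathMap_eq_or h hg).resolve_left hg0
    subst hgf
    have hb : Btw n u s v := by
      by_contra hb
      rw [h.map_zero _ _ _ hb] at hf
      exact h.map_ne _ _ hf
    refine ⟨s, ?_, hsv, hb⟩
    -- If `s = u`, the path before the last step is closed and of positive length, so its composite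
    -- is zero; but `f s s` is nonzero.
    rintro rfl
    generalize hf' : Γ.f ϖ s s = g' at hg
    cases hg with
    | nil => omega
    | @cons m _ r _ g hg hrs =>
      have hne : Γ.f ϖ r s ∘ₗ g = 0 := by
        rcases isPathMap_eq_or h hg with rfl | rfl
        · exact LinearMap.comp_zero _
        · exact h.map_zero _ _ _ fun hb => hrs (h.eq_of_btw_self hb)
      exact h.map_ne _ _ (hf'.trans hne)

/-- Induction over the pairs of vertices, starting from the arrows of the quiver. -/
theorem arrow_induction [Finite I] (h : Linked n (Γ.f ϖ) S) {P : I → I → Prop}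
    (hself : ∀ u, P u u) (harrow : ∀ u v, Γ.Arrow ϖ u v → P u v)
    (hcomp : ∀ u s v, Btw n u s v → P u s → P s v → P u v) (u v : I) : P u v := by
  induction hk : Set.ncard {y | Btw n u y v} using Nat.strong_induction_on generalizing u v with
  | _ k ih =>
    by_cases huv : u = v
    · subst huv; exact hself u
    by_cases hA : Γ.Arrow ϖ u v
    · exact harrow u v hA
    obtain ⟨s, hsu, hsv, hb⟩ := exists_btw_of_not_arrow h huv hA
    refine hcomp u s v hb (ih _ ?_ u s rfl) (ih _ ?_ s v rfl)
    · rw [← hk]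
      refine Set.ncard_lt_ncard ⟨fun y hy => h.trans_left hb hy, fun hle => ?_⟩
      exact hsv (h.eq_right hb (hle h.btw_right))
    · rw [← hk]
      refine Set.ncard_lt_ncard ⟨fun y hy => h.trans_right hb hy, fun hle => ?_⟩
      exact hsu (h.eq_left hb (hle h.btw_left)).symm

/-- Stability under arrows propagates to all pairs by `arrow_induction`, which makes the results on
linked families applicable to points of the Grassmannian. -/
theorem isSubrep_iff [Finite I] (h : Linked n (Γ.f ϖ) S)
    {V : ∀ v, Submodule (ResidueField R) (Γ.Lbar v)} :
    Γ.IsSubrep ϖ V ↔ ∀ u v, (V u).map (Γ.f ϖ u v) ≤ V v := by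
  constructor
  · intro hV
    refine arrow_induction h (fun u => ?_) (fun u v hA => ?_) (fun u s v hb h1 h2 => ?_)
    · rw [h.map_self, Submodule.map_id]
    · rintro _ ⟨y, hy, rfl⟩
      exact hV u v hA y hy
    · rw [← h.map_comp u s v hb, Submodule.map_comp]
      exact (Submodule.map_mono h1).trans h2
  · intro hV u v _ y hy
    exact hV u v (Submodule.mem_map_of_mem hy)

theorem rankVector_eq_of_iso [Finite I] (h : Linked n (Γ.f ϖ) S) {M N : QuiverGr Γ ϖ x}
    (hMN : M.Iso N) : M.rankVector = N.rankVector := by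
  obtain ⟨φ, hφ⟩ := hMN
  have hM := (isSubrep_iff h).mp M.isSubrep
  have key : ∀ u v, ∀ (y : M.V u) (hy : Γ.f ϖ u v y ∈ M.V v),
      (φ v ⟨Γ.f ϖ u v y, hy⟩ : Γ.Lbar v) = Γ.f ϖ u v (φ u y) := by
    refine arrow_induction h (fun u y hy => ?_) (fun u v hA y hy => hφ u v hA y)
      (fun u s v hb h1 h2 y hy => ?_)
    · have e1 : Γ.f ϖ u u y = y := by rw [h.map_self]; rfl
      have e2 : Γ.f ϖ u u (φ u y) = φ u y := by rw [h.map_self]; rfl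
      rw [e2]
      congr 2
      exact Subtype.ext e1
    · have hs : Γ.f ϖ u s y ∈ M.V s := hM u s (Submodule.mem_map_of_mem y.2)
      have e1 := h2 ⟨_, hs⟩ (by rw [h.apply_apply hb]; exact hy)
      rw [h1 y hs] at e1
      refine Eq.trans ?_ (e1.trans (h.apply_apply hb _))
      congr 2
      exact Subtype.ext (h.apply_apply hb _).symm
  funext p
  obtain ⟨u, v⟩ := p
  have hmap : (((M.V u).map (Γ.f ϖ u v)).comap (M.V v).subtype).map (φ v).toLinearMap =
      ((N.V u).map (Γ.f ϖ u v)).comap (N.V v).subtype := by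
    ext z
    constructor
    · rintro ⟨w, ⟨y, hy, hyw⟩, rfl⟩
      refine ⟨φ u ⟨y, hy⟩, (φ u ⟨y, hy⟩).2, ?_⟩
      have := key u v ⟨y, hy⟩ (hM u v (Submodule.mem_map_of_mem hy))
      rw [← this]
      change (φ v _ : Γ.Lbar v) = φ v w
      congr 2
      exact Subtype.ext hyw
    · rintro ⟨y, hy, hyz⟩
      obtain ⟨y', hy'⟩ := (φ u).surjective ⟨y, hy⟩
      have hm := hM u v (Submodule.mem_map_of_mem y'.2)
      refine ⟨⟨_, hm⟩, ⟨y', y'.2, rfl⟩, Subtype.ext ?_⟩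
      have := key u v y' hm
      rw [hy'] at this
      exact this.trans hyz
  have hN := (isSubrep_iff h).mp N.isSubrep
  have e1 : ∀ L : QuiverGr Γ ϖ x, (∀ u v, (L.V u).map (Γ.f ϖ u v) ≤ L.V v) →
      L.rankVector (u, v) = Module.finrank (ResidueField R)
        (((L.V u).map (Γ.f ϖ u v)).comap (L.V v).subtype : Submodule _ (L.V v)) := fun L hL =>
    (LinearEquiv.finrank_eq (Submodule.comapSubtypeEquivOfLe (hL u v))).symm
  rw [e1 M hM, e1 N hN, ← hmap]
  exact (LinearEquiv.finrank_map_eq (φ v) _).symm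

variable [∀ v, FiniteDimensional (ResidueField R) (Γ.Lbar v)]

theorem iso_of_rankVector_eq [Finite I] (h : Linked n (Γ.f ϖ) S) {M N : QuiverGr Γ ϖ x}
    (hMN : M.rankVector = N.rankVector) : M.Iso N := by
  obtain ⟨e, he⟩ := h.exists_equiv ((isSubrep_iff h).mp M.isSubrep) ((isSubrep_iff h).mp N.isSubrep)
    (fun u v => congrFun hMN (u, v))
  exact ⟨e, fun u v hA y => he u v y _⟩

/-- Induction on the sum of the gaps between the two rank vectors, which the deformation strictly
reduces. -/
theorem mem_closure_of_rankVector_le [Finite I] [Infinite (ResidueField R)]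
    (h : Linked n (Γ.f ϖ) S) {M M' : QuiverGr Γ ϖ x} (hle : M.rankVector ≤ M'.rankVector) :
    M ∈ closure M'.rankStratum := by
  have := Fintype.ofFinite I
  induction hk : ∑ p, (M'.rankVector p - M.rankVector p) using Nat.strong_induction_on
    generalizing M with
  | _ k ih =>
    by_cases heq : M.rankVector = M'.rankVector
    · exact subset_closure heq
    obtain ⟨p, hp⟩ : ∃ p, M.rankVector p ≠ M'.rankVector p := by
      by_contra hh
      push Not at hh
      exact heq (funext hh)
    obtain ⟨b, b', hb, hspan, hmain⟩ := h.exists_deformation M.finrank_eq M'.finrank_eq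
      ((isSubrep_iff h).mp M.isSubrep) ((isSubrep_iff h).mp M'.isSubrep) (fun u v => hle (u, v))
      (lt_of_le_of_ne (hle p) hp)
    have hBM : (fun v => Submodule.span (ResidueField R) (Set.range (b v))) = M.V := funext hspan
    set B : Frame Γ ϖ x := ⟨b, hb, by rw [hBM]; exact M.isSubrep⟩ with hB
    have hBM' : B.toGr = M := QuiverGr.ext hspan
    -- The other points of the line are only known to lie in the closure of the stratum, by
    -- induction.
    rw [← hBM', ← closure_closure]
    refine mem_closure_of_line B b' fun t ht hli => ?_
    obtain ⟨h1, h2⟩ := hmain t _ (fun q => rfl)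
    obtain ⟨h3, ⟨u, v, h4⟩, h5⟩ := h2 ht hli
    set B' : Frame Γ ϖ x := ⟨fun v => b v + t • b' v, hli, (isSubrep_iff h).mpr h1⟩ with hB'
    refine ⟨B', rfl, ih _ ?_ (M := B'.toGr) (fun p => h5 p.1 p.2) rfl⟩
    rw [← hk]
    refine Finset.sum_lt_sum (fun p _ => ?_) ⟨(u, v), Finset.mem_univ _, ?_⟩
    · have : M.rankVector p ≤ B'.toGr.rankVector p := h3 p.1 p.2
      omega
    · have e1 : M.rankVector (u, v) < B'.toGr.rankVector (u, v) := h4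
      have e2 : B'.toGr.rankVector (u, v) ≤ M'.rankVector (u, v) := h5 u v
      omega

theorem rankStratum_subset_closure_iff [Finite I] [Infinite (ResidueField R)]
    (h : Linked n (Γ.f ϖ) S) {M M' : QuiverGr Γ ϖ x} :
    M.rankStratum ⊆ closure M'.rankStratum ↔ M.rankVector ≤ M'.rankVector := by
  constructor
  · intro hle p
    obtain ⟨N, hN, hNM⟩ := mem_closure_iff.mp (hle (rfl : M.rankVector = M.rankVector)) _
      (isOpen_le_rankVector p (M.rankVector p)) (le_refl (M.rankVector p))
    have : N.rankVector = M'.rankVector := hNM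
    rw [← this]
    exact hN
  · intro hle N hN
    have : N.rankVector = M.rankVector := hN
    exact mem_closure_of_rankVector_le h (this ▸ hle)

theorem iso_iff_rankVector_eq [Finite I] (h : Linked n (Γ.f ϖ) S) {M N : QuiverGr Γ ϖ x} :
    M.Iso N ↔ M.rankVector = N.rankVector :=
  ⟨rankVector_eq_of_iso h, iso_of_rankVector_eq h⟩

theorem quiverStratum_eq_rankStratum [Finite I] (h : Linked n (Γ.f ϖ) S) (M : QuiverGr Γ ϖ x) :
    M.quiverStratum = M.rankStratum :=
  Set.ext fun _ => iso_iff_rankVector_eq h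

end QuiverGr

end LinkedGrassmannian

namespace LinkedGrassmannian

/-! ### Lattices over a discrete valuation ring -/

section LatticeBasics

variable {R K : Type*} [CommRing R] [Field K] [Algebra R K] {d : ℕ}

theorem mem_smul_iff {c : K} (hc : c ≠ 0) {N : Submodule R (Fin d → K)} {x : Fin d → K} :
    x ∈ c • N ↔ c⁻¹ • x ∈ N := by
  rw [Submodule.mem_smul_pointwise_iff_exists]
  constructor
  · rintro ⟨y, hy, rfl⟩
    rwa [inv_smul_smul₀ hc]
  · intro h
    exact ⟨_, h, smul_inv_smul₀ hc x⟩

theorem smul_mem_of_mem_range {c : K} (hc : c ∈ Set.range (algebraMap R K))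
    {N : Submodule R (Fin d → K)} {x : Fin d → K} (hx : x ∈ N) : c • x ∈ N := by
  obtain ⟨r, rfl⟩ := hc
  rw [algebraMap_smul]
  exact N.smul_mem r hx

variable [IsDomain R] [IsDiscreteValuationRing R] [IsFractionRing R K] {ϖ : R}

theorem algebraMap_uniformizer_ne_zero (hϖ : Irreducible ϖ) : algebraMap R K ϖ ≠ 0 := by
  simpa using hϖ.ne_zero

theorem zpow_mem_range (n : ℤ) (hn : 0 ≤ n) : algebraMap R K ϖ ^ n ∈ Set.range (algebraMap R K) := by
  lift n to ℕ using hn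
  exact ⟨ϖ ^ n, by simp⟩

theorem zpow_smul_mem {n m : ℤ} (hϖ : Irreducible ϖ) (hnm : n ≤ m) {N : Submodule R (Fin d → K)}
    {x : Fin d → K} (hx : algebraMap R K ϖ ^ n • x ∈ N) : algebraMap R K ϖ ^ m • x ∈ N := by
  have h1 := smul_mem_of_mem_range (zpow_mem_range (ϖ := ϖ) (m - n) (by omega)) hx
  rwa [smul_smul, ← zpow_add₀ (algebraMap_uniformizer_ne_zero hϖ), sub_add_cancel] at h1

theorem exists_zpow_mul_mem_range_iff (hϖ : Irreducible ϖ) {c : K} (hc : c ≠ 0) :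
    ∃ v : ℤ, ∀ n : ℤ, algebraMap R K ϖ ^ n * c ∈ Set.range (algebraMap R K) ↔ v ≤ n := by
  have hp := algebraMap_uniformizer_ne_zero (K := K) hϖ
  obtain ⟨m, u, rfl⟩ := IsDiscreteValuationRing.exists_units_eq_smul_zpow_of_irreducible hϖ hc
  refine ⟨-m, fun n => ?_⟩
  have h1 : algebraMap R K ϖ ^ n * u • algebraMap R K ϖ ^ m =
      algebraMap R K u * algebraMap R K ϖ ^ (n + m) := by
    rw [zpow_add₀ hp, Units.smul_def, Algebra.smul_def]
    ring
  rw [h1]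
  constructor
  · rintro ⟨r, hr⟩
    by_contra hlt
    obtain ⟨k, hk⟩ := Int.eq_ofNat_of_zero_le (a := -(n + m)) (by omega)
    have h2 : algebraMap R K (r * ϖ ^ k) = algebraMap R K u := by
      rw [map_mul, hr, map_pow, ← zpow_natCast, ← hk, mul_assoc, ← zpow_add₀ hp, add_neg_cancel,
        zpow_zero, mul_one]
    have h3 := IsFractionRing.injective R K h2
    have h4 : IsUnit (ϖ ^ k) := isUnit_of_dvd_unit (Dvd.intro_left r h3) u.isUnit
    rw [isUnit_pow_iff (by omega)] at h4
    exact hϖ.not_isUnit h4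
  · intro hn
    obtain ⟨r, hr⟩ := zpow_mem_range (ϖ := ϖ) (K := K) (n + m) (by omega)
    exact ⟨u * r, by rw [map_mul, hr]⟩

/-- A lattice consists of the vectors with integral coordinates in some basis. -/
theorem exists_basis_of_isLattice (L : Submodule R (Fin d → K)) [L.IsLattice K] :
    ∃ e : Module.Basis (Fin d) K (Fin d → K), (∀ k, e k ∈ L) ∧
      ∀ x, x ∈ L ↔ ∀ k, e.repr x k ∈ Set.range (algebraMap R K) := by
  have : Module.IsTorsionFree R K := inferInstance
  have h1 : Module.finrank R L = d := by
    rw [Submodule.IsLattice.finrank_of_pi K L, Fintype.card_fin]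
  let b := Module.finBasisOfFinrankEq R L h1
  have h2 : L = Submodule.span R (Set.range (b.extendOfIsLattice K)) := by
    have h3 : Set.range (b.extendOfIsLattice K) = L.subtype '' Set.range b := by
      rw [← Set.range_comp]
      congr 1
      funext k
      simp
    rw [h3, ← Submodule.map_span, b.span_eq, Submodule.map_top, Submodule.range_subtype]
  refine ⟨b.extendOfIsLattice K, fun k => by simp, fun x => ?_⟩
  conv_lhs => rw [h2]
  exact Module.Basis.mem_span_iff_repr_mem R _ x

theorem exists_forall_le_int {ι : Type*} [Finite ι] (g : ι → ℤ) : ∃ M, ∀ i, g i ≤ M := by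
  obtain ⟨M, hM⟩ := (Set.finite_range g).bddAbove
  exact ⟨M, fun i => hM ⟨i, rfl⟩⟩

theorem exists_zpow_smul_mem (hϖ : Irreducible ϖ) (L : Submodule R (Fin d → K)) [L.IsLattice K]
    (x : Fin d → K) : ∃ n : ℤ, algebraMap R K ϖ ^ n • x ∈ L := by
  obtain ⟨e, -, he⟩ := exists_basis_of_isLattice L
  have h1 : ∀ k, ∃ v : ℤ, ∀ n, v ≤ n →
      algebraMap R K ϖ ^ n * e.repr x k ∈ Set.range (algebraMap R K) := by
    intro k
    by_cases hc : e.repr x k = 0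
    · exact ⟨0, fun n _ => ⟨0, by simp [hc]⟩⟩
    · obtain ⟨v, hv⟩ := exists_zpow_mul_mem_range_iff hϖ hc
      exact ⟨v, fun n => (hv n).mpr⟩
  choose v hv using h1
  obtain ⟨M, hM⟩ := exists_forall_le_int v
  exact ⟨M, (he _).mpr fun k => by simpa using hv k M (hM k)⟩

theorem exists_le_of_zpow_smul_mem (hϖ : Irreducible ϖ) (L : Submodule R (Fin d → K))
    [L.IsLattice K] {x : Fin d → K} (hx : x ≠ 0) :
    ∃ v : ℤ, ∀ n, algebraMap R K ϖ ^ n • x ∈ L → v ≤ n := by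
  obtain ⟨e, -, he⟩ := exists_basis_of_isLattice L
  obtain ⟨k, hk⟩ : ∃ k, e.repr x k ≠ 0 := by
    by_contra hh
    push Not at hh
    exact hx (e.repr.map_eq_zero_iff.mp (Finsupp.ext hh))
  obtain ⟨v, hv⟩ := exists_zpow_mul_mem_range_iff hϖ hk
  exact ⟨v, fun n hn => (hv n).mp (by simpa using (he _).mp hn k)⟩

/-- The admissible exponents form an upward closed set, nonempty because finitely many basis vectors
have to be treated and bounded below because `0 < d`; so the infimum is attained. -/
theorem minExp_le_iff (hϖ : Irreducible ϖ) (hd : 0 < d) (L L' : Submodule R (Fin d → K))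
    [L.IsLattice K] [L'.IsLattice K] {n : ℤ} :
    minExp ϖ L L' ≤ n ↔ ∀ x ∈ L, algebraMap R K ϖ ^ n • x ∈ L' := by
  have hup : ∀ m : ℤ, (∀ x ∈ L, algebraMap R K ϖ ^ m • x ∈ L') → ∀ n, m ≤ n →
      ∀ x ∈ L, algebraMap R K ϖ ^ n • x ∈ L' := fun m hm n hmn x hx =>
    zpow_smul_mem hϖ hmn (hm x hx)
  obtain ⟨e, heL, he⟩ := exists_basis_of_isLattice L
  have hne : {n : ℤ | ∀ x ∈ L, algebraMap R K ϖ ^ n • x ∈ L'}.Nonempty := by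
    choose v hv using fun k => exists_zpow_smul_mem hϖ L' (e k)
    obtain ⟨M, hM⟩ := exists_forall_le_int v
    refine ⟨M, fun x hx => ?_⟩
    rw [← e.sum_repr x, Finset.smul_sum]
    refine Submodule.sum_mem _ fun k _ => ?_
    rw [smul_comm]
    exact smul_mem_of_mem_range ((he x).mp hx k) (zpow_smul_mem hϖ (hM k) (hv k))
  have hbdd : BddBelow {n : ℤ | ∀ x ∈ L, algebraMap R K ϖ ^ n • x ∈ L'} := by
    obtain ⟨v, hv⟩ := exists_le_of_zpow_smul_mem hϖ L' (e.ne_zero ⟨0, hd⟩)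
    exact ⟨v, fun n hn => hv n (hn _ (heL _))⟩
  constructor
  · intro hn
    exact hup _ (Int.csInf_mem hne hbdd) n hn
  · intro hn
    exact csInf_le hbdd hn

theorem Homothetic.exists_zpow (hϖ : Irreducible ϖ) {N N' : Submodule R (Fin d → K)}
    (h : Homothetic N N') : ∃ m : ℤ, ∀ x, x ∈ N ↔ algebraMap R K ϖ ^ m • x ∈ N' := by
  obtain ⟨c, hc, rfl⟩ := h
  obtain ⟨m, u, rfl⟩ := IsDiscreteValuationRing.exists_units_eq_smul_zpow_of_irreducible hϖ hc
  refine ⟨-m, fun x => ?_⟩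
  rw [mem_smul_iff hc]
  have h1 : (u • algebraMap R K ϖ ^ m)⁻¹ = (algebraMap R K (↑u⁻¹ : R)) * algebraMap R K ϖ ^ (-m) := by
    have hu : algebraMap R K (↑u⁻¹ : R) * algebraMap R K u = 1 := by
      rw [← map_mul, Units.inv_mul, map_one]
    rw [Units.smul_def, Algebra.smul_def, mul_inv, zpow_neg, ← eq_inv_of_mul_eq_one_left hu]
  have hiff : ∀ (w : Rˣ) (y : Fin d → K), (w : R) • y ∈ N' ↔ y ∈ N' := fun w y => by
    constructor
    · intro hy
      have := N'.smul_mem (↑w⁻¹ : R) hy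
      rwa [smul_smul, Units.inv_mul, one_smul] at this
    · exact N'.smul_mem _
  rw [h1, mul_smul, algebraMap_smul, hiff]

theorem homothetic_zpow_smul (hϖ : Irreducible ϖ) (m : ℤ) (N : Submodule R (Fin d → K)) :
    Homothetic (algebraMap R K ϖ ^ m • N) N :=
  ⟨_, zpow_ne_zero _ (algebraMap_uniformizer_ne_zero hϖ), rfl⟩

end LatticeBasics

section Config

variable {R K : Type*} [CommRing R] [IsDomain R] [IsDiscreteValuationRing R] [Field K]
  [Algebra R K] [IsFractionRing R K] {ϖ : R} {d : ℕ} {I : Type*} {Γ : LatticeConfig R K d I}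

open IsLocalRing (ResidueField)

namespace LatticeConfig

/-- The least exponent `n` with `ϖ ^ n L_u ⊆ L_v`. -/
noncomputable def exp (Γ : LatticeConfig R K d I) (ϖ : R) (u v : I) : ℤ :=
  minExp ϖ (Γ.L u) (Γ.L v)

theorem exp_le_iff (hϖ : Irreducible ϖ) (hd : 0 < d) {u v : I} {n : ℤ} :
    Γ.exp ϖ u v ≤ n ↔ ∀ x ∈ Γ.L u, algebraMap R K ϖ ^ n • x ∈ Γ.L v :=
  have := Γ.isLattice u
  have := Γ.isLattice v
  minExp_le_iff hϖ hd _ _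

theorem zpow_exp_smul_mem (hϖ : Irreducible ϖ) (hd : 0 < d) {u v : I} {x : Fin d → K}
    (hx : x ∈ Γ.L u) : algebraMap R K ϖ ^ Γ.exp ϖ u v • x ∈ Γ.L v :=
  (exp_le_iff hϖ hd).mp le_rfl x hx

theorem isLinkMetric (hϖ : Irreducible ϖ) (hd : 0 < d) : IsLinkMetric (Γ.exp ϖ) := by
  have hp := algebraMap_uniformizer_ne_zero (K := K) hϖ
  have htri : ∀ u v w, Γ.exp ϖ u w ≤ Γ.exp ϖ u v + Γ.exp ϖ v w := fun u v w => by
    rw [exp_le_iff hϖ hd]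
    intro x hx
    rw [add_comm, zpow_add₀ hp, mul_smul]
    exact zpow_exp_smul_mem hϖ hd (zpow_exp_smul_mem hϖ hd hx)
  have hself : ∀ u, Γ.exp ϖ u u = 0 := fun u => by
    have h1 : Γ.exp ϖ u u ≤ 0 := (exp_le_iff hϖ hd).mpr fun x hx => by simpa using hx
    have := htri u u u
    omega
  refine ⟨hself, htri, fun u v huv => ?_⟩
  -- If `n u v + n v u ≤ 0`, multiplication by `ϖ ^ n u v` identifies `L_u` with `L_v`, so the
  -- vertices coincide.
  by_contra hlt
  have h1 := htri u v u
  rw [hself] at h1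
  refine huv (Γ.distinct u v ⟨algebraMap R K ϖ ^ (-Γ.exp ϖ u v), zpow_ne_zero _ hp, ?_⟩)
  ext x
  rw [mem_smul_iff (zpow_ne_zero _ hp), zpow_neg, inv_inv]
  constructor
  · exact zpow_exp_smul_mem hϖ hd
  · intro hx
    have h2 := (exp_le_iff hϖ hd (u := v) (v := u) (n := -Γ.exp ϖ u v)).mp (by omega) _ hx
    rwa [smul_smul, ← zpow_add₀ hp, neg_add_cancel, zpow_zero, one_smul] at h2

/-- By convexity, `ϖ ^ i L_u ∩ ϖ ^ j L_v` is of the form `ϖ ^ m L_s`. -/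
theorem Convex.exists_inter (hϖ : Irreducible ϖ) (hΓ : Γ.Convex) (u v : I) (i j : ℤ) :
    ∃ (s : I) (m : ℤ), ∀ x, algebraMap R K ϖ ^ m • x ∈ Γ.L s ↔
      algebraMap R K ϖ ^ i • x ∈ Γ.L u ∧ algebraMap R K ϖ ^ j • x ∈ Γ.L v := by
  have hp := algebraMap_uniformizer_ne_zero (K := K) hϖ
  obtain ⟨s, hs⟩ := hΓ u v _ _ (homothetic_zpow_smul hϖ (-i) (Γ.L u))
    (homothetic_zpow_smul hϖ (-j) (Γ.L v))
  obtain ⟨m, hm⟩ := hs.exists_zpow hϖ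
  refine ⟨s, m, fun x => ?_⟩
  rw [← hm, Submodule.mem_inf, mem_smul_iff (zpow_ne_zero _ hp), mem_smul_iff (zpow_ne_zero _ hp),
    zpow_neg, inv_inv, zpow_neg, inv_inv]

/-- The reduction of a vector of `L_v`. -/
noncomputable def red (Γ : LatticeConfig R K d I) (v : I) : Γ.L v →ₗ[R] Γ.Lbar v :=
  TensorProduct.mk R (ResidueField R) (Γ.L v) 1

theorem red_surjective (v : I) : Function.Surjective (Γ.red v) :=
  TensorProduct.mk_surjective R (Γ.L v) (ResidueField R) IsLocalRing.residue_surjective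

theorem red_eq_zero_iff (hϖ : Irreducible ϖ) {v : I} {x : Γ.L v} :
    Γ.red v x = 0 ↔ (algebraMap R K ϖ ^ (-1 : ℤ)) • (x : Fin d → K) ∈ Γ.L v := by
  have hp := algebraMap_uniformizer_ne_zero (K := K) hϖ
  have h1 : Γ.red v x = 0 ↔ x ∈ (IsLocalRing.maximalIdeal R • ⊤ : Submodule R (Γ.L v)) := by
    rw [← Submodule.Quotient.mk_eq_zero,
      ← TensorProduct.quotTensorEquivQuotSMul_mk_one_tmul (IsLocalRing.maximalIdeal R) x,
      LinearEquiv.map_eq_zero_iff]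
    rfl
  rw [h1, hϖ.maximalIdeal_eq, Submodule.ideal_span_singleton_smul,
    Submodule.mem_smul_pointwise_iff_exists]
  constructor
  · rintro ⟨y, -, rfl⟩
    rw [Submodule.coe_smul, ← algebraMap_smul K ϖ, smul_smul, zpow_neg_one, inv_mul_cancel₀ hp,
      one_smul]
    exact y.2
  · intro hx
    refine ⟨⟨_, hx⟩, trivial, Subtype.ext ?_⟩
    rw [Submodule.coe_smul, ← algebraMap_smul K ϖ, smul_smul, zpow_neg_one, mul_inv_cancel₀ hp,
      one_smul]

theorem f_red (hϖ : Irreducible ϖ) (hd : 0 < d) {u v : I} (x : Γ.L u) :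
    Γ.f ϖ u v (Γ.red u x) = Γ.red v ⟨_, zpow_exp_smul_mem hϖ hd x.2⟩ := by
  have h1 : ∀ y ∈ Γ.L u, (algebraMap R K ϖ ^ minExp ϖ (Γ.L u) (Γ.L v)) • y ∈ Γ.L v :=
    fun y hy => zpow_exp_smul_mem hϖ hd hy
  change (1 : ResidueField R) ⊗ₜ[R] latticeMap ϖ (Γ.L u) (Γ.L v) x = _
  rw [latticeMap, dif_pos h1]
  rfl

end LatticeConfig

end Config

end LinkedGrassmannian

namespace LinkedGrassmannian

/-! ### The representation of a locally weakly independent configuration -/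

section Config

variable {R K : Type*} [CommRing R] [IsDomain R] [IsDiscreteValuationRing R] [Field K]
  [Algebra R K] [IsFractionRing R K] {ϖ : R} {d : ℕ} {I : Type*} {Γ : LatticeConfig R K d I}

open IsLocalRing (ResidueField)

namespace LatticeConfig

theorem lt_exp_iff (hϖ : Irreducible ϖ) (hd : 0 < d) {u v : I} {n : ℤ} :
    n < Γ.exp ϖ u v ↔ ∃ x ∈ Γ.L u, algebraMap R K ϖ ^ n • x ∉ Γ.L v := by
  rw [← not_le, exp_le_iff hϖ hd]
  push Not
  rfl

/-- Take the class of `N = L_v ∩ ϖ ^ (1 - n v u) L_u`. It contains `ϖ L_v` and `ϖ ^ n u v L_u`,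
hence is at distance at most one from `v` and on a geodesic from `u`. It differs from `[L_v]`: `N =
L_v` would contradict the minimality of `n v u`, and `N = ϖ L_v` that of `n u v`. -/
theorem exists_adj_right (hϖ : Irreducible ϖ) (hd : 0 < d) (hΓ : Γ.Convex) {u v : I}
    (huv : u ≠ v) : ∃ w, Adj (Γ.exp ϖ) w v ∧ Btw (Γ.exp ϖ) u w v := by
  have hp := algebraMap_uniformizer_ne_zero (K := K) hϖ
  have hm := isLinkMetric (Γ := Γ) hϖ hd
  set n := Γ.exp ϖ with hn
  have hsum := hm.pos u v huv
  obtain ⟨w, m, hw⟩ := hΓ.exists_inter hϖ v u 0 (-1 + n v u)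
  have h1 : n w v ≤ -m := (exp_le_iff hϖ hd).mpr fun x hx => by
    have := ((hw (algebraMap R K ϖ ^ (-m) • x)).mp (by
      rwa [smul_smul, ← zpow_add₀ hp, add_neg_cancel, zpow_zero, one_smul])).1
    rwa [zpow_zero, one_smul] at this
  have h2 : n v w ≤ m + 1 := (exp_le_iff hϖ hd).mpr fun x hx => by
    rw [zpow_add₀ hp, mul_smul, hw, smul_smul, smul_smul, ← zpow_add₀ hp, ← zpow_add₀ hp]
    refine ⟨zpow_smul_mem hϖ (n := 0) (by omega) (by simpa using hx), ?_⟩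
    rw [show -1 + n v u + 1 = n v u by ring]
    exact zpow_exp_smul_mem hϖ hd hx
  have h3 : n u w ≤ m + n u v := (exp_le_iff hϖ hd).mpr fun x hx => by
    rw [zpow_add₀ hp, mul_smul, hw, smul_smul, smul_smul, ← zpow_add₀ hp, ← zpow_add₀ hp]
    refine ⟨by rw [zero_add]; exact zpow_exp_smul_mem hϖ hd hx, ?_⟩
    exact zpow_smul_mem hϖ (n := 0) (by omega) (by simpa using hx)
  have hb : Btw n u w v := by
    have := hm.tri u w v
    unfold Btw
    omega
  by_cases hwv : w = v
  · subst hwv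
    exfalso
    have h4 := hm.self w
    rcases (by omega : m = 0 ∨ m = -1) with rfl | rfl
    · obtain ⟨x, hx, hxu⟩ := (lt_exp_iff (Γ := Γ) hϖ hd (n := -1 + n w u) (u := w) (v := u)).mp
        (by rw [← hn]; omega)
      exact hxu ((hw x).mp (by simpa using hx)).2
    · have : n u w ≤ -1 + n u w := h3
      omega
  · have := hm.pos w v hwv
    exact ⟨w, by unfold Adj; omega, hb⟩

theorem mem_ker_f_iff (hϖ : Irreducible ϖ) (hd : 0 < d) {u v : I} {x : Γ.L u} :
    Γ.f ϖ u v (Γ.red u x) = 0 ↔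
      algebraMap R K ϖ ^ (-1 + Γ.exp ϖ u v) • (x : Fin d → K) ∈ Γ.L v := by
  rw [f_red hϖ hd, red_eq_zero_iff hϖ, smul_smul,
    ← zpow_add₀ (algebraMap_uniformizer_ne_zero (K := K) hϖ)]

theorem ext_red {u : I} {W : Type*} [AddCommGroup W] [Module (ResidueField R) W]
    {g g' : Γ.Lbar u →ₗ[ResidueField R] W} (h : ∀ x, g (Γ.red u x) = g' (Γ.red u x)) : g = g' := by
  ext y
  obtain ⟨x, rfl⟩ := Γ.red_surjective u y
  exact h x

theorem f_self (hϖ : Irreducible ϖ) (hd : 0 < d) (u : I) : Γ.f ϖ u u = LinearMap.id := by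
  refine ext_red fun x => ?_
  rw [f_red hϖ hd, LinearMap.id_apply]
  congr 1
  refine Subtype.ext ?_
  simp [(isLinkMetric (Γ := Γ) hϖ hd).self u]

theorem f_comp (hϖ : Irreducible ϖ) (hd : 0 < d) {u v w : I} (hb : Btw (Γ.exp ϖ) u v w) :
    Γ.f ϖ v w ∘ₗ Γ.f ϖ u v = Γ.f ϖ u w := by
  refine ext_red fun x => ?_
  rw [LinearMap.comp_apply, f_red hϖ hd, f_red hϖ hd, f_red hϖ hd]
  congr 1
  refine Subtype.ext ?_
  simp only
  rw [smul_smul, ← zpow_add₀ (algebraMap_uniformizer_ne_zero (K := K) hϖ), add_comm, ← hb]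

/-- Off geodesics the exponents add up to at least one more than `n u w`, so the composite is
divisible by `ϖ`. -/
theorem f_comp_eq_zero (hϖ : Irreducible ϖ) (hd : 0 < d) {u v w : I}
    (hb : ¬ Btw (Γ.exp ϖ) u v w) : Γ.f ϖ v w ∘ₗ Γ.f ϖ u v = 0 := by
  refine ext_red fun x => ?_
  rw [LinearMap.comp_apply, f_red hϖ hd, LinearMap.zero_apply, mem_ker_f_iff hϖ hd, smul_smul,
    ← zpow_add₀ (algebraMap_uniformizer_ne_zero (K := K) hϖ)]
  have h1 := (isLinkMetric (Γ := Γ) hϖ hd).tri u v w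
  unfold Btw at hb
  exact (exp_le_iff hϖ hd).mp (by omega) _ x.2

theorem f_ne_zero (hϖ : Irreducible ϖ) (hd : 0 < d) (u v : I) : Γ.f ϖ u v ≠ 0 := by
  intro h0
  have : Γ.exp ϖ u v ≤ -1 + Γ.exp ϖ u v := (exp_le_iff hϖ hd).mpr fun x hx => by
    rw [← mem_ker_f_iff hϖ hd (x := ⟨x, hx⟩), h0, LinearMap.zero_apply]
  omega

theorem ker_f_eq (hϖ : Irreducible ϖ) (hd : 0 < d) {u v : I} (huv : Adj (Γ.exp ϖ) u v) :
    LinearMap.ker (Γ.f ϖ u v) = LinearMap.range (Γ.f ϖ v u) := by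
  have hp := algebraMap_uniformizer_ne_zero (K := K) hϖ
  have hm := isLinkMetric (Γ := Γ) hϖ hd
  apply le_antisymm
  · intro y hy
    obtain ⟨x, rfl⟩ := Γ.red_surjective u y
    rw [LinearMap.mem_ker, mem_ker_f_iff hϖ hd] at hy
    -- The preimage is `ϖ ^ (n u v - 1) x`; it returns to `x` because `n u v + n v u = 1`.
    refine ⟨Γ.red v ⟨_, hy⟩, ?_⟩
    rw [f_red hϖ hd]
    congr 1
    refine Subtype.ext ?_
    simp only
    unfold Adj at huv
    rw [smul_smul, ← zpow_add₀ hp, show Γ.exp ϖ v u + (-1 + Γ.exp ϖ u v) = 0 by omega, zpow_zero,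
      one_smul]
  · rw [LinearMap.range_le_ker_iff]
    refine f_comp_eq_zero hϖ hd fun hb => ?_
    exact hm.adj_ne huv (hm.eq_of_btw_self hb)

/-- Take the class of `N = ϖ⁻¹ L_u ∩ ϖ ^ (-n u v) L_v`, which lies between `L_u` and `ϖ⁻¹ L_u`. An
`x ∈ L_u` reduces into `ker f u v` exactly when `ϖ⁻¹ x ∈ N`, so the kernel is that of the map to the
class of `N`. -/
theorem exists_adj_ker (hϖ : Irreducible ϖ) (hd : 0 < d) (hΓ : Γ.Convex) {u v : I}
    (huv : u ≠ v) : ∃ s, Adj (Γ.exp ϖ) u s ∧ Btw (Γ.exp ϖ) u s v ∧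
      LinearMap.ker (Γ.f ϖ u v) = LinearMap.ker (Γ.f ϖ u s) := by
  have hp := algebraMap_uniformizer_ne_zero (K := K) hϖ
  have hm := isLinkMetric (Γ := Γ) hϖ hd
  set n := Γ.exp ϖ with hn
  have hsum := hm.pos u v huv
  obtain ⟨s, m, hs⟩ := hΓ.exists_inter hϖ u v 1 (n u v)
  have h1 : n u s ≤ m := (exp_le_iff hϖ hd).mpr fun x hx => by
    rw [hs]
    exact ⟨zpow_smul_mem hϖ (n := 0) (by omega) (by simpa using hx), zpow_exp_smul_mem hϖ hd hx⟩
  have h2 : n s u ≤ 1 - m := (exp_le_iff hϖ hd).mpr fun x hx => by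
    have := ((hs (algebraMap R K ϖ ^ (-m) • x)).mp (by
      rwa [smul_smul, ← zpow_add₀ hp, add_neg_cancel, zpow_zero, one_smul])).1
    rwa [smul_smul, ← zpow_add₀ hp] at this
  have h3 : n s v ≤ n u v - m := (exp_le_iff hϖ hd).mpr fun x hx => by
    have := ((hs (algebraMap R K ϖ ^ (-m) • x)).mp (by
      rwa [smul_smul, ← zpow_add₀ hp, add_neg_cancel, zpow_zero, one_smul])).2
    rwa [smul_smul, ← zpow_add₀ hp] at this
  have hb : Btw n u s v := by
    have := hm.tri u s v
    unfold Btw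
    omega
  have hsu : u ≠ s := by
    rintro rfl
    have h4 := hm.self u
    rcases (by omega : m = 0 ∨ m = 1) with rfl | rfl
    · obtain ⟨x, hx, hxu⟩ := (lt_exp_iff (Γ := Γ) hϖ hd (n := -n u v) (u := v) (v := u)).mp
        (by rw [← hn]; omega)
      -- If `N = L_u`, then elements of `L_u` of the form `ϖ ^ (-n u v + k + 1) x` with `x ∈ L_v`
      -- can be divided by `ϖ` inside `L_u`, down to exponent `-n u v`, against the choice of `x`.
      have key : ∀ k : ℕ, algebraMap R K ϖ ^ (-n u v + k) • x ∈ Γ.L u →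
          algebraMap R K ϖ ^ (-n u v) • x ∈ Γ.L u := by
        intro k
        induction k with
        | zero => intro hk; simpa using hk
        | succ k ih =>
          intro hk
          refine ih ?_
          have := (hs (algebraMap R K ϖ ^ (-n u v + k) • x)).mpr ⟨by
            rw [smul_smul, ← zpow_add₀ hp]
            convert hk using 3
            push_cast
            ring, by
            rw [smul_smul, ← zpow_add₀ hp]
            exact zpow_smul_mem hϖ (n := 0) (by omega) (by simpa using hx)⟩
          simpa using this
      have h5 := (exp_le_iff (Γ := Γ) hϖ hd (u := v) (v := u) (n := -n u v + (n v u + n u v).toNat)).mp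
        (by rw [← hn]; omega) x hx
      exact hxu (key _ h5)
    · obtain ⟨x, hx, hxu⟩ := (lt_exp_iff (Γ := Γ) hϖ hd (n := -1 + n u v) (u := u) (v := v)).mp
        (by rw [← hn]; omega)
      refine hxu ?_
      have := ((hs (algebraMap R K ϖ ^ (-1 : ℤ) • x)).mp (by
        rw [smul_smul, ← zpow_add₀ hp]; simpa using hx)).2
      rwa [smul_smul, ← zpow_add₀ hp, add_comm] at this
  have hpos := hm.pos u s hsu
  refine ⟨s, by unfold Adj; omega, hb, le_antisymm ?_ ?_⟩
  · intro y hy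
    obtain ⟨x, rfl⟩ := Γ.red_surjective u y
    rw [LinearMap.mem_ker, mem_ker_f_iff hϖ hd] at hy ⊢
    rw [← hn, show n u s = m by omega, add_comm, zpow_add₀ hp, mul_smul, hs, smul_smul, smul_smul,
      ← zpow_add₀ hp, ← zpow_add₀ hp]
    refine ⟨by simp, ?_⟩
    rwa [add_comm] at hy
  · rw [← f_comp hϖ hd hb]
    exact LinearMap.ker_le_ker_comp _ _

/-- The remaining point is that every `w ∈ S v` is adjacent to `v`. A neighbour `w₁` of `v` on a
geodesic from `w` has a predecessor `w' ∈ S v`. Then `im f w v ⊆ im f w' v`, so `w = w'` by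
independence, and `w₁ = w`. -/
theorem exists_linked (hϖ : Irreducible ϖ) (hd : 0 < d) (hΓ : Γ.Convex)
    (hlwi : Γ.LocallyWeaklyIndependent ϖ) : ∃ S, Linked (Γ.exp ϖ) (Γ.f ϖ) S := by
  have hm := isLinkMetric (Γ := Γ) hϖ hd
  choose S hS using hlwi
  have hpred : ∀ u v, u ≠ v → ∃ w ∈ S v, Btw (Γ.exp ϖ) u w v := fun u v huv => by
    obtain ⟨w, hw, hf⟩ := (hS v).1 u huv
    refine ⟨w, hw, ?_⟩
    by_contra hb
    rw [f_comp_eq_zero hϖ hd hb] at hf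
    exact f_ne_zero hϖ hd _ _ hf
  refine ⟨S, ⟨hm, f_self hϖ hd, fun u v w => f_comp hϖ hd, fun u v w => f_comp_eq_zero hϖ hd,
    f_ne_zero hϖ hd, fun u v => ker_f_eq hϖ hd, hpred, fun v w hw => ?_, fun v => (hS v).2.2,
    fun u v => exists_adj_ker hϖ hd hΓ⟩⟩
  have hwv : w ≠ v := by
    rintro rfl
    have h1 := (hS w).2.1 w hw
    rw [f_self hϖ hd, LinearMap.range_id, LinearMap.ker_id] at h1
    refine f_ne_zero (Γ := Γ) hϖ hd w w (LinearMap.ext fun y => ?_)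
    rw [f_self hϖ hd, LinearMap.id_apply, LinearMap.zero_apply, ← Submodule.mem_bot (ResidueField R),
      ← h1]
    trivial
  obtain ⟨w₁, ha, hb⟩ := exists_adj_right hϖ hd hΓ hwv
  obtain ⟨w', hw', hb'⟩ := hpred w₁ v (hm.adj_ne ha)
  have hle : ∀ {x y}, Btw (Γ.exp ϖ) x y v →
      LinearMap.range (Γ.f ϖ x v) ≤ LinearMap.range (Γ.f ϖ y v) := fun hxy => by
    rw [← f_comp hϖ hd hxy]
    exact LinearMap.range_comp_le_range _ _
  have heq : w = w' := by
    by_contra hne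
    have hdj := (hS v).2.2.pairwiseDisjoint (i := ⟨w, hw⟩) (j := ⟨w', hw'⟩) (by simpa using hne)
    have := hdj le_rfl ((hle hb).trans (hle hb'))
    exact f_ne_zero hϖ hd w v (LinearMap.range_eq_bot.mp (le_bot_iff.mp this))
  subst heq
  have := hm.eq_left hb hb'
  rwa [this]

theorem finrank_Lbar (v : I) : Module.finrank (ResidueField R) (Γ.Lbar v) = d := by
  have := Γ.isLattice v
  have : Module.IsTorsionFree R K := inferInstance
  rw [Module.finrank_baseChange, Submodule.IsLattice.finrank_of_pi K (Γ.L v), Fintype.card_fin]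

theorem finiteDimensional_Lbar (v : I) : FiniteDimensional (ResidueField R) (Γ.Lbar v) := by
  have := Γ.isLattice v
  infer_instance

end LatticeConfig

end Config

end LinkedGrassmannian

namespace LinkedGrassmannian

/-! ### The extended affine Weyl group as a group of permutations of the integers -/

section Weyl

variable {d : ℕ} [NeZero d]

theorem exists_eq_mul_add (d : ℕ) [NeZero d] (n : ℤ) : ∃ (l : ℤ) (k : Fin d), n = l * d + (k : ℕ) :=
  ⟨_, _, ((Int.divModEquiv d).symm_apply_apply n).symm⟩

theorem mul_add_inj {l l' : ℤ} {k k' : Fin d} (h : l * d + (k : ℕ) = l' * d + (k' : ℕ)) :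
    l = l' ∧ k = k' := by
  have := (Int.divModEquiv d).symm.injective (a₁ := (l, k)) (a₂ := (l', k')) h
  simpa using this

namespace ExtAffineWeyl

theorem ext' {w w' : ExtAffineWeyl d} (h1 : w.perm = w'.perm) (h2 : w.trans = w'.trans) :
    w = w' := by
  refine SemidirectProduct.ext ?_ h1
  funext k
  exact congrFun h2 k

theorem inv_perm_apply (σ : Equiv.Perm (Fin d)) (k : Fin d) : σ⁻¹ (σ k) = k := σ.symm_apply_apply k

theorem perm_apply_inv (σ : Equiv.Perm (Fin d)) (k : Fin d) : σ (σ⁻¹ k) = k := σ.apply_symm_apply k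

theorem smul_apply (w : ExtAffineWeyl d) (a : Fin d → ℤ) (k : Fin d) :
    (w • a) k = a (w.perm⁻¹ k) + w.trans k := rfl

/-- The permutation of `ℤ` attached to an element `(σ, t)`: for `0 ≤ k < d`, the integer `k + l d` is
mapped to `σ k + (l + t_{σ k}) d`. -/
noncomputable def ev (w : ExtAffineWeyl d) (n : ℤ) : ℤ :=
  ((Int.divModEquiv d n).1 + w.trans (w.perm (Int.divModEquiv d n).2)) * d +
    (w.perm (Int.divModEquiv d n).2 : ℕ)

theorem ev_apply (w : ExtAffineWeyl d) (l : ℤ) (k : Fin d) :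
    ev w (l * d + (k : ℕ)) = (l + w.trans (w.perm k)) * d + (w.perm k : ℕ) := by
  have h : Int.divModEquiv d (l * d + (k : ℕ)) = (l, k) :=
    (Int.divModEquiv d).apply_symm_apply (l, k)
  rw [ev, h]

theorem ev_mul (w w' : ExtAffineWeyl d) (n : ℤ) : ev (w * w') n = ev w (ev w' n) := by
  obtain ⟨l, k, rfl⟩ := exists_eq_mul_add d n
  simp only [ev_apply, perm_mul, trans_mul, Equiv.Perm.mul_apply, inv_perm_apply]
  ring

theorem ev_one (n : ℤ) : ev (1 : ExtAffineWeyl d) n = n := by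
  obtain ⟨l, k, rfl⟩ := exists_eq_mul_add d n
  simp [ev_apply, perm_one, trans_one]

theorem ev_inv_ev (w : ExtAffineWeyl d) (n : ℤ) : ev w⁻¹ (ev w n) = n := by
  rw [← ev_mul, inv_mul_cancel, ev_one]

theorem ev_ev_inv (w : ExtAffineWeyl d) (n : ℤ) : ev w (ev w⁻¹ n) = n := by
  rw [← ev_mul, mul_inv_cancel, ev_one]

theorem ev_inj {w : ExtAffineWeyl d} {m n : ℤ} : ev w m = ev w n ↔ m = n :=
  ⟨fun h => by rw [← ev_inv_ev w m, h, ev_inv_ev], fun h => h ▸ rfl⟩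

theorem ev_add_mul (w : ExtAffineWeyl d) (n l : ℤ) : ev w (n + l * d) = ev w n + l * d := by
  obtain ⟨m, k, rfl⟩ := exists_eq_mul_add d n
  rw [show m * d + (k : ℕ) + l * d = (m + l) * d + (k : ℕ) by ring, ev_apply, ev_apply]
  ring

theorem ev_injective {w w' : ExtAffineWeyl d} (h : ∀ n, ev w n = ev w' n) : w = w' := by
  have h1 : ∀ k, w.trans (w.perm k) = w'.trans (w'.perm k) ∧ w.perm k = w'.perm k := fun k => by
    have h2 := h (0 * d + (k : ℕ))
    rw [ev_apply, ev_apply] at h2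
    simpa using mul_add_inj h2
  have h2 : w.perm = w'.perm := Equiv.ext fun k => (h1 k).2
  refine ext' h2 (funext fun k => ?_)
  have := (h1 (w.perm⁻¹ k)).1
  rwa [← h2, perm_apply_inv] at this

theorem dvd_ev_sub_iff {w : ExtAffineWeyl d} {m n : ℤ} :
    (d : ℤ) ∣ ev w m - ev w n ↔ (d : ℤ) ∣ m - n := by
  have key : ∀ (w : ExtAffineWeyl d) {m n : ℤ}, (d : ℤ) ∣ m - n → (d : ℤ) ∣ ev w m - ev w n := by
    rintro w m n ⟨l, hl⟩
    obtain rfl : m = n + l * d := by linarith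
    rw [ev_add_mul]
    exact ⟨l, by ring⟩
  refine ⟨fun h => ?_, key w⟩
  have := key w⁻¹ h
  rwa [ev_inv_ev, ev_inv_ev] at this

/-- The set of integers attached to an integer vector. -/
def stair (a : Fin d → ℤ) : Set ℤ :=
  {n | (Int.divModEquiv d n).1 < a (Int.divModEquiv d n).2}

theorem mem_stair {a : Fin d → ℤ} {l : ℤ} {k : Fin d} : l * d + (k : ℕ) ∈ stair a ↔ l < a k := by
  have h : Int.divModEquiv d (l * d + (k : ℕ)) = (l, k) :=
    (Int.divModEquiv d).apply_symm_apply (l, k)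
  rw [stair, Set.mem_ofPred_eq, h]

/-- Translates the action on integer vectors into the action on subsets of `ℤ`; the vertices `ω_m`
become half-lines. -/
theorem ev_mem_stair_smul {w : ExtAffineWeyl d} {a : Fin d → ℤ} {n : ℤ} :
    ev w n ∈ stair (w • a) ↔ n ∈ stair a := by
  obtain ⟨l, k, rfl⟩ := exists_eq_mul_add d n
  rw [ev_apply, mem_stair, mem_stair, smul_apply, inv_perm_apply]
  omega

theorem stair_injective {a b : Fin d → ℤ} (h : ∀ n, n ∈ stair a ↔ n ∈ stair b) : a = b := by
  funext k
  have h1 := h (a k * d + (k : ℕ))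
  have h2 := h (b k * d + (k : ℕ))
  simp only [mem_stair] at h1 h2
  omega

theorem smul_eq_iff {w : ExtAffineWeyl d} {a b : Fin d → ℤ} :
    w • a = b ↔ ∀ n, ev w n ∈ stair b ↔ n ∈ stair a := by
  constructor
  · rintro rfl n
    exact ev_mem_stair_smul
  · intro h
    refine stair_injective fun n => ?_
    rw [← ev_ev_inv w n, ev_mem_stair_smul, h]

theorem mem_stair_add {a : Fin d → ℤ} {c n : ℤ} :
    n ∈ stair (fun k => a k + c) ↔ n - c * d ∈ stair a := by
  obtain ⟨l, k, rfl⟩ := exists_eq_mul_add d n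
  rw [show l * d + (k : ℕ) - c * d = (l - c) * d + (k : ℕ) by ring, mem_stair, mem_stair]
  omega

theorem mem_stair_omega {m : Fin d} {n : ℤ} : n ∈ stair (omega m) ↔ n < (m : ℕ) := by
  obtain ⟨l, k, rfl⟩ := exists_eq_mul_add d n
  rw [mem_stair, omega]
  have hk := k.2
  have hm := m.2
  rcases lt_trichotomy l 0 with h | rfl | h
  · have : l * d + d ≤ 0 := by nlinarith
    split_ifs <;> omega
  · split_ifs with h <;> simp only [Fin.lt_def] at h <;> omega
  · have : (d : ℤ) ≤ l * d := by nlinarith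
    split_ifs <;> omega

theorem sum_ev (w : ExtAffineWeyl d) :
    ∑ k : Fin d, ev w (k : ℕ) = ∑ k : Fin d, ((k : ℕ) : ℤ) + (∑ k, w.trans k) * d := by
  have h1 : ∀ k : Fin d, ev w (k : ℕ) = w.trans (w.perm k) * d + ((w.perm k : ℕ) : ℤ) := fun k => by
    have := ev_apply w 0 k
    simpa using this
  simp only [h1, Finset.sum_add_distrib, ← Finset.sum_mul]
  rw [Equiv.sum_comp w.perm w.trans, Equiv.sum_comp w.perm fun k => ((k : ℕ) : ℤ), add_comm]

theorem finRotate_cases (i : Fin d) :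
    ((i : ℕ) + 1 < d ∧ (finRotate d i : ℕ) = i + 1) ∨ ((i : ℕ) + 1 = d ∧ (finRotate d i : ℕ) = 0) := by
  obtain ⟨n, rfl⟩ : ∃ n, d = n + 1 := ⟨d - 1, by have := NeZero.ne d; omega⟩
  rw [coe_finRotate]
  have := i.2
  split_ifs with h
  · right; subst h; simp
  · left
    have : (i : ℕ) ≠ n := fun hh => h (Fin.ext hh)
    omega

theorem ev_iota (n : ℤ) : ev (iota d) n = n + 1 := by
  obtain ⟨l, k, rfl⟩ := exists_eq_mul_add d n
  rw [ev_apply]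
  change (l + if (finRotate d k).val = 0 then 1 else 0) * d + ((finRotate d k : ℕ) : ℤ) = _
  rcases finRotate_cases k with ⟨h1, h2⟩ | ⟨h1, h2⟩
  · rw [h2, if_neg (by omega)]
    push_cast
    ring
  · rw [h2, if_pos rfl, show ((k : ℕ) : ℤ) = d - 1 by omega]
    push_cast
    ring

theorem ev_iota_pow (r : ℕ) (n : ℤ) : ev (iota d ^ r) n = n + r := by
  induction r generalizing n with
  | zero => simp [ev_one]
  | succ r ih =>
    rw [pow_succ, ev_mul, ev_iota, ih]
    push_cast
    ring

theorem mem_stair_iota_pow_omega {r : ℕ} {m : Fin d} {n : ℤ} :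
    n ∈ stair (iota d ^ r • omega m) ↔ n < (m : ℕ) + r := by
  have h1 : n = ev (iota d ^ r) (n - r) := by rw [ev_iota_pow]; ring
  rw [h1, ev_mem_stair_smul, mem_stair_omega, ev_iota_pow]
  omega

theorem ev_simpleReflection (hd : 2 ≤ d) (i : Fin d) (n : ℤ) :
    ev (simpleReflection i) n =
      if (d : ℤ) ∣ n - (i : ℕ) then n - 1 else if (d : ℤ) ∣ n + 1 - (i : ℕ) then n + 1 else n := by
  obtain ⟨l, k, rfl⟩ := exists_eq_mul_add d n
  set j := (finRotate d).symm i with hj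
  have hji : finRotate d j = i := (finRotate d).apply_symm_apply i
  have hne : j ≠ i := by
    intro h
    rw [h] at hji
    have := finRotate_cases i
    rw [hji] at this
    omega
  have hdvd : ∀ k' : Fin d, (d : ℤ) ∣ l * d + (k : ℕ) - (k' : ℕ) ↔ k = k' := by
    intro k'
    constructor
    · rintro ⟨c, hc⟩
      exact (mul_add_inj (l := l) (l' := c) (k := k) (k' := k') (by linarith)).2
    · rintro rfl
      exact ⟨l, by ring⟩
  have hdvd' : (d : ℤ) ∣ l * d + (k : ℕ) + 1 - (i : ℕ) ↔ k = j := by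
    rw [← hdvd j]
    have h2 := finRotate_cases j
    rw [hji] at h2
    rcases h2 with ⟨-, h2⟩ | ⟨h1, h2⟩
    · rw [h2]; push_cast; ring_nf
    · rw [h2]
      rw [show l * d + (k : ℕ) + 1 - ((0 : ℕ) : ℤ) = l * d + (k : ℕ) - (j : ℕ) + d by
        rw [show ((j : ℕ) : ℤ) = d - 1 by omega]; push_cast; ring]
      exact dvd_add_self_right
  rw [ev_apply]
  simp only [hdvd, hdvd']
  change (l + (if i.val = 0 then Pi.single i 1 - Pi.single j 1 else 0 : Fin d → ℤ)
    (Equiv.swap j i k)) * d + ((Equiv.swap j i k : ℕ) : ℤ) = _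
  have h2 := finRotate_cases j
  rw [hji] at h2
  by_cases hk : k = i
  · subst hk
    rw [if_pos rfl, Equiv.swap_apply_right]
    rcases h2 with ⟨-, h2⟩ | ⟨h1, h2⟩
    · rw [if_neg (by omega), h2]
      push_cast
      simp
      ring
    · rw [if_pos h2, h2]
      have : (Pi.single k 1 - Pi.single j 1 : Fin d → ℤ) j = -1 := by simp [hne]
      rw [this, show ((j : ℕ) : ℤ) = d - 1 by omega]
      push_cast
      ring
  rw [if_neg hk]
  by_cases hkj : k = j
  · subst hkj
    rw [if_pos rfl, Equiv.swap_apply_left]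
    rcases h2 with ⟨-, h2⟩ | ⟨h1, h2⟩
    · rw [if_neg (by omega), h2]
      push_cast
      simp
      ring
    · rw [if_pos h2, h2]
      have : (Pi.single i 1 - Pi.single j 1 : Fin d → ℤ) i = 1 := by simp [hne.symm]
      rw [this, show ((j : ℕ) : ℤ) = d - 1 by omega]
      push_cast
      ring
  · rw [if_neg hkj, Equiv.swap_apply_of_ne_of_ne hkj hk]
    have : (if i.val = 0 then Pi.single i 1 - Pi.single j 1 else 0 : Fin d → ℤ) k = 0 := by
      split_ifs
      · simp [hk, hkj]
      · rfl
    rw [this, add_zero]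

theorem simpleReflection_mem (i : Fin d) : simpleReflection i ∈ affineWeyl d := by
  change ∑ k, (if i.val = 0 then Pi.single i 1 - Pi.single ((finRotate d).symm i) 1 else 0 :
    Fin d → ℤ) k = 0
  split_ifs
  · simp [Finset.sum_sub_distrib]
  · simp

theorem iota_pow_sum (r : ℕ) : ∑ k, (iota d ^ r).trans k = r := by
  have h := sum_ev (iota d ^ r)
  simp only [ev_iota_pow, Finset.sum_add_distrib, Finset.sum_const, Finset.card_univ,
    Fintype.card_fin, nsmul_eq_mul] at h
  have hd : (d : ℤ) ≠ 0 := by exact_mod_cast NeZero.ne d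
  have : (d : ℤ) * r = (∑ k, (iota d ^ r).trans k) * d := by linarith
  rw [mul_comm] at this
  exact (mul_right_cancel₀ hd this).symm

theorem sum_trans_mul (w w' : ExtAffineWeyl d) :
    ∑ k, (w * w').trans k = ∑ k, w.trans k + ∑ k, w'.trans k := by
  simp only [trans_mul, Finset.sum_add_distrib]
  rw [Equiv.sum_comp w.perm⁻¹ w'.trans]

theorem sum_smul (w : ExtAffineWeyl d) (a : Fin d → ℤ) :
    ∑ k, (w • a) k = ∑ k, a k + ∑ k, w.trans k := by
  simp only [smul_apply, Finset.sum_add_distrib]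
  rw [Equiv.sum_comp w.perm⁻¹ a]

theorem mem_affineWeyl {w : ExtAffineWeyl d} : w ∈ affineWeyl d ↔ ∑ k, w.trans k = 0 := Iff.rfl

/-- An increasing element of the affine Weyl group is trivial. -/
theorem eq_one_of_strictMono {w : ExtAffineWeyl d} (hw : w ∈ affineWeyl d)
    (h : ∀ n, ev w n < ev w (n + 1)) : w = 1 := by
  have hmono : StrictMono (ev w) := strictMono_int_of_lt_succ h
  have hstep : ∀ n, ev w (n + 1) = ev w n + 1 := fun n => by
    by_contra hne
    have h1 := h n
    have h2 := ev_ev_inv w (ev w n + 1)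
    have h3 : n < ev w⁻¹ (ev w n + 1) := hmono.lt_iff_lt.mp (by rw [h2]; omega)
    have h4 : ev w⁻¹ (ev w n + 1) < n + 1 := hmono.lt_iff_lt.mp (by rw [h2]; omega)
    omega
  have hlin : ∀ k : ℕ, ev w k = k + ev w 0 := fun k => by
    induction k with
    | zero => simp
    | succ k ih =>
      push_cast
      rw [hstep, ih]
      ring
  have h5 := sum_ev w
  rw [mem_affineWeyl.mp hw] at h5
  simp only [hlin, Finset.sum_add_distrib, Finset.sum_const, Finset.card_univ, Fintype.card_fin,
    nsmul_eq_mul] at h5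
  have hd : (d : ℤ) ≠ 0 := by exact_mod_cast NeZero.ne d
  have h0 : ev w 0 = 0 := by
    have : (d : ℤ) * ev w 0 = 0 := by linarith
    exact (mul_eq_zero.mp this).resolve_left hd
  refine ev_injective fun n => ?_
  obtain ⟨l, k, rfl⟩ := exists_eq_mul_add d n
  rw [add_comm, ev_add_mul, hlin, h0, ev_one]
  ring

end ExtAffineWeyl

end Weyl

end LinkedGrassmannian

namespace LinkedGrassmannian

/-! ### Reflections and length -/

section Weyl

variable {d : ℕ} [NeZero d]

namespace ExtAffineWeyl

/-- The element `t` acts on `ℤ` by exchanging `x + l d` and `y + l d` for all `l`. -/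
structure IsSwap (t : ExtAffineWeyl d) (x y : ℤ) : Prop where
  lt : x < y
  left : ∀ n, (d : ℤ) ∣ n - x → ev t n = n + (y - x)
  right : ∀ n, (d : ℤ) ∣ n - y → ev t n = n - (y - x)
  other : ∀ n, ¬ (d : ℤ) ∣ n - x → ¬ (d : ℤ) ∣ n - y → ev t n = n

theorem IsSwap.eq {t t' : ExtAffineWeyl d} {x y x' y' : ℤ} (h : IsSwap t x y)
    (h' : IsSwap t' x' y') (hx : (d : ℤ) ∣ x' - x) (hy : y' - x' = y - x) : t = t' := by
  refine ev_injective fun n => ?_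
  have e1 : (d : ℤ) ∣ n - x ↔ (d : ℤ) ∣ n - x' := by
    rw [show n - x = (n - x') + (x' - x) by ring]
    exact (dvd_add_left hx)
  have e2 : (d : ℤ) ∣ n - y ↔ (d : ℤ) ∣ n - y' := by
    rw [show n - y = (n - y') + (x' - x) by linarith]
    exact (dvd_add_left hx)
  by_cases hn : (d : ℤ) ∣ n - x
  · rw [h.left n hn, h'.left n (e1.mp hn), hy]
  by_cases hn' : (d : ℤ) ∣ n - y
  · rw [h.right n hn', h'.right n (e2.mp hn'), hy]
  · rw [h.other n hn hn', h'.other n (fun hh => hn (e1.mpr hh)) (fun hh => hn' (e2.mpr hh))]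

theorem IsSwap.mul_self {t : ExtAffineWeyl d} {x y : ℤ} (h : IsSwap t x y) : t * t = 1 := by
  refine ev_injective fun n => ?_
  rw [ev_mul, ev_one]
  by_cases hn : (d : ℤ) ∣ n - x
  · rw [h.left n hn, h.right _ (by rwa [show n + (y - x) - y = n - x by ring])]
    ring
  by_cases hn' : (d : ℤ) ∣ n - y
  · rw [h.right n hn', h.left _ (by rwa [show n - (y - x) - x = n - y by ring])]
    ring
  · rw [h.other n hn hn', h.other n hn hn']

theorem IsSwap.inv {t : ExtAffineWeyl d} {x y : ℤ} (h : IsSwap t x y) : t⁻¹ = t :=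
  inv_eq_of_mul_eq_one_left h.mul_self

theorem IsSwap.ev_left {t : ExtAffineWeyl d} {x y : ℤ} (h : IsSwap t x y) : ev t x = y := by
  rw [h.left x (by simp)]; ring

theorem IsSwap.ev_right {t : ExtAffineWeyl d} {x y : ℤ} (h : IsSwap t x y) : ev t y = x := by
  rw [h.right y (by simp)]; ring

theorem ev_add_sub {c : ExtAffineWeyl d} {m n k : ℤ} (h : (d : ℤ) ∣ n - m) :
    ev c (n + k) = ev c (m + k) + (n - m) := by
  obtain ⟨l, hl⟩ := h
  rw [show n + k = m + k + l * d by linarith, ev_add_mul]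
  linarith

theorem dvd_ev_inv_sub {c : ExtAffineWeyl d} {n x : ℤ} :
    (d : ℤ) ∣ ev c⁻¹ n - x ↔ (d : ℤ) ∣ n - ev c x := by
  rw [← dvd_ev_sub_iff (w := c), ev_ev_inv]

theorem IsSwap.conj {t : ExtAffineWeyl d} {x y : ℤ} (h : IsSwap t x y) (c : ExtAffineWeyl d)
    (hc : ev c x < ev c y) : IsSwap (c * t * c⁻¹) (ev c x) (ev c y) := by
  refine ⟨hc, fun n hn => ?_, fun n hn => ?_, fun n hn hn' => ?_⟩
  · rw [ev_mul, ev_mul, h.left _ (dvd_ev_inv_sub.mpr hn), ev_add_sub (dvd_ev_inv_sub.mpr hn),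
      show x + (y - x) = y by ring]
    obtain ⟨l, hl⟩ := dvd_ev_inv_sub.mpr hn
    have : n = ev c x + l * d := by
      rw [← ev_add_mul, ← ev_ev_inv c n]
      congr 1
      linarith
    linarith
  · rw [ev_mul, ev_mul, h.right _ (dvd_ev_inv_sub.mpr hn), sub_eq_add_neg,
      ev_add_sub (dvd_ev_inv_sub.mpr hn), show y + -(y - x) = x by ring]
    obtain ⟨l, hl⟩ := dvd_ev_inv_sub.mpr hn
    have : n = ev c y + l * d := by
      rw [← ev_add_mul, ← ev_ev_inv c n]
      congr 1
      linarith
    linarith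
  · rw [ev_mul, ev_mul, h.other _ (fun hh => hn (dvd_ev_inv_sub.mp hh))
      (fun hh => hn' (dvd_ev_inv_sub.mp hh)), ev_ev_inv]

theorem IsSwap.conj' {t : ExtAffineWeyl d} {x y : ℤ} (h : IsSwap t x y) (c : ExtAffineWeyl d)
    (hc : ev c y < ev c x) : IsSwap (c * t * c⁻¹) (ev c y) (ev c x) := by
  refine ⟨hc, fun n hn => ?_, fun n hn => ?_, fun n hn hn' => ?_⟩
  · rw [ev_mul, ev_mul, h.right _ (dvd_ev_inv_sub.mpr hn), sub_eq_add_neg,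
      ev_add_sub (dvd_ev_inv_sub.mpr hn), show y + -(y - x) = x by ring]
    obtain ⟨l, hl⟩ := dvd_ev_inv_sub.mpr hn
    have : n = ev c y + l * d := by
      rw [← ev_add_mul, ← ev_ev_inv c n]
      congr 1
      linarith
    linarith
  · rw [ev_mul, ev_mul, h.left _ (dvd_ev_inv_sub.mpr hn), ev_add_sub (dvd_ev_inv_sub.mpr hn),
      show x + (y - x) = y by ring]
    obtain ⟨l, hl⟩ := dvd_ev_inv_sub.mpr hn
    have : n = ev c x + l * d := by
      rw [← ev_add_mul, ← ev_ev_inv c n]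
      congr 1
      linarith
    linarith
  · rw [ev_mul, ev_mul, h.other _ (fun hh => hn' (dvd_ev_inv_sub.mp hh))
      (fun hh => hn (dvd_ev_inv_sub.mp hh)), ev_ev_inv]

theorem not_dvd_one (hd : 2 ≤ d) : ¬ (d : ℤ) ∣ 1 := fun h => by
  have := Int.le_of_dvd one_pos h
  omega

theorem isSwap_simpleReflection (hd : 2 ≤ d) (i : Fin d) {y : ℤ} (hy : (d : ℤ) ∣ y - (i : ℕ)) :
    IsSwap (simpleReflection i) (y - 1) y := by
  have e1 : ∀ n : ℤ, (d : ℤ) ∣ n - y ↔ (d : ℤ) ∣ n - (i : ℕ) := fun n => by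
    rw [show n - ((i : ℕ) : ℤ) = (n - y) + (y - (i : ℕ)) by ring]
    exact (dvd_add_left hy).symm
  have e2 : ∀ n : ℤ, (d : ℤ) ∣ n - (y - 1) ↔ (d : ℤ) ∣ n + 1 - (i : ℕ) := fun n => by
    rw [← e1]
    ring_nf
  refine ⟨by omega, fun n hn => ?_, fun n hn => ?_, fun n hn hn' => ?_⟩
  · rw [ev_simpleReflection hd, if_neg, if_pos ((e2 n).mp hn)]
    · ring
    · intro hh
      refine not_dvd_one hd ?_
      have := dvd_sub hn ((e1 n).mpr hh)
      rwa [show n - (y - 1) - (n - y) = 1 by ring] at this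
  · rw [ev_simpleReflection hd, if_pos ((e1 n).mp hn)]
    ring
  · rw [ev_simpleReflection hd, if_neg (fun hh => hn' ((e1 n).mpr hh)),
      if_neg (fun hh => hn ((e2 n).mpr hh))]

theorem exists_dvd_sub (y : ℤ) : ∃ i : Fin d, (d : ℤ) ∣ y - (i : ℕ) := by
  obtain ⟨l, k, rfl⟩ := exists_eq_mul_add d y
  exact ⟨k, l, by ring⟩

theorem simpleReflection_mul_self (hd : 2 ≤ d) (i : Fin d) :
    simpleReflection i * simpleReflection i = 1 :=
  (isSwap_simpleReflection hd i (y := (i : ℕ)) (by simp)).mul_self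

theorem _root_.LinkedGrassmannian.IsReflection.exists_isSwap (hd : 2 ≤ d) {t : ExtAffineWeyl d}
    (ht : IsReflection t) : ∃ x y, IsSwap t x y := by
  obtain ⟨c, -, i, rfl⟩ := ht
  have h := isSwap_simpleReflection hd i (y := (i : ℕ)) (by simp)
  rcases lt_trichotomy (ev c ((i : ℕ) - 1)) (ev c (i : ℕ)) with h1 | h1 | h1
  · exact ⟨_, _, h.conj c h1⟩
  · have := ev_inj.mp h1
    omega
  · exact ⟨_, _, h.conj' c h1⟩

theorem isReflection_simpleReflection (i : Fin d) : IsReflection (simpleReflection i) :=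
  ⟨1, one_mem _, i, by simp⟩

theorem _root_.LinkedGrassmannian.IsReflection.conj {t c : ExtAffineWeyl d} (ht : IsReflection t)
    (hc : c ∈ affineWeyl d) : IsReflection (c * t * c⁻¹) := by
  obtain ⟨c', hc', i, rfl⟩ := ht
  exact ⟨c * c', mul_mem hc hc', i, by group⟩

theorem _root_.LinkedGrassmannian.IsReflection.mem {t : ExtAffineWeyl d} (ht : IsReflection t) :
    t ∈ affineWeyl d := by
  obtain ⟨c, hc, i, rfl⟩ := ht
  exact mul_mem (mul_mem hc (simpleReflection_mem i)) (inv_mem hc)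

/-- The element of `W_a` represented by a word. -/
noncomputable def wordProd (l : List (Fin d)) : ExtAffineWeyl d := (l.map simpleReflection).prod

theorem wordProd_cons (i : Fin d) (l : List (Fin d)) :
    wordProd (i :: l) = simpleReflection i * wordProd l := by simp [wordProd]

theorem wordProd_append (l l' : List (Fin d)) : wordProd (l ++ l') = wordProd l * wordProd l' := by
  simp [wordProd]

theorem wordProd_reverse (hd : 2 ≤ d) (l : List (Fin d)) : wordProd l.reverse = (wordProd l)⁻¹ := by
  induction l with
  | nil => simp [wordProd]
  | cons i l ih =>
    rw [List.reverse_cons, wordProd_append, ih, wordProd_cons i l, mul_inv_rev,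
      inv_eq_of_mul_eq_one_left (simpleReflection_mul_self hd i)]
    simp [wordProd]

theorem wordProd_mem (l : List (Fin d)) : wordProd l ∈ affineWeyl d := by
  induction l with
  | nil => exact one_mem _
  | cons i l ih =>
    rw [wordProd_cons]
    exact mul_mem (simpleReflection_mem i) ih

/-- A simple reflection exchanges neighbouring integers only. -/
theorem eq_add_one_of_reverse (hd : 2 ≤ d) {i : Fin d} {a b : ℤ} (hab : a < b)
    (h : ev (simpleReflection i) b < ev (simpleReflection i) a) :
    b = a + 1 ∧ (d : ℤ) ∣ b - (i : ℕ) := by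
  rw [ev_simpleReflection hd, ev_simpleReflection hd] at h
  split_ifs at h with h1 h2 h3 h4 h5 h6 h7 h8
  all_goals omega

/-- The strong exchange condition. -/
theorem exists_word_mul_swap (hd : 2 ≤ d) (l : List (Fin d)) {t : ExtAffineWeyl d} {x y : ℤ}
    (ht : IsSwap t x y) (h : ev (wordProd l) y < ev (wordProd l) x) :
    ∃ l' : List (Fin d), l'.length < l.length ∧ wordProd l' = wordProd l * t := by
  induction l with
  | nil =>
    have h1 := ht.lt
    simp only [wordProd, List.map_nil, List.prod_nil, ev_one] at h
    omega
  | cons i l ih =>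
    rcases lt_trichotomy (ev (wordProd l) x) (ev (wordProd l) y) with h1 | h1 | h1
    -- The first letter is what reverses the pair, so it is the conjugate of `t` by the rest of the
    -- word, and deleting it amounts to multiplying by `t`.
    · refine ⟨l, by simp, ?_⟩
      rw [wordProd_cons, ev_mul, ev_mul] at h
      obtain ⟨h2, h3⟩ := eq_add_one_of_reverse hd h1 h
      have h4 := isSwap_simpleReflection hd i h3
      have h5 := (ht.conj _ h1).eq h4 (by
        rw [h2]; simp) (by omega)
      rw [wordProd_cons, ← h5]
      simp only [mul_assoc, inv_mul_cancel, mul_one, ht.mul_self]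
    · have := ht.lt
      have := ev_inj.mp h1
      omega
    · obtain ⟨l', hl, h2⟩ := ih h1
      exact ⟨i :: l', by simpa using hl, by rw [wordProd_cons, wordProd_cons, h2, mul_assoc]⟩

/-- The sum of the squares of the displacements of an element. -/
noncomputable def displacement (w : ExtAffineWeyl d) : ℤ := ∑ k : Fin d, (ev w (k : ℕ) - (k : ℕ)) ^ 2

/-- Exchanging the values at `i - 1` and `i` lowers the sum of squares by `2 (w (i - 1) - w i)`. -/
theorem displacement_mul_lt (hd : 2 ≤ d) (w : ExtAffineWeyl d) (i : Fin d)
    (h : ev w (i : ℕ) < ev w ((i : ℕ) - 1)) :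
    displacement (w * simpleReflection i) < displacement w := by
  obtain ⟨j, hj⟩ := exists_dvd_sub (d := d) ((i : ℕ) - 1)
  have hs := isSwap_simpleReflection hd i (y := (i : ℕ)) (by simp)
  have hne : i ≠ j := by
    rintro rfl
    refine not_dvd_one hd ?_
    have := (dvd_neg (α := ℤ)).mpr hj
    rwa [show -(((i : ℕ) : ℤ) - 1 - (i : ℕ)) = 1 by ring] at this
  have hj' : (d : ℤ) ∣ ((j : ℕ) : ℤ) - ((i : ℕ) - 1) := by
    rw [dvd_sub_comm]; exact hj
  rw [← sub_neg, displacement, displacement, ← Finset.sum_sub_distrib, Fintype.sum_eq_add i j hne]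
  · rw [ev_mul, ev_mul, hs.ev_right, hs.left _ hj', ev_add_sub hj']
    have e1 : ev w (j : ℕ) = ev w ((i : ℕ) - 1) + ((j : ℕ) - ((i : ℕ) - 1)) := by
      have := ev_add_sub (c := w) (k := 0) hj'
      simpa using this
    rw [e1, show ((i : ℕ) : ℤ) - 1 + ((i : ℕ) - ((i : ℕ) - 1)) = (i : ℕ) by ring]
    nlinarith
  · rintro k ⟨hki, hkj⟩
    have hdv : ∀ k' : Fin d, (d : ℤ) ∣ ((k : ℕ) : ℤ) - (k' : ℕ) → k = k' := by
      rintro k' ⟨c, hc⟩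
      exact (mul_add_inj (l := 0) (l' := c) (k := k) (k' := k') (by linarith)).2
    rw [ev_mul, hs.other, sub_self]
    · intro hh
      refine hkj (hdv j ?_)
      have := dvd_add hh hj
      rwa [sub_add_sub_cancel] at this
    · exact fun hh => hki (hdv i hh)

theorem exists_descent {w : ExtAffineWeyl d} (hw : w ∈ affineWeyl d) (h1 : w ≠ 1) :
    ∃ i : Fin d, ev w (i : ℕ) < ev w ((i : ℕ) - 1) := by
  obtain ⟨n, hn⟩ : ∃ n, ¬ ev w n < ev w (n + 1) := by
    by_contra hh
    push Not at hh
    exact h1 (eq_one_of_strictMono hw hh)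
  obtain ⟨l, k, hk⟩ := exists_eq_mul_add d (n + 1)
  refine ⟨k, ?_⟩
  have e1 := ev_add_mul w (k : ℕ) l
  have e2 := ev_add_mul w ((k : ℕ) - 1) l
  rw [add_comm, ← hk] at e1
  rw [show ((k : ℕ) : ℤ) - 1 + l * d = n by linarith] at e2
  have : ev w n ≠ ev w (n + 1) := fun hh => by
    have := ev_inj.mp hh
    omega
  omega

theorem displacement_nonneg (w : ExtAffineWeyl d) : 0 ≤ displacement w :=
  Finset.sum_nonneg fun _ _ => sq_nonneg _

/-- A nontrivial element has a descent, and removing it lowers `displacement`, a nonnegative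
integer. -/
theorem exists_wordProd_eq (hd : 2 ≤ d) {w : ExtAffineWeyl d} (hw : w ∈ affineWeyl d) :
    ∃ l, wordProd l = w := by
  induction hk : (displacement w).toNat using Nat.strong_induction_on generalizing w with
  | _ k ih =>
    by_cases h1 : w = 1
    · exact ⟨[], by simp [wordProd, h1]⟩
    obtain ⟨i, hi⟩ := exists_descent hw h1
    have h2 := displacement_mul_lt hd w i hi
    have h3 := displacement_nonneg (w * simpleReflection i)
    obtain ⟨l, hl⟩ := ih _ (by omega) (mul_mem hw (simpleReflection_mem i)) rfl
    refine ⟨l ++ [i], ?_⟩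
    rw [wordProd_append, hl]
    simp [wordProd, mul_assoc, simpleReflection_mul_self hd]

theorem weylLength_le (l : List (Fin d)) : weylLength (wordProd l) ≤ l.length :=
  Nat.sInf_le ⟨l, rfl, rfl⟩

theorem exists_reduced_word (hd : 2 ≤ d) {w : ExtAffineWeyl d} (hw : w ∈ affineWeyl d) :
    ∃ l, wordProd l = w ∧ l.length = weylLength w := by
  obtain ⟨l, hl⟩ := exists_wordProd_eq hd hw
  obtain ⟨l', h1, h2⟩ := Nat.sInf_mem (s := {n | ∃ l : List (Fin d), l.length = n ∧
    (l.map simpleReflection).prod = w}) ⟨_, l, rfl, hl⟩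
  exact ⟨l', h2, h1⟩

theorem weylLength_inv (hd : 2 ≤ d) {w : ExtAffineWeyl d} (hw : w ∈ affineWeyl d) :
    weylLength w⁻¹ = weylLength w := by
  have key : ∀ {w : ExtAffineWeyl d}, w ∈ affineWeyl d → weylLength w⁻¹ ≤ weylLength w := by
    intro w hw
    obtain ⟨l, rfl, hl⟩ := exists_reduced_word hd hw
    rw [← hl, ← wordProd_reverse hd, ← List.length_reverse]
    exact weylLength_le _
  refine le_antisymm (key hw) ?_
  have := key (inv_mem hw)
  rwa [inv_inv] at this

theorem weylLength_mul_swap_lt (hd : 2 ≤ d) {w t : ExtAffineWeyl d} (hw : w ∈ affineWeyl d)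
    {x y : ℤ} (ht : IsSwap t x y) (h : ev w y < ev w x) : weylLength (w * t) < weylLength w := by
  obtain ⟨l, rfl, hl⟩ := exists_reduced_word hd hw
  obtain ⟨l', hl', h2⟩ := exists_word_mul_swap hd l ht h
  rw [← h2, ← hl]
  exact (weylLength_le l').trans_lt hl'

theorem lt_weylLength_mul_swap (hd : 2 ≤ d) {w t : ExtAffineWeyl d} (hw : w ∈ affineWeyl d)
    (htm : t ∈ affineWeyl d) {x y : ℤ} (ht : IsSwap t x y) (h : ev w x < ev w y) :
    weylLength w < weylLength (w * t) := by
  have := weylLength_mul_swap_lt hd (mul_mem hw htm) ht (by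
    rwa [ev_mul, ev_mul, ht.ev_left, ht.ev_right])
  rwa [mul_assoc, ht.mul_self, mul_one] at this

/-- The infimum of the empty set of natural numbers is `0`, so positive length guarantees a word. -/
theorem mem_of_weylLength_pos {w : ExtAffineWeyl d} (h : 0 < weylLength w) : w ∈ affineWeyl d := by
  have hne : {n | ∃ l : List (Fin d), l.length = n ∧ (l.map simpleReflection).prod = w}.Nonempty := by
    by_contra hh
    rw [Set.not_nonempty_iff_eq_empty] at hh
    rw [weylLength, hh, Nat.sInf_empty] at h
    exact lt_irrefl _ h
  obtain ⟨n, l, -, hl⟩ := hne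
  rw [← hl]
  exact wordProd_mem l

end ExtAffineWeyl

end Weyl

end LinkedGrassmannian

namespace LinkedGrassmannian

/-! ### The Bruhat order -/

section Weyl

variable {d : ℕ} [NeZero d]

namespace ExtAffineWeyl

/-- The integers below `i` mapped to integers at least `j`. -/
def crossing (w : ExtAffineWeyl d) (i j : ℤ) : Set ℤ := {n | n < i ∧ j ≤ ev w n}

theorem exists_ev_le (w : ExtAffineWeyl d) : ∃ M, ∀ n, ev w n ≤ n + M := by
  obtain ⟨M, hM⟩ := exists_forall_le_int fun k : Fin d => ev w (k : ℕ) - (k : ℕ)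
  refine ⟨M, fun n => ?_⟩
  obtain ⟨l, k, rfl⟩ := exists_eq_mul_add d n
  have := hM k
  rw [add_comm (l * (d : ℤ)), ev_add_mul]
  linarith

theorem finite_crossing (w : ExtAffineWeyl d) (i j : ℤ) : (crossing w i j).Finite := by
  obtain ⟨M, hM⟩ := exists_ev_le w
  refine (Set.finite_Ico (j - M) i).subset fun n hn => ⟨?_, hn.1⟩
  have := hM n
  have := hn.2
  omega

/-- The number of integers below `i` mapped to integers at least `j`. -/
noncomputable def cnt (w : ExtAffineWeyl d) (i j : ℤ) : ℤ := (crossing w i j).ncard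

open Classical in
theorem cnt_succ_left (w : ExtAffineWeyl d) (i j : ℤ) :
    cnt w (i + 1) j = cnt w i j + if j ≤ ev w i then 1 else 0 := by
  unfold cnt
  split_ifs with h
  · have h1 : crossing w (i + 1) j = insert i (crossing w i j) := by
      ext n
      simp only [crossing, Set.mem_ofPred_eq, Set.mem_insert_iff]
      constructor
      · rintro ⟨h2, h3⟩
        by_cases hn : n = i
        · exact Or.inl hn
        · exact Or.inr ⟨by omega, h3⟩
      · rintro (rfl | ⟨h2, h3⟩)
        · exact ⟨by omega, h⟩
        · exact ⟨by omega, h3⟩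
    rw [h1, Set.ncard_insert_of_notMem (fun hh => lt_irrefl _ hh.1) (finite_crossing w i j)]
    push_cast
    rfl
  · have h1 : crossing w (i + 1) j = crossing w i j := by
      ext n
      simp only [crossing, Set.mem_ofPred_eq]
      constructor
      · rintro ⟨h2, h3⟩
        refine ⟨?_, h3⟩
        by_contra hn
        obtain rfl : n = i := by omega
        exact h h3
      · rintro ⟨h2, h3⟩
        exact ⟨by omega, h3⟩
    rw [h1, add_zero]

open Classical in
theorem cnt_succ_right (w : ExtAffineWeyl d) (i j : ℤ) :
    cnt w i j = cnt w i (j + 1) + if ev w⁻¹ j < i then 1 else 0 := by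
  unfold cnt
  split_ifs with h
  · have h1 : crossing w i j = insert (ev w⁻¹ j) (crossing w i (j + 1)) := by
      ext n
      simp only [crossing, Set.mem_ofPred_eq, Set.mem_insert_iff]
      constructor
      · rintro ⟨h2, h3⟩
        by_cases hn : ev w n = j
        · exact Or.inl (by rw [← hn, ev_inv_ev])
        · exact Or.inr ⟨h2, by omega⟩
      · rintro (rfl | ⟨h2, h3⟩)
        · exact ⟨h, by rw [ev_ev_inv]⟩
        · exact ⟨h2, by omega⟩
    rw [h1, Set.ncard_insert_of_notMem (fun hh => by
      have := hh.2
      rw [ev_ev_inv] at this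
      omega) (finite_crossing w i (j + 1))]
    push_cast
    rfl
  · have h1 : crossing w i j = crossing w i (j + 1) := by
      ext n
      simp only [crossing, Set.mem_ofPred_eq]
      constructor
      · rintro ⟨h2, h3⟩
        refine ⟨h2, ?_⟩
        by_contra hn
        obtain rfl : ev w n = j := by omega
        rw [ev_inv_ev] at h
        exact h h2
      · rintro ⟨h2, h3⟩
        exact ⟨h2, by omega⟩
    rw [h1, add_zero]

theorem ev_eq_of_cnt_eq {w w' : ExtAffineWeyl d} (h : ∀ i j, cnt w i j = cnt w' i j) : w = w' := by
  refine ev_injective fun n => ?_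
  have key : ∀ j, j ≤ ev w n ↔ j ≤ ev w' n := fun j => by
    have h1 := cnt_succ_left w n j
    rw [h, h, cnt_succ_left w' n j] at h1
    split_ifs at h1 <;> omega
  exact le_antisymm ((key _).mp le_rfl) ((key _).mpr le_rfl)

/-- Multiplication by a reflection increasing the length increases `cnt`. -/
theorem cnt_le_cnt_mul_swap {w t : ExtAffineWeyl d} {x y : ℤ} (ht : IsSwap t x y)
    (h : ev w x < ev w y) (i j : ℤ) : cnt w i j ≤ cnt (w * t) i j := by
  classical
  unfold cnt
  refine Nat.cast_le.mpr ?_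
  have hst : ∀ n, ev t (ev t n) = n := fun n => by rw [← ev_mul, ht.mul_self, ev_one]
  -- Move `n` to `t n` if that stays below `i`. Otherwise `n ≡ x` modulo `d`, and `w t` has at `n` a
  -- value larger than that of `w`.
  refine Set.ncard_le_ncard_of_injOn (fun n => if ev t n < i then ev t n else n) ?_ ?_
    (finite_crossing _ i j)
  · rintro n ⟨hn, hj⟩
    split_ifs with hi
    · exact ⟨hi, by rwa [ev_mul, hst]⟩
    · refine ⟨hn, ?_⟩
      have hdv : (d : ℤ) ∣ n - x := by
        by_contra hd1
        by_cases hd2 : (d : ℤ) ∣ n - y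
        · rw [ht.right n hd2] at hi
          have := ht.lt
          omega
        · rw [ht.other n hd1 hd2] at hi
          omega
      rw [ev_mul, ht.left n hdv, ev_add_sub hdv, show x + (y - x) = y by ring]
      have := ev_add_sub (c := w) (k := 0) hdv
      rw [add_zero, add_zero] at this
      omega
  · rintro n ⟨hn, hj⟩ n' ⟨hn', hj'⟩ heq
    simp only at heq
    split_ifs at heq with h1 h2 h2
    · exact ev_inj.mp heq
    · rw [← heq, hst] at h2
      omega
    · rw [heq, hst] at h1
      omega
    · exact heq

theorem cnt_le_of_bruhatLE (hd : 2 ≤ d) {u w : ExtAffineWeyl d} (h : BruhatLE u w) (i j : ℤ) :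
    cnt u i j ≤ cnt w i j := by
  induction h with
  | refl => exact le_rfl
  | @tail v w _ hvw ih =>
    refine ih.trans ?_
    obtain ⟨t, ht, rfl, hl⟩ := hvw
    obtain ⟨x, y, hxy⟩ := ht.exists_isSwap hd
    have hm := mem_of_weylLength_pos (hl.pos)
    have hv : v ∈ affineWeyl d := by
      have := mul_mem hm ht.mem
      rwa [mul_assoc, hxy.mul_self, mul_one] at this
    refine cnt_le_cnt_mul_swap hxy ?_ i j
    by_contra hlt
    have hne : ev v y ≠ ev v x := fun hh => by
      have := ev_inj.mp hh
      have := hxy.lt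
      omega
    exact absurd (weylLength_mul_swap_lt hd hv hxy (by omega)) (by omega)

/-- Lifting property of the Bruhat order. -/
theorem bruhatLE_mul_of_descent (hd : 2 ≤ d) {v w : ExtAffineWeyl d} (h : BruhatLE v w)
    (hv : v ∈ affineWeyl d) {s : Fin d}
    (hs : weylLength w < weylLength (w * simpleReflection s)) :
    BruhatLE (v * simpleReflection s) (w * simpleReflection s) := by
  have hS := isSwap_simpleReflection hd s (y := (s : ℕ)) (by simp)
  have hww : BruhatLE w (w * simpleReflection s) :=
    Relation.ReflTransGen.single ⟨_, isReflection_simpleReflection s, rfl, hs⟩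
  induction h using Relation.ReflTransGen.head_induction_on with
  | refl => exact Relation.ReflTransGen.refl
  | @head v v₁ hv1 hv1w ih =>
    obtain ⟨t, ht, rfl, hl⟩ := hv1
    obtain ⟨x, y, hxy⟩ := ht.exists_isSwap hd
    -- If `t = s`, then `v s ≤ w ≤ w s` already. Otherwise conjugation by `s` preserves the
    -- direction of the step.
    by_cases hts : t = simpleReflection s
    · subst hts
      exact hv1w.trans hww
    refine Relation.ReflTransGen.head ⟨simpleReflection s * t * (simpleReflection s)⁻¹,
      ht.conj (simpleReflection_mem s), ?_, ?_⟩ (ih (mul_mem hv ht.mem))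
    · rw [hS.inv]
      simp only [mul_assoc]
      rw [← mul_assoc (simpleReflection s) (simpleReflection s), simpleReflection_mul_self hd, one_mul]
    · have hlt : ev v x < ev v y := by
        by_contra hlt
        have hne : ev v y ≠ ev v x := fun hh => by
          have := ev_inj.mp hh
          have := hxy.lt
          omega
        exact absurd (weylLength_mul_swap_lt hd hv hxy (by omega)) (by omega)
      have hord : ev (simpleReflection s) x < ev (simpleReflection s) y := by
        by_contra hlt
        have hne : ev (simpleReflection s) y ≠ ev (simpleReflection s) x := fun hh => by
          have := ev_inj.mp hh
          have := hxy.lt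
          omega
        obtain ⟨h1, h2⟩ := eq_add_one_of_reverse (i := s) hd hxy.lt (by omega)
        exact hts (hxy.eq (isSwap_simpleReflection hd s h2) (by rw [h1]; simp) (by omega))
      have := lt_weylLength_mul_swap hd (mul_mem hv (simpleReflection_mem s))
        (ht.conj (simpleReflection_mem s)).mem (hxy.conj _ hord) (by
          rw [ev_mul, ev_mul, ← ev_mul (simpleReflection s), ← ev_mul (simpleReflection s),
            simpleReflection_mul_self hd, ev_one, ev_one]
          exact hlt)
      convert this using 2
      rw [hS.inv]
      simp only [mul_assoc]
      rw [← mul_assoc (simpleReflection s) (simpleReflection s), simpleReflection_mul_self hd, one_mul]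

/-- Unless `i ≡ s` modulo `d`, the reflection permutes the integers below `i`. -/
theorem cnt_mul_simpleReflection (hd : 2 ≤ d) (w : ExtAffineWeyl d) (s : Fin d) {i : ℤ}
    (hi : ¬ (d : ℤ) ∣ i - (s : ℕ)) (j : ℤ) : cnt (w * simpleReflection s) i j = cnt w i j := by
  have hS := isSwap_simpleReflection hd s (y := (s : ℕ)) (by simp)
  have hst : ∀ n, ev (simpleReflection s) (ev (simpleReflection s) n) = n := fun n => by
    rw [← ev_mul, hS.mul_self, ev_one]
  have hlt : ∀ n, n < i → ev (simpleReflection s) n < i := fun n hn => by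
    rw [ev_simpleReflection hd]
    split_ifs with h1 h2
    · omega
    · have : n + 1 ≠ i := fun hh => hi (hh ▸ h2)
      omega
    · exact hn
  unfold cnt
  congr 1
  refine Set.ncard_congr (fun n _ => ev (simpleReflection s) n) ?_ ?_ ?_
  · rintro n ⟨hn, hj⟩
    exact ⟨hlt n hn, by rwa [ev_mul] at hj⟩
  · rintro n m - - h
    exact ev_inj.mp h
  · rintro n ⟨hn, hj⟩
    exact ⟨_, ⟨hlt n hn, by rwa [ev_mul, hst]⟩, hst n⟩

theorem cnt_mul_simpleReflection' (hd : 2 ≤ d) (w : ExtAffineWeyl d) (s : Fin d) {i : ℤ}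
    (hi : (d : ℤ) ∣ i - (s : ℕ)) (j : ℤ) :
    cnt (w * simpleReflection s) i j + cnt w i j = cnt w (i - 1) j + cnt w (i + 1) j := by
  classical
  have hS := isSwap_simpleReflection hd s hi
  have h1 := cnt_succ_left (w * simpleReflection s) (i - 1) j
  have h2 := cnt_succ_left w (i - 1) j
  have h3 := cnt_succ_left w i j
  rw [sub_add_cancel] at h1 h2
  rw [ev_mul, hS.ev_left, cnt_mul_simpleReflection hd w s (i := i - 1) (fun hh => not_dvd_one hd (by
    have := dvd_sub hi hh
    rwa [show i - (s : ℕ) - (i - 1 - (s : ℕ)) = 1 by ring] at this))] at h1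
  omega

/-- The value of `cnt` at an ascent is determined by the neighbouring values. -/
theorem cnt_eq_max_of_ascent (w : ExtAffineWeyl d) {i : ℤ} (h : ev w (i - 1) < ev w i) (j : ℤ) :
    cnt w i j = max (cnt w (i - 1) j) (cnt w (i + 1) j - 1) := by
  classical
  have h2 := cnt_succ_left w (i - 1) j
  have h3 := cnt_succ_left w i j
  rw [sub_add_cancel] at h2
  split_ifs at h2 h3 <;> omega

theorem cnt_eq_min_of_descent (w : ExtAffineWeyl d) {i : ℤ} (h : ev w i < ev w (i - 1)) (j : ℤ) :
    cnt w i j = min (cnt w (i - 1) j + 1) (cnt w (i + 1) j) := by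
  classical
  have h2 := cnt_succ_left w (i - 1) j
  have h3 := cnt_succ_left w i j
  rw [sub_add_cancel] at h2
  split_ifs at h2 h3 <;> omega

theorem eq_one_of_ev_le {w : ExtAffineWeyl d} (hw : w ∈ affineWeyl d) (h : ∀ n, ev w n ≤ n) :
    w = 1 := by
  have h1 := sum_ev w
  rw [mem_affineWeyl.mp hw, zero_mul, add_zero] at h1
  have h2 := (Finset.sum_eq_sum_iff_of_le fun (k : Fin d) _ => h (k : ℕ)).mp h1
  refine ev_injective fun n => ?_
  obtain ⟨l, k, rfl⟩ := exists_eq_mul_add d n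
  rw [add_comm, ev_add_mul, h2 k (Finset.mem_univ k), ev_one]

/-- If the value of `u` at `i` is at an ascent then an inequality of `cnt` descends. -/
theorem cnt_le_mul_of_ascent (hd : 2 ≤ d) {u w : ExtAffineWeyl d} {s : Fin d}
    (hu : ev u ((s : ℕ) - 1) < ev u (s : ℕ)) (hw : ev w (s : ℕ) < ev w ((s : ℕ) - 1))
    (h : ∀ i j, ¬ (d : ℤ) ∣ i - (s : ℕ) → cnt u i j ≤ cnt w i j) (i j : ℤ) :
    cnt u i j ≤ cnt (w * simpleReflection s) i j := by
  by_cases hi : (d : ℤ) ∣ i - (s : ℕ)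
  · have e0 := cnt_mul_simpleReflection' hd w s hi j
    have hsh : ∀ v : ExtAffineWeyl d, ev v i = ev v (s : ℕ) + (i - (s : ℕ)) ∧
        ev v (i - 1) = ev v ((s : ℕ) - 1) + (i - (s : ℕ)) := fun v =>
      ⟨by simpa using ev_add_sub (c := v) (k := 0) hi, ev_add_sub (c := v) (k := -1) hi⟩
    have e1 := cnt_eq_max_of_ascent u (i := i) (by
      have := hsh u
      omega) j
    have e2 := cnt_eq_min_of_descent w (i := i) (by
      have := hsh w
      omega) j
    have hn : ∀ k : ℤ, (k = 1 ∨ k = -1) → ¬ (d : ℤ) ∣ i + k - (s : ℕ) := fun k hk hh => by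
      have h3 := dvd_sub hh hi
      rw [show i + k - (s : ℕ) - (i - (s : ℕ)) = k by ring] at h3
      rcases hk with rfl | rfl
      · exact not_dvd_one hd h3
      · exact not_dvd_one hd ((dvd_neg (α := ℤ)).mp h3)
    have h1 := h (i - 1) j (hn _ (Or.inr rfl))
    have h2 := h (i + 1) j (hn _ (Or.inl rfl))
    omega
  · rw [cnt_mul_simpleReflection hd w s hi]
    exact h i j hi

/-- Induction on the length of `w`, using a right descent `s` of `w`. If `u` ascends at `s`, the
inequalities descend to `u` and `w s`. Otherwise they descend to `u s` and `w s`, and the lifting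
property brings the relation back to `u` and `w`. -/
theorem bruhatLE_of_cnt_le (hd : 2 ≤ d) {u w : ExtAffineWeyl d} (hu : u ∈ affineWeyl d)
    (hw : w ∈ affineWeyl d) (h : ∀ i j, cnt u i j ≤ cnt w i j) : BruhatLE u w := by
  induction hk : weylLength w using Nat.strong_induction_on generalizing u w with
  | _ k ih =>
    by_cases h1 : w = 1
    · subst h1
      have hu1 : u = 1 := eq_one_of_ev_le hu fun n => by
        by_contra hn
        have h2 := h (n + 1) (n + 1)
        have h3 : cnt (1 : ExtAffineWeyl d) (n + 1) (n + 1) = 0 := by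
          have : crossing (1 : ExtAffineWeyl d) (n + 1) (n + 1) = ∅ := by
            ext m
            simp only [crossing, ev_one, Set.mem_ofPred_eq, Set.mem_empty_iff_false, iff_false]
            omega
          rw [cnt, this]
          simp
        have h4 : 0 < (crossing u (n + 1) (n + 1)).ncard :=
          (Set.ncard_pos (finite_crossing _ _ _)).mpr ⟨n, by omega, by omega⟩
        have h5 : cnt u (n + 1) (n + 1) = (crossing u (n + 1) (n + 1)).ncard := rfl
        omega
      rw [hu1]
      exact Relation.ReflTransGen.refl
    obtain ⟨s, hs⟩ := exists_descent hw h1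
    have hS := isSwap_simpleReflection hd s (y := (s : ℕ)) (by simp)
    have hlt := weylLength_mul_swap_lt hd hw hS hs
    have hws := mul_mem hw (simpleReflection_mem s)
    have hss : w * simpleReflection s * simpleReflection s = w := by
      rw [mul_assoc, hS.mul_self, mul_one]
    have hww : BruhatLE (w * simpleReflection s) w := Relation.ReflTransGen.single
      ⟨_, isReflection_simpleReflection s, hss.symm, hlt⟩
    rcases lt_trichotomy (ev u ((s : ℕ) - 1)) (ev u (s : ℕ)) with hus | hus | hus
    · exact (ih _ (hk ▸ hlt) hu hws
        (cnt_le_mul_of_ascent hd hus hs fun i j _ => h i j) rfl).trans hww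
    · have := ev_inj.mp hus
      omega
    · have hle := ih _ (hk ▸ hlt) (mul_mem hu (simpleReflection_mem s)) hws
        (cnt_le_mul_of_ascent hd (by
          rw [ev_mul, ev_mul, hS.ev_left, hS.ev_right]
          exact hus) hs fun i j hi => by
            rw [cnt_mul_simpleReflection hd u s hi]
            exact h i j) rfl
      have := bruhatLE_mul_of_descent hd hle (mul_mem hu (simpleReflection_mem s)) (s := s)
        (by rw [hss]; exact hlt)
      rwa [hss, mul_assoc, hS.mul_self, mul_one] at this

/-- Comparison of a convex staircase with another staircase. -/
theorem interpolate {F F' : ℤ → ℤ} {P : ℤ → Prop} [DecidablePred P] {i₀ i₁ : ℤ}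
    (hF : ∀ i, F (i + 1) = F i + if P i then 1 else 0)
    (hF' : ∀ i, F' i ≤ F' (i + 1) ∧ F' (i + 1) ≤ F' i + 1)
    (hP : ∀ n, i₀ < n → n < i₁ → P (n - 1) → P n) (h0 : F i₀ ≤ F' i₀) (h1 : F i₁ ≤ F' i₁) {i : ℤ}
    (hi : i₀ ≤ i) (hi1 : i ≤ i₁) : F i ≤ F' i := by
  induction i, hi using Int.leInduction with
  | base => exact h0
  | succ i hi ih =>
    have ih := ih (by omega)
    have h2 := hF i
    have h3 := hF' i
    by_cases hPi : P i
    · have key : ∀ n, i ≤ n → n < i₁ → P n := by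
        intro n hn
        induction n, hn using Int.leInduction with
        | base => exact fun _ => hPi
        | succ n hn ihn =>
          intro hlt
          refine hP (n + 1) (by omega) hlt ?_
          rw [add_sub_cancel_right]
          exact ihn (by omega)
      have key2 : ∀ n, i + 1 ≤ n → n ≤ i₁ → F n = F (i + 1) + (n - (i + 1)) ∧
          F' n ≤ F' (i + 1) + (n - (i + 1)) := by
        intro n hn
        induction n, hn using Int.leInduction with
        | base => exact fun _ => ⟨by omega, by omega⟩
        | succ n hn ihn =>
          intro hlt
          have h4 := ihn (by omega)
          have h5 := hF n
          have h6 := hF' n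
          rw [if_pos (key n (by omega) (by omega))] at h5
          omega
      have := key2 i₁ (by omega) le_rfl
      omega
    · rw [if_neg hPi] at h2
      omega

theorem exists_consecutive {G : Set ℤ} {c : ℤ} (hc : 0 < c) (hne : G.Nonempty)
    (hG : ∀ n ∈ G, ∀ l : ℤ, n + l * c ∈ G) (i : ℤ) :
    ∃ i₀ i₁, i₀ ≤ i ∧ i < i₁ ∧ i₀ ∈ G ∧ i₁ ∈ G ∧ ∀ n, i₀ < n → n < i₁ → n ∉ G := by
  obtain ⟨g, hg⟩ := hne
  have hlow : g + (-|i - g|) * c ≤ i := by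
    have := neg_abs_le (i - g)
    nlinarith [abs_nonneg (i - g)]
  have hup : i < g + (|i - g| + 1) * c := by
    have := le_abs_self (i - g)
    nlinarith [abs_nonneg (i - g)]
  obtain ⟨i₀, ⟨h1, h2⟩, h3⟩ := Int.exists_greatest_of_bdd (P := fun n => n ≤ i ∧ n ∈ G)
    ⟨i, fun z hz => hz.1⟩ ⟨_, hlow, hG g hg _⟩
  obtain ⟨i₁, ⟨h4, h5⟩, h6⟩ := Int.exists_least_of_bdd (P := fun n => i < n ∧ n ∈ G)
    ⟨i, fun z hz => hz.1.le⟩ ⟨_, hup, hG g hg _⟩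
  refine ⟨i₀, i₁, h1, h4, h2, h5, fun n hn hn1 hnG => ?_⟩
  rcases le_or_gt n i with h | h
  · have := h3 n ⟨h, hnG⟩
    omega
  · have := h6 n ⟨h, hnG⟩
    omega

/-- Comparison of an element, minimal in its double coset, with another element. -/
theorem cnt_le_of_grid {u w : ExtAffineWeyl d} {G H : Set ℤ} (hGne : G.Nonempty)
    (hHne : H.Nonempty) (hG : ∀ n ∈ G, ∀ l : ℤ, n + l * d ∈ G) (hH : ∀ n ∈ H, ∀ l : ℤ, n + l * d ∈ H)
    (hu : ∀ n, n ∉ G → ev u (n - 1) < ev u n) (hu' : ∀ n, n ∉ H → ev u⁻¹ (n - 1) < ev u⁻¹ n)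
    (h : ∀ i ∈ G, ∀ j ∈ H, cnt u i j ≤ cnt w i j) (i j : ℤ) : cnt u i j ≤ cnt w i j := by
  classical
  have hd : (0 : ℤ) < d := by exact_mod_cast NeZero.pos d
  have step1 : ∀ i, ∀ j ∈ H, cnt u i j ≤ cnt w i j := by
    intro i j hj
    obtain ⟨i₀, i₁, h1, h2, h3, h4, h5⟩ := exists_consecutive hd hGne hG i
    refine interpolate (F := fun i => cnt u i j) (F' := fun i => cnt w i j)
      (P := fun n => j ≤ ev u n) (fun i => cnt_succ_left u i j) (fun i => ?_) (fun n hn hn1 hP => ?_)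
      (h i₀ h3 j hj) (h i₁ h4 j hj) h1 h2.le
    · have := cnt_succ_left w i j
      split_ifs at this <;> omega
    · have := hu n (h5 n hn hn1)
      omega
  obtain ⟨j₀, j₁, h1, h2, h3, h4, h5⟩ := exists_consecutive hd hHne hH j
  -- In the second variable `cnt` is decreasing, hence the substitution `j ↦ -j`.
  have := interpolate (F := fun j => cnt u i (-j)) (F' := fun j => cnt w i (-j))
    (P := fun n => ev u⁻¹ (-n - 1) < i) (i₀ := -j₁) (i₁ := -j₀) (i := -j) (fun n => ?_) (fun n => ?_)
    (fun n hn hn1 hP => ?_) (by simpa using step1 i j₁ h4) (by simpa using step1 i j₀ h3)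
    (by omega) (by omega)
  · simpa using this
  · have := cnt_succ_right u i (-(n + 1))
    rw [show -(n + 1) + 1 = -n by ring, show -(n + 1) = -n - 1 by ring] at this
    rw [show -(n + 1) = -n - 1 by ring]
    exact this
  · have := cnt_succ_right w i (-(n + 1))
    rw [show -(n + 1) + 1 = -n by ring] at this
    split_ifs at this <;> omega
  · have := hu' (-n) (h5 (-n) (by omega) (by omega))
    rw [show -(n - 1) - 1 = -n by ring] at hP
    omega

end ExtAffineWeyl

end Weyl

end LinkedGrassmannian

namespace LinkedGrassmannian

/-! ### Double cosets of stabilizers -/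

section Weyl

variable {d : ℕ} [NeZero d]

namespace ExtAffineWeyl

theorem mem_weylStabilizer {F : Set (Fin d → ℤ)} {w : ExtAffineWeyl d} :
    w ∈ weylStabilizer F ↔ w ∈ affineWeyl d ∧ ∀ a ∈ F, w • a = a := by
  rw [weylStabilizer, Subgroup.mem_inf, mem_fixingSubgroup_iff]

/-- The total amount by which the coordinates of `a` exceed those of `b`. -/
def excess (a b : Fin d → ℤ) : ℤ := ∑ k, max 0 (a k - b k)

theorem ncard_stair_diff (a b : Fin d → ℤ) : ((stair a \ stair b).ncard : ℤ) = excess a b := by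
  have h1 : stair a \ stair b = ((Finset.univ.sigma fun k => Finset.Ico (b k) (a k)).image
      fun p : (Σ _ : Fin d, ℤ) => p.2 * d + (p.1 : ℕ) : Finset ℤ) := by
    ext n
    obtain ⟨l, k, rfl⟩ := exists_eq_mul_add d n
    simp only [Set.mem_sdiff, mem_stair, Finset.coe_image, Set.mem_image, Finset.mem_coe,
      Finset.mem_sigma, Finset.mem_univ, true_and, Finset.mem_Ico]
    constructor
    · rintro ⟨h1, h2⟩
      exact ⟨⟨k, l⟩, ⟨not_lt.mp h2, h1⟩, rfl⟩
    · rintro ⟨⟨k', l'⟩, ⟨h1, h2⟩, h3⟩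
      obtain ⟨rfl, rfl⟩ := mul_add_inj h3
      exact ⟨h2, not_lt.mpr h1⟩
  rw [h1, Set.ncard_coe_finset, Finset.card_image_of_injOn, Finset.card_sigma, excess]
  · push_cast
    refine Finset.sum_congr rfl fun k _ => ?_
    rw [Int.card_Ico]
    omega
  · rintro ⟨k, l⟩ - ⟨k', l'⟩ - h3
    obtain ⟨rfl, rfl⟩ := mul_add_inj h3
    rfl

theorem smul_add_const (g : ExtAffineWeyl d) (a : Fin d → ℤ) (c : ℤ) :
    g • (fun k => a k + c) = fun k => (g • a) k + c := by
  funext k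
  simp only [smul_apply]
  ring

theorem excess_smul (g : ExtAffineWeyl d) (a b : Fin d → ℤ) :
    excess (g • a) (g • b) = excess a b := by
  unfold excess
  simp only [smul_apply, add_sub_add_right_eq_sub]
  exact Equiv.sum_comp g.perm⁻¹ fun k => max 0 (a k - b k)

theorem excess_add_const (a b : Fin d → ℤ) (c : ℤ) :
    excess (fun k => a k + c) (fun k => b k + c) = excess a b := by
  unfold excess
  simp

/-- `w` maps the integers counted on the left bijectively onto `stair (w • a) \ stair b`. -/
theorem cnt_eq_excess {w : ExtAffineWeyl d} {i j : ℤ} {a b : Fin d → ℤ}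
    (ha : ∀ n, n ∈ stair a ↔ n < i) (hb : ∀ n, n ∈ stair b ↔ n < j) :
    cnt w i j = excess (w • a) b := by
  rw [cnt, ← ncard_stair_diff]
  congr 1
  refine Set.ncard_congr (fun n _ => ev w n) ?_ ?_ ?_
  · rintro n ⟨hn, hj⟩
    exact ⟨ev_mem_stair_smul.mpr ((ha n).mpr hn), fun hh => not_lt.mpr hj ((hb _).mp hh)⟩
  · rintro n m - - h
    exact ev_inj.mp h
  · rintro n ⟨hn, hj⟩
    rw [← ev_ev_inv w n, ev_mem_stair_smul, ha] at hn
    refine ⟨ev w⁻¹ n, ⟨hn, ?_⟩, ev_ev_inv w n⟩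
    rw [ev_ev_inv]
    exact not_lt.mp fun hh => hj ((hb n).mpr hh)

/-- Links the Bruhat order to ranks: `ι⁻ʳ` carries the half-line below `m + r` to the staircase of
`ω_m`, and `g` can be moved to both arguments of `excess`. -/
theorem cnt_conj (g h : ExtAffineWeyl d) (r : ℕ) (m m' : Fin d) (l : ℤ) :
    cnt (g⁻¹ * h * g * (iota d ^ r)⁻¹) ((m : ℕ) + r) ((m' : ℕ) + l * d) =
      excess (h • g • omega m) (fun k => (g • omega m') k + l) := by
  rw [cnt_eq_excess (a := iota d ^ r • omega m) (b := fun k => omega m' k + l)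
    (fun n => mem_stair_iota_pow_omega)
    (fun n => by rw [mem_stair_add, mem_stair_omega]; constructor <;> intro <;> linarith),
    ← smul_add_const, ← excess_smul g, ← mul_smul, ← mul_smul, ← mul_smul]
  congr 2
  group

theorem cnt_add_mul (w : ExtAffineWeyl d) (i j l : ℤ) : cnt w (i + l * d) (j + l * d) = cnt w i j := by
  unfold cnt
  congr 1
  refine (Set.ncard_congr (fun n _ => n + l * d) ?_ ?_ ?_).symm
  · rintro n ⟨hn, hj⟩
    exact ⟨by omega, by rw [ev_add_mul]; omega⟩
  · rintro n m - - h
    simpa using h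
  · rintro n ⟨hn, hj⟩
    refine ⟨n - l * d, ⟨by omega, ?_⟩, by ring⟩
    have := ev_add_mul w (n - l * d) l
    rw [sub_add_cancel] at this
    omega

/-- The stabilizer of the vertices `ι ^ r • ω_m`, `m ∈ J`. -/
def stab (r : ℕ) (J : Set (Fin d)) : Subgroup (ExtAffineWeyl d) :=
  weylStabilizer ((fun m => iota d ^ r • omega m) '' J)

theorem stab_zero (J : Set (Fin d)) : stab 0 J = weylStabilizer (omega '' J) := by
  simp [stab]

theorem mem_stab {r : ℕ} {J : Set (Fin d)} {w : ExtAffineWeyl d} :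
    w ∈ stab r J ↔ w ∈ affineWeyl d ∧
      ∀ m ∈ J, ∀ n, ev w n < (m : ℕ) + r ↔ n < (m : ℕ) + r := by
  rw [stab, mem_weylStabilizer, Set.forall_mem_image]
  simp only [smul_eq_iff, mem_stair_iota_pow_omega]

theorem simpleReflection_mem_stab (hd : 2 ≤ d) {r : ℕ} {J : Set (Fin d)} {s : Fin d}
    (hs : ∀ m ∈ J, ¬ (d : ℤ) ∣ (m : ℕ) + r - (s : ℕ)) : simpleReflection s ∈ stab r J := by
  refine mem_stab.mpr ⟨simpleReflection_mem s, fun m hm n => ?_⟩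
  rw [ev_simpleReflection hd]
  split_ifs with h1 h2
  · have : n ≠ (m : ℕ) + r := fun hh => hs m hm (hh ▸ h1)
    omega
  · have : n + 1 ≠ (m : ℕ) + r := fun hh => hs m hm (hh ▸ h2)
    omega
  · exact Iff.rfl

/-- The walls of the stabilizer. -/
def grid (r : ℕ) (J : Set (Fin d)) : Set ℤ := {n | ∃ m ∈ J, (d : ℤ) ∣ n - ((m : ℕ) + r)}

theorem grid_add {r : ℕ} {J : Set (Fin d)} {n : ℤ} (hn : n ∈ grid r J) (l : ℤ) :
    n + l * d ∈ grid r J := by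
  obtain ⟨m, hm, c, hc⟩ := hn
  exact ⟨m, hm, c + l, by rw [mul_add, ← hc]; ring⟩

theorem grid_nonempty {r : ℕ} {J : Set (Fin d)} (hJ : J.Nonempty) : (grid r J).Nonempty := by
  obtain ⟨m, hm⟩ := hJ
  exact ⟨(m : ℕ) + r, m, hm, by simp⟩

/-- Off the walls, the reflection exchanging `n - 1` and `n` belongs to the stabilizer, and a
descent there would make the element shorter. -/
theorem lt_ev_of_forall_weylLength_le (hd : 2 ≤ d) {u : ExtAffineWeyl d} (hu : u ∈ affineWeyl d)
    {r : ℕ} {J : Set (Fin d)} (h : ∀ s, simpleReflection s ∈ stab r J →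
      weylLength u ≤ weylLength (u * simpleReflection s)) {n : ℤ} (hn : n ∉ grid r J) :
    ev u (n - 1) < ev u n := by
  obtain ⟨s, hs⟩ := exists_dvd_sub (d := d) n
  have hS := isSwap_simpleReflection hd s hs
  have h1 := h s (simpleReflection_mem_stab hd fun m hm hh => hn ⟨m, hm, by
    have := dvd_sub hs hh
    rwa [show n - (s : ℕ) - ((m : ℕ) + r - (s : ℕ)) = n - ((m : ℕ) + r) by ring] at this⟩)
  by_contra hlt
  have hne : ev u n ≠ ev u (n - 1) := fun hh => by
    have := ev_inj.mp hh
    omega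
  have := weylLength_mul_swap_lt hd hu hS (by omega)
  omega

theorem stab_le (r : ℕ) (J : Set (Fin d)) : stab r J ≤ affineWeyl d := fun _ hw => (mem_stab.mp hw).1

theorem mem_affineWeyl_of_mem_doubleCoset {u v : ExtAffineWeyl d} {r r' : ℕ} {J J' : Set (Fin d)}
    (hu : u ∈ affineWeyl d) (hv : v ∈ DoubleCoset.doubleCoset u (stab r J : Set (ExtAffineWeyl d))
      (stab r' J')) : v ∈ affineWeyl d := by
  obtain ⟨x, hx, y, hy, rfl⟩ := DoubleCoset.mem_doubleCoset.mp hv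
  exact mul_mem (mul_mem (stab_le _ _ hx) hu) (stab_le _ _ hy)

/-- The right factor preserves the half-line below `m + r`, the left factor the one below `m' + l
d`. -/
theorem cnt_doubleCoset {u v : ExtAffineWeyl d} {r : ℕ} {J : Set (Fin d)}
    (hv : v ∈ DoubleCoset.doubleCoset u (stab 0 J : Set (ExtAffineWeyl d)) (stab r J))
    {m m' : Fin d} (hm : m ∈ J) (hm' : m' ∈ J) (l : ℤ) :
    cnt v ((m : ℕ) + r) ((m' : ℕ) + l * d) = cnt u ((m : ℕ) + r) ((m' : ℕ) + l * d) := by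
  obtain ⟨x, hx, y, hy, rfl⟩ := DoubleCoset.mem_doubleCoset.mp hv
  have hy' := (mem_stab.mp hy).2 m hm
  have hx' : ∀ n, (m' : ℕ) + l * d ≤ ev x n ↔ (m' : ℕ) + l * d ≤ n := fun n => by
    have h1 := (mem_stab.mp hx).2 m' hm' (n + (-l) * d)
    rw [ev_add_mul] at h1
    push_cast at h1
    constructor <;> intro h2 <;> by_contra h3
    · have := h1.mpr (by linarith)
      linarith
    · have := h1.mp (by linarith)
      linarith
  unfold cnt
  congr 1
  refine Set.ncard_congr (fun n _ => ev y n) ?_ ?_ ?_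
  · rintro n ⟨hn, hj⟩
    rw [ev_mul, ev_mul, hx'] at hj
    exact ⟨(hy' n).mpr hn, hj⟩
  · rintro n k - - h
    exact ev_inj.mp h
  · rintro n ⟨hn, hj⟩
    refine ⟨ev y⁻¹ n, ⟨?_, ?_⟩, ev_ev_inv y n⟩
    · rw [← hy', ev_ev_inv]
      exact hn
    · rw [ev_mul, ev_mul, hx', ev_ev_inv]
      exact hj

/-- A representative of minimal length of a double coset. -/
theorem exists_minimal_representative (hd : 2 ≤ d) {u : ExtAffineWeyl d} (hu : u ∈ affineWeyl d)
    (r : ℕ) {J : Set (Fin d)} (hJ : J.Nonempty) :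
    ∃ v ∈ DoubleCoset.doubleCoset u (stab 0 J : Set (ExtAffineWeyl d)) (stab r J),
      ∀ w : ExtAffineWeyl d, (∀ m ∈ J, ∀ m' ∈ J, ∀ l : ℤ,
        cnt u ((m : ℕ) + r) ((m' : ℕ) + l * d) ≤ cnt w ((m : ℕ) + r) ((m' : ℕ) + l * d)) →
        ∀ i j, cnt v i j ≤ cnt w i j := by
  set D := DoubleCoset.doubleCoset u (stab 0 J : Set (ExtAffineWeyl d)) (stab r J) with hD
  obtain ⟨v, hv, hmin⟩ := exists_minimalFor_of_wellFoundedLT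
    (fun v : ExtAffineWeyl d => v ∈ D) (fun v : ExtAffineWeyl d => weylLength v)
    ⟨u, DoubleCoset.mem_doubleCoset_self _ _ u⟩
  have hmin' : ∀ w ∈ D, weylLength v ≤ weylLength w := fun w hw => by
    by_contra hlt
    exact hlt (hmin hw (not_le.mp hlt).le)
  have hva := mem_affineWeyl_of_mem_doubleCoset hu hv
  obtain ⟨x, hx, y, hy, hxy⟩ := DoubleCoset.mem_doubleCoset.mp hv
  refine ⟨v, hv, fun w hw => cnt_le_of_grid (grid_nonempty (r := r) hJ) (grid_nonempty (r := 0) hJ)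
    (fun n hn => grid_add hn) (fun n hn => grid_add hn)
    (fun n hn => lt_ev_of_forall_weylLength_le hd hva (fun s hs => hmin' _ ?_) hn)
    (fun n hn => lt_ev_of_forall_weylLength_le hd (inv_mem hva) (fun s hs => ?_) hn) ?_⟩
  · exact DoubleCoset.mem_doubleCoset.mpr ⟨x, hx, y * simpleReflection s, mul_mem hy hs, by
      rw [hxy]; group⟩
  · have h1 : simpleReflection s * v ∈ D :=
      DoubleCoset.mem_doubleCoset.mpr ⟨simpleReflection s * x, mul_mem hs hx, y, hy, by
        rw [hxy]; group⟩
    have h2 := weylLength_inv hd (mul_mem (simpleReflection_mem s) hva)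
    rw [mul_inv_rev, inv_eq_of_mul_eq_one_left (simpleReflection_mul_self hd s)] at h2
    rw [weylLength_inv hd hva, h2]
    exact hmin' _ h1
  · rintro i ⟨m, hm, c, hc⟩ j ⟨m', hm', c', hc'⟩
    obtain rfl : i = ((m : ℕ) + r) + c * d := by linarith
    obtain rfl : j = ((m' : ℕ) + (c' - c) * d) + c * d := by push_cast at hc'; linarith
    rw [cnt_add_mul, cnt_add_mul, cnt_doubleCoset hv hm hm']
    exact hw m hm m' hm' _

/-- Values of `cnt` at walls are invariants of the double coset, and a representative of minimal
length is below any `w` that dominates them there. -/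
theorem doubleCosetBruhatLE_iff (hd : 2 ≤ d) {u w : ExtAffineWeyl d} (hu : u ∈ affineWeyl d)
    (hw : w ∈ affineWeyl d) (r : ℕ) {J : Set (Fin d)} (hJ : J.Nonempty) :
    DoubleCosetBruhatLE (stab 0 J) (stab r J) u w ↔ ∀ m ∈ J, ∀ m' ∈ J, ∀ l : ℤ,
      cnt u ((m : ℕ) + r) ((m' : ℕ) + l * d) ≤ cnt w ((m : ℕ) + r) ((m' : ℕ) + l * d) := by
  constructor
  · rintro ⟨u', hu', w', hw', h⟩ m hm m' hm' l
    rw [← cnt_doubleCoset hu' hm hm', ← cnt_doubleCoset hw' hm hm']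
    exact cnt_le_of_bruhatLE hd h _ _
  · intro h
    obtain ⟨v, hv, hmin⟩ := exists_minimal_representative hd hu r hJ
    exact ⟨v, hv, w, DoubleCoset.mem_doubleCoset_self _ _ w,
      bruhatLE_of_cnt_le hd (mem_affineWeyl_of_mem_doubleCoset hu hv) hw (hmin w h)⟩

/-- Representatives of minimal length of the two double cosets dominate each other, hence have the
same `cnt` and coincide. -/
theorem mem_doubleCoset_of_cnt_eq (hd : 2 ≤ d) {u w : ExtAffineWeyl d} (hu : u ∈ affineWeyl d)
    (hw : w ∈ affineWeyl d) (r : ℕ) {J : Set (Fin d)} (hJ : J.Nonempty)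
    (h : ∀ m ∈ J, ∀ m' ∈ J, ∀ l : ℤ,
      cnt u ((m : ℕ) + r) ((m' : ℕ) + l * d) = cnt w ((m : ℕ) + r) ((m' : ℕ) + l * d)) :
    w ∈ DoubleCoset.doubleCoset u (stab 0 J : Set (ExtAffineWeyl d)) (stab r J) := by
  obtain ⟨v, hv, hmin⟩ := exists_minimal_representative hd hu r hJ
  obtain ⟨v', hv', hmin'⟩ := exists_minimal_representative hd hw r hJ
  have h1 : v = v' := ev_eq_of_cnt_eq fun i j => le_antisymm
    (hmin v' (fun m hm m' hm' l => by rw [cnt_doubleCoset hv' hm hm', h m hm m' hm']) i j)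
    (hmin' v (fun m hm m' hm' l => by rw [cnt_doubleCoset hv hm hm', h m hm m' hm']) i j)
  subst h1
  rw [← DoubleCoset.doubleCoset_eq_of_mem hv, DoubleCoset.doubleCoset_eq_of_mem hv']
  exact DoubleCoset.mem_doubleCoset_self _ _ w

/-- The vectors `a v`, `v ∈ τ`, are translates of the vertices `ω_m`, `m ∈ J`, up to homothety. -/
def IsFaceOf {I : Type*} (a : I → Fin d → ℤ) (τ : Set I) (g : ExtAffineWeyl d) (J : Set (Fin d)) :
    Prop :=
  (∀ v ∈ τ, ∃ m ∈ J, SameClass (a v) (g • omega m)) ∧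
    ∀ m ∈ J, ∃ v ∈ τ, SameClass (a v) (g • omega m)

variable {I : Type*} {a : I → Fin d → ℤ} {τ : Set I} {g : ExtAffineWeyl d} {J : Set (Fin d)}

theorem excess_sameClass {x y x' y' : Fin d → ℤ} (hx : SameClass x x') (hy : SameClass y y') :
    ∃ c : ℤ, ∀ (h : ExtAffineWeyl d) (l : ℤ),
      excess (h • x) (fun k => y k + (l + c)) = excess (h • x') (fun k => y' k + l) := by
  obtain ⟨c, hc⟩ := hx
  obtain ⟨c', hc'⟩ := hy
  refine ⟨c - c', fun h l => ?_⟩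
  obtain rfl : x = fun k => x' k + c := funext hc
  rw [smul_add_const, ← excess_add_const (h • x') _ c]
  congr 1
  funext k
  rw [hc']
  ring

theorem mem_affineWeyl_conj {h : ExtAffineWeyl d} {r : ℕ} (hh : ∑ k, h.trans k = r) :
    g⁻¹ * h * g * (iota d ^ r)⁻¹ ∈ affineWeyl d := by
  have hinv : ∀ w : ExtAffineWeyl d, ∑ k, w⁻¹.trans k = - ∑ k, w.trans k := fun w => by
    have h1 := sum_trans_mul w w⁻¹
    rw [mul_inv_cancel, trans_one] at h1
    simp only [Pi.zero_apply, Finset.sum_const_zero] at h1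
    linarith
  rw [mem_affineWeyl, sum_trans_mul, sum_trans_mul, sum_trans_mul, hinv, hinv, hh, iota_pow_sum]
  ring

theorem IsFaceOf.doubleCosetBruhatLE_iff (hd : 2 ≤ d) (hτ : IsFaceOf a τ g J) (hne : τ.Nonempty)
    {h h' : ExtAffineWeyl d} {r : ℕ} (hh : ∑ k, h.trans k = r) (hh' : ∑ k, h'.trans k = r) :
    DoubleCosetBruhatLE (weylStabilizer (omega '' J))
      (weylStabilizer ((fun m => iota d ^ r • omega m) '' J))
      (g⁻¹ * h * g * (iota d ^ r)⁻¹) (g⁻¹ * h' * g * (iota d ^ r)⁻¹) ↔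
      ∀ u ∈ τ, ∀ v ∈ τ, ∀ l : ℤ, excess (h • a u) (fun k => a v k + l) ≤
        excess (h' • a u) (fun k => a v k + l) := by
  have hJ : J.Nonempty := by
    obtain ⟨v, hv⟩ := hne
    obtain ⟨m, hm, -⟩ := hτ.1 v hv
    exact ⟨m, hm⟩
  have h1 := ExtAffineWeyl.doubleCosetBruhatLE_iff hd (mem_affineWeyl_conj (g := g) hh)
    (mem_affineWeyl_conj (g := g) hh') r hJ
  rw [stab_zero, stab] at h1
  rw [h1]
  simp only [cnt_conj]
  constructor
  · intro h2 u hu v hv l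
    obtain ⟨m, hm, hum⟩ := hτ.1 u hu
    obtain ⟨m', hm', hvm⟩ := hτ.1 v hv
    obtain ⟨c, hc⟩ := excess_sameClass hum hvm
    have := h2 m hm m' hm' (l - c)
    rwa [← hc, ← hc, sub_add_cancel] at this
  · intro h2 m hm m' hm' l
    obtain ⟨u, hu, hum⟩ := hτ.2 m hm
    obtain ⟨v, hv, hvm⟩ := hτ.2 m' hm'
    obtain ⟨c, hc⟩ := excess_sameClass hum hvm
    rw [← hc, ← hc]
    exact h2 u hu v hv _

theorem IsFaceOf.doubleCoset_eq (hd : 2 ≤ d) (hτ : IsFaceOf a τ g J) {σ : Set I} (hσ : σ ⊆ τ)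
    {h h' : ExtAffineWeyl d} {r : ℕ} (hh : ∑ k, h.trans k = r) (hh' : ∑ k, h'.trans k = r)
    (heq : ∀ u ∈ σ, ∀ v ∈ σ, ∀ l : ℤ, excess (h • a u) (fun k => a v k + l) =
      excess (h' • a u) (fun k => a v k + l)) :
    DoubleCoset.doubleCoset h (weylStabilizer (a '' σ) : Set (ExtAffineWeyl d))
        (weylStabilizer (a '' σ)) =
      DoubleCoset.doubleCoset h' (weylStabilizer (a '' σ) : Set (ExtAffineWeyl d))
        (weylStabilizer (a '' σ)) := by
  symm
  refine DoubleCoset.doubleCoset_eq_of_mem (DoubleCoset.mem_doubleCoset.mpr ?_)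
  have hinv : ∀ w : ExtAffineWeyl d, ∑ k, w⁻¹.trans k = - ∑ k, w.trans k := fun w => by
    have h1 := sum_trans_mul w w⁻¹
    rw [mul_inv_cancel, trans_one] at h1
    simp only [Pi.zero_apply, Finset.sum_const_zero] at h1
    linarith
  rcases σ.eq_empty_or_nonempty with rfl | ⟨v₀, hv₀⟩
  -- For empty `σ` the stabilizer is all of `W_a`, which contains `h⁻¹ h'` because the translation
  -- sums agree.
  · refine ⟨1, one_mem _, h⁻¹ * h', ?_, by group⟩
    refine mem_weylStabilizer.mpr ⟨?_, by simp⟩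
    rw [mem_affineWeyl, sum_trans_mul, hinv, hh, hh']
    ring
  · set J' : Set (Fin d) := {m | ∃ v ∈ σ, SameClass (a v) (g • omega m)} with hJ'
    have hface : ∀ v ∈ σ, ∃ m ∈ J', SameClass (a v) (g • omega m) := fun v hv => by
      obtain ⟨m, -, hm⟩ := hτ.1 v (hσ hv)
      exact ⟨m, ⟨v, hv, hm⟩, hm⟩
    have hJne : J'.Nonempty := by
      obtain ⟨m, hm, -⟩ := hface v₀ hv₀
      exact ⟨m, hm⟩
    have h1 := mem_doubleCoset_of_cnt_eq hd (mem_affineWeyl_conj (g := g) hh)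
      (mem_affineWeyl_conj (g := g) hh') r hJne (fun m hm m' hm' l => by
        rw [cnt_conj, cnt_conj]
        obtain ⟨u, hu, hum⟩ := hm
        obtain ⟨v, hv, hvm⟩ := hm'
        obtain ⟨c, hc⟩ := excess_sameClass hum hvm
        rw [← hc, ← hc]
        exact heq u hu v hv _)
    obtain ⟨x, hx, y, hy, hxy⟩ := DoubleCoset.mem_doubleCoset.mp h1
    -- conjugates of the stabilizers
    have key : ∀ w ∈ affineWeyl d, (∀ m ∈ J', w • omega m = omega m) →
        g * w * g⁻¹ ∈ weylStabilizer (a '' σ) := by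
      intro w hw hfix
      refine mem_weylStabilizer.mpr ⟨?_, ?_⟩
      · rw [mem_affineWeyl, sum_trans_mul, sum_trans_mul, hinv, mem_affineWeyl.mp hw]
        ring
      · rintro _ ⟨v, hv, rfl⟩
        obtain ⟨m, hm, c, hc⟩ := hface v hv
        rw [show a v = fun k => (g • omega m) k + c from funext hc, smul_add_const, mul_smul,
          mul_smul, inv_smul_smul, hfix m hm]
    rw [SetLike.mem_coe, stab_zero, mem_weylStabilizer] at hx
    rw [SetLike.mem_coe, stab, mem_weylStabilizer] at hy
    refine ⟨_, key x hx.1 fun m hm => hx.2 _ ⟨m, hm, rfl⟩, _,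
      key ((iota d ^ r)⁻¹ * y * iota d ^ r) ?_ fun m hm => ?_, ?_⟩
    · rw [mem_affineWeyl, sum_trans_mul, sum_trans_mul, hinv, mem_affineWeyl.mp hy.1]
      ring
    · rw [mul_smul, mul_smul, hy.2 _ ⟨m, hm, rfl⟩, inv_smul_smul]
    · have h2 : h' = g * (g⁻¹ * h' * g * (iota d ^ r)⁻¹) * iota d ^ r * g⁻¹ := by group
      rw [h2, hxy]
      group

end ExtAffineWeyl

end Weyl

end LinkedGrassmannian

namespace LinkedGrassmannian

/-! ### Simplices in an apartment -/

section Columns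

variable {I : Type*} {n : I → I → ℤ} {τ : Set I}

/-- The integers `β v`, `v ∈ τ`, are the exponents of one coordinate of a chain of lattices. -/
def IsColumn (n : I → I → ℤ) (τ : Set I) (β : I → ℤ) : Prop :=
  ∀ u ∈ τ, ∀ v ∈ τ, β u - n u v ≤ β v

theorem IsLinkMetric.swap (h : IsLinkMetric n) : IsLinkMetric fun u v => n v u where
  self := h.self
  tri u v w := (h.tri w v u).trans_eq (add_comm _ _)
  pos u v huv := (h.pos u v huv).trans_eq (add_comm _ _)

/-- For two vertices the column inequalities have total slack one, so exactly one of them is an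
equality. Directing each pair accordingly gives a transitive tournament, whose first vertex is the
source. -/
theorem IsColumn.exists_source [Finite I] (h : IsLinkMetric n) (hne : τ.Nonempty)
    (hτ : ∀ u ∈ τ, ∀ v ∈ τ, u ≠ v → Adj n u v) {β : I → ℤ} (hβ : IsColumn n τ β) :
    ∃ s ∈ τ, ∀ v ∈ τ, β v = β s - n s v := by
  let r : τ → τ → Prop := fun u v => u ≠ v ∧ β v = β u - n u v
  have h1 : IsTrans τ r := ⟨fun u v w huv hvw => by
    have h2 := h.tri u v w
    have h3 := hβ u u.2 w w.2
    refine ⟨?_, by have := huv.2; have := hvw.2; omega⟩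
    rintro rfl
    have := h.pos u v (fun hh => huv.1 (Subtype.ext hh))
    have := huv.2
    have := hvw.2
    omega⟩
  have h2 : Std.Irrefl r := ⟨fun u hu => hu.1 rfl⟩
  obtain ⟨s, -, hs⟩ := (Finite.wellFounded_of_trans_of_irrefl r).has_min Set.univ
    ⟨⟨_, hne.some_mem⟩, trivial⟩
  refine ⟨s, s.2, fun v hv => ?_⟩
  by_cases hvs : v = s
  · rw [hvs, h.self, sub_zero]
  · have h3 := hs ⟨v, hv⟩ trivial
    have h4 : β s ≠ β v - n v s := fun hh => h3 ⟨fun he => hvs (congrArg Subtype.val he), hh⟩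
    have h5 := hβ v hv s s.2
    have h6 := hβ s s.2 v hv
    have h7 := hτ v hv s s.2 hvs
    unfold Adj at h7
    omega

/-- The last vertex of a simplex with respect to the cyclic order starting at `s`. -/
theorem exists_sink [Finite I] (h : IsLinkMetric n)
    (hτ : ∀ u ∈ τ, ∀ v ∈ τ, u ≠ v → Adj n u v) {s : I} (hs : s ∈ τ) :
    ∃ w ∈ τ, ∀ v ∈ τ, Btw n s v w := by
  obtain ⟨w, hw, hw'⟩ := IsColumn.exists_source (n := fun u v => n v u) (β := n s) h.swap ⟨s, hs⟩
    (fun u hu v hv huv => (hτ u hu v hv huv).symm)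
    (fun u _ v _ => by have := h.tri s v u; simp only; omega)
  refine ⟨w, hw, fun v hv => ?_⟩
  have := hw' v hv
  unfold Btw
  omega

variable {d : ℕ} {a b : I → Fin d → ℤ}

open Classical in
-- With `w` the last vertex from `s`, the difference `a s k - a w k` is `n s w` if `s` is the source
-- of the coordinate `k` and `n s w - 1` otherwise.
theorem card_source (hτ : ∀ u ∈ τ, ∀ v ∈ τ, u ≠ v → Adj n u v) {σ : Fin d → I} (hσ : ∀ k, σ k ∈ τ)
    (hσ' : ∀ k, ∀ v ∈ τ, a v k = a (σ k) k - n (σ k) v) {s w : I} (hs : s ∈ τ) (hw : w ∈ τ)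
    (hsw : ∀ v ∈ τ, Btw n s v w) :
    (Fintype.card {k // σ k = s} : ℤ) = ∑ k, a s k - ∑ k, a w k - d * (n s w - 1) := by
  have h1 : ∀ k, (if σ k = s then 1 else 0 : ℤ) = a s k - a w k - (n s w - 1) := fun k => by
    split_ifs with hk
    · have := hσ' k w hw
      rw [hk] at this
      omega
    · have h2 := hσ' k w hw
      have h3 := hσ' k s hs
      have h4 := hsw _ (hσ k)
      have h5 := hτ _ (hσ k) s hs hk
      unfold Btw at h4
      unfold Adj at h5
      omega
  rw [Fintype.card_subtype, Finset.card_filter]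
  push_cast
  rw [Finset.sum_congr rfl fun k _ => h1 k]
  simp [Finset.sum_sub_distrib, mul_sub]

/-- A column is determined by its source and its value there. By `card_source` both families have
equally many coordinates with a given source; match them by a permutation and adjust by a
translation. -/
theorem exists_smul_eq [Finite I] [NeZero d] (h : IsLinkMetric n) (hne : τ.Nonempty)
    (hτ : ∀ u ∈ τ, ∀ v ∈ τ, u ≠ v → Adj n u v) (ha : ∀ k, IsColumn n τ fun v => a v k)
    (hb : ∀ k, IsColumn n τ fun v => b v k) {r : ℤ}
    (hsum : ∀ v ∈ τ, ∑ k, b v k - ∑ k, a v k = r) :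
    ∃ w : ExtAffineWeyl d, ∀ v ∈ τ, w • a v = b v := by
  classical
  choose σ hσ hσ' using fun k => (ha k).exists_source h hne hτ
  choose ρ hρ hρ' using fun k => (hb k).exists_source h hne hτ
  have hcard : ∀ s, Fintype.card {k // σ k = s} = Fintype.card {k // ρ k = s} := fun s => by
    by_cases hs : s ∈ τ
    · obtain ⟨w, hw, hsw⟩ := exists_sink h hτ hs
      have h1 := card_source hτ hσ hσ' hs hw hsw
      have h2 := card_source hτ hρ hρ' hs hw hsw
      have h3 := hsum s hs
      have h4 := hsum w hw
      zify
      rw [h1, h2]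
      linarith
    · have h1 : IsEmpty {k // σ k = s} := ⟨fun k => hs (k.2 ▸ hσ k.1)⟩
      have h2 : IsEmpty {k // ρ k = s} := ⟨fun k => hs (k.2 ▸ hρ k.1)⟩
      rw [Fintype.card_eq_zero, Fintype.card_eq_zero]
  let π : Equiv.Perm (Fin d) := Equiv.ofFiberEquiv fun s => Fintype.equivOfCardEq (hcard s)
  have hπ : ∀ k, ρ (π k) = σ k := fun k => Equiv.ofFiberEquiv_map _ k
  refine ⟨ExtAffineWeyl.mk π fun k => b (ρ k) k - a (ρ k) (π⁻¹ k), fun v hv => ?_⟩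
  funext k
  change a v (π⁻¹ k) + (b (ρ k) k - a (ρ k) (π⁻¹ k)) = b v k
  have h1 := hσ' (π⁻¹ k) v hv
  have h2 := hπ (π⁻¹ k)
  rw [ExtAffineWeyl.perm_apply_inv] at h2
  rw [← h2] at h1
  have h3 := hρ' k v hv
  omega

theorem mem_iff_lt_card_of_isLowerSet {A : Finset (Fin d)}
    (hA : ∀ i j, i ≤ j → j ∈ A → i ∈ A) (j : Fin d) : j ∈ A ↔ (j : ℕ) < A.card := by
  constructor
  · intro hj
    have h1 : Finset.Iic j ⊆ A := fun i hi => hA i j (Finset.mem_Iic.mp hi) hj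
    have := Finset.card_le_card h1
    rw [Fin.card_Iic] at this
    omega
  · intro hj
    by_contra hn
    have h1 : A ⊆ Finset.Iio j := fun i hi =>
      Finset.mem_Iio.mpr (not_le.mp fun hji => hn (hA j i hji hi))
    have := Finset.card_le_card h1
    rw [Fin.card_Iio] at this
    omega

/-- A simplex is a translate of a face of the standard alcove. -/
theorem exists_isFaceOf [Finite I] [NeZero d] (h : IsLinkMetric n) (hne : τ.Nonempty)
    (hτ : ∀ u ∈ τ, ∀ v ∈ τ, u ≠ v → Adj n u v) (ha : ∀ k, IsColumn n τ fun v => a v k)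
    (hatt : ∀ u ∈ τ, ∀ v ∈ τ, ∃ k, a v k = a u k - n u v) :
    ∃ (g : ExtAffineWeyl d) (J : Set (Fin d)), ExtAffineWeyl.IsFaceOf a τ g J := by
  classical
  obtain ⟨o, ho⟩ := hne
  -- The coordinates in which `a v` exceeds its lower bound `a o - n o v`, necessarily by one. These
  -- sets are totally ordered by inclusion.
  let T : I → Finset (Fin d) := fun v => Finset.univ.filter fun k => a v k ≠ a o k - n o v
  have hT : ∀ v k, k ∈ T v ↔ a v k ≠ a o k - n o v := fun v k => by simp [T]
  have hT' : ∀ v ∈ τ, ∀ k ∈ T v, a v k = a o k - n o v + 1 := fun v hv k hk => by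
    rw [hT] at hk
    have hvo : v ≠ o := by
      rintro rfl
      exact hk (by rw [h.self, sub_zero])
    have h1 := ha k o ho v hv
    have h2 := ha k v hv o ho
    have h3 := hτ v hv o ho hvo
    unfold Adj at h3
    simp only at h1 h2
    omega
  have hchain : ∀ u ∈ τ, ∀ v ∈ τ, ∀ k ∈ T u, k ∉ T v → ∀ k' ∈ T v, k' ∈ T u := by
    intro u hu v hv k hk hkv k' hk'
    by_contra hku
    have huv : u ≠ v := by
      rintro rfl
      exact hkv hk
    have h1 := hT' u hu k hk
    have h2 := hT' v hv k' hk'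
    rw [hT, not_not] at hkv hku
    have h3 := ha k u hu v hv
    have h4 := ha k' v hv u hu
    have h5 := hτ u hu v hv huv
    unfold Adj at h5
    simp only at h3 h4
    omega
  -- Sorting the coordinates by `φ` turns every `T v` into an initial segment, that is, into some
  -- `ω_m`.
  let φ : Fin d → ℕ := fun k => {v | v ∈ τ ∧ k ∉ T v}.ncard
  have hφ : ∀ v ∈ τ, ∀ k ∈ T v, ∀ k', k' ∉ T v → φ k < φ k' := fun v hv k hk k' hk' => by
    refine Set.ncard_lt_ncard ?_ (Set.toFinite _)
    refine ⟨fun u hu => ⟨hu.1, fun hk'u => hk' ?_⟩, fun hh => (hh (a := v) ⟨hv, hk'⟩).2 hk⟩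
    exact hchain v hv u hu.1 k hk hu.2 k' hk'u
  let π : Equiv.Perm (Fin d) := Tuple.sort φ
  have hπ : Monotone (φ ∘ π) := Tuple.monotone_sort φ
  have hmem : ∀ v ∈ τ, ∀ j, π j ∈ T v ↔ (j : ℕ) < (T v).card := fun v hv j => by
    have h1 : (T v).card = (Finset.univ.filter fun j => π j ∈ T v).card := by
      refine (Finset.card_bij (fun j _ => π j) ?_ ?_ ?_).symm
      · intro j hj
        simpa using hj
      · intro i _ j _ hij
        exact π.injective hij
      · intro k hk
        exact ⟨π⁻¹ k, by simpa [ExtAffineWeyl.perm_apply_inv] using hk,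
          ExtAffineWeyl.perm_apply_inv π k⟩
    rw [h1, ← mem_iff_lt_card_of_isLowerSet]
    · exact ⟨fun hj => Finset.mem_filter.mpr ⟨Finset.mem_univ _, hj⟩,
        fun hj => (Finset.mem_filter.mp hj).2⟩
    · intro i j hij hj
      rw [Finset.mem_filter] at hj ⊢
      refine ⟨Finset.mem_univ _, ?_⟩
      by_contra hi
      exact not_le.mpr (hφ v hv _ hj.2 _ hi) (hπ hij)
  have hlt : ∀ v ∈ τ, (T v).card < d := fun v hv => by
    obtain ⟨k, hk⟩ := hatt o ho v hv
    have : (T v).card < Fintype.card (Fin d) :=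
      Finset.card_lt_univ_of_notMem (x := k) fun hh => (hT v k).mp hh hk
    simpa using this
  have hsame : ∀ v ∈ τ, ∀ m : Fin d, (m : ℕ) = (T v).card →
      SameClass (a v) (ExtAffineWeyl.mk π (a o) • omega m) := fun v hv m hm => by
    refine ⟨-n o v, fun k => ?_⟩
    change a v k = (if π⁻¹ k < m then 1 else 0) + a o k + _
    have h1 := hmem v hv (π⁻¹ k)
    rw [ExtAffineWeyl.perm_apply_inv, ← hm] at h1
    split_ifs with hk
    · rw [hT' v hv k (h1.mpr hk)]
      ring
    · have h2 := mt h1.mp hk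
      rw [hT, not_not] at h2
      rw [h2]
      ring
  refine ⟨ExtAffineWeyl.mk π (a o), {m | ∃ v ∈ τ, (m : ℕ) = (T v).card}, fun v hv => ?_, ?_⟩
  · exact ⟨⟨_, hlt v hv⟩, ⟨v, hv, rfl⟩, hsame v hv _ rfl⟩
  · rintro m ⟨v, hv, hm⟩
    exact ⟨v, hv, hsame v hv m hm⟩

open ExtAffineWeyl in
-- Only `l = m` carries information: for smaller `l` the excess is a difference of sums, fixed by
-- `r`, and for larger `l` it is zero.
theorem excess_le_of_le {a a' b b' : Fin d → ℤ} {m r : ℤ}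
    (ha : ∀ k, m - 1 ≤ a k - a' k ∧ a k - a' k ≤ m) (hb : ∀ k, a k ≤ b k ∧ b k ≤ a k + 1)
    (hb' : ∀ k, a k ≤ b' k ∧ b' k ≤ a k + 1) (hr : ∑ k, b k - ∑ k, a k = r)
    (hr' : ∑ k, b' k - ∑ k, a k = r)
    (hle : excess b (fun k => a' k + m) ≤ excess b' (fun k => a' k + m)) (l : ℤ) :
    excess b (fun k => a' k + l) ≤ excess b' (fun k => a' k + l) := by
  rcases lt_trichotomy l m with hl | rfl | hl
  · have h1 : ∀ c : Fin d → ℤ, (∀ k, a k ≤ c k ∧ c k ≤ a k + 1) →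
        excess c (fun k => a' k + l) = ∑ k, c k - ∑ k, (a' k + l) := fun c hc => by
      rw [excess, ← Finset.sum_sub_distrib]
      refine Finset.sum_congr rfl fun k _ => max_eq_right ?_
      have := ha k
      have := hc k
      omega
    rw [h1 b hb, h1 b' hb']
    linarith
  · exact hle
  · have h1 : ∀ c : Fin d → ℤ, (∀ k, a k ≤ c k ∧ c k ≤ a k + 1) →
        excess c (fun k => a' k + l) = 0 := fun c hc => by
      refine Finset.sum_eq_zero fun k _ => max_eq_left ?_
      simp only
      have := ha k
      have := hc k
      omega
    rw [h1 b hb, h1 b' hb']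

end Columns

end LinkedGrassmannian

namespace LinkedGrassmannian

/-! ### Lattices in an apartment -/

section Apartment

variable {R K : Type*} [CommRing R] [IsDomain R] [IsDiscreteValuationRing R] [Field K]
  [Algebra R K] [IsFractionRing R K] {ϖ : R} {d : ℕ} {I : Type*} {Γ : LatticeConfig R K d I}

open IsLocalRing (ResidueField residue)

theorem residue_eq_zero_iff_zpow_mul_mem_range (hϖ : Irreducible ϖ) {r : R} :
    residue R r = 0 ↔
      algebraMap R K ϖ ^ (-1 : ℤ) * algebraMap R K r ∈ Set.range (algebraMap R K) := by
  have hp := algebraMap_uniformizer_ne_zero (K := K) hϖ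
  rw [IsLocalRing.residue_eq_zero_iff, hϖ.maximalIdeal_eq, Ideal.mem_span_singleton, zpow_neg_one]
  constructor
  · rintro ⟨s, rfl⟩
    exact ⟨s, by rw [map_mul, inv_mul_cancel_left₀ hp]⟩
  · rintro ⟨s, hs⟩
    refine ⟨s, IsFractionRing.injective R K ?_⟩
    rw [map_mul, hs, mul_inv_cancel_left₀ hp]

theorem zpow_mem_range_iff (hϖ : Irreducible ϖ) {n : ℤ} :
    algebraMap R K ϖ ^ n ∈ Set.range (algebraMap R K) ↔ 0 ≤ n := by
  refine ⟨fun h => ?_, zpow_mem_range n⟩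
  by_contra hn
  have hp := algebraMap_uniformizer_ne_zero (K := K) hϖ
  have h1 : algebraMap R K ϖ ^ (-1 : ℤ) * algebraMap R K 1 ∈ Set.range (algebraMap R K) := by
    obtain ⟨r, hr⟩ := h
    obtain ⟨s, hs⟩ := zpow_mem_range (K := K) (ϖ := ϖ) (-1 - n) (by omega)
    refine ⟨r * s, ?_⟩
    rw [map_mul, hr, hs, ← zpow_add₀ hp, map_one, mul_one]
    congr 1
    ring
  rw [← residue_eq_zero_iff_zpow_mul_mem_range hϖ, map_one] at h1
  exact one_ne_zero h1

variable {e : Module.Basis (Fin d) K (Fin d → K)} {a b : Fin d → ℤ}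

theorem mem_apartmentLattice (hϖ : Irreducible ϖ) {x : Fin d → K} :
    x ∈ apartmentLattice ϖ e a ↔
      ∀ k, algebraMap R K ϖ ^ a k * e.repr x k ∈ Set.range (algebraMap R K) := by
  have hp := algebraMap_uniformizer_ne_zero (K := K) hϖ
  let e' := e.unitsSMul fun k => Units.mk0 (algebraMap R K ϖ ^ (-a k)) (zpow_ne_zero _ hp)
  have h1 : apartmentLattice ϖ e a = Submodule.span R (Set.range e') := by
    unfold apartmentLattice
    congr 2
    funext k
    rw [Module.Basis.unitsSMul_apply]
    rfl
  rw [h1, Module.Basis.mem_span_iff_repr_mem]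
  refine forall_congr' fun k => ?_
  rw [Module.Basis.repr_unitsSMul, Units.smul_def]
  simp

theorem zpow_smul_mem_apartmentLattice (hϖ : Irreducible ϖ) {m : ℤ} {k : Fin d} :
    algebraMap R K ϖ ^ m • e k ∈ apartmentLattice ϖ e a ↔ 0 ≤ a k + m := by
  have hp := algebraMap_uniformizer_ne_zero (K := K) hϖ
  rw [mem_apartmentLattice hϖ, ← zpow_mem_range_iff (K := K) hϖ]
  constructor
  · intro h
    have := h k
    simp only [map_smul, Module.Basis.repr_self, Finsupp.smul_single, smul_eq_mul, mul_one,
      Finsupp.single_eq_same] at this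
    rwa [zpow_add₀ hp]
  · intro h j
    by_cases hj : j = k
    · subst hj
      simp only [map_smul, Module.Basis.repr_self, Finsupp.smul_single, smul_eq_mul, mul_one,
        Finsupp.single_eq_same]
      rwa [← zpow_add₀ hp]
    · refine ⟨0, ?_⟩
      simp [Ne.symm hj]

namespace LatticeConfig

theorem exp_le_iff_of_eq_apartmentLattice (hϖ : Irreducible ϖ) (hd : 0 < d) {u v : I}
    (hu : Γ.L u = apartmentLattice ϖ e a) (hv : Γ.L v = apartmentLattice ϖ e b) {m : ℤ} :
    Γ.exp ϖ u v ≤ m ↔ ∀ k, a k - m ≤ b k := by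
  have hp := algebraMap_uniformizer_ne_zero (K := K) hϖ
  rw [exp_le_iff hϖ hd]
  constructor
  · intro h k
    have h1 := h (algebraMap R K ϖ ^ (-a k) • e k) (by
      rw [hu, zpow_smul_mem_apartmentLattice hϖ]; omega)
    rw [smul_smul, ← zpow_add₀ hp, hv, zpow_smul_mem_apartmentLattice hϖ] at h1
    omega
  · intro h x hx
    rw [hu, mem_apartmentLattice hϖ] at hx
    rw [hv, mem_apartmentLattice hϖ]
    intro k
    obtain ⟨r, hr⟩ := hx k
    obtain ⟨s, hs⟩ := zpow_mem_range (K := K) (ϖ := ϖ) (b k + m - a k) (by have := h k; omega)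
    refine ⟨s * r, ?_⟩
    rw [map_mul, hr, hs, map_smul, Finsupp.smul_apply, smul_eq_mul, ← mul_assoc, ← mul_assoc,
      ← zpow_add₀ hp, ← zpow_add₀ hp]
    congr 2
    ring

theorem exists_exp_eq (hϖ : Irreducible ϖ) (hd : 0 < d) {u v : I}
    (hu : Γ.L u = apartmentLattice ϖ e a) (hv : Γ.L v = apartmentLattice ϖ e b) :
    ∃ k, b k = a k - Γ.exp ϖ u v := by
  by_contra hh
  push Not at hh
  have h1 := (exp_le_iff_of_eq_apartmentLattice hϖ hd hu hv).mp le_rfl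
  have h2 := (exp_le_iff_of_eq_apartmentLattice hϖ hd hu hv (m := Γ.exp ϖ u v - 1)).mpr fun k => by
    have := h1 k
    have := hh k
    omega
  omega

/-- The generators of `L_v` given by an apartment. -/
noncomputable def gen {v : I} (hϖ : Irreducible ϖ) (hv : Γ.L v = apartmentLattice ϖ e a) (k : Fin d) : Γ.L v :=
  ⟨algebraMap R K ϖ ^ (-a k) • e k, by rw [hv, zpow_smul_mem_apartmentLattice hϖ]; omega⟩

variable {u v : I}

theorem residue_smul (r : R) (y : Γ.Lbar v) : residue R r • y = r • y := by
  rw [← IsLocalRing.ResidueField.algebraMap_eq, algebraMap_smul]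

theorem linearIndependent_red_gen (hϖ : Irreducible ϖ) (hv : Γ.L v = apartmentLattice ϖ e a) :
    LinearIndependent (ResidueField R) fun k => Γ.red v (gen hϖ hv k) := by
  have hp := algebraMap_uniformizer_ne_zero (K := K) hϖ
  rw [Fintype.linearIndependent_iff]
  intro c hc k
  choose r hr using fun k => IsLocalRing.residue_surjective (c k)
  have h1 : Γ.red v (∑ k, r k • gen hϖ hv k) = 0 := by
    rw [map_sum, ← hc]
    refine Finset.sum_congr rfl fun k _ => ?_
    rw [map_smul, ← hr, residue_smul]
  rw [red_eq_zero_iff hϖ] at h1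
  have h2 := (mem_apartmentLattice hϖ).mp (hv.le h1) k
  rw [← hr k, residue_eq_zero_iff_zpow_mul_mem_range (K := K) hϖ]
  convert h2 using 1
  have h3 : ((∑ k, r k • gen hϖ hv k : Γ.L v) : Fin d → K) =
      ∑ k, (algebraMap R K (r k) * algebraMap R K ϖ ^ (-a k)) • e k := by
    simp only [AddSubmonoidClass.coe_finsetSum, Submodule.coe_smul, gen, mul_smul, algebraMap_smul]
  rw [h3, map_smul, Finsupp.smul_apply, smul_eq_mul, Module.Basis.repr_sum_self, zpow_neg (_ : K) (a k)]
  field_simp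

/-- The basis of `L_v / ϖ L_v` given by an apartment. -/
noncomputable def redBasis (hϖ : Irreducible ϖ) (hd : 0 < d) (hv : Γ.L v = apartmentLattice ϖ e a) :
    Module.Basis (Fin d) (ResidueField R) (Γ.Lbar v) :=
  haveI : Nonempty (Fin d) := ⟨⟨0, hd⟩⟩
  basisOfLinearIndependentOfCardEqFinrank (linearIndependent_red_gen hϖ hv)
    (by rw [Fintype.card_fin, finrank_Lbar])

theorem redBasis_apply (hϖ : Irreducible ϖ) (hd : 0 < d) (hv : Γ.L v = apartmentLattice ϖ e a)
    (k : Fin d) : redBasis hϖ hd hv k = Γ.red v (gen hϖ hv k) := by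
  simp [redBasis]

theorem redBasis_repr (hϖ : Irreducible ϖ) (hd : 0 < d) (hv : Γ.L v = apartmentLattice ϖ e a)
    (x : Γ.L v) : ∃ r : Fin d → R,
      (∀ k, algebraMap R K (r k) = algebraMap R K ϖ ^ a k * e.repr (x : Fin d → K) k) ∧
      ∀ k, (redBasis hϖ hd hv).repr (Γ.red v x) k = residue R (r k) := by
  have hp := algebraMap_uniformizer_ne_zero (K := K) hϖ
  have h1 : (x : Fin d → K) ∈ apartmentLattice ϖ e a := hv ▸ x.2
  rw [mem_apartmentLattice hϖ] at h1
  choose r hr using h1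
  refine ⟨r, hr, fun k => ?_⟩
  have h2 : x = ∑ k, r k • gen hϖ hv k := by
    refine Subtype.ext ?_
    simp only [AddSubmonoidClass.coe_finsetSum, Submodule.coe_smul, gen]
    conv_lhs => rw [← e.sum_repr x]
    refine Finset.sum_congr rfl fun k _ => ?_
    rw [← algebraMap_smul K (r k), smul_smul, hr, mul_right_comm, ← zpow_add₀ hp, add_neg_cancel,
      zpow_zero, one_mul]
  have h3 : Γ.red v x = ∑ k, residue R (r k) • redBasis hϖ hd hv k := by
    conv_lhs => rw [h2]
    rw [map_sum]
    refine Finset.sum_congr rfl fun k _ => ?_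
    rw [map_smul, redBasis_apply, residue_smul]
  rw [h3, Module.Basis.repr_sum_self]

theorem f_redBasis (hϖ : Irreducible ϖ) (hd : 0 < d) (hu : Γ.L u = apartmentLattice ϖ e a)
    (hv : Γ.L v = apartmentLattice ϖ e b) (k : Fin d) :
    Γ.f ϖ u v (redBasis hϖ hd hu k) =
      if b k = a k - Γ.exp ϖ u v then redBasis hϖ hd hv k else 0 := by
  have hp := algebraMap_uniformizer_ne_zero (K := K) hϖ
  rw [redBasis_apply]
  split_ifs with hk
  · rw [redBasis_apply, f_red hϖ hd]
    congr 1
    refine Subtype.ext ?_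
    simp only [gen]
    rw [smul_smul, ← zpow_add₀ hp, hk]
    congr 2
    ring
  · rw [mem_ker_f_iff hϖ hd]
    simp only [gen]
    rw [smul_smul, ← zpow_add₀ hp, hv, zpow_smul_mem_apartmentLattice hϖ]
    have := (exp_le_iff_of_eq_apartmentLattice hϖ hd hu hv).mp le_rfl k
    omega

theorem mem_preimage {V : Submodule (ResidueField R) (Γ.Lbar v)} {y : Fin d → K} :
    y ∈ Γ.preimage v V ↔ ∃ h : y ∈ Γ.L v, Γ.red v ⟨y, h⟩ ∈ V := by
  unfold preimage
  rw [Submodule.mem_map]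
  constructor
  · rintro ⟨x, hx, rfl⟩
    exact ⟨x.2, hx⟩
  · rintro ⟨h, hy⟩
    exact ⟨⟨y, h⟩, hy, rfl⟩

theorem red_mem_span_iff (hϖ : Irreducible ϖ) (hd : 0 < d) (hv : Γ.L v = apartmentLattice ϖ e a)
    (hb : ∀ k, a k ≤ b k ∧ b k ≤ a k + 1) (x : Γ.L v) :
    Γ.red v x ∈ Submodule.span (ResidueField R) (redBasis hϖ hd hv '' {k | b k = a k + 1}) ↔
      (algebraMap R K ϖ)⁻¹ • (x : Fin d → K) ∈ apartmentLattice ϖ e b := by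
  have hp := algebraMap_uniformizer_ne_zero (K := K) hϖ
  obtain ⟨r, hr, hr'⟩ := redBasis_repr hϖ hd hv x
  rw [Module.Basis.mem_span_image, mem_apartmentLattice hϖ]
  have h0 : ∀ k, algebraMap R K ϖ ^ b k * e.repr ((algebraMap R K ϖ)⁻¹ • (x : Fin d → K)) k =
      algebraMap R K ϖ ^ (b k - a k - 1) * algebraMap R K (r k) := fun k => by
    rw [hr, map_smul, Finsupp.smul_apply, smul_eq_mul, ← mul_assoc, ← mul_assoc, ← zpow_neg_one,
      ← zpow_add₀ hp, ← zpow_add₀ hp]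
    congr 2
    ring
  constructor
  · intro h k
    rw [h0]
    by_cases hk : b k = a k + 1
    · exact ⟨r k, by rw [hk]; simp⟩
    · have h1 : b k = a k := by have := hb k; omega
      have h2 : k ∉ ((redBasis hϖ hd hv).repr (Γ.red v x)).support := fun hh => hk (h hh)
      rw [Finsupp.notMem_support_iff, hr', residue_eq_zero_iff_zpow_mul_mem_range (K := K) hϖ] at h2
      rwa [h1, sub_self, zero_sub]
  · intro h k hk
    by_contra hne
    have h1 : b k = a k := by
      have := hb k
      simp only [Set.mem_ofPred_eq] at hne
      omega
    have h2 := h k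
    rw [h0, h1, sub_self, zero_sub, ← residue_eq_zero_iff_zpow_mul_mem_range hϖ, ← hr'] at h2
    exact (Finsupp.mem_support_iff.mp hk) h2

theorem inv_smul_preimage_eq_iff (hϖ : Irreducible ϖ) (hd : 0 < d)
    (hv : Γ.L v = apartmentLattice ϖ e a) (hb : ∀ k, a k ≤ b k ∧ b k ≤ a k + 1)
    {V : Submodule (ResidueField R) (Γ.Lbar v)} :
    (algebraMap R K ϖ)⁻¹ • Γ.preimage v V = apartmentLattice ϖ e b ↔
      V = Submodule.span (ResidueField R) (redBasis hϖ hd hv '' {k | b k = a k + 1}) := by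
  have hp := algebraMap_uniformizer_ne_zero (K := K) hϖ
  constructor
  · intro h
    ext y
    obtain ⟨x, rfl⟩ := Γ.red_surjective v y
    rw [red_mem_span_iff hϖ hd hv hb, ← h, mem_smul_iff (inv_ne_zero hp), inv_inv,
      smul_inv_smul₀ hp, mem_preimage]
    exact ⟨fun hh => ⟨x.2, hh⟩, fun ⟨_, hh⟩ => hh⟩
  · rintro rfl
    ext y
    rw [mem_smul_iff (inv_ne_zero hp), inv_inv, mem_preimage]
    constructor
    · rintro ⟨h1, h2⟩
      rw [red_mem_span_iff hϖ hd hv hb] at h2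
      rwa [inv_smul_smul₀ hp] at h2
    · intro h
      have h1 : algebraMap R K ϖ • y ∈ Γ.L v := by
        rw [hv, mem_apartmentLattice hϖ]
        rw [mem_apartmentLattice hϖ] at h
        intro k
        obtain ⟨r, hr⟩ := h k
        obtain ⟨s, hs⟩ := zpow_mem_range (K := K) (ϖ := ϖ) (a k + 1 - b k)
          (by have := hb k; omega)
        refine ⟨s * r, ?_⟩
        rw [map_mul, hr, hs, map_smul, Finsupp.smul_apply, smul_eq_mul, ← mul_assoc, ← mul_assoc,
          ← zpow_add₀ hp, ← zpow_add_one₀ hp]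
        congr 2
        ring
      refine ⟨h1, ?_⟩
      rw [red_mem_span_iff hϖ hd hv hb]
      rwa [inv_smul_smul₀ hp]

open ExtAffineWeyl in
-- Both sides count the `k` with `c k = a k + 1` and `b k = a k - n u v`: these basis vectors lie in
-- the subspace and survive, and these are the coordinates where `c` exceeds `b + n u v`, by one.
theorem finrank_map_f (hϖ : Irreducible ϖ) (hd : 0 < d) (hu : Γ.L u = apartmentLattice ϖ e a)
    (hv : Γ.L v = apartmentLattice ϖ e b) {c : Fin d → ℤ} (hc : ∀ k, a k ≤ c k ∧ c k ≤ a k + 1) :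
    (Module.finrank (ResidueField R) ((Submodule.span (ResidueField R)
      (redBasis hϖ hd hu '' {k | c k = a k + 1})).map (Γ.f ϖ u v)) : ℤ) =
      excess c fun k => b k + Γ.exp ϖ u v := by
  classical
  have h1 : (Submodule.span (ResidueField R)
      (redBasis hϖ hd hu '' {k | c k = a k + 1})).map (Γ.f ϖ u v) =
      Submodule.span (ResidueField R) (redBasis hϖ hd hv ''
        {k | c k = a k + 1 ∧ b k = a k - Γ.exp ϖ u v}) := by
    rw [Submodule.map_span, Set.image_image]
    apply le_antisymm
    · rw [Submodule.span_le]
      rintro _ ⟨k, hk, rfl⟩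
      change Γ.f ϖ u v _ ∈ _
      rw [f_redBasis hϖ hd hu hv]
      split_ifs with hh
      · exact Submodule.subset_span ⟨k, ⟨hk, hh⟩, rfl⟩
      · exact zero_mem _
    · rw [Submodule.span_le]
      rintro _ ⟨k, ⟨hk, hh⟩, rfl⟩
      exact Submodule.subset_span ⟨k, hk, (f_redBasis hϖ hd hu hv k).trans (if_pos hh)⟩
  have h2 := finrank_span_eq_card ((redBasis hϖ hd hv).linearIndependent.comp
    (Subtype.val : {k | c k = a k + 1 ∧ b k = a k - Γ.exp ϖ u v} → Fin d) Subtype.val_injective)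
  rw [Set.range_comp, Subtype.range_val] at h2
  rw [h1, h2, Fintype.card_subtype,
    Finset.card_filter, excess]
  push_cast
  refine Finset.sum_congr rfl fun k _ => ?_
  have h2 := (exp_le_iff_of_eq_apartmentLattice hϖ hd hu hv).mp le_rfl k
  have h3 := hc k
  simp only [Set.mem_ofPred_eq]
  split_ifs with hk <;> omega

end LatticeConfig

end Apartment

end LinkedGrassmannian

namespace LinkedGrassmannian

/-! ### Simplices, change of apartment -/

section Apartment

variable {R K : Type*} [CommRing R] [IsDomain R] [IsDiscreteValuationRing R] [Field K]
  [Algebra R K] [IsFractionRing R K] {ϖ : R} {d : ℕ} {I : Type*} {Γ : LatticeConfig R K d I}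

open IsLocalRing (ResidueField residue)

namespace LatticeConfig

theorem adjacent_iff (hϖ : Irreducible ϖ) (hd : 0 < d) {u v : I} (huv : u ≠ v) :
    Adjacent ϖ (Γ.L u) (Γ.L v) ↔ Adj (Γ.exp ϖ) u v := by
  have hp := algebraMap_uniformizer_ne_zero (K := K) hϖ
  have hpos := (isLinkMetric (Γ := Γ) hϖ hd).pos u v huv
  unfold Adj
  constructor
  · rintro ⟨N₁, N₂, h1, h2, h3, h4⟩
    obtain ⟨i, hi⟩ := h1.exists_zpow hϖ
    obtain ⟨j, hj⟩ := h2.exists_zpow hϖ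
    have h5 : Γ.exp ϖ u v ≤ -i + 1 + j := (exp_le_iff hϖ hd).mpr fun x hx => by
      have h6 : algebraMap R K ϖ ^ (-i) • x ∈ N₁ := by
        rwa [hi, smul_smul, ← zpow_add₀ hp, add_neg_cancel, zpow_zero, one_smul]
      have h7 := h3 (Submodule.smul_mem_pointwise_smul _ (algebraMap R K ϖ) _ h6)
      rw [hj] at h7
      convert h7 using 1
      rw [smul_smul, smul_smul, ← zpow_add_one₀ hp, ← zpow_add₀ hp]
      congr 2
      ring
    have h6 : Γ.exp ϖ v u ≤ -j + i := (exp_le_iff hϖ hd).mpr fun x hx => by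
      have h7 : algebraMap R K ϖ ^ (-j) • x ∈ N₂ := by
        rwa [hj, smul_smul, ← zpow_add₀ hp, add_neg_cancel, zpow_zero, one_smul]
      have h8 := h4 h7
      rw [hi, smul_smul, ← zpow_add₀ hp] at h8
      rwa [add_comm]
    omega
  · intro h
    refine ⟨Γ.L u, algebraMap R K ϖ ^ Γ.exp ϖ v u • Γ.L v, ⟨1, one_ne_zero, by simp⟩,
      homothetic_zpow_smul hϖ _ _, ?_, ?_⟩
    · intro x hx
      rw [mem_smul_iff hp] at hx
      rw [mem_smul_iff (zpow_ne_zero _ hp)]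
      have h1 := zpow_exp_smul_mem hϖ hd (v := v) hx
      convert h1 using 1
      rw [smul_smul, ← zpow_neg_one, ← zpow_neg_one, ← zpow_add₀ hp, ← zpow_mul]
      congr 2
      omega
    · intro x hx
      rw [mem_smul_iff (zpow_ne_zero _ hp)] at hx
      have h1 := zpow_exp_smul_mem hϖ hd (v := u) hx
      rwa [smul_inv_smul₀ (zpow_ne_zero _ hp)] at h1

theorem MaxSimplex.adj (hϖ : Irreducible ϖ) (hd : 0 < d) (τ : Γ.MaxSimplex ϖ) :
    ∀ u ∈ τ.1, ∀ v ∈ τ.1, u ≠ v → Adj (Γ.exp ϖ) u v := fun u hu v hv huv =>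
  (adjacent_iff hϖ hd huv).mp (τ.2.prop.2 u hu v hv huv)

theorem exists_maxSimplex [Finite I] (hϖ : Irreducible ϖ) (hd : 0 < d) {u v : I}
    (huv : Adj (Γ.exp ϖ) u v) : ∃ τ : Γ.MaxSimplex ϖ, u ∈ τ.1 ∧ v ∈ τ.1 := by
  have hne := (isLinkMetric (Γ := Γ) hϖ hd).adj_ne huv
  have h1 : Γ.IsSimplex ϖ {u, v} := by
    refine ⟨⟨u, by simp⟩, ?_⟩
    rintro x (rfl | rfl) y (rfl | rfl) hxy
    · exact absurd rfl hxy
    · exact (adjacent_iff hϖ hd hne).mpr huv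
    · exact (adjacent_iff hϖ hd hne.symm).mpr huv.symm
    · exact absurd rfl hxy
  obtain ⟨τ, hle, hτ⟩ := (Set.toFinite {τ : Set I | Γ.IsSimplex ϖ τ}).exists_le_maximal h1
  exact ⟨⟨τ, hτ⟩, hle (by simp), hle (by simp)⟩

/-- Vectors that span the reductions of some lattices span these lattices. -/
theorem exists_basis_of_span_red {τ : Set I} (hne : τ.Nonempty) (x : Fin d → Fin d → K)
    (a : I → Fin d → ℤ) (h : ∀ v ∈ τ, ∃ y : Fin d → Γ.L v,
      (∀ k, (y k : Fin d → K) = algebraMap R K ϖ ^ (-a v k) • x k) ∧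
      ⊤ ≤ Submodule.span (ResidueField R) (Set.range fun k => Γ.red v (y k))) :
    ∃ e : Module.Basis (Fin d) K (Fin d → K), (∀ k, e k = x k) ∧
      ∀ v ∈ τ, Γ.L v = apartmentLattice ϖ e (a v) := by
  have h1 : ∀ v ∈ τ, Γ.L v =
      Submodule.span R (Set.range fun k => algebraMap R K ϖ ^ (-a v k) • x k) := fun v hv => by
    obtain ⟨y, hy, hsp⟩ := h v hv
    have := Γ.isLattice v
    have : Module.Finite R (Γ.L v) := Module.Finite.iff_fg.mpr Submodule.IsLattice.fg
    -- Nakayama's lemma.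
    have h2 := IsLocalRing.span_eq_top_of_tmul_eq_basis (R := R) y
      (basisOfTopLeSpanOfCardEqFinrank _ hsp (by rw [Fintype.card_fin, finrank_Lbar]))
      fun k => by rw [coe_basisOfTopLeSpanOfCardEqFinrank]; rfl
    have h3 := congrArg (Submodule.map (Γ.L v).subtype) h2
    rw [Submodule.map_span, Submodule.map_top, Submodule.range_subtype, ← Set.range_comp] at h3
    rw [← h3]
    congr 2
    funext k
    exact hy k
  obtain ⟨v, hv⟩ := hne
  have h2 : ⊤ ≤ Submodule.span K (Set.range x) := by
    have := Γ.isLattice v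
    rw [← Submodule.IsLattice.span_eq_top (A := K) (M := Γ.L v), Submodule.span_le]
    intro z hz
    rw [SetLike.mem_coe, h1 v hv] at hz
    refine Submodule.span_induction ?_ (zero_mem _) (fun _ _ _ _ => add_mem) ?_ hz
    · rintro _ ⟨k, rfl⟩
      exact Submodule.smul_mem _ _ (Submodule.subset_span ⟨k, rfl⟩)
    · intro r y _ hy
      rw [← algebraMap_smul K r]
      exact Submodule.smul_mem _ _ hy
  refine ⟨basisOfTopLeSpanOfCardEqFinrank x h2 (by simp), fun k => by simp, fun v hv => ?_⟩
  rw [h1 v hv, apartmentLattice]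
  simp

end LatticeConfig

variable {e e' : Module.Basis (Fin d) K (Fin d → K)} {a : Fin d → ℤ}

/-- Conjugation by a diagonal matrix of powers of `ϖ` makes the matrix integral and keeps the
determinant. -/
theorem det_toMatrix_mem_range (hϖ : Irreducible ϖ)
    (h : apartmentLattice ϖ e' a ≤ apartmentLattice ϖ e a) :
    (e.toMatrix e').det ∈ Set.range (algebraMap R K) := by
  have hp := algebraMap_uniformizer_ne_zero (K := K) hϖ
  have h1 : ∀ i j, algebraMap R K ϖ ^ a i * e.toMatrix e' i j * algebraMap R K ϖ ^ (-a j) ∈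
      Set.range (algebraMap R K) := fun i j => by
    have h2 := h ((zpow_smul_mem_apartmentLattice hϖ (m := -a j) (k := j)).mpr (by omega))
    have h3 := (mem_apartmentLattice hϖ).mp h2 i
    rw [map_smul, Finsupp.smul_apply, smul_eq_mul] at h3
    rw [Module.Basis.toMatrix_apply, mul_assoc, mul_comm (e.repr _ _)]
    exact h3
  choose B hB using h1
  refine ⟨(Matrix.of B).det, ?_⟩
  have h4 : (algebraMap R K).mapMatrix (Matrix.of B) =
      Matrix.diagonal (fun i => algebraMap R K ϖ ^ a i) * e.toMatrix e' *
        Matrix.diagonal (fun i => algebraMap R K ϖ ^ (-a i)) := by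
    ext i j
    rw [Matrix.mul_diagonal, Matrix.diagonal_mul]
    exact hB i j
  rw [RingHom.map_det, h4, Matrix.det_mul, Matrix.det_mul, Matrix.det_diagonal,
    Matrix.det_diagonal, mul_right_comm, ← Finset.prod_mul_distrib]
  rw [Finset.prod_congr rfl fun i _ => by rw [← zpow_add₀ hp, add_neg_cancel, zpow_zero],
    Finset.prod_const_one, one_mul]

/-- Two apartments that contain a lattice with the same coordinates are translates of each other under
the special linear group. -/
theorem exists_slTranslate_eq (hϖ : Irreducible ϖ) (hd : 0 < d)
    (h : apartmentLattice ϖ e a = apartmentLattice ϖ e' a) :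
    ∃ p : Matrix.SpecialLinearGroup (Fin d) K, ∀ c : Fin d → ℤ,
      slTranslate p (apartmentLattice ϖ e c) = apartmentLattice ϖ e' c := by
  classical
  set D := (e.toMatrix e').det with hD
  have hmul : D * (e'.toMatrix e).det = 1 := by
    rw [← Matrix.det_mul, Module.Basis.toMatrix_mul_toMatrix_flip, Matrix.det_one]
  have hD0 : D ≠ 0 := left_ne_zero_of_mul_eq_one hmul
  have hDR : D ∈ Set.range (algebraMap R K) := det_toMatrix_mem_range hϖ h.ge
  have hDR' : D⁻¹ ∈ Set.range (algebraMap R K) := by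
    rw [← eq_inv_of_mul_eq_one_right hmul]
    exact det_toMatrix_mem_range hϖ h.le
  let o : Fin d := ⟨0, hd⟩
  -- One basis vector is rescaled by `D⁻¹` to reach determinant one. As `D` is a unit of `R`, no
  -- lattice of the apartment changes.
  let w : Fin d → K := fun k => if k = o then D⁻¹ else 1
  have hw : ∀ k, w k ≠ 0 := fun k => by
    simp only [w]
    split_ifs
    exacts [inv_ne_zero hD0, one_ne_zero]
  have hwR : ∀ k, w k ∈ Set.range (algebraMap R K) := fun k => by
    simp only [w]
    split_ifs
    exacts [hDR', ⟨1, map_one _⟩]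
  have hwR' : ∀ k, (w k)⁻¹ ∈ Set.range (algebraMap R K) := fun k => by
    simp only [w]
    split_ifs
    exacts [by rwa [inv_inv], ⟨1, by simp⟩]
  let f : (Fin d → K) →ₗ[K] (Fin d → K) := e.constr K fun k => w k • e' k
  have hf : ∀ k, f (e k) = w k • e' k := fun k => e.constr_basis K _ k
  have hdet : (LinearMap.toMatrix' f).det = 1 := by
    rw [LinearMap.det_toMatrix', ← LinearMap.det_toMatrix e]
    have h1 : LinearMap.toMatrix e e f = Matrix.of fun i j => w j * e.toMatrix e' i j := by
      ext i j
      rw [LinearMap.toMatrix_apply, hf, map_smul]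
      rfl
    rw [h1, Matrix.det_mul_row, ← hD, Finset.prod_ite_eq' Finset.univ o, if_pos (Finset.mem_univ _),
      inv_mul_cancel₀ hD0]
  refine ⟨⟨LinearMap.toMatrix' f, hdet⟩, fun c => ?_⟩
  unfold slTranslate apartmentLattice
  rw [Submodule.map_span, ← Set.range_comp]
  have h2 : ∀ k, ((Matrix.toLin' (LinearMap.toMatrix' f)).restrictScalars R)
      (algebraMap R K ϖ ^ (-c k) • e k) = algebraMap R K ϖ ^ (-c k) • w k • e' k := fun k => by
    rw [Matrix.toLin'_toMatrix', LinearMap.restrictScalars_apply, map_smul, hf]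
  apply le_antisymm
  · rw [Submodule.span_le]
    rintro _ ⟨k, rfl⟩
    rw [Function.comp_apply]
    change ((Matrix.toLin' (LinearMap.toMatrix' f)).restrictScalars R) _ ∈ _
    rw [h2, smul_comm]
    exact smul_mem_of_mem_range (hwR k) (Submodule.subset_span ⟨k, rfl⟩)
  · rw [Submodule.span_le]
    rintro _ ⟨k, rfl⟩
    have h3 := smul_mem_of_mem_range (hwR' k)
      (Submodule.subset_span (R := R) (s := Set.range ((((Matrix.toLin' (LinearMap.toMatrix' f)).restrictScalars R)) ∘
        fun k => algebraMap R K ϖ ^ (-c k) • e k)) ⟨k, rfl⟩)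
    rw [Function.comp_apply, h2, smul_comm, inv_smul_smul₀ (hw k)] at h3
    exact h3

theorem exists_apartmentLattice_eq_slTranslate (p : Matrix.SpecialLinearGroup (Fin d) K) :
    ∃ e' : Module.Basis (Fin d) K (Fin d → K), ∀ c : Fin d → ℤ,
      slTranslate p (apartmentLattice ϖ e c) = apartmentLattice ϖ e' c := by
  refine ⟨e.map (Matrix.SpecialLinearGroup.toLin' p), fun c => ?_⟩
  unfold slTranslate apartmentLattice
  rw [Submodule.map_span, ← Set.range_comp]
  congr 2
  funext k
  simp
  rfl

/-- The Weyl group acts by monomial changes of the basis: a permutation and powers of `ϖ`. -/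
theorem exists_apartmentLattice_smul_eq (hϖ : Irreducible ϖ) (w : ExtAffineWeyl d) :
    ∃ e' : Module.Basis (Fin d) K (Fin d → K), ∀ c : Fin d → ℤ,
      apartmentLattice ϖ e (w • c) = apartmentLattice ϖ e' c := by
  have hp := algebraMap_uniformizer_ne_zero (K := K) hϖ
  let e₁ := e.unitsSMul fun k => Units.mk0 (algebraMap R K ϖ ^ (-w.trans k)) (zpow_ne_zero _ hp)
  refine ⟨e₁.reindex w.perm.symm, fun c => ?_⟩
  unfold apartmentLattice
  congr 1
  rw [← w.perm.surjective.range_comp]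
  congr 1
  funext k
  rw [Function.comp_apply, Module.Basis.reindex_apply, Module.Basis.unitsSMul_apply, Equiv.symm_symm,
    Units.smul_mk0, smul_smul, ← zpow_add₀ hp]
  congr 2
  change -(c (w.perm⁻¹ (w.perm k)) + w.trans (w.perm k)) = _
  rw [show w.perm⁻¹ (w.perm k) = k from w.perm.symm_apply_apply k]
  ring

end Apartment

end LinkedGrassmannian

namespace LinkedGrassmannian

/-! ### Generators of a sub-representation relative to a simplex -/

section Relative

variable {κ : Type*} [Field κ] {I : Type*} {W : I → Type*} [∀ v, AddCommGroup (W v)]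
  [∀ v, Module κ (W v)] {n : I → I → ℤ} {f : ∀ u v, W u →ₗ[κ] W v} {S : I → Set I}

/-- A remainder in `rad s` comes from another vertex `w` of `τ`, and its image in `W q` is zero
unless `s` lies between `w` and `q`; so induction from the far vertices applies. -/
theorem Linked.le_span_of_rad [Finite I] (h : Linked n f S) {τ : Set I} (rad : ∀ s, Submodule κ (W s))
    (hrad : ∀ s ∈ τ, (∃ w ∈ τ, w ≠ s ∧ rad s = LinearMap.range (f w s)) ∨ rad s = ⊥)
    {q : I} (U : Submodule κ (W q)) (A : Set (W q)) (hA : A ⊆ U)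
    (hU : ∀ s ∈ τ, ∀ z, f s q z ∈ U → ∃ y, f s q y ∈ Submodule.span κ A ∧ z - y ∈ rad s)
    {s : I} (hs : s ∈ τ) (z : W s) (hz : f s q z ∈ U) : f s q z ∈ Submodule.span κ A := by
  induction s using (h.wellFounded_left q).induction with
  | _ s ih =>
    obtain ⟨y, hy, hzy⟩ := hU s hs z hz
    have hyU : f s q y ∈ U := Submodule.span_le.mpr hA hy
    suffices h1 : f s q (z - y) ∈ Submodule.span κ A by
      have := add_mem h1 hy
      rwa [map_sub, sub_add_cancel] at this
    have h2 : f s q (z - y) ∈ U := by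
      rw [map_sub]
      exact sub_mem hz hyU
    rcases hrad s hs with ⟨w, hw, hws, hr⟩ | hr
    · rw [hr] at hzy
      obtain ⟨z', hz'⟩ := hzy
      rw [← hz'] at h2 ⊢
      by_cases hb : Btw n w s q
      · rw [h.apply_apply hb] at h2 ⊢
        exact ih w ⟨hb, hws⟩ hw z' h2
      · rw [h.apply_apply_zero hb]
        exact zero_mem _
    · rw [hr, Submodule.mem_bot] at hzy
      rw [hzy, LinearMap.map_zero]
      exact zero_mem _

/-- At each `s ∈ τ` take a basis of `W s` modulo `rad s` adapted to the preimages of the `V q`, `q ∈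
τ`. -/
theorem Linked.exists_relative_generators [Finite I] [∀ v, FiniteDimensional κ (W v)]
    (h : Linked n f S) {V : ∀ v, Submodule κ (W v)} (hV : ∀ u v, (V u).map (f u v) ≤ V v)
    {τ : Set I} (hτ : ∀ u ∈ τ, ∀ v ∈ τ, u ≠ v → Adj n u v) {d : ℕ} {σ : Fin d → I}
    (rad : ∀ s, Submodule κ (W s))
    (hrad : ∀ s ∈ τ, (∃ w ∈ τ, w ≠ s ∧ rad s = LinearMap.range (f w s)) ∨ rad s = ⊥)
    (hcard : ∀ s ∈ τ, Module.finrank κ (W s) - Module.finrank κ (rad s) = Nat.card {k // σ k = s}) :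
    ∃ x : ∀ k, W (σ k), ∀ q ∈ τ,
      ⊤ ≤ Submodule.span κ (Set.range fun k => f (σ k) q (x k)) ∧
      V q ≤ Submodule.span κ ((fun k => f (σ k) q (x k)) '' {k | f (σ k) q (x k) ∈ V q}) := by
  have h1 : ∀ s, ∃ x : {k // σ k = s} → W s, s ∈ τ →
      (∀ z, ∃ y ∈ Submodule.span κ (Set.range x), z - y ∈ rad s) ∧
      ∀ q ∈ τ, ∀ z, f s q z ∈ V q →
        ∃ y ∈ Submodule.span κ (x '' {i | f s q (x i) ∈ V q}), z - y ∈ rad s := by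
    intro s
    by_cases hs : s ∈ τ
    · obtain ⟨x, -, -, hx1, hx2⟩ := exists_relative_flag (A := ⊤) (B := rad s) le_top
        (fun q : τ => (V q).comap (f s q)) (fun _ => le_top)
        (fun q q' => by
          -- These preimages form a chain, since of two adjacent vertices one lies between `s` and
          -- the other.
          have hle : ∀ a b : I, Btw n s a b → (V a).comap (f s a) ≤ (V b).comap (f s b) :=
            fun a b hb z hz => by
              rw [Submodule.mem_comap, ← h.apply_apply hb]
              exact hV a b ⟨_, hz, rfl⟩
          by_cases hqq : (q : I) = q'
          · rw [hqq]
            exact Or.inl le_rfl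
          · exact (h.adj_btw_or (hτ q q.2 q' q'.2 hqq) s).imp (hle _ _) (hle _ _))
        (n := Nat.card {k // σ k = s}) (by rw [finrank_top, hcard s hs]) _ (fun _ => rfl)
      have e : {k // σ k = s} ≃ Fin (Nat.card {k // σ k = s}) := Finite.equivFin _
      refine ⟨x ∘ e, fun _ => ⟨fun z => ?_, fun q hq z hz => ?_⟩⟩
      · obtain ⟨b, hb, y, hy, hby⟩ := Submodule.mem_sup.mp (hx1 (Submodule.mem_top (x := z)))
        refine ⟨y, by rwa [e.surjective.range_comp], ?_⟩
        rwa [← hby, add_sub_cancel_right]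
      · obtain ⟨b, hb, y, hy, hby⟩ := Submodule.mem_sup.mp ((hx2 ⟨q, hq⟩).2 hz)
        refine ⟨y, Submodule.span_mono ?_ hy, by rwa [← hby, add_sub_cancel_right]⟩
        rintro _ ⟨j, hj, rfl⟩
        refine ⟨e.symm j, ?_, by simp⟩
        have := (hx2 ⟨q, hq⟩).1 j hj
        simpa using this
    · exact ⟨0, fun hh => absurd hh hs⟩
  choose x hx using h1
  have hx' : ∀ (s q : I) (i : {k // σ k = s}), f s q (x s i) = f (σ i) q (x (σ i) ⟨i, rfl⟩) := by
    rintro s q ⟨k, rfl⟩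
    rfl
  refine ⟨fun k => x (σ k) ⟨k, rfl⟩, fun q hq => ⟨fun z _ => ?_, fun z hz => ?_⟩⟩
  · have h2 := h.le_span_of_rad rad hrad (q := q) ⊤
      (Set.range fun k => f (σ k) q (x (σ k) ⟨k, rfl⟩)) (Set.subset_univ _) (fun s hs z _ => by
        obtain ⟨y, hy, hzy⟩ := (hx s hs).1 z
        refine ⟨y, ?_, hzy⟩
        have h3 := Submodule.mem_map_of_mem (f := f s q) hy
        rw [Submodule.map_span] at h3
        refine Submodule.span_mono ?_ h3
        rintro _ ⟨_, ⟨i, rfl⟩, rfl⟩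
        exact ⟨i, (hx' s q i).symm⟩) hq z trivial
    rwa [h.map_self] at h2
  · have h2 := h.le_span_of_rad rad hrad (V q)
      ((fun k => f (σ k) q (x (σ k) ⟨k, rfl⟩)) '' {k | f (σ k) q (x (σ k) ⟨k, rfl⟩) ∈ V q})
      (by rintro _ ⟨k, hk, rfl⟩; exact hk) (fun s hs z hz => by
        obtain ⟨y, hy, hzy⟩ := (hx s hs).2 q hq z hz
        refine ⟨y, ?_, hzy⟩
        have h3 := Submodule.mem_map_of_mem (f := f s q) hy
        rw [Submodule.map_span] at h3
        refine Submodule.span_mono ?_ h3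
        rintro _ ⟨_, ⟨i, hi, rfl⟩, rfl⟩
        refine ⟨i, ?_, (hx' s q i).symm⟩
        rw [Set.mem_ofPred_eq, hx'] at hi
        exact hi) hq z (by rw [h.map_self]; exact hz)
    rwa [h.map_self] at h2

end Relative

end LinkedGrassmannian

namespace LinkedGrassmannian

/-! ### Existence of apartments, relative position with respect to a simplex -/

section Position

variable {R K : Type*} [CommRing R] [IsDomain R] [IsDiscreteValuationRing R] [Field K]
  [Algebra R K] [IsFractionRing R K] {ϖ : R} {d : ℕ} {I : Type*} [Finite I]
  {Γ : LatticeConfig R K d I} {S : I → Set I}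

open IsLocalRing (ResidueField residue)

namespace LatticeConfig

/-- Vectors `x k` of the reductions of `L_{s k}` whose images form a basis of the reduction of every
`L_q` lift to a basis of `K ^ d` that is adapted to the lattices. -/
theorem exists_basis_of_span_f (hϖ : Irreducible ϖ) (hd : 0 < d) {τ : Set I} (hne : τ.Nonempty)
    (s : Fin d → I) (x : ∀ k, Γ.Lbar (s k)) (c : Fin d → ℤ)
    (h : ∀ q ∈ τ, ⊤ ≤ Submodule.span (ResidueField R)
      (Set.range fun k => Γ.f ϖ (s k) q (x k))) :
    ∃ e : Module.Basis (Fin d) K (Fin d → K), ∀ q ∈ τ,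
      ∃ hq : Γ.L q = apartmentLattice ϖ e (fun k => c k - Γ.exp ϖ (s k) q),
        ∀ k, redBasis hϖ hd hq k = Γ.f ϖ (s k) q (x k) := by
  have hp := algebraMap_uniformizer_ne_zero (K := K) hϖ
  choose X hX using fun k => Γ.red_surjective (s k) (x k)
  have h1 : ∀ (q : I) (k : Fin d),
      algebraMap R K ϖ ^ (-(c k - Γ.exp ϖ (s k) q)) • algebraMap R K ϖ ^ c k • (X k : Fin d → K) =
        algebraMap R K ϖ ^ Γ.exp ϖ (s k) q • (X k : Fin d → K) := fun q k => by
    rw [smul_smul, ← zpow_add₀ hp]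
    congr 2
    ring
  obtain ⟨e, he, hL⟩ := exists_basis_of_span_red (ϖ := ϖ) hne
    (fun k => algebraMap R K ϖ ^ c k • (X k : Fin d → K))
    (fun q k => c k - Γ.exp ϖ (s k) q) fun q hq =>
      ⟨fun k => ⟨_, zpow_exp_smul_mem hϖ hd (v := q) (X k).2⟩, fun k => (h1 q k).symm, by
        refine (h q hq).trans_eq ?_
        congr 2
        funext k
        rw [← hX, f_red hϖ hd]⟩
  refine ⟨e, fun q hq => ⟨hL q hq, fun k => ?_⟩⟩
  rw [redBasis_apply, ← hX, f_red hϖ hd]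
  congr 1
  refine Subtype.ext ?_
  simp only [gen]
  rw [he, h1]

theorem exists_inApartment (hϖ : Irreducible ϖ) (hd : 0 < d)
    (h : Linked (Γ.exp ϖ) (Γ.f ϖ) S) :
    ∃ (e : Module.Basis (Fin d) K (Fin d → K)) (a : I → Fin d → ℤ), Γ.InApartment ϖ e a := by
  rcases isEmpty_or_nonempty I with hI | ⟨⟨q₀⟩⟩
  · exact ⟨Pi.basisFun K (Fin d), fun _ _ => 0, fun v => isEmptyElim v⟩
  have := fun v => Γ.finiteDimensional_Lbar v
  obtain ⟨x, hx⟩ := h.exists_adaptedGens (V := fun _ => ⊤) (fun _ _ => le_top) rfl rfl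
  -- For `V = ⊤` the image of `V w` is all of `im f w u`, so every generator has class `none` and
  -- none is killed.
  have hzero : ∀ u (w : S u), genCount (Γ.f ϖ) S (fun _ => ⊤) u (some w) = 0 := fun u w => by
    refine Nat.sub_eq_zero_of_le (Submodule.finrank_mono ?_)
    refine inf_le_right.trans ?_
    rw [LinearMap.range_eq_map]
    exact le_rfl
  have hkill : ∀ q t, ¬ Killed (Γ.f ϖ) (killCount (Γ.f ϖ) S fun _ => ⊤)
      (δ := genCount (Γ.f ϖ) S fun _ => ⊤) t q := by
    rintro q ⟨u, o, j⟩ ⟨-, w, hw, -⟩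
    have h0 : genCount (Γ.f ϖ) S (fun _ => ⊤) u o = 0 := by
      rw [show o = some w from hw]
      exact hzero u w
    exact (Fin.cast h0 j).elim0
  obtain ⟨b, hb⟩ := hx.exists_basis h q₀
  have h1 : Nat.card {t : Σ u, Σ o : Option (S u), Fin (genCount (Γ.f ϖ) S (fun _ => ⊤) u o) //
      ¬ Killed (Γ.f ϖ) (killCount (Γ.f ϖ) S fun _ => ⊤) t q₀} = d := by
    rw [← Module.finrank_eq_nat_card_basis b, finrank_top, finrank_Lbar]
  have hfin : Finite {t : Σ u, Σ o : Option (S u), Fin (genCount (Γ.f ϖ) S (fun _ => ⊤) u o) //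
      ¬ Killed (Γ.f ϖ) (killCount (Γ.f ϖ) S fun _ => ⊤) t q₀} :=
    Nat.finite_of_card_ne_zero (by omega)
  let E := (Finite.equivFinOfCardEq h1).symm
  obtain ⟨e, he⟩ := exists_basis_of_span_f hϖ hd (τ := Set.univ) ⟨q₀, trivial⟩
    (fun k => (E k).1.1) (fun k => x _ _ (E k).1.2.2) 0 fun q _ => by
      have h2 := hx.span_eq h q
      rw [← h2, Submodule.span_le]
      rintro _ ⟨t, rfl⟩
      refine Submodule.subset_span ⟨E.symm ⟨t.1, hkill q₀ t.1⟩, ?_⟩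
      simp only
      rw [E.apply_symm_apply]
  exact ⟨e, _, fun v => (he v trivial).1⟩

variable {x : I → ℕ} {e : Module.Basis (Fin d) K (Fin d → K)} {a : I → Fin d → ℤ} {τ : Set I}

theorem isColumn (hϖ : Irreducible ϖ) (hd : 0 < d) (ha : ∀ v ∈ τ, Γ.L v = apartmentLattice ϖ e (a v))
    (k : Fin d) : IsColumn (Γ.exp ϖ) τ fun v => a v k := fun u hu v hv =>
  (exp_le_iff_of_eq_apartmentLattice hϖ hd (ha u hu) (ha v hv)).mp le_rfl k

/-- A point of the quiver Grassmannian and a simplex of an apartment have a common adapted basis. -/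
theorem exists_position (hϖ : Irreducible ϖ) (hd : 0 < d) (h : Linked (Γ.exp ϖ) (Γ.f ϖ) S)
    (M : QuiverGr Γ ϖ x) (hne : τ.Nonempty) (hτ : ∀ u ∈ τ, ∀ v ∈ τ, u ≠ v → Adj (Γ.exp ϖ) u v)
    (ha : ∀ v ∈ τ, Γ.L v = apartmentLattice ϖ e (a v)) :
    ∃ (e' : Module.Basis (Fin d) K (Fin d → K)) (b : I → Fin d → ℤ),
      (∀ v k, a v k ≤ b v k ∧ b v k ≤ a v k + 1) ∧
      ∀ v ∈ τ, ∃ hv : Γ.L v = apartmentLattice ϖ e' (a v), M.V v =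
        Submodule.span (ResidueField R) (redBasis hϖ hd hv '' {k | b v k = a v k + 1}) := by
  classical
  have hm := isLinkMetric (Γ := Γ) hϖ hd
  have := fun v => Γ.finiteDimensional_Lbar v
  have hV : ∀ u v, (M.V u).map (Γ.f ϖ u v) ≤ M.V v := (isSubrep_iff h).mp M.isSubrep
  choose σ hσ hσ' using fun k => (isColumn hϖ hd ha k).exists_source hm hne hτ
  -- The span of the coordinates with source other than `s`. It is the image from the last vertex of
  -- `τ` in the cyclic order starting at `s`, or zero if `τ = {s}`.
  let rad : ∀ s, Submodule (ResidueField R) (Γ.Lbar s) := fun s =>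
    if hs : s ∈ τ then Submodule.span (ResidueField R) (redBasis hϖ hd (ha s hs) '' {k | σ k ≠ s})
    else ⊥
  have hrad' : ∀ s (hs : s ∈ τ), rad s =
      Submodule.span (ResidueField R) (redBasis hϖ hd (ha s hs) '' {k | σ k ≠ s}) :=
    fun s hs => dif_pos hs
  have hrad : ∀ s ∈ τ, (∃ w ∈ τ, w ≠ s ∧ rad s = LinearMap.range (Γ.f ϖ w s)) ∨ rad s = ⊥ := by
    intro s hs
    obtain ⟨w, hw, hsw⟩ := exists_sink hm hτ hs
    by_cases hws : w = s
    · right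
      subst hws
      have h1 : {k | σ k ≠ w} = ∅ := Set.eq_empty_of_forall_notMem fun k hk =>
        hk (hm.eq_of_btw_self (hsw _ (hσ k)))
      rw [hrad' w hs, h1, Set.image_empty, Submodule.span_empty]
    · refine Or.inl ⟨w, hw, hws, ?_⟩
      have hA := hτ w hw s hs hws
      have h1 : ∀ k, σ k ≠ s ↔ a s k = a w k - Γ.exp ϖ w s := fun k => by
        have h2 := hσ' k w hw
        have h3 := hσ' k s hs
        have h4 := hsw _ (hσ k)
        unfold Btw at h4
        unfold Adj at hA
        constructor
        · intro hk
          have h5 := hτ _ (hσ k) s hs hk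
          unfold Adj at h5
          omega
        · rintro h6 h7
          rw [h7] at h2
          omega
      rw [hrad' s hs, LinearMap.range_eq_map, ← (redBasis hϖ hd (ha w hw)).span_eq,
        Submodule.map_span]
      apply le_antisymm <;> rw [Submodule.span_le]
      · rintro _ ⟨k, hk, rfl⟩
        refine Submodule.subset_span ⟨_, ⟨k, rfl⟩, ?_⟩
        rw [f_redBasis hϖ hd (ha w hw) (ha s hs), if_pos ((h1 k).mp hk)]
      · rintro _ ⟨_, ⟨k, rfl⟩, rfl⟩
        rw [f_redBasis hϖ hd (ha w hw) (ha s hs)]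
        split_ifs with hk
        · exact Submodule.subset_span ⟨k, (h1 k).mpr hk, rfl⟩
        · exact zero_mem _
  have hcard : ∀ s ∈ τ, Module.finrank (ResidueField R) (Γ.Lbar s) -
      Module.finrank (ResidueField R) (rad s) = Nat.card {k // σ k = s} := fun s hs => by
    have h2 := finrank_span_eq_card ((redBasis hϖ hd (ha s hs)).linearIndependent.comp
      (Subtype.val : {k | σ k ≠ s} → Fin d) Subtype.val_injective)
    rw [Set.range_comp, Subtype.range_val] at h2
    rw [hrad' s hs, h2, finrank_Lbar, Nat.card_eq_fintype_card]
    have h3 := Fintype.card_subtype_compl fun k => σ k = s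
    have h4 := Fintype.card_subtype_le fun k => σ k = s
    rw [Fintype.card_fin] at h3 h4
    change d - Fintype.card {k // ¬ σ k = s} = _
    omega
  obtain ⟨y, hy⟩ := h.exists_relative_generators hV hτ rad hrad hcard
  obtain ⟨e', he'⟩ := exists_basis_of_span_f hϖ hd hne σ y (fun k => a (σ k) k)
    fun q hq => (hy q hq).1
  refine ⟨e', fun v k => a v k + if Γ.f ϖ (σ k) v (y k) ∈ M.V v then 1 else 0, fun v k => ?_,
    fun v hv => ?_⟩
  · simp only
    split_ifs <;> omega
  · obtain ⟨hq, hq'⟩ := he' v hv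
    have h1 : (fun k => a (σ k) k - Γ.exp ϖ (σ k) v) = a v := funext fun k => (hσ' k v hv).symm
    have hset : {k | a v k + (if Γ.f ϖ (σ k) v (y k) ∈ M.V v then 1 else 0) = a v k + 1} =
        {k | Γ.f ϖ (σ k) v (y k) ∈ M.V v} := by
      ext k
      simp
    rw [hset]
    have hq₂ : Γ.L v = apartmentLattice ϖ e' (a v) := by rw [hq, h1]
    have hq₂' : ∀ k, redBasis hϖ hd hq₂ k = Γ.f ϖ (σ k) v (y k) := fun k => by
      rw [← hq']
      congr 1
      simp only [h1]
    refine ⟨hq₂, ?_⟩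
    have himg : redBasis hϖ hd hq₂ '' {k | Γ.f ϖ (σ k) v (y k) ∈ M.V v} =
        (fun k => Γ.f ϖ (σ k) v (y k)) '' {k | Γ.f ϖ (σ k) v (y k) ∈ M.V v} :=
      Set.image_congr fun k _ => hq₂' k
    rw [himg]
    refine le_antisymm (hy v hv).2 ?_
    rw [Submodule.span_le]
    rintro _ ⟨k, hk, rfl⟩
    exact hk

end LatticeConfig

end Position

end LinkedGrassmannian

namespace LinkedGrassmannian

/-! ### The Bruhat stratification -/

section Bruhat

variable {R K : Type*} [CommRing R] [IsDomain R] [IsDiscreteValuationRing R] [Field K]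
  [Algebra R K] [IsFractionRing R K] {ϖ : R} {d : ℕ} {I : Type*} [Finite I]
  {Γ : LatticeConfig R K d I} {S : I → Set I}
  {e : Module.Basis (Fin d) K (Fin d → K)} {a : I → Fin d → ℤ} {r : ℕ}

open IsLocalRing (ResidueField residue)
open LatticeConfig ExtAffineWeyl

/-- Replaces translation under the parahoric subgroup by a choice of another basis in which the
lattices of `τ` have the same exponents. -/
theorem mem_schubertStratum_iff (hϖ : Irreducible ϖ) (hd : 0 < d) (hA : Γ.InApartment ϖ e a)
    {X : AdmissibleCollection Γ ϖ a r} {M : QuiverGr Γ ϖ fun _ => r} :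
    M ∈ schubertStratum Γ ϖ e a X ↔ ∀ τ : Γ.MaxSimplex ϖ,
      ∃ e' : Module.Basis (Fin d) K (Fin d → K), ∀ v ∈ τ.1, Γ.L v = apartmentLattice ϖ e' (a v) ∧
        (algebraMap R K ϖ)⁻¹ • Γ.preimage v (M.V v) = apartmentLattice ϖ e' (X.h τ • a v) := by
  refine forall_congr' fun τ => ⟨?_, ?_⟩
  · rintro ⟨p, hp, hM⟩
    obtain ⟨e', he'⟩ := exists_apartmentLattice_eq_slTranslate (ϖ := ϖ) (e := e) p
    exact ⟨e', fun v hv => ⟨by rw [← he', ← hA v, hp v hv], by rw [← he', hM v hv]⟩⟩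
  · rintro ⟨e', he'⟩
    obtain ⟨o, ho⟩ := τ.2.prop.1
    obtain ⟨p, hp⟩ := exists_slTranslate_eq hϖ hd ((hA o).symm.trans (he' o ho).1)
    refine ⟨p, fun v hv => ?_, fun v hv => by rw [hp, (he' v hv).2]⟩
    conv_lhs => rw [hA v]
    rw [hp, (he' v hv).1]

theorem rankVector_eq_excess (hϖ : Irreducible ϖ) (hd : 0 < d) {x : I → ℕ} (M : QuiverGr Γ ϖ x)
    {u v : I} {c : Fin d → ℤ} (hu : Γ.L u = apartmentLattice ϖ e (a u))
    (hv : Γ.L v = apartmentLattice ϖ e (a v)) (hc : ∀ k, a u k ≤ c k ∧ c k ≤ a u k + 1)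
    (hM : (algebraMap R K ϖ)⁻¹ • Γ.preimage u (M.V u) = apartmentLattice ϖ e c) :
    (M.rankVector (u, v) : ℤ) = excess c fun k => a v k + Γ.exp ϖ u v := by
  rw [← finrank_map_f hϖ hd hu hv hc, ← (inv_smul_preimage_eq_iff hϖ hd hu hc).mp hM]
  rfl

theorem exp_sub_one_le (hϖ : Irreducible ϖ) (hd : 0 < d) (hA : Γ.InApartment ϖ e a)
    (τ : Γ.MaxSimplex ϖ) {u v : I} (hu : u ∈ τ.1) (hv : v ∈ τ.1) (k : Fin d) :
    Γ.exp ϖ u v - 1 ≤ a u k - a v k ∧ a u k - a v k ≤ Γ.exp ϖ u v := by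
  have hm := isLinkMetric (Γ := Γ) hϖ hd
  by_cases huv : u = v
  · subst huv
    rw [hm.self]
    omega
  · have h1 := MaxSimplex.adj hϖ hd τ u hu v hv huv
    have h2 := isColumn hϖ hd (fun w (_ : w ∈ τ.1) => hA w) k u hu v hv
    have h3 := isColumn hϖ hd (fun w (_ : w ∈ τ.1) => hA w) k v hv u hu
    simp only at h2 h3
    unfold Adj at h1
    omega

theorem sum_trans_eq [NeZero d] {h : ExtAffineWeyl d} {c : Fin d → ℤ} {r : ℤ}
    (hs : ∑ k, (h • c) k - ∑ k, c k = r) : ∑ k, h.trans k = r := by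
  rw [sum_smul] at hs
  linarith

theorem MaxSimplex.exists_isFaceOf [NeZero d] (hϖ : Irreducible ϖ) (hd : 0 < d)
    (hA : Γ.InApartment ϖ e a) (τ : Γ.MaxSimplex ϖ) :
    ∃ (g : ExtAffineWeyl d) (J : Set (Fin d)), IsFaceOf a τ.1 g J :=
  LinkedGrassmannian.exists_isFaceOf (isLinkMetric hϖ hd) τ.2.prop.1 (MaxSimplex.adj hϖ hd τ)
    (isColumn hϖ hd fun v _ => hA v) fun u _ v _ => exists_exp_eq hϖ hd (hA u) (hA v)

theorem rankVector_self (hϖ : Irreducible ϖ) (hd : 0 < d) {x : I → ℕ} (M : QuiverGr Γ ϖ x) (v : I) :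
    M.rankVector (v, v) = x v := by
  unfold QuiverGr.rankVector
  simp only
  rw [f_self hϖ hd, Submodule.map_id, M.finrank_eq]

/-- The relative position of a point and a maximal simplex. -/
theorem exists_weyl_position [NeZero d] (hϖ : Irreducible ϖ) (hd : 0 < d)
    (hL : Linked (Γ.exp ϖ) (Γ.f ϖ) S) (hA : Γ.InApartment ϖ e a) (M : QuiverGr Γ ϖ fun _ => r)
    (τ : Γ.MaxSimplex ϖ) :
    ∃ (h : ExtAffineWeyl d) (e' : Module.Basis (Fin d) K (Fin d → K)),
      (∀ v ∈ τ.1, ∀ k, a v k ≤ (h • a v) k ∧ (h • a v) k ≤ a v k + 1) ∧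
      (∀ v ∈ τ.1, ∑ k, (h • a v) k - ∑ k, a v k = r) ∧
      ∀ v ∈ τ.1, Γ.L v = apartmentLattice ϖ e' (a v) ∧
        (algebraMap R K ϖ)⁻¹ • Γ.preimage v (M.V v) = apartmentLattice ϖ e' (h • a v) := by
  have hm := isLinkMetric (Γ := Γ) hϖ hd
  obtain ⟨e', b, hb, hM⟩ := exists_position hϖ hd hL M τ.2.prop.1 (MaxSimplex.adj hϖ hd τ)
    fun v _ => hA v
  have hpre : ∀ v ∈ τ.1,
      (algebraMap R K ϖ)⁻¹ • Γ.preimage v (M.V v) = apartmentLattice ϖ e' (b v) := fun v hv => by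
    obtain ⟨h1, h2⟩ := hM v hv
    exact (inv_smul_preimage_eq_iff hϖ hd h1 (hb v)).mpr h2
  have hsum : ∀ v ∈ τ.1, ∑ k, b v k - ∑ k, a v k = r := fun v hv => by
    have h1 := rankVector_eq_excess hϖ hd M (hM v hv).1 (hM v hv).1 (hb v) (hpre v hv)
    rw [rankVector_self hϖ hd, hm.self, excess] at h1
    rw [h1, ← Finset.sum_sub_distrib]
    refine Finset.sum_congr rfl fun k _ => ?_
    have := hb v k
    omega
  -- Stability of `M` under `f u v` makes the lattices `ϖ⁻¹ (preimage of V_v)` satisfy the same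
  -- inclusions as the `L_v`.
  have hcol : ∀ k, IsColumn (Γ.exp ϖ) τ.1 fun v => b v k := fun k u hu v hv => by
    obtain ⟨h1, h2⟩ := hM u hu
    obtain ⟨h3, h4⟩ := hM v hv
    have h5 := isColumn hϖ hd (fun w (_ : w ∈ τ.1) => hA w) k u hu v hv
    have h6 := hb u k
    have h7 := hb v k
    simp only at h5 ⊢
    by_contra hlt
    have h8 : b u k = a u k + 1 := by omega
    have h9 : a v k = a u k - Γ.exp ϖ u v := by omega
    have h10 : redBasis hϖ hd h1 k ∈ M.V u := by
      rw [h2]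
      exact Submodule.subset_span ⟨k, h8, rfl⟩
    have h11 : redBasis hϖ hd h3 k ∈ M.V v := by
      have := (isSubrep_iff hL).mp M.isSubrep u v ⟨_, h10, rfl⟩
      rwa [f_redBasis hϖ hd h1 h3, if_pos h9] at this
    rw [h4, Module.Basis.mem_span_image, Module.Basis.repr_self,
      Finsupp.support_single _ one_ne_zero, Finset.coe_singleton,
      Set.singleton_subset_iff, Set.mem_ofPred_eq] at h11
    omega
  obtain ⟨h, hh⟩ := exists_smul_eq hm τ.2.prop.1 (MaxSimplex.adj hϖ hd τ)
    (isColumn hϖ hd fun v _ => hA v) hcol hsum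
  refine ⟨h, e', fun v hv k => ?_, fun v hv => ?_, fun v hv => ⟨(hM v hv).1, ?_⟩⟩
  · rw [hh v hv]
    exact hb v k
  · rw [hh v hv]
    exact hsum v hv
  · rw [hh v hv]
    exact hpre v hv

theorem excess_le_iff [NeZero d] (hϖ : Irreducible ϖ) (hd : 0 < d) (hA : Γ.InApartment ϖ e a)
    (τ : Γ.MaxSimplex ϖ) {u v : I} (hu : u ∈ τ.1) (hv : v ∈ τ.1) {b b' : Fin d → ℤ}
    (hb : ∀ k, a u k ≤ b k ∧ b k ≤ a u k + 1) (hb' : ∀ k, a u k ≤ b' k ∧ b' k ≤ a u k + 1)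
    (hr : ∑ k, b k - ∑ k, a u k = r) (hr' : ∑ k, b' k - ∑ k, a u k = r) :
    (∀ l : ℤ, excess b (fun k => a v k + l) ≤ excess b' (fun k => a v k + l)) ↔
      excess b (fun k => a v k + Γ.exp ϖ u v) ≤ excess b' (fun k => a v k + Γ.exp ϖ u v) :=
  ⟨fun h => h _, fun h => excess_le_of_le (exp_sub_one_le hϖ hd hA τ hu hv) hb hb' hr hr' h⟩

/-- Relative positions with the same ranks lie in the same double coset. -/
theorem doubleCoset_eq_of_rank_eq [NeZero d] (hϖ : Irreducible ϖ) (hd : 2 ≤ d)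
    (hA : Γ.InApartment ϖ e a) {τ τ' : Γ.MaxSimplex ϖ} {σ : Set I} (hσ : σ ⊆ τ.1) (hσ' : σ ⊆ τ'.1)
    {h h' : ExtAffineWeyl d}
    (hb : ∀ v ∈ τ.1, ∀ k, a v k ≤ (h • a v) k ∧ (h • a v) k ≤ a v k + 1)
    (hr : ∀ v ∈ τ.1, ∑ k, (h • a v) k - ∑ k, a v k = r)
    (hb' : ∀ v ∈ τ'.1, ∀ k, a v k ≤ (h' • a v) k ∧ (h' • a v) k ≤ a v k + 1)
    (hr' : ∀ v ∈ τ'.1, ∑ k, (h' • a v) k - ∑ k, a v k = r)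
    (heq : ∀ u ∈ σ, ∀ v ∈ σ, excess (h • a u) (fun k => a v k + Γ.exp ϖ u v) =
      excess (h' • a u) (fun k => a v k + Γ.exp ϖ u v)) :
    DoubleCoset.doubleCoset h (weylStabilizer (a '' σ) : Set (ExtAffineWeyl d))
        (weylStabilizer (a '' σ)) =
      DoubleCoset.doubleCoset h' (weylStabilizer (a '' σ) : Set (ExtAffineWeyl d))
        (weylStabilizer (a '' σ)) := by
  have hd0 : 0 < d := by omega
  obtain ⟨g, J, hJ⟩ := MaxSimplex.exists_isFaceOf hϖ hd0 hA τ
  obtain ⟨o, ho⟩ := τ.2.prop.1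
  obtain ⟨o', ho'⟩ := τ'.2.prop.1
  refine hJ.doubleCoset_eq hd hσ (sum_trans_eq (hr o ho)) (sum_trans_eq (hr' o' ho'))
    fun u hu v hv l => le_antisymm ?_ ?_
  · exact (excess_le_iff hϖ hd0 hA τ (hσ hu) (hσ hv) (hb u (hσ hu)) (hb' u (hσ' hu))
      (hr u (hσ hu)) (hr' u (hσ' hu))).mpr (heq u hu v hv).le l
  · exact (excess_le_iff hϖ hd0 hA τ (hσ hu) (hσ hv) (hb' u (hσ' hu)) (hb u (hσ hu))
      (hr' u (hσ' hu)) (hr u (hσ hu))).mpr (heq u hu v hv).ge l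

theorem exists_mem_schubertStratum [NeZero d] (hϖ : Irreducible ϖ) (hd : 2 ≤ d)
    (hL : Linked (Γ.exp ϖ) (Γ.f ϖ) S) (hA : Γ.InApartment ϖ e a) (M : QuiverGr Γ ϖ fun _ => r) :
    ∃ X : AdmissibleCollection Γ ϖ a r, M ∈ schubertStratum Γ ϖ e a X := by
  have hd0 : 0 < d := by omega
  choose h e' hb hr he' using exists_weyl_position hϖ hd0 hL hA M
  refine ⟨⟨h, hb, hr, fun τ τ' => doubleCoset_eq_of_rank_eq hϖ hd hA Set.inter_subset_left
    Set.inter_subset_right (hb τ) (hr τ) (hb τ') (hr τ') fun u hu v hv => ?_⟩,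
    (mem_schubertStratum_iff hϖ hd0 hA).mpr fun τ => ⟨e' τ, he' τ⟩⟩
  rw [← rankVector_eq_excess hϖ hd0 M (he' τ u hu.1).1 (he' τ v hv.1).1 (hb τ u hu.1)
    (he' τ u hu.1).2, ← rankVector_eq_excess hϖ hd0 M (he' τ' u hu.2).1 (he' τ' v hv.2).1
    (hb τ' u hu.2) (he' τ' u hu.2).2]

theorem rankVector_eq_of_mem_schubertStratum (hϖ : Irreducible ϖ) (hd : 0 < d)
    (hA : Γ.InApartment ϖ e a) {X : AdmissibleCollection Γ ϖ a r} {M : QuiverGr Γ ϖ fun _ => r}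
    (hM : M ∈ schubertStratum Γ ϖ e a X) (τ : Γ.MaxSimplex ϖ) {u v : I} (hu : u ∈ τ.1)
    (hv : v ∈ τ.1) :
    (M.rankVector (u, v) : ℤ) = excess (X.h τ • a u) fun k => a v k + Γ.exp ϖ u v := by
  obtain ⟨e', he'⟩ := (mem_schubertStratum_iff hϖ hd hA).mp hM τ
  exact rankVector_eq_excess hϖ hd M (he' u hu).1 (he' v hv).1 (X.bounds τ u hu) (he' u hu).2

/-- Adjacent pairs determine the rank vector, and each is contained in a maximal simplex. -/
theorem rankVector_le_iff (hϖ : Irreducible ϖ) (hd : 0 < d) (hL : Linked (Γ.exp ϖ) (Γ.f ϖ) S)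
    {M M' : QuiverGr Γ ϖ fun _ => r} :
    M.rankVector ≤ M'.rankVector ↔ ∀ τ : Γ.MaxSimplex ϖ, ∀ u ∈ τ.1, ∀ v ∈ τ.1,
      M.rankVector (u, v) ≤ M'.rankVector (u, v) := by
  refine ⟨fun h τ u _ v _ => h (u, v), fun h => ?_⟩
  have := fun v => Γ.finiteDimensional_Lbar v
  rintro ⟨u, v⟩
  refine hL.subRank_le_of_adj (V := M.V) (V' := M'.V) ?_ ?_ u v
  · intro w
    rw [M.finrank_eq, M'.finrank_eq]
  · intro p q hpq
    obtain ⟨τ, hp, hq⟩ := exists_maxSimplex hϖ hd hpq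
    exact h τ p hp q hq

/-- The Bruhat strata are the rank vector strata. -/
theorem schubertStratum_eq_rankStratum [NeZero d] (hϖ : Irreducible ϖ) (hd : 2 ≤ d)
    (hL : Linked (Γ.exp ϖ) (Γ.f ϖ) S) (hA : Γ.InApartment ϖ e a)
    {X : AdmissibleCollection Γ ϖ a r} {M : QuiverGr Γ ϖ fun _ => r}
    (hM : M ∈ schubertStratum Γ ϖ e a X) : schubertStratum Γ ϖ e a X = M.rankStratum := by
  have hd0 : 0 < d := by omega
  have hrank := fun τ u v => rankVector_eq_of_mem_schubertStratum hϖ hd0 hA hM τ (u := u) (v := v)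
  ext N
  constructor
  · intro hN
    apply le_antisymm <;> refine (rankVector_le_iff hϖ hd0 hL).mpr fun τ u hu v hv => ?_
    all_goals
      zify
      rw [hrank τ u v hu hv, rankVector_eq_of_mem_schubertStratum hϖ hd0 hA hN τ hu hv]
  · intro hN
    refine (mem_schubertStratum_iff hϖ hd0 hA).mpr fun τ => ?_
    obtain ⟨h, e', hb, hr, he'⟩ := exists_weyl_position hϖ hd0 hL hA N τ
    have h1 := doubleCoset_eq_of_rank_eq hϖ hd hA (le_refl τ.1) (le_refl τ.1) (X.bounds τ) (X.size τ)
      hb hr fun u hu v hv => by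
        rw [← hrank τ u v hu hv, ← rankVector_eq_excess hϖ hd0 N (he' u hu).1 (he' v hv).1 (hb u hu)
          (he' u hu).2, show N.rankVector = M.rankVector from hN]
    have h2 := DoubleCoset.mem_doubleCoset_self (weylStabilizer (a '' τ.1))
      (weylStabilizer (a '' τ.1)) h
    rw [← h1] at h2
    obtain ⟨w, hw, w', hw', rfl⟩ := DoubleCoset.mem_doubleCoset.mp h2
    have hw := (mem_weylStabilizer.mp hw).2
    have hw' := (mem_weylStabilizer.mp hw').2
    -- The left factor `w` fixes the vertices of `τ` and is absorbed into the basis; the right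
    -- factor `w'` acts trivially on the `a v`.
    obtain ⟨e₂, he₂⟩ := exists_apartmentLattice_smul_eq (e := e') hϖ w
    refine ⟨e₂, fun v hv => ⟨?_, ?_⟩⟩
    · rw [← he₂, hw _ ⟨v, hv, rfl⟩, (he' v hv).1]
    · rw [← he₂, (he' v hv).2, mul_smul, mul_smul, hw' _ ⟨v, hv, rfl⟩]

theorem bruhatStrata_eq_rankStrata [NeZero d] (hϖ : Irreducible ϖ) (hd : 2 ≤ d)
    (hL : Linked (Γ.exp ϖ) (Γ.f ϖ) S) (hA : Γ.InApartment ϖ e a) :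
    bruhatStrata Γ ϖ e a r = rankStrata Γ ϖ fun _ => r := by
  ext T
  constructor
  · rintro ⟨⟨M, hM⟩, X, rfl⟩
    exact ⟨M, (schubertStratum_eq_rankStratum hϖ hd hL hA hM).symm⟩
  · rintro ⟨M, rfl⟩
    obtain ⟨X, hX⟩ := exists_mem_schubertStratum hϖ hd hL hA M
    exact ⟨⟨M, rfl⟩, X, (schubertStratum_eq_rankStratum hϖ hd hL hA hX).symm⟩

/-- The criterion by excesses does not involve `g` and `J`, so the existential choice in the
generalized Bruhat order is harmless. -/
theorem bruhatLE_iff [NeZero d] (hϖ : Irreducible ϖ) (hd : 2 ≤ d)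
    (hL : Linked (Γ.exp ϖ) (Γ.f ϖ) S) (hA : Γ.InApartment ϖ e a)
    {X Y : AdmissibleCollection Γ ϖ a r} {M M' : QuiverGr Γ ϖ fun _ => r}
    (hM : M ∈ schubertStratum Γ ϖ e a X) (hM' : M' ∈ schubertStratum Γ ϖ e a Y) :
    X.BruhatLE Y ↔ M.rankVector ≤ M'.rankVector := by
  have hd0 : 0 < d := by omega
  rw [rankVector_le_iff hϖ hd0 hL]
  refine forall_congr' fun τ => ?_
  obtain ⟨o, ho⟩ := τ.2.prop.1
  have key : ∀ u ∈ τ.1, ∀ v ∈ τ.1, (∀ l : ℤ, excess (X.h τ • a u) (fun k => a v k + l) ≤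
      excess (Y.h τ • a u) (fun k => a v k + l)) ↔
        M.rankVector (u, v) ≤ M'.rankVector (u, v) := fun u hu v hv => by
    rw [excess_le_iff hϖ hd0 hA τ hu hv (X.bounds τ u hu) (Y.bounds τ u hu) (X.size τ u hu)
      (Y.size τ u hu), ← rankVector_eq_of_mem_schubertStratum hϖ hd0 hA hM τ hu hv,
      ← rankVector_eq_of_mem_schubertStratum hϖ hd0 hA hM' τ hu hv, Nat.cast_le]
  constructor
  · rintro ⟨g, J, h1, h2, h3⟩ u hu v hv
    exact (key u hu v hv).mp ((IsFaceOf.doubleCosetBruhatLE_iff hd ⟨h1, h2⟩ ⟨o, ho⟩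
      (sum_trans_eq (X.size τ o ho)) (sum_trans_eq (Y.size τ o ho))).mp h3 u hu v hv)
  · intro h
    obtain ⟨g, J, hJ⟩ := MaxSimplex.exists_isFaceOf hϖ hd0 hA τ
    exact ⟨g, J, hJ.1, hJ.2, (hJ.doubleCosetBruhatLE_iff hd ⟨o, ho⟩
      (sum_trans_eq (X.size τ o ho)) (sum_trans_eq (Y.size τ o ho))).mpr fun u hu v hv =>
        (key u hu v hv).mpr (h u hu v hv)⟩

end Bruhat

end LinkedGrassmannian

/-! ### The theorem -/

open LinkedGrassmannian in
theorem mainTheorem2 {R K : Type*} [CommRing R] [IsDomain R] [IsDiscreteValuationRing R]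
    [IsAlgClosed (IsLocalRing.ResidueField R)] [Field K] [Algebra R K] [IsFractionRing R K]
    (ϖ : R) (hϖ : Irreducible ϖ) {d : ℕ} (hd : 0 < d) {I : Type*} [Finite I]
    (Γ : LatticeConfig R K d I) (hconv : Γ.Convex) (hΓ : Γ.LocallyWeaklyIndependent ϖ) :
    (∀ (x : I → ℕ) (M M' : QuiverGr Γ ϖ x),
      (M.rankVector = M'.rankVector ↔ M.Iso M') ∧
      (M.quiverStratum ⊆ closure M'.quiverStratum ↔ M.rankVector ≤ M'.rankVector)) ∧
    (∃ (e : Module.Basis (Fin d) K (Fin d → K)) (a : I → Fin d → ℤ), Γ.InApartment ϖ e a) ∧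
    (∀ (e : Module.Basis (Fin d) K (Fin d → K)) (a : I → Fin d → ℤ), Γ.InApartment ϖ e a →
      ∀ r : ℕ, 0 < r → r < d →
        quiverStrata Γ ϖ (fun _ => r) = rankStrata Γ ϖ (fun _ => r) ∧
        bruhatStrata Γ ϖ e a r = rankStrata Γ ϖ (fun _ => r) ∧
        ∀ X Y : AdmissibleCollection Γ ϖ a r,
          (schubertStratum Γ ϖ e a X).Nonempty → (schubertStratum Γ ϖ e a Y).Nonempty →
          (schubertStratum Γ ϖ e a X ⊆ closure (schubertStratum Γ ϖ e a Y) ↔ X.BruhatLE Y) ∧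
          ∀ M ∈ schubertStratum Γ ϖ e a X, ∀ M' ∈ schubertStratum Γ ϖ e a Y,
            (schubertStratum Γ ϖ e a X ⊆ closure (schubertStratum Γ ϖ e a Y) ↔
              M.rankVector ≤ M'.rankVector)) := by
  have := fun v => Γ.finiteDimensional_Lbar v
  have : Infinite (IsLocalRing.ResidueField R) := IsAlgClosed.instInfinite
  obtain ⟨S, hL⟩ := LatticeConfig.exists_linked hϖ hd hconv hΓ
  refine ⟨fun x M M' => ⟨(iso_iff_rankVector_eq hL).symm, ?_⟩,
    LatticeConfig.exists_inApartment hϖ hd hL, fun e a hA r hr hrd => ?_⟩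
  · rw [quiverStratum_eq_rankStratum hL, quiverStratum_eq_rankStratum hL,
      rankStratum_subset_closure_iff hL]
  -- From `0 < r < d`; the Coxeter generators are reflections only in this range.
  have hd2 : 2 ≤ d := by omega
  have : NeZero d := ⟨hd.ne'⟩
  refine ⟨congrArg Set.range (funext (quiverStratum_eq_rankStratum hL)),
    bruhatStrata_eq_rankStrata hϖ hd2 hL hA, fun X Y hX hY => ?_⟩
  have key : ∀ M ∈ schubertStratum Γ ϖ e a X, ∀ M' ∈ schubertStratum Γ ϖ e a Y,
      (schubertStratum Γ ϖ e a X ⊆ closure (schubertStratum Γ ϖ e a Y) ↔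
        M.rankVector ≤ M'.rankVector) := fun M hM M' hM' => by
    rw [schubertStratum_eq_rankStratum hϖ hd2 hL hA hM,
      schubertStratum_eq_rankStratum hϖ hd2 hL hA hM', rankStratum_subset_closure_iff hL]
  refine ⟨?_, key⟩
  obtain ⟨M, hM⟩ := hX
  obtain ⟨M', hM'⟩ := hY
  rw [key M hM M' hM', bruhatLE_iff hϖ hd2 hL hA hM hM']
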